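/- **Setting.** Let $A:\mathbb R\to(0,\infty)$ be real-analytic, even and integrable, with $A'(x)<0$ for $x>0$ and $A''(0)<0$. Fix $x\ne 0$, put $J=\operatorname{sign}(x)$, $a=A(x)$, $A_0=A(0)$ and $\hbar_N=\frac1{N\pi}\int_{\mathbb R}A(u)\,du$ for $N\ge 1$. Write $\Pi=\sigma_1^{(1-J)/2}$, i.e. $\Pi=\mathbb I$ if $J=1$ and $\Pi=\begin{pmatrix}0&1\\1&0\end{pmatrix}$ if $J=-1$. The imaginary axis is oriented upwards, and $f_+$, $f_-$ denote boundary values from its left and right. All roots and powers of complex arguments are principal unless stated otherwise. *Phase functions.* For $\eta\in(0,iA_0)$ let $\rho^0(\eta)=\frac{\eta}{\pi}\int_{x_-(\eta)}^{x_+(\eta)}\frac{du}{\sqrt{A(u)^2+\eta^2}}$, where $x_-(\eta)<0<x_+(\eta)$ solve $iA(x_\pm)=\eta$. Let $R(\lambda)^2=\lambda^2+a^2$, with $R$ analytic off $[-ia,ia]$ and $R(\lambda)\sim-\lambda$ at infinity. For $\eta\in(0,ia)$ let $$\rho(\eta)=\rho^0(\eta)+\frac{R_+(\eta)}{\pi i}\int_{-iA_0}^{-ia}\frac{\overline{\rho^0(\bar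 s)}\,ds}{(\eta-s)R(s)}+\frac{R_+(\eta)}{\pi i}\int_{ia}^{iA_0}\frac{\rho^0(s)\,ds}{(\eta-s)R(s)} .$$ With $L^0_\eta(\lambda)=\log(-i(\lambda-\eta))+\frac{i\pi}{2}$ and $\overline L^0_\eta=\frac12(L^0_{\eta+}+L^0_{\eta-})$ on the imaginary axis, let $$g(\lambda)=\tfrac J2\int_{-ia}^0L^0_\eta(\lambda)\overline{\rho(\bar\eta)}\,d\eta+\tfrac J2\int_0^{ia}L^0_\eta(\lambda)\rho(\eta)\,d\eta,\qquad \theta=iJ(g_+-g_-),$$ $$\tilde\phi(\lambda)=2i\lambda|x|+\int_0^{iA_0}\overline L^0_\eta(\lambda)\rho^0(\eta)\,d\eta+\int_{-iA_0}^0\overline L^0_\eta(\lambda)\overline{\rho^0(\bar\eta)}\,d\eta-Jg_+(\lambda)-Jg_-(\lambda).$$ The matrix $\tilde{\mathbf N}$ (formal continuum limit) is, in a small disk about $ia$, analytic off the imaginary axis, has boundary values on it, and satisfies $\tilde{\mathbf N}_-^{-1}\tilde{\mathbf N}_+=V_N$ there, where $$V_N(\lambda)=\Pi\begin{pmatrix}e^{i\theta(\lambda)/\hbar_N}&0\\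 i\,e^{\tilde\phi(\lambda)/\hbar_N}&e^{-i\theta(\lambda)/\hbar_N}\end{pmatrix}\Pi .$$ *Local coordinate and lens.* Near $ia$, $\theta$ also denotes its analytic continuation from $(0,ia)$ to a disk about $ia$ cut along the imaginary axis above $ia$; $\varphi=\theta^{2/3}$, positive on the imaginary axis below $ia$, extends to the whole disk; and $\zeta(\lambda)=\hbar_N^{-2/3}\varphi(\lambda)$. The lens factor $\Lambda(\lambda)$ is $\begin{pmatrix}1&-ie^{-i\theta/\hbar_N}\\0&1\end{pmatrix}$ where $-\frac\pi3<\arg\zeta<0$, $\begin{pmatrix}1&ie^{i\theta/\hbar_N}\\0&1\end{pmatrix}$ where $0<\arg\zeta<\frac\pi3$, and $\mathbb I$ elsewhere. *Outer model.* Let $\beta(\lambda)^4=\frac{\lambda+ia}{\lambda-ia}$, with $\beta$ analytic off $[-ia,ia]$ and $\beta(\infty)=1$. Near $ia$, $\hat{\mathbf N}_{\rm out}=\tilde{\mathbf O}\,\Pi\Lambda\Pi$ with $$\tilde{\mathbf O}(\lambda)=\frac1{2R\beta}\begin{pmatrix}R-\lambda-ia&R+\lambda+ia\\R+\lambda+ia&R-\lambda-ia\end{pmatrix}.$$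 *Airy model.* Let $\tilde{\mathbf S}^{\rm loc}(\zeta)=\frac1{\sqrt2}(-\zeta)^{\sigma_3/4}\begin{pmatrix}1&1\\-1&1\end{pmatrix}$ and $$\mathbf S^{\rm loc}(\zeta)=\mathbf T(\zeta)\,\mathrm{diag}\left(e^{-(-\zeta)^{3/2}/2+i\pi/4},\,e^{(-\zeta)^{3/2}/2-i\pi/4}\right).$$ For $\frac\pi3<\arg\zeta<\pi$, with $k=(3/4)^{2/3}$, $c_1=(32/3)^{1/6}\sqrt\pi$, $c_2=6^{1/6}\sqrt\pi$, $$\mathbf T(\zeta)=\begin{pmatrix}e^{7i\pi/12}c_1\mathrm{Ai}'(k\zeta e^{-i\pi/3})&e^{5i\pi/4}c_1\mathrm{Ai}'(-k\zeta)\\-e^{-i\pi/12}c_2\mathrm{Ai}(k\zeta e^{-i\pi/3})&e^{i\pi/4}c_2\mathrm{Ai}(-k\zeta)\end{pmatrix}.$$ In the sectors $0<\arg\zeta<\frac\pi3$, $-\frac\pi3<\arg\zeta<0$ and $-\pi<\arg\zeta<-\frac\pi3$, $\mathbf T$ is this (entire) matrix times $U$, $UW$ and $UWU$ respectively, where $U=\begin{pmatrix}1&1\\0&1\end{pmatrix}$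 and $W=\begin{pmatrix}0&-1\\1&0\end{pmatrix}$. *Endpoint model.* Let $\tilde{\mathbf S}^{\rm hol}(\lambda)=\Pi\tilde{\mathbf O}(\lambda)\Pi\,\tilde{\mathbf S}^{\rm loc}(\zeta(\lambda))^{-1}$ and $$\hat{\mathbf N}_{\rm endpoint}(\lambda)=\Pi\,\tilde{\mathbf S}^{\rm hol}(\lambda)\,\mathbf S^{\rm loc}(\zeta(\lambda))\,\Lambda(\lambda)\,\Pi ,$$ where the values on the lens boundaries $\arg\zeta=\pm\frac\pi3$ are the limits from outside the lens. **Proposition.** (0) $\mathbf S^{\rm loc}$ solves the local Riemann–Hilbert problem: it is analytic off the rays $\arg\zeta\in\{0,\pm\frac\pi3,\pi\}$ and continuous up to them from each sector. With the rays $\arg\zeta=0,\pm\frac\pi3$ oriented towards $0$ and the ray $\arg\zeta=\pi$ oriented away from $0$, one has $\mathbf S^{\rm loc}_+=\mathbf S^{\rm loc}_-v$, where $v=\begin{pmatrix}0&i\\i&0\end{pmatrix}$ on $\arg\zeta=0$, $v=\begin{pmatrix}1&-ie^{\pm i\zeta^{3/2}}\\0&1\end{pmatrix}$ on $\arg\zeta=\pm\frac\pi3$,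 and $v=\begin{pmatrix}1&0\\ie^{-(-\zeta)^{3/2}}&1\end{pmatrix}$ on $\arg\zeta=\pi$. Moreover $\mathbf S^{\rm loc}(\tilde{\mathbf S}^{\rm loc})^{-1}\to\mathbb I$ as $\zeta\to\infty$. There is $r_0>0$ with $r_0<a$ and $r_0<A_0-a$ such that the continuations $\theta$ and $\varphi$ above exist on the (cut) disk of radius $r_0$ about $ia$, with $\varphi$ analytic and injective there. For every disk $D$ with centre $ia$ and radius $r\in(0,r_0)$: (1) for every $N\ge1$, $\hat{\mathbf N}_{\rm endpoint}$ is analytic in the open left and right halves of $D$, has boundary values $\hat{\mathbf N}_{{\rm endpoint},\pm}$ on the imaginary axis in $D$ with $\hat{\mathbf N}_{{\rm endpoint},-}$ invertible, and $$\hat{\mathbf N}_{{\rm endpoint},-}^{-1}\hat{\mathbf N}_{{\rm endpoint},+}=V_N=\tilde{\mathbf N}_-^{-1}\tilde{\mathbf N}_+ ;$$ (2) there is a constant $C$, independent of $N$ and $\lambda$, such that all entries of $\hat{\mathbf N}_{\rm endpoint}(\lambda)$ are at most $C\hbar_N^{-1/3}$ in absolute value for all $N\ge1$ and all $\lambda\in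 D$ off the imaginary axis; (3) there is a constant $C$, independent of $N$ and $\lambda$, such that all entries of $\hat{\mathbf N}_{\rm endpoint}(\lambda)\hat{\mathbf N}_{\rm out}(\lambda)^{-1}-\mathbb I$ are at most $C\hbar_N^{1/3}$ in absolute value for all $N\ge1$ and all $\lambda\in\partial D$ off the imaginary axis. -/

import Mathlib

open Complex Filter Topology MeasureTheory

namespace EndpointModel

noncomputable section

/-- Two by two complex matrices. -/
abbrev Mat := Matrix (Fin 2) (Fin 2) ℂ

/-! ### Contours on the imaginary axis, boundary values -/

/-- The contour integral of `f` along the imaginary segment from `i a` to `i b`. -/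
def imInt (f : ℂ → ℂ) (a b : ℝ) : ℂ := ∫ s in a..b, f (s * I) * I

/-- Boundary value at `z` (on the imaginary axis) from the left of the upward oriented imaginary
axis; the subscript `+`. -/
def leftBV {E : Type*} [TopologicalSpace E] [Nonempty E] (f : ℂ → E) (z : ℂ) : E :=
  limUnder (𝓝[{w : ℂ | w.re < 0}] z) f

/-- Boundary value at `z` from the right; the subscript `-`. -/
def rightBV {E : Type*} [TopologicalSpace E] [Nonempty E] (f : ℂ → E) (z : ℂ) : E :=
  limUnder (𝓝[{w : ℂ | 0 < w.re}] z) f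

/-- At the point `z` of the imaginary axis the matrix function `F` has boundary values `F₊`, `F₋`
from the left and from the right, `F₋` is invertible, and `F₋⁻¹ F₊ = V`. -/
def HasJump (F : ℂ → Mat) (z : ℂ) (V : Mat) : Prop :=
  ∃ Fp Fm : Mat, Tendsto F (𝓝[{w : ℂ | w.re < 0}] z) (𝓝 Fp) ∧
    Tendsto F (𝓝[{w : ℂ | 0 < w.re}] z) (𝓝 Fm) ∧ IsUnit Fm.det ∧ Fm⁻¹ * Fp = V

/-! ### The profile `A` and the complex phase function -/

/-- The initial data: positive, real-analytic, even, bell-shaped with one genuine maximum at `0`,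
and decaying (only integrability is needed of the decay). -/
structure IsProfile (A : ℝ → ℝ) : Prop where
  pos : ∀ x, 0 < A x
  analytic : AnalyticOnNhd ℝ A Set.univ
  even : ∀ x, A (-x) = A x
  decreasing : ∀ x, 0 < x → deriv A x < 0
  genuine : deriv (deriv A) 0 < 0
  integrable : Integrable A

/-- The values of the semiclassical parameter, `ħ_N = (1 / (N π)) ∫ A`. -/
def hbar (A : ℝ → ℝ) (N : ℕ) : ℝ := 1 / (N * Real.pi) * ∫ x, A x

/-- `J = sign x`. -/
def J (x : ℝ) : ℂ := (Real.sign x : ℝ)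

/-- `σ₁ ^ ((1 - J) / 2)` for `J = sign x`. -/
def sig (x : ℝ) : Mat := if 0 < x then 1 else !![0, 1; 1, 0]

/-- WKB density `ρ⁰(η) = (η/π) ∫_{x₋(η)}^{x₊(η)} dx / √(A(x)² + η²)` at a positive imaginary
`η = i s` below `i A(0)`; there `(x₋(η), x₊(η))` is the set where `A > s`, and `η² = -s²`. -/
def rho0 (A : ℝ → ℝ) (η : ℂ) : ℂ :=
  η / Real.pi * ((∫ u in {u : ℝ | η.im < A u}, 1 / Real.sqrt (A u ^ 2 - η.im ^ 2) : ℝ) : ℂ)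

/-- The logarithm `L⁰_η(z) = log(-i (z - η)) + iπ/2`, cut downwards from `η`. -/
def L0 (η z : ℂ) : ℂ := Complex.log (-I * (z - η)) + I * Real.pi / 2

/-- The average of the two boundary values of `L⁰_η` at a point of the imaginary axis. -/
def L0avg (η z : ℂ) : ℂ := (leftBV (L0 η) z + rightBV (L0 η) z) / 2

/-- `R(z)² = z² + a²`, analytic off `[-i a, i a]`, `R(z) ∼ -z` at infinity. -/
def R (a : ℝ) (z : ℂ) : ℂ := -z * (1 + a ^ 2 / z ^ 2) ^ (1 / 2 : ℂ)

/-- The density `ρ` on `(0, i A(x))`. -/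
def rho (A : ℝ → ℝ) (x : ℝ) (η : ℂ) : ℂ :=
  rho0 A η
    + leftBV (R (A x)) η / (Real.pi * I) *
        imInt (fun s => (starRingEnd ℂ) (rho0 A ((starRingEnd ℂ) s)) / ((η - s) * R (A x) s))
          (-A 0) (-A x)
    + leftBV (R (A x)) η / (Real.pi * I) *
        imInt (fun s => rho0 A s / ((η - s) * R (A x) s)) (A x) (A 0)

/-- The complex phase function `g`. -/
def g (A : ℝ → ℝ) (x : ℝ) (z : ℂ) : ℂ :=
  J x / 2 * imInt (fun η => L0 η z * (starRingEnd ℂ) (rho A x ((starRingEnd ℂ) η))) (-A x) 0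
    + J x / 2 * imInt (fun η => L0 η z * rho A x η) 0 (A x)

/-- `θ = i J (g₊ - g₋)` on the imaginary axis. -/
def theta (A : ℝ → ℝ) (x : ℝ) (z : ℂ) : ℂ :=
  I * J x * (leftBV (g A x) z - rightBV (g A x) z)

/-- The function `φ̃` on the positive imaginary axis. -/
def phiTilde (A : ℝ → ℝ) (x : ℝ) (z : ℂ) : ℂ :=
  2 * I * z * |x|
    + imInt (fun η => L0avg η z * rho0 A η) 0 (A 0)
    + imInt (fun η => L0avg η z * (starRingEnd ℂ) (rho0 A ((starRingEnd ℂ) η))) (-A 0) 0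
    - J x * leftBV (g A x) z - J x * rightBV (g A x) z

/-! ### The formal continuum limit near `i A(x)` -/

/-- The jump matrix prescribed on the positive imaginary axis in the Riemann-Hilbert problem
("formal continuum limit") that defines `Ñ`. -/
def continuumJump (A : ℝ → ℝ) (x h : ℝ) (z : ℂ) : Mat :=
  sig x * !![exp (I * theta A x z / h), 0;
    I * exp (phiTilde A x z / h), exp (-(I * theta A x z) / h)] * sig x

/-- What the Riemann-Hilbert problem for `Ñ` says in an open set `U` around `i A(x)` which meets
no part of the jump contour other than the imaginary segment from `0` to `i A(0)`:  `Ñ` is analytic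
off the imaginary axis, has boundary values on it, and `Ñ₊ = Ñ₋ · (jump matrix)`. -/
structure SolvesContinuumLimitOn (A : ℝ → ℝ) (x h : ℝ) (U : Set ℂ) (Nt : ℂ → Mat) : Prop where
  analytic : ∀ i j, AnalyticOnNhd ℂ (fun z => Nt z i j) (U ∩ {z | z.re ≠ 0})
  jump : ∀ z ∈ U, z.re = 0 → HasJump Nt z (continuumJump A x h z)

/-! ### The outer model -/

/-- `β(z)⁴ = (z + i a) / (z - i a)`, analytic off `[-i a, i a]`, `β ∼ 1` at infinity. -/
def beta (a : ℝ) (z : ℂ) : ℂ := ((z + I * a) / (z - I * a)) ^ (1 / 4 : ℂ)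

/-- The solution `Õ` of the outer model problem. -/
def Otilde (a : ℝ) (z : ℂ) : Mat :=
  (1 / (2 * R a z * beta a z)) •
    !![R a z - z - I * a, R a z + z + I * a; R a z + z + I * a, R a z - z - I * a]

/-- The triangular factor of the lens about `[0, i A(x)]`.  Near `i A(x)` the lens boundaries
`L_L` and `L_R` are the preimages of the rays `arg ζ = -π/3` and `arg ζ = π/3` of the local
coordinate `ζ`, and `[0, i A(x)]` that of `arg ζ = 0`, so the part of the lens between `L_L` and the
imaginary axis is `-π/3 < arg ζ < 0`, and the part between the imaginary axis and `L_R` is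
`0 < arg ζ < π/3`.  The argument `t` stands for `θ / ħ`. -/
def lensFactor (ζ t : ℂ) : Mat :=
  if -(Real.pi / 3) < ζ.arg ∧ ζ.arg < 0 then !![1, -I * exp (-(I * t)); 0, 1]
  else if 0 < ζ.arg ∧ ζ.arg < Real.pi / 3 then !![1, I * exp (I * t); 0, 1]
  else 1

/-- `Θ` is the analytic continuation of `θ` from `(0, i A(x))` to the disk of radius `r` about
`i A(x)`, cut along the imaginary axis above the centre, and `φ = θ ^ (2/3)` (positive on
`(0, i A(x))`) is a conformal map of that disk; the closed disk contains neither `0` nor `i A(0)`. -/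
structure IsEndpointMap (A : ℝ → ℝ) (x r : ℝ) (Θ φ : ℂ → ℂ) : Prop where
  pos : 0 < r
  not_zero : r < A x
  not_top : r < A 0 - A x
  theta_analytic : AnalyticOnNhd ℂ Θ
    (Metric.ball (I * A x) r \ {z | z.re = 0 ∧ A x ≤ z.im})
  theta_eq : ∀ y : ℝ, A x - r < y → y < A x → Θ (I * y) = theta A x (I * y)
  phi_analytic : AnalyticOnNhd ℂ φ (Metric.ball (I * A x) r)
  phi_injective : Set.InjOn φ (Metric.ball (I * A x) r)
  phi_eq : ∀ y : ℝ, A x - r < y → y < A x → φ (I * y) = theta A x (I * y) ^ (2 / 3 : ℂ)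
  phi_cube : ∀ z ∈ Metric.ball (I * A x) r \ {z | z.re = 0 ∧ A x ≤ z.im}, φ z ^ 3 = Θ z ^ 2

/-- The local coordinate `ζ = (θ / ħ) ^ (2/3)`. -/
def zeta (φ : ℂ → ℂ) (h : ℝ) (z : ℂ) : ℂ := ((h ^ (-(2 / 3) : ℝ) : ℝ) : ℂ) * φ z

/-- The outer model `N̂_out` near `i A(x)`. -/
def Nout (A : ℝ → ℝ) (x : ℝ) (Θ φ : ℂ → ℂ) (h : ℝ) (z : ℂ) : Mat :=
  Otilde (A x) z * (sig x * lensFactor (zeta φ h z) (Θ z / h) * sig x)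

/-! ### The Airy model -/

/-- The Airy function, by the contour integral `(1 / 2πi) ∫ exp(t³/3 - w t) dt` from
`∞ e^{-iπ/3}` to `∞ e^{iπ/3}`, taken along the two rays `t = u e^{±iπ/3}`. -/
def airyAi (w : ℂ) : ℂ :=
  1 / (2 * Real.pi * I) *
    ((∫ u in Set.Ioi (0 : ℝ), exp (I * Real.pi / 3) *
        exp (-(u : ℂ) ^ 3 / 3 - w * (u * exp (I * Real.pi / 3))))
      - ∫ u in Set.Ioi (0 : ℝ), exp (-(I * Real.pi / 3)) *
        exp (-(u : ℂ) ^ 3 / 3 - w * (u * exp (-(I * Real.pi / 3)))))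

/-- The factor `S̃^loc(ζ) = 2^{-1/2} (-ζ)^{σ₃/4} [1 1; -1 1]`. -/
def StildeLoc (ζ : ℂ) : Mat :=
  (1 / (Real.sqrt 2 : ℂ)) • !![(-ζ) ^ (1 / 4 : ℂ), (-ζ) ^ (1 / 4 : ℂ);
    -(-ζ) ^ (-(1 / 4) : ℂ), (-ζ) ^ (-(1 / 4) : ℂ)]

/-- The matrix `T` in the sector between the rays `arg ζ = π/3` and `arg ζ = π`. -/
def Tsector (ζ : ℂ) : Mat :=
  let k : ℂ := (((3 / 4 : ℝ) ^ (2 / 3 : ℝ) : ℝ) : ℂ)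
  let c₁ : ℂ := (((32 / 3 : ℝ) ^ (1 / 6 : ℝ) * Real.sqrt Real.pi : ℝ) : ℂ)
  let c₂ : ℂ := (((6 : ℝ) ^ (1 / 6 : ℝ) * Real.sqrt Real.pi : ℝ) : ℂ)
  !![exp (7 * I * Real.pi / 12) * c₁ * deriv airyAi (k * ζ * exp (-(I * Real.pi / 3))),
      exp (5 * I * Real.pi / 4) * c₁ * deriv airyAi (-(k * ζ));
    -exp (-(I * Real.pi / 12)) * c₂ * airyAi (k * ζ * exp (-(I * Real.pi / 3))),
      exp (I * Real.pi / 4) * c₂ * airyAi (-(k * ζ))]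

/-- The matrix `T`, extended from the sector above to the other sectors by its constant jumps. -/
def T (ζ : ℂ) : Mat :=
  if Real.pi / 3 ≤ ζ.arg then Tsector ζ
  else if 0 ≤ ζ.arg then Tsector ζ * !![1, 1; 0, 1]
  else if -(Real.pi / 3) < ζ.arg then Tsector ζ * !![1, 1; 0, 1] * !![0, -1; 1, 0]
  else Tsector ζ * !![1, 1; 0, 1] * !![0, -1; 1, 0] * !![1, 1; 0, 1]

/-- The local model `S^loc`. -/
def Sloc (ζ : ℂ) : Mat :=
  T ζ * !![exp (-(-ζ) ^ (3 / 2 : ℂ) / 2 + I * Real.pi / 4), 0;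
    0, exp ((-ζ) ^ (3 / 2 : ℂ) / 2 - I * Real.pi / 4)]

/-- The open sector `a < arg ζ < b`. -/
def sector (a b : ℝ) : Set ℂ := {ζ | ζ ≠ 0 ∧ a < ζ.arg ∧ ζ.arg < b}

/-- The complement of the contour formed by the rays `arg ζ = 0, π/3, -π/3, π`. -/
def offContour : Set ℂ :=
  sector 0 (Real.pi / 3) ∪ sector (Real.pi / 3) Real.pi ∪
    sector (-Real.pi) (-(Real.pi / 3)) ∪ sector (-(Real.pi / 3)) 0

/-- The Riemann-Hilbert problem for `S^loc`.  The rays `arg ζ = 0, ±π/3` are oriented towards the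
origin and the ray `arg ζ = π` away from it; the boundary value from the left of a ray is that of the
sector on its left.  `G₁`, `G₂`, `G₃`, `G₄` are the continuous extensions of `S` from the
four open sectors to their closures. -/
structure IsAiryModel (S : ℂ → Mat) : Prop where
  analytic : ∀ i j, AnalyticOnNhd ℂ (fun ζ => S ζ i j) offContour
  jump : ∃ G₁ G₂ G₃ G₄ : ℂ → Mat,
    (Set.EqOn S G₁ (sector 0 (Real.pi / 3)) ∧
      ContinuousOn G₁ (closure (sector 0 (Real.pi / 3)))) ∧
    (Set.EqOn S G₂ (sector (Real.pi / 3) Real.pi) ∧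
      ContinuousOn G₂ (closure (sector (Real.pi / 3) Real.pi))) ∧
    (Set.EqOn S G₃ (sector (-Real.pi) (-(Real.pi / 3))) ∧
      ContinuousOn G₃ (closure (sector (-Real.pi) (-(Real.pi / 3))))) ∧
    (Set.EqOn S G₄ (sector (-(Real.pi / 3)) 0) ∧
      ContinuousOn G₄ (closure (sector (-(Real.pi / 3)) 0))) ∧
    (∀ ζ : ℂ, ζ ≠ 0 → ζ.arg = 0 → G₄ ζ = G₁ ζ * !![0, I; I, 0]) ∧
    (∀ ζ : ℂ, ζ.arg = -(Real.pi / 3) →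
      G₃ ζ = G₄ ζ * !![1, -I * exp (-(I * ζ ^ (3 / 2 : ℂ))); 0, 1]) ∧
    (∀ ζ : ℂ, ζ.arg = Real.pi / 3 →
      G₁ ζ = G₂ ζ * !![1, -I * exp (I * ζ ^ (3 / 2 : ℂ)); 0, 1]) ∧
    (∀ ζ : ℂ, ζ.arg = Real.pi →
      G₃ ζ = G₂ ζ * !![1, 0; I * exp (-(-ζ) ^ (3 / 2 : ℂ)), 1])
  normalization : Tendsto (fun ζ => S ζ * (StildeLoc ζ)⁻¹)
    (Bornology.cobounded ℂ ⊓ 𝓟 offContour) (𝓝 1)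

/-! ### The endpoint model -/

/-- The prefactor `S̃^hol`, as a function of `z`: the quotient of
`S̃ = σ₁^((1-J)/2) Õ σ₁^((1-J)/2)` by `S̃^loc(ζ(z))`, given here off `[0, i A(x)]`. -/
def Shol (A : ℝ → ℝ) (x : ℝ) (φ : ℂ → ℂ) (h : ℝ) (z : ℂ) : Mat :=
  sig x * Otilde (A x) z * sig x * (StildeLoc (zeta φ h z))⁻¹

/-- The matrix `Ŝ = S̃^hol S^loc` at `ζ = ζ(z)`. -/
def Shat (A : ℝ → ℝ) (x : ℝ) (φ : ℂ → ℂ) (h : ℝ) (z : ℂ) : Mat :=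
  Shol A x φ h z * Sloc (zeta φ h z)

/-- The local model `N̂_endpoint`.  It is meant off the imaginary axis; on the lens boundaries it is
given by its boundary value from outside the lens. -/
def Nendpoint (A : ℝ → ℝ) (x : ℝ) (Θ φ : ℂ → ℂ) (h : ℝ) (z : ℂ) : Mat :=
  sig x * Shat A x φ h z * lensFactor (zeta φ h z) (Θ z / h) * sig x

end

end EndpointModel

open EndpointModel

/-! In the variable w = -iλ the endpoint ia becomes the real point a, and everything near it is
governed by one conformal map φ and one explicit Airy matrix.

Phases. The WKB density is a superposition over u of Abel kernels s/√(A(u)² - s²) (`rho0_eq`).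
Arcsine integrals then evaluate all potentials. The Cauchy type integrals in ρ remove exactly the
contribution of |u| < |x| (`rho_eq`). The logarithm is itself an Abel transform, so integrating it
against an Abel kernel composes two Abel transforms and yields an elementary root (`abel_inversion`,
`abel_log_kernel`, `abel_log_kernel_complex`). Hence on the positive imaginary axis θ(iy) is the
integral of √(A² - y²) over {A ≤ a}, and φ̃(iy) is minus the integral of √(y² - A²) over {A > a},
both roots being zero where the radicand is negative (`theta_eq_integral`, `phiTilde_eq_integral`).

Local coordinate. Substituting v = A(u) shows that near y = a these are (a - y)^{3/2} H(y) below a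
and -(y - a)^{3/2} H(y) above it, with one and the same analytic H, positive at a
(`exists_phase_density`). So φ = (a - w) H^{2/3} is conformal, θ = φ^{3/2} below ia, φ̃ =
-(-φ)^{3/2} above it, and each phase vanishes on the other side.

Airy model. The columns of T are rotated Airy functions; the connection formula gives constant jumps
between sectors, and the diagonal exponential factor turns them into the prescribed ones. The
asymptotics come from moving the contour to the saddle. This is done by differentiating half-line
integrals in a parameter and integrating by parts, so that no contour deformation is needed
(`translate_contour`, `cubicInt_rotate`). The outcome is agreement with the frame
2^{-1/2}(-ζ)^{σ₃/4}[1 1; -1 1] up to relative error |ζ|^{-3/4} (`Sloc_nearFrame`).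

Assembly. The quarter-root branches of β and (-φ)^{1/4} cancel in the product, which is a
nonvanishing holomorphic function e; the prefactor is therefore an explicit unimodular matrix with
entries proportional to E and 1/E, where E = ħ^{-1/6} e (`EndpointData.Shol_eq`). The lens factor
undoes the jumps on arg ζ = ±π/3, so the model is one analytic expression on each half-disk, and the
single remaining jump is V_N (`EndpointData.hasJump`). Prefactor and Airy matrix are each
O(ħ^{-1/6}), which gives the bound ħ^{-1/3}. On the circle |ζ| is of order ħ^{-2/3}; conjugation by
the prefactor weights the Airy errors so that all of them become O(ħ^{1/2}), more than is claimed
(`EndpointData.matching`). -/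

namespace EndpointModel

noncomputable section

/-! ### Moments of cubic exponentials on a half-line -/

/-- The moments `∫₀^∞ uⁿ exp(κ u³ + s u² + w u) du`. -/
def cubicInt (n : ℕ) (κ s w : ℂ) : ℂ :=
  ∫ u in Set.Ioi (0 : ℝ), (u : ℂ) ^ n * exp (κ * u ^ 3 + s * u ^ 2 + w * u)

/-- Beyond the cutoff t + 1 the cubic term beats both lower ones; before it these are bounded by
their values at the cutoff. The spare -2u pays for a polynomial factor, via u^n ≤ n! e^u, and still
leaves an integrable e^{-u}. -/
lemma cubic_le {δ M u : ℝ} (hδ : 0 < δ) (hM : 0 ≤ M) (hu : 0 ≤ u) :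
    -δ * u ^ 3 + M * u ^ 2 + M * u ≤
      (M * ((2 * M + 2) / δ + 1) ^ 2 + (M + 2) * ((2 * M + 2) / δ + 1)) - 2 * u := by
  set t := (2 * M + 2) / δ with ht
  have htpos : 0 < t := by positivity
  rcases le_total u (t + 1) with h | h
  · have h1 : u ^ 2 ≤ (t + 1) ^ 2 := by gcongr
    have h2 : 0 ≤ δ * u ^ 3 := by positivity
    nlinarith [mul_le_mul_of_nonneg_left h1 hM, mul_le_mul_of_nonneg_left h hM]
  · have h1 : 2 * M + 2 ≤ δ * u := by
      have : (2 * M + 2) = δ * t := by rw [ht]; field_simp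
      rw [this]; gcongr; linarith
    have h2 : (2 * M + 2) * u ^ 2 ≤ δ * u ^ 3 := by
      have := mul_le_mul_of_nonneg_right h1 (sq_nonneg u); nlinarith
    have hu1 : 1 ≤ u := by linarith
    have h3 : u ≤ u ^ 2 := by nlinarith
    have h4 : 0 ≤ M * (t + 1) ^ 2 + (M + 2) * (t + 1) := by positivity
    nlinarith [mul_le_mul_of_nonneg_left h3 hM]

lemma integrableOn_pow_mul_exp_neg_cubic (n : ℕ) {δ M : ℝ} (hδ : 0 < δ) (hM : 0 ≤ M) :
    IntegrableOn (fun u : ℝ => u ^ n * Real.exp (-δ * u ^ 3 + M * u ^ 2 + M * u))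
      (Set.Ioi 0) := by
  set C := (M * ((2 * M + 2) / δ + 1) ^ 2 + (M + 2) * ((2 * M + 2) / δ + 1))
  have h0 : IntegrableOn (fun u : ℝ => Real.exp C * (n.factorial : ℝ) * Real.exp (-1 * u))
      (Set.Ioi 0) := (integrableOn_exp_mul_Ioi (by norm_num) 0).const_mul _
  refine h0.mono' (by fun_prop) ?_
  filter_upwards [self_mem_ae_restrict measurableSet_Ioi] with u hu
  have hu : (0 : ℝ) < u := hu
  rw [Real.norm_of_nonneg (by positivity)]
  have h1 : u ^ n ≤ n.factorial * Real.exp u := by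
    have := Real.pow_div_factorial_le_exp u hu.le n
    rwa [div_le_iff₀' (by positivity)] at this
  have h2 := Real.exp_le_exp.2 (cubic_le hδ hM hu.le)
  calc _ ≤ (n.factorial * Real.exp u) * Real.exp (C - 2 * u) := by gcongr
    _ = _ := by
      rw [show C - 2 * u = C + (-1 * u) + (-u) by ring, Real.exp_add, Real.exp_add, Real.exp_neg u]
      field_simp

lemma norm_cubic_le {κ s w : ℂ} {δ M u : ℝ} (hκ : κ.re ≤ -δ) (hs : ‖s‖ ≤ M) (hw : ‖w‖ ≤ M)
    (hu : 0 ≤ u) (n : ℕ) :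
    ‖(u : ℂ) ^ n * exp (κ * u ^ 3 + s * u ^ 2 + w * u)‖ ≤
      u ^ n * Real.exp (-δ * u ^ 3 + M * u ^ 2 + M * u) := by
  rw [norm_mul, norm_pow, Complex.norm_real, Real.norm_of_nonneg hu, Complex.norm_exp]
  gcongr
  have h1 : (κ * (u : ℂ) ^ 3 + s * (u : ℂ) ^ 2 + w * u).re = κ.re * u ^ 3 + s.re * u ^ 2 + w.re * u := by
    simp [← ofReal_pow]
  rw [h1]
  have := (re_le_norm s).trans hs
  have := (re_le_norm w).trans hw
  gcongr

lemma integrableOn_cubicInt (n : ℕ) {κ : ℂ} (hκ : κ.re < 0) (s w : ℂ) :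
    IntegrableOn (fun u : ℝ => (u : ℂ) ^ n * exp (κ * u ^ 3 + s * u ^ 2 + w * u)) (Set.Ioi 0) := by
  refine (integrableOn_pow_mul_exp_neg_cubic n (δ := -κ.re) (M := ‖s‖ + ‖w‖) (by linarith)
    (by positivity)).mono' (by fun_prop) ?_
  filter_upwards [self_mem_ae_restrict measurableSet_Ioi] with u hu
  exact norm_cubic_le (by linarith) (by linarith [norm_nonneg w]) (by linarith [norm_nonneg s])
    (le_of_lt hu) n

lemma hasDerivAt_cubicInt (n : ℕ) {κ s w : ℂ → ℂ} (hκ : Differentiable ℂ κ)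
    (hs : Differentiable ℂ s) (hw : Differentiable ℂ w) {z₀ : ℂ} (h0 : (κ z₀).re < 0) :
    HasDerivAt (fun z => cubicInt n (κ z) (s z) (w z))
      (deriv κ z₀ * cubicInt (n + 3) (κ z₀) (s z₀) (w z₀) +
        deriv s z₀ * cubicInt (n + 2) (κ z₀) (s z₀) (w z₀) +
        deriv w z₀ * cubicInt (n + 1) (κ z₀) (s z₀) (w z₀)) z₀ := by
  have cd : ∀ f : ℂ → ℂ, Differentiable ℂ f → Continuous (deriv f) := fun f hf =>
    (hf.contDiff (n := 1)).continuous_deriv le_rfl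
  -- `b` dominates at once every coefficient norm that enters the differentiated integrand, and
  -- halving Re κ keeps strict decay, so one neighbourhood of z₀ carries one majorant.
  set b : ℂ → ℝ := fun z => ‖s z‖ + ‖w z‖ + ‖deriv κ z‖ + ‖deriv s z‖ + ‖deriv w z‖ with hb
  have hbc : Continuous b := by
    have := cd κ hκ; have := cd s hs; have := cd w hw
    have := hs.continuous; have := hw.continuous
    fun_prop
  set M := b z₀ + 1 with hMd
  have hM0 : 0 ≤ M := by positivity
  set δ := -(κ z₀).re / 2 with hδd
  have hδ : 0 < δ := by rw [hδd]; linarith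
  have hU : {z | b z < M ∧ (κ z).re < -δ} ∈ 𝓝 z₀ := by
    refine inter_mem (hbc.continuousAt.eventually_lt_const (by linarith)) ?_
    exact ((continuous_re.comp hκ.continuous).continuousAt).eventually_lt_const
      (show (κ z₀).re < -δ by rw [hδd]; linarith)
  set F' : ℂ → ℝ → ℂ := fun z u => (u : ℂ) ^ n *
    (exp (κ z * u ^ 3 + s z * u ^ 2 + w z * u) *
      (deriv κ z * u ^ 3 + deriv s z * u ^ 2 + deriv w z * u)) with hF'
  have key := hasDerivAt_integral_of_dominated_loc_of_deriv_le
    (μ := volume.restrict (Set.Ioi (0 : ℝ)))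
    (F := fun z (u : ℝ) => (u : ℂ) ^ n * exp (κ z * u ^ 3 + s z * u ^ 2 + w z * u))
    (F' := F') (x₀ := z₀)
    (bound := fun u => M * (u ^ (n + 3) * Real.exp (-δ * u ^ 3 + M * u ^ 2 + M * u)) +
      M * (u ^ (n + 2) * Real.exp (-δ * u ^ 3 + M * u ^ 2 + M * u)) +
      M * (u ^ (n + 1) * Real.exp (-δ * u ^ 3 + M * u ^ 2 + M * u)))
    hU (Eventually.of_forall fun z => by fun_prop)
    (integrableOn_cubicInt n h0 _ _) (by simp only [hF']; fun_prop) ?_ ?_ ?_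
  · refine key.2.congr_deriv ?_
    simp only [cubicInt, hF']
    rw [← integral_const_mul, ← integral_const_mul, ← integral_const_mul, ← integral_add,
      ← integral_add]
    · congr 1; ext u; ring
    · exact ((integrableOn_cubicInt (n+3) h0 _ _).const_mul _).add
        ((integrableOn_cubicInt (n+2) h0 _ _).const_mul _)
    · exact (integrableOn_cubicInt (n+1) h0 _ _).const_mul _
    · exact (integrableOn_cubicInt (n+3) h0 _ _).const_mul _
    · exact (integrableOn_cubicInt (n+2) h0 _ _).const_mul _
  · filter_upwards [self_mem_ae_restrict measurableSet_Ioi] with u hu z hz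
    have hu : (0 : ℝ) < u := hu
    obtain ⟨hz1, hz2⟩ := hz
    simp only [hb] at hz1
    have n1 := norm_nonneg (s z); have n2 := norm_nonneg (w z)
    have n3 := norm_nonneg (deriv κ z); have n4 := norm_nonneg (deriv s z)
    have n5 := norm_nonneg (deriv w z)
    have e : F' z u = deriv κ z * ((u : ℂ) ^ (n + 3) * exp (κ z * u ^ 3 + s z * u ^ 2 + w z * u)) +
      deriv s z * ((u : ℂ) ^ (n + 2) * exp (κ z * u ^ 3 + s z * u ^ 2 + w z * u)) +
      deriv w z * ((u : ℂ) ^ (n + 1) * exp (κ z * u ^ 3 + s z * u ^ 2 + w z * u)) := by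
      simp only [hF']; ring
    rw [e]
    have hh := fun m => norm_cubic_le (κ := κ z) (s := s z) (w := w z) (δ := δ) (M := M)
      hz2.le (by linarith) (by linarith) hu.le m
    refine (norm_add₃_le).trans ?_
    rw [norm_mul (deriv κ z), norm_mul (deriv s z), norm_mul (deriv w z)]
    have a1 : ‖deriv κ z‖ ≤ M := by linarith
    have a2 : ‖deriv s z‖ ≤ M := by linarith
    have a3 : ‖deriv w z‖ ≤ M := by linarith
    have b1 := mul_le_mul a1 (hh (n + 3)) (norm_nonneg _) hM0
    have b2 := mul_le_mul a2 (hh (n + 2)) (norm_nonneg _) hM0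
    have b3 := mul_le_mul a3 (hh (n + 1)) (norm_nonneg _) hM0
    exact add_le_add (add_le_add b1 b2) b3
  · exact (((integrableOn_pow_mul_exp_neg_cubic _ hδ hM0).const_mul M).add
      ((integrableOn_pow_mul_exp_neg_cubic _ hδ hM0).const_mul M)).add
      ((integrableOn_pow_mul_exp_neg_cubic _ hδ hM0).const_mul M)
  · filter_upwards with u z hz
    have h1 : HasDerivAt (fun z => κ z * u ^ 3 + s z * u ^ 2 + w z * u)
        (deriv κ z * u ^ 3 + deriv s z * u ^ 2 + deriv w z * u) z :=
      (((hκ z).hasDerivAt.mul_const _).add ((hs z).hasDerivAt.mul_const _)).add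
        ((hw z).hasDerivAt.mul_const _)
    exact h1.cexp.const_mul _

lemma tendsto_cubic_atTop (n : ℕ) {κ : ℂ} (hκ : κ.re < 0) (s w : ℂ) :
    Tendsto (fun u : ℝ => (u : ℂ) ^ n * exp (κ * u ^ 3 + s * u ^ 2 + w * u)) atTop (𝓝 0) := by
  set M := ‖s‖ + ‖w‖ with hM
  have hM0 : 0 ≤ M := by positivity
  have hδ : 0 < -κ.re := by linarith
  set C := (M * ((2 * M + 2) / (-κ.re) + 1) ^ 2 + (M + 2) * ((2 * M + 2) / (-κ.re) + 1))
  have h0 : Tendsto (fun u : ℝ => Real.exp C * (n.factorial : ℝ) * Real.exp (-u)) atTop (𝓝 0) := by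
    simpa using Real.tendsto_exp_neg_atTop_nhds_zero.const_mul (Real.exp C * (n.factorial : ℝ))
  refine squeeze_zero_norm' ?_ h0
  filter_upwards [eventually_ge_atTop 0] with u hu
  refine (norm_cubic_le (δ := -κ.re) (M := M) (by linarith) (by linarith [norm_nonneg w])
    (by linarith [norm_nonneg s]) hu n).trans ?_
  have h1 : u ^ n ≤ n.factorial * Real.exp u := by
    have := Real.pow_div_factorial_le_exp u hu n
    rwa [div_le_iff₀' (by positivity)] at this
  have h2 := Real.exp_le_exp.2 (cubic_le hδ hM0 hu)
  calc _ ≤ (n.factorial * Real.exp u) * Real.exp (C - 2 * u) := by gcongr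
    _ = _ := by
      rw [show C - 2 * u = C + (-u) + (-u) by ring, Real.exp_add, Real.exp_add, Real.exp_neg u]
      field_simp

/-- Integration by parts for the moments. -/
lemma cubicInt_parts (n : ℕ) {κ : ℂ} (hκ : κ.re < 0) (s w : ℂ) :
    3 * κ * cubicInt (n + 2) κ s w + 2 * s * cubicInt (n + 1) κ s w + w * cubicInt n κ s w
      + n * cubicInt (n - 1) κ s w = -(0 : ℂ) ^ n := by
  have hd : ∀ u ∈ Set.Ici (0 : ℝ), HasDerivAt
      (fun u : ℝ => (u : ℂ) ^ n * exp (κ * u ^ 3 + s * u ^ 2 + w * u))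
      (3 * κ * ((u : ℂ) ^ (n + 2) * exp (κ * u ^ 3 + s * u ^ 2 + w * u)) +
        2 * s * ((u : ℂ) ^ (n + 1) * exp (κ * u ^ 3 + s * u ^ 2 + w * u)) +
        w * ((u : ℂ) ^ n * exp (κ * u ^ 3 + s * u ^ 2 + w * u)) +
        n * ((u : ℂ) ^ (n - 1) * exp (κ * u ^ 3 + s * u ^ 2 + w * u))) u := by
    intro u _
    have h1 : HasDerivAt (fun u : ℂ => u ^ n * exp (κ * u ^ 3 + s * u ^ 2 + w * u))
        (n * (u : ℂ) ^ (n - 1) * exp (κ * u ^ 3 + s * u ^ 2 + w * u) +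
          (u : ℂ) ^ n * (exp (κ * u ^ 3 + s * u ^ 2 + w * u) *
          (κ * (3 * (u : ℂ) ^ 2) + s * (2 * u) + w * 1))) u := by
      refine HasDerivAt.mul (hasDerivAt_pow n _) (HasDerivAt.cexp ?_)
      refine ((HasDerivAt.const_mul _ ?_).add (HasDerivAt.const_mul _ ?_)).add
        ((hasDerivAt_id _).const_mul _)
      · simpa using hasDerivAt_pow 3 (u : ℂ)
      · simpa using hasDerivAt_pow 2 (u : ℂ)
    refine h1.comp_ofReal.congr_deriv ?_
    ring
  have hi : ∀ m, IntegrableOn (fun u : ℝ => (u : ℂ) ^ m * exp (κ * u ^ 3 + s * u ^ 2 + w * u))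
    (Set.Ioi 0) := fun m => integrableOn_cubicInt m hκ s w
  have h12 := ((hi (n + 2)).const_mul (3 * κ)).add ((hi (n + 1)).const_mul (2 * s))
  have h123 := h12.add ((hi n).const_mul w)
  -- Only the lower endpoint contributes, and only for n = 0. The truncated exponent n - 1 is
  -- harmless at n = 0 because it comes with the factor n.
  have key := integral_Ioi_of_hasDerivAt_of_tendsto' hd
    (h123.add ((hi (n - 1)).const_mul (n : ℂ))) (tendsto_cubic_atTop n hκ s w)
  simp only [cubicInt]
  rw [← integral_const_mul, ← integral_const_mul, ← integral_const_mul, ← integral_const_mul,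
    ← integral_add, ← integral_add, ← integral_add]
  · rw [key]; simp
  · exact h123
  · exact (hi (n - 1)).const_mul (n : ℂ)
  · exact h12
  · exact (hi n).const_mul w
  · exact (hi (n + 2)).const_mul (3 * κ)
  · exact (hi (n + 1)).const_mul (2 * s)

/-! ### The Airy function: equation, connection formula, saddle point form -/

/-- The sixth root of unity `e^{iπ/3}`. -/
def sixthRoot : ℂ := exp (I * Real.pi / 3)

lemma sixthRoot_eq : sixthRoot = 1 / 2 + (Real.sqrt 3 / 2 : ℝ) * I := by
  have : I * (Real.pi : ℂ) / 3 = ((Real.pi / 3 : ℝ) : ℂ) * I := by push_cast; ring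
  rw [sixthRoot, this, exp_mul_I, ← ofReal_cos, ← ofReal_sin, Real.cos_pi_div_three,
    Real.sin_pi_div_three]
  push_cast; ring

lemma sqrt_three_sq : ((Real.sqrt 3 : ℝ) : ℂ) ^ 2 = 3 := by
  rw [← ofReal_pow, Real.sq_sqrt (by norm_num)]; norm_num

lemma sixthRoot_sq : sixthRoot ^ 2 = sixthRoot - 1 := by
  rw [sixthRoot_eq]; push_cast
  linear_combination (1 / 4) * I ^ 2 * sqrt_three_sq + (3 / 4) * I_sq

/-- With this, both directions of the Airy contour are polynomials in one number, and every identity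
between them follows from its quadratic relation. -/
lemma exp_neg_sixthRoot : exp (-(I * Real.pi / 3)) = 1 - sixthRoot := by
  have h : sixthRoot * (1 - sixthRoot) = 1 := by linear_combination -sixthRoot_sq
  have h2 : sixthRoot * exp (-(I * Real.pi / 3)) = 1 := by
    rw [sixthRoot, ← exp_add]; simp
  have h0 : sixthRoot ≠ 0 := exp_ne_zero _
  exact mul_left_cancel₀ h0 (h2.trans h.symm)

lemma sixthRoot_cube : sixthRoot ^ 3 = -1 := by
  linear_combination (sixthRoot + 1) * sixthRoot_sq

lemma airyAi_eq (w : ℂ) : airyAi w = 1 / (2 * Real.pi * I) *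
    (sixthRoot * cubicInt 0 (-1 / 3) 0 (-w * sixthRoot) -
      (1 - sixthRoot) * cubicInt 0 (-1 / 3) 0 (-w * (1 - sixthRoot))) := by
  rw [airyAi, ← exp_neg_sixthRoot]
  simp only [cubicInt]
  rw [← integral_const_mul, ← integral_const_mul]
  congr 2
  · refine integral_congr_ae (Eventually.of_forall fun u => ?_)
    simp only [sixthRoot, pow_zero, one_mul]; congr 2; ring
  · refine integral_congr_ae (Eventually.of_forall fun u => ?_)
    simp only [pow_zero, one_mul]; congr 2; ring

lemma hasDerivAt_cubicInt_scale (n : ℕ) (q w : ℂ) :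
    HasDerivAt (fun w => cubicInt n (-1 / 3) 0 (-w * q))
      (-q * cubicInt (n + 1) (-1 / 3) 0 (-w * q)) w := by
  have h := hasDerivAt_cubicInt n (κ := fun _ => -1 / 3) (s := fun _ => 0) (w := fun w => -w * q)
    (by fun_prop) (by fun_prop) (by fun_prop) (z₀ := w) (by norm_num)
  refine h.congr_deriv ?_
  have : deriv (fun w : ℂ => -w * q) w = -q := by
    have : HasDerivAt (fun w : ℂ => -w * q) (-1 * q) w := (hasDerivAt_neg w).mul_const q
    rw [this.deriv]; ring
  rw [this]; simp

lemma hasDerivAt_airyAi (w : ℂ) : HasDerivAt airyAi (1 / (2 * Real.pi * I) *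
    (-sixthRoot ^ 2 * cubicInt 1 (-1 / 3) 0 (-w * sixthRoot) +
      (1 - sixthRoot) ^ 2 * cubicInt 1 (-1 / 3) 0 (-w * (1 - sixthRoot)))) w := by
  rw [funext airyAi_eq]
  refine ((((hasDerivAt_cubicInt_scale 0 sixthRoot w).const_mul sixthRoot).sub
    ((hasDerivAt_cubicInt_scale 0 (1 - sixthRoot) w).const_mul (1 - sixthRoot))).const_mul
    _).congr_deriv ?_
  ring

lemma differentiable_airyAi : Differentiable ℂ airyAi := fun w =>
  (hasDerivAt_airyAi w).differentiableAt

/-- Airy's equation. -/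
lemma hasDerivAt_deriv_airyAi (w : ℂ) : HasDerivAt (deriv airyAi) (w * airyAi w) w := by
  rw [show deriv airyAi = _ from funext fun w => (hasDerivAt_airyAi w).deriv]
  refine ((((hasDerivAt_cubicInt_scale 1 sixthRoot w).const_mul (-sixthRoot ^ 2)).add
    ((hasDerivAt_cubicInt_scale 1 (1 - sixthRoot) w).const_mul ((1 - sixthRoot) ^ 2))).const_mul
    _).congr_deriv ?_
  -- Integration by parts trades the second moment for the zeroth. Its boundary terms cancel between
  -- the two rays because both directions have cube -1.
  have h1 := cubicInt_parts 0 (κ := -1 / 3) (by norm_num) 0 (-w * sixthRoot)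
  have h2 := cubicInt_parts 0 (κ := -1 / 3) (by norm_num) 0 (-w * (1 - sixthRoot))
  simp only [zero_add, Nat.cast_zero, zero_mul, mul_zero, add_zero, pow_zero] at h1 h2
  rw [airyAi_eq, show (1 : ℕ) + 1 = 2 from rfl]
  set X := cubicInt 2 (-1 / 3) 0 (-w * sixthRoot)
  set Y := cubicInt 2 (-1 / 3) 0 (-w * (1 - sixthRoot))
  have hx : X = 1 - w * sixthRoot * cubicInt 0 (-1 / 3) 0 (-w * sixthRoot) := by
    linear_combination -h1
  have hy : Y = 1 - w * (1 - sixthRoot) * cubicInt 0 (-1 / 3) 0 (-w * (1 - sixthRoot)) := by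
    linear_combination -h2
  have e : (1 - sixthRoot) ^ 3 = -1 := by
    linear_combination (-sixthRoot + 2) * sixthRoot_sq
  have : -sixthRoot ^ 2 * (-sixthRoot * X) + (1 - sixthRoot) ^ 2 * (-(1 - sixthRoot) * Y) =
      w * (sixthRoot * cubicInt 0 (-1 / 3) 0 (-w * sixthRoot) -
      (1 - sixthRoot) * cubicInt 0 (-1 / 3) 0 (-w * (1 - sixthRoot))) := by
    have : -sixthRoot ^ 2 * (-sixthRoot * X) + (1 - sixthRoot) ^ 2 * (-(1 - sixthRoot) * Y) =
      sixthRoot ^ 3 * X - (1 - sixthRoot) ^ 3 * Y := by ring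
    rw [this, e, sixthRoot_cube, hx, hy]; ring
  rw [this]; ring

/-- The connection formula of the three rotated Airy functions. -/
lemma airyAi_connection (w : ℂ) :
    airyAi w + sixthRoot ^ 2 * airyAi (sixthRoot ^ 2 * w) -
      sixthRoot * airyAi (-sixthRoot * w) = 0 := by
  rw [airyAi_eq, airyAi_eq, airyAi_eq]
  have e0 : sixthRoot ^ 2 = sixthRoot - 1 := sixthRoot_sq
  -- Each rotated Airy function is a difference of integrals over two of the same three rays, so the
  -- six half-line integrals coincide in pairs.
  have e1 : -(sixthRoot ^ 2 * w) * sixthRoot = w := by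
    linear_combination -w * sixthRoot_cube
  have e2 : -(sixthRoot ^ 2 * w) * (1 - sixthRoot) = -w * sixthRoot := by
    linear_combination w * sixthRoot_cube - w * sixthRoot_sq
  have e3 : -(-sixthRoot * w) * sixthRoot = -w * (1 - sixthRoot) := by
    linear_combination w * sixthRoot_sq
  have e4 : -(-sixthRoot * w) * (1 - sixthRoot) = w := by
    linear_combination -w * sixthRoot_sq
  rw [e1, e2, e3, e4]
  linear_combination (1 / (2 * Real.pi * I)) * sixthRoot_cube * cubicInt 0 (-1 / 3) 0 w +
    (1 / (2 * Real.pi * I)) * sixthRoot_sq * (sixthRoot * cubicInt 0 (-1 / 3) 0 (-w * sixthRoot) - cubicInt 0 (-1 / 3) 0 w -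
      cubicInt 0 (-1 / 3) 0 (-w * (1 - sixthRoot)))

lemma airyAi_connection_deriv (w : ℂ) :
    deriv airyAi w + sixthRoot ^ 4 * deriv airyAi (sixthRoot ^ 2 * w) +
      sixthRoot ^ 2 * deriv airyAi (-sixthRoot * w) = 0 := by
  have hd : ∀ q : ℂ, HasDerivAt (fun w => airyAi (q * w)) (deriv airyAi (q * w) * q) w := by
    intro q
    have h := (differentiable_airyAi (q * w)).hasDerivAt
    have h2 : HasDerivAt (fun w : ℂ => q * w) q w := by
      simpa using (hasDerivAt_id w).const_mul q
    exact h.comp w h2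
  have h := ((differentiable_airyAi w).hasDerivAt.add ((hd (sixthRoot ^ 2)).const_mul
    (sixthRoot ^ 2))).sub ((hd (-sixthRoot)).const_mul sixthRoot)
  have h0 : HasDerivAt (fun w => airyAi w + sixthRoot ^ 2 * airyAi (sixthRoot ^ 2 * w) -
      sixthRoot * airyAi (-sixthRoot * w)) 0 w := by
    rw [funext airyAi_connection]; exact hasDerivAt_const _ _
  linear_combination h.unique h0

/-- Translating the contour of the Airy integral by `c`. -/
lemma translate_contour (q w : ℂ) (hq : q ^ 3 = -1) (c : ℂ) :
    HasDerivAt (fun c => exp (c ^ 3 / 3 - w * c) *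
      (q * cubicInt 0 (-1 / 3) (c * q ^ 2) ((c ^ 2 - w) * q)))
      (-exp (c ^ 3 / 3 - w * c)) c := by
  have h1 : HasDerivAt (fun c : ℂ => exp (c ^ 3 / 3 - w * c))
      (exp (c ^ 3 / 3 - w * c) * (c ^ 2 - w)) c := by
    refine HasDerivAt.cexp ?_
    refine (((hasDerivAt_pow 3 c).div_const 3).sub ((hasDerivAt_id c).const_mul w)).congr_deriv ?_
    simp
  have h2 := hasDerivAt_cubicInt 0 (κ := fun _ => -1 / 3) (s := fun c => c * q ^ 2)
    (w := fun c => (c ^ 2 - w) * q) (by fun_prop) (by fun_prop) (by fun_prop) (z₀ := c)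
    (by norm_num)
  have d1 : deriv (fun c : ℂ => c * q ^ 2) c = q ^ 2 := by
    simp
  have d2 : deriv (fun c : ℂ => (c ^ 2 - w) * q) c = 2 * c * q := by
    simp
  rw [d1, d2] at h2
  refine (h1.mul (h2.const_mul q)).congr_deriv ?_
  have h3 := cubicInt_parts 0 (κ := -1 / 3) (by norm_num) (c * q ^ 2) ((c ^ 2 - w) * q)
  simp only [zero_add, Nat.cast_zero, zero_mul, add_zero, pow_zero, deriv_const] at h3 ⊢
  set X := cubicInt 2 (-1 / 3) (c * q ^ 2) ((c ^ 2 - w) * q)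
  set Y := cubicInt 1 (-1 / 3) (c * q ^ 2) ((c ^ 2 - w) * q)
  set Z := cubicInt 0 (-1 / 3) (c * q ^ 2) ((c ^ 2 - w) * q)
  -- The function is the integral of exp(t³/3 - wt) along the ray t = c + qu (expand, using q³ =
  -- -1). Moving the starting point therefore costs the integrand there, and `h3` is the formal
  -- expression of this.
  linear_combination exp (c ^ 3 / 3 - w * c) * (h3 + X * hq)

/-- The saddle point form of the Airy function. -/
lemma airyAi_saddle (c : ℂ) : 2 * Real.pi * I * airyAi (c ^ 2) = exp (-(2 / 3) * c ^ 3) *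
    (sixthRoot * cubicInt 0 (-1 / 3) (c * sixthRoot ^ 2) 0 -
      (1 - sixthRoot) * cubicInt 0 (-1 / 3) (c * (1 - sixthRoot) ^ 2) 0) := by
  have e : (1 - sixthRoot) ^ 3 = -1 := by
    linear_combination (-sixthRoot + 2) * sixthRoot_sq
  -- The derivative just found does not depend on q, so the difference of the two rays is constant
  -- in c. Taking w = c² starts both rays at the saddle and removes the linear term.
  have hd := fun z => (translate_contour sixthRoot (c ^ 2) sixthRoot_cube z).sub
    (translate_contour (1 - sixthRoot) (c ^ 2) e z)
  have hc := is_const_of_deriv_eq_zero (fun z => (hd z).differentiableAt)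
    (fun z => by rw [(hd z).deriv]; ring) 0 c
  have hpi : (2 * Real.pi * I : ℂ) ≠ 0 := by simp [Real.pi_ne_zero]
  rw [airyAi_eq, ← mul_assoc, mul_one_div_cancel hpi, one_mul]
  have e2 : c ^ 3 / 3 - c ^ 2 * c = -(2 / 3) * c ^ 3 := by ring
  have e3 : (0 : ℂ) ^ 3 / 3 - c ^ 2 * 0 = 0 := by ring
  have e4 : ((0 : ℂ) ^ 2 - c ^ 2) = -c ^ 2 := by ring
  simp only [Pi.sub_apply, sub_self, zero_mul, e2, e3, e4, exp_zero, one_mul] at hc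
  rw [hc]; ring

/-! ### Asymptotics of the Airy function -/

lemma exp_mul_I_re (x : ℂ) : (exp (I * x)).re = Real.exp (-x.im) * Real.cos x.re := by
  rw [exp_re]; simp

/-- Rotating the contour of the moments. -/
lemma cubicInt_rotate (n : ℕ) (s : ℂ) {β : ℝ} (hβ : |β| < Real.pi / 6) :
    cubicInt n (-1 / 3) s 0 = exp (I * (n + 1) * β) *
      cubicInt n (-exp (I * (3 * β)) / 3) (s * exp (I * (2 * β))) 0 := by
  set U : Set ℂ := {z | -(Real.pi / 6) < z.re} ∩ {z | z.re < Real.pi / 6} with hU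
  have hUo : IsOpen U := (isOpen_lt continuous_const continuous_re).inter
    (isOpen_lt continuous_re continuous_const)
  have hUc : Convex ℝ U := (convex_halfSpace_re_gt _).inter (convex_halfSpace_re_lt _)
  have hκ : ∀ z ∈ U, (-exp (I * (3 * z)) / 3).re < 0 := by
    intro z hz
    obtain ⟨h1, h2⟩ := hz
    have h1 : -(Real.pi / 6) < z.re := h1
    have h2 : z.re < Real.pi / 6 := h2
    have : 0 < (exp (I * (3 * z))).re := by
      rw [exp_mul_I_re]
      have : (3 * z).re = 3 * z.re := by simp
      rw [this]
      have := Real.cos_pos_of_mem_Ioo (x := 3 * z.re) ⟨by linarith, by linarith⟩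
      positivity
    have e : (-exp (I * (3 * z)) / 3).re = -(exp (I * (3 * z))).re / 3 := by
      rw [show (3 : ℂ) = ((3 : ℝ) : ℂ) by norm_num, div_ofReal_re, neg_re]
    rw [e]; linarith
  have hE : ∀ (k z : ℂ), HasDerivAt (fun z => exp (I * (k * z))) (exp (I * (k * z)) * (I * k)) z := by
    intro k z
    refine HasDerivAt.cexp ?_
    simpa using ((hasDerivAt_id z).const_mul k).const_mul I
  have hd : ∀ z ∈ U, HasDerivAt (fun z => exp (I * ((n + 1 : ℂ) * z)) *
      cubicInt n (-exp (I * (3 * z)) / 3) (s * exp (I * (2 * z))) 0) 0 z := by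
    intro z hz
    have h2 := hasDerivAt_cubicInt n (κ := fun z => -exp (I * (3 * z)) / 3)
      (s := fun z => s * exp (I * (2 * z))) (w := fun z => 0) (by fun_prop) (by fun_prop)
      (by fun_prop) (z₀ := z) (hκ z hz)
    have d1 : deriv (fun z => -exp (I * (3 * z)) / 3) z = -(exp (I * (3 * z)) * (I * 3)) / 3 :=
      ((hE 3 z).neg.div_const 3).deriv
    have d2 : deriv (fun z => s * exp (I * (2 * z))) z = s * (exp (I * (2 * z)) * (I * 2)) :=
      ((hE 2 z).const_mul s).deriv
    rw [d1, d2] at h2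
    refine ((hE (n + 1) z).mul h2).congr_deriv ?_
    -- The derivative in the rotation angle is a multiple of the integration by parts identity at
    -- index n + 1, whose boundary term vanishes. The strip of half-width π/6 is where the rotated
    -- cubic coefficient keeps negative real part.
    have h3 := cubicInt_parts (n + 1) (hκ z hz) (s * exp (I * (2 * z))) 0
    simp only [deriv_const, Nat.add_sub_cancel, zero_mul, add_zero, Nat.cast_add, Nat.cast_one] at h3 ⊢
    rw [zero_pow (Nat.succ_ne_zero n), show n + 1 + 2 = n + 3 from rfl, show n + 1 + 1 = n + 2 from rfl] at h3
    linear_combination exp (I * ((n + 1) * z)) * I * h3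
  have hc := hUo.is_const_of_deriv_eq_zero hUc.isPreconnected
    (fun z hz => (hd z hz).differentiableAt.differentiableWithinAt)
    (fun z hz => (hd z hz).deriv) (x := 0) (y := β)
    ⟨by simp [Real.pi_pos], by simp [Real.pi_pos]⟩
    ⟨by simpa using (abs_lt.1 hβ).1, by simpa using (abs_lt.1 hβ).2⟩
  simp only [mul_zero, exp_zero, one_mul, mul_one] at hc
  rw [hc, mul_assoc]

/-- Mean value inequality on the convex half-plane where the derivative of exp has modulus at most
1. -/
lemma norm_exp_sub_one_le_of_re_nonpos {z : ℂ} (hz : z.re ≤ 0) : ‖exp z - 1‖ ≤ ‖z‖ := by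
  have h := Convex.norm_image_sub_le_of_norm_deriv_le (𝕜 := ℂ) (f := exp) (C := 1)
    (s := {z | z.re ≤ 0}) (x := 0) (y := z) (fun x _ => differentiable_exp x)
    (fun x hx => by
      rw [Complex.deriv_exp, norm_exp]; exact Real.exp_le_one_iff.2 hx)
    (convex_halfSpace_re_le 0) (by simp) hz
  simpa using h

lemma integral_pow_mul_exp_neg_mul_sq (m : ℕ) {d : ℝ} (hd : 0 < d) :
    ∫ u in Set.Ioi (0 : ℝ), u ^ m * Real.exp (-d * u ^ 2) =
      d ^ (-((m : ℝ) + 1) / 2) * (1 / 2) * Real.Gamma (((m : ℝ) + 1) / 2) := by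
  have := _root_.integral_rpow_mul_exp_neg_mul_rpow (p := 2) (q := m) (b := d) (by norm_num)
    (by have : (0:ℝ) ≤ m := by positivity
        linarith) hd
  rw [← this]
  refine setIntegral_congr_fun measurableSet_Ioi fun u hu => ?_
  simp

lemma integrableOn_pow_mul_exp_neg_mul_sq (m : ℕ) {d : ℝ} (hd : 0 < d) :
    IntegrableOn (fun u : ℝ => u ^ m * Real.exp (-d * u ^ 2)) (Set.Ioi 0) := by
  have := integrableOn_rpow_mul_exp_neg_mul_sq (b := d) hd (s := m)
    (by have : (0:ℝ) ≤ m := by positivity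
        linarith)
  simpa using this

lemma norm_cubicInt_le (n : ℕ) {κ s : ℂ} {d : ℝ} (hd : 0 < d) (hκ : κ.re < 0) (hs : s.re ≤ -d) :
    ‖cubicInt n κ s 0‖ ≤ d ^ (-((n : ℝ) + 1) / 2) * (1 / 2) * Real.Gamma (((n : ℝ) + 1) / 2) := by
  rw [← integral_pow_mul_exp_neg_mul_sq n hd]
  refine norm_integral_le_of_norm_le (integrableOn_pow_mul_exp_neg_mul_sq n hd) ?_
  filter_upwards [self_mem_ae_restrict measurableSet_Ioi] with u hu
  have hu : 0 < u := hu
  rw [norm_mul, norm_pow, Complex.norm_real, Real.norm_of_nonneg hu.le, Complex.norm_exp]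
  gcongr
  have h1 : (κ * (u : ℂ) ^ 3 + s * (u : ℂ) ^ 2 + 0 * u).re = κ.re * u ^ 3 + s.re * u ^ 2 := by
    simp [← ofReal_pow]
  rw [h1]
  have : κ.re * u ^ 3 ≤ 0 := mul_nonpos_of_nonpos_of_nonneg hκ.le (by positivity)
  nlinarith [mul_le_mul_of_nonneg_right hs (sq_nonneg u)]

/-- Replacing exp(κu³) by 1 costs at most |κ|u³ ≤ u³, so the error is bounded by the third moment of
a Gaussian. -/
lemma norm_cubicInt_sub_gaussian_le {κ s : ℂ} {d : ℝ} (hd : 0 < d) (hκ : κ.re < 0)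
    (hκ1 : ‖κ‖ ≤ 1) (hs : s.re ≤ -d) :
    ‖cubicInt 0 κ s 0 - (Real.pi / (-s)) ^ (1 / 2 : ℂ) / 2‖ ≤
      d ^ (-2 : ℝ) * (1 / 2) * Real.Gamma 2 := by
  have hs0 : 0 < (-s).re := by rw [neg_re]; linarith
  rw [← integral_gaussian_complex_Ioi hs0]
  have h3' : ∫ u in Set.Ioi (0 : ℝ), u ^ 3 * Real.exp (-d * u ^ 2) =
      d ^ (-2 : ℝ) * (1 / 2) * Real.Gamma 2 := by
    rw [integral_pow_mul_exp_neg_mul_sq 3 hd, show -(((3 : ℕ) : ℝ) + 1) / 2 = -2 by norm_num,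
      show (((3 : ℕ) : ℝ) + 1) / 2 = 2 by norm_num]
  rw [← h3', cubicInt]
  have hi : IntegrableOn (fun u : ℝ => exp (-(-s) * (u : ℂ) ^ 2)) (Set.Ioi 0) :=
    (integrable_cexp_neg_mul_sq hs0).integrableOn
  rw [← integral_sub (integrableOn_cubicInt 0 hκ s 0) hi]
  refine norm_integral_le_of_norm_le (integrableOn_pow_mul_exp_neg_mul_sq 3 hd) ?_
  filter_upwards [self_mem_ae_restrict measurableSet_Ioi] with u hu
  have hu : 0 < u := hu
  have e : (u : ℂ) ^ 0 * exp (κ * u ^ 3 + s * u ^ 2 + 0 * u) - exp (-(-s) * (u : ℂ) ^ 2) =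
      (exp (κ * u ^ 3) - 1) * exp (s * u ^ 2) := by
    rw [sub_mul, ← exp_add]; simp
  have r1 : (κ * (u : ℂ) ^ 3).re = κ.re * u ^ 3 := by simp [← ofReal_pow]
  have r2 : (s * (u : ℂ) ^ 2).re = s.re * u ^ 2 := by simp [← ofReal_pow]
  rw [e, norm_mul]
  refine mul_le_mul ?_ ?_ (norm_nonneg _) (by positivity)
  · refine (norm_exp_sub_one_le_of_re_nonpos ?_).trans ?_
    · rw [r1]; exact mul_nonpos_of_nonpos_of_nonneg hκ.le (by positivity)
    · rw [norm_mul, norm_pow, Complex.norm_real, Real.norm_of_nonneg hu.le]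
      exact mul_le_of_le_one_left (by positivity) hκ1
  · rw [Complex.norm_exp, r2, Real.exp_le_exp]
    gcongr

lemma norm_exp_I_mul_ofReal (x : ℝ) : ‖exp (I * x)‖ = 1 := by
  rw [mul_comm]; exact norm_exp_ofReal_mul_I x

/-- Asymptotics of the half-line integrals at the saddle point; `ε = ±1`. -/
lemma saddle_half {ε : ℝ} (hε : ε = 1 ∨ ε = -1) {l : ℂ} (hl : |l.im| ≤ Real.pi / 3) :
    ‖exp (I * (ε * Real.pi / 3)) *
        cubicInt 0 (-1 / 3) (exp l * exp (I * (ε * Real.pi / 3)) ^ 2) 0 -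
      ε * (I * (Real.sqrt Real.pi / 2 : ℝ) * exp (-l / 2))‖ ≤
      (Real.exp l.re * Real.sin (Real.pi / 18)) ^ (-2 : ℝ) * (1 / 2) * Real.Gamma 2 ∧
    ‖cubicInt 2 (-1 / 3) (exp l * exp (I * (ε * Real.pi / 3)) ^ 2) 0‖ ≤
      (Real.exp l.re * Real.sin (Real.pi / 18)) ^ (-(((2 : ℕ) : ℝ) + 1) / 2) * (1 / 2) *
        Real.Gamma ((((2 : ℕ) : ℝ) + 1) / 2) := by
  have hpi := Real.pi_pos
  -- For |Im l| ≤ π/3 the quadratic coefficient, of argument 2πε/3 + Im l, can have positive real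
  -- part. Rotating the ray by πε/9 changes the argument to 8πε/9 + Im l, at least π/18 away from
  -- the imaginary directions, while 3β = πε/3 still leaves decay in the cubic term.
  set β : ℝ := ε * Real.pi / 9 with hβ
  have hβ' : |β| < Real.pi / 6 := by
    rcases hε with h | h <;> rw [hβ, h, abs_lt] <;> constructor <;> linarith
  set s := exp l * exp (I * (ε * Real.pi / 3)) ^ 2 with hs
  set κ := -exp (I * (3 * β)) / 3 with hκd
  set σ := s * exp (I * (2 * β)) with hσd
  obtain ⟨hl1, hl2⟩ := abs_le.1 hl
  have hκ : κ.re < 0 := by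
    have h1 : (exp (I * (3 * β))).re = 1 / 2 := by
      rw [exp_mul_I_re]
      have e1 : (3 * (β : ℂ)).im = 0 := by simp
      have e2 : (3 * (β : ℂ)).re = ε * (Real.pi / 3) := by simp [hβ]; ring
      rw [e1, e2]
      rcases hε with h | h <;> rw [h] <;> simp
    rw [hκd, show (3 : ℂ) = ((3 : ℝ) : ℂ) by norm_num, div_ofReal_re, neg_re]
    rw [show ((3 : ℝ) : ℂ) = 3 by norm_num, h1]; norm_num
  have hκ1 : ‖κ‖ ≤ 1 := by
    have := norm_exp_I_mul_ofReal (3 * β)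
    push_cast at this
    rw [hκd, norm_div, norm_neg, this]; norm_num
  have hd : 0 < Real.exp l.re * Real.sin (Real.pi / 18) :=
    mul_pos (Real.exp_pos _) (Real.sin_pos_of_pos_of_lt_pi (by positivity) (by linarith))
  have hσ : σ = exp (l + I * (ε * (8 * Real.pi / 9))) := by
    rw [hσd, hs, ← exp_nat_mul, ← exp_add, ← exp_add]; congr 1; rw [hβ]; push_cast; ring
  have hσre : σ.re ≤ -(Real.exp l.re * Real.sin (Real.pi / 18)) := by
    rw [hσ, exp_re]
    have e1 : (l + I * (ε * (8 * Real.pi / 9))).re = l.re := by simp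
    have e2 : (l + I * (ε * (8 * Real.pi / 9))).im = l.im + ε * (8 * Real.pi / 9) := by
      simp
    rw [e1, e2, ← mul_neg]
    refine mul_le_mul_of_nonneg_left ?_ (Real.exp_pos _).le
    have key : ∀ y : ℝ, |y| ≤ Real.pi / 3 → Real.cos (y + 8 * Real.pi / 9) ≤ -Real.sin (Real.pi / 18) := by
      intro y hy
      obtain ⟨h1, h2⟩ := abs_le.1 hy
      have : Real.cos (y + 8 * Real.pi / 9) = -Real.cos (y - Real.pi / 9) := by
        rw [← Real.cos_add_pi]; congr 1; ring
      rw [this, ← Real.cos_pi_div_two_sub, ← Real.cos_abs (y - Real.pi / 9)]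
      refine neg_le_neg (Real.cos_le_cos_of_nonneg_of_le_pi (abs_nonneg _) (by linarith) ?_)
      rw [abs_le]; constructor <;> linarith
    rcases hε with h | h <;> rw [h]
    · rw [one_mul]; exact key _ hl
    · rw [← Real.cos_neg, show -(l.im + -1 * (8 * Real.pi / 9)) = -l.im + 8 * Real.pi / 9 by ring]
      exact key _ (by rwa [abs_neg])
  constructor
  · rw [cubicInt_rotate 0 s hβ']
    have hg := norm_cubicInt_sub_gaussian_le hd hκ hκ1 hσre
    -- The argument of -σ has modulus at most 4π/9, so the principal root is obtained by halving the
    -- exponent.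
    have e : (Real.pi / (-σ)) ^ (1 / 2 : ℂ) =
        (Real.sqrt Real.pi : ℝ) * exp (-l / 2 + I * (ε * (Real.pi / 18))) := by
      have e1 : (Real.pi : ℂ) / (-σ) = exp (Real.log Real.pi - l + I * (ε * (Real.pi / 9))) := by
        have e2 : -σ = exp (l - I * (ε * (Real.pi / 9))) := by
          rw [hσ]
          have : (-1 : ℂ) = exp (-(ε * Real.pi * I)) := by
            rcases hε with h | h <;> rw [h]
            · rw [exp_neg]; simp
            · simp
          rw [neg_eq_neg_one_mul, this, ← exp_add]; congr 1; ring
        have e3 : (Real.pi : ℂ) = exp (Real.log Real.pi : ℝ) := by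
          rw [← ofReal_exp, Real.exp_log hpi]
        rw [e2]; nth_rewrite 1 [e3]; rw [← exp_sub]; congr 1; ring
      have im1 : (Real.log Real.pi - l + I * (ε * (Real.pi / 9))).im = -l.im + ε * (Real.pi / 9) := by
        have : ((Real.log Real.pi : ℝ) : ℂ).im = 0 := ofReal_im _
        simp only [sub_im, add_im, this]
        simp
      rw [e1, cpow_def_of_ne_zero (exp_ne_zero _), log_exp, Real.sqrt_eq_rpow,
        Real.rpow_def_of_pos hpi, ofReal_exp, ← exp_add]
      · congr 1; push_cast; ring
      · rw [im1]; rcases hε with h | h <;> rw [h] <;> linarith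
      · rw [im1]; rcases hε with h | h <;> rw [h] <;> linarith
    rw [e] at hg
    have e5 : ε * (I * (Real.sqrt Real.pi / 2 : ℝ) * exp (-l / 2)) =
        exp (I * (ε * Real.pi / 3)) * (exp (I * ((0 : ℕ) + 1) * β) *
        ((Real.sqrt Real.pi : ℝ) * exp (-l / 2 + I * (ε * (Real.pi / 18))) / 2)) := by
      have : (ε : ℂ) * I = exp (I * (ε * (Real.pi / 2))) := by
        rcases hε with h | h <;> rw [h]
        · rw [show I * (((1 : ℝ) : ℂ) * (Real.pi / 2)) = Real.pi / 2 * I by push_cast; ring,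
            exp_pi_div_two_mul_I]; simp
        · rw [show I * (((-1 : ℝ) : ℂ) * (Real.pi / 2)) = -Real.pi / 2 * I by push_cast; ring,
            exp_neg_pi_div_two_mul_I]; simp
      have e6 : exp (I * (ε * (Real.pi / 2))) * exp (-l / 2) = exp (I * (ε * Real.pi / 3)) *
        exp (I * ((0 : ℕ) + 1) * β) * exp (-l / 2 + I * (ε * (Real.pi / 18))) := by
        rw [← exp_add, ← exp_add, ← exp_add]; congr 1; rw [hβ]; push_cast; ring
      push_cast
      push_cast at e6
      linear_combination (((Real.sqrt Real.pi : ℝ) : ℂ) / 2) * e6 +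
        (((Real.sqrt Real.pi : ℝ) : ℂ) / 2) * exp (-l / 2) * this
    rw [e5, ← mul_sub, ← mul_sub, norm_mul, norm_mul]
    have n1 : ‖exp (I * (ε * Real.pi / 3))‖ = 1 := by
      have := norm_exp_I_mul_ofReal (ε * Real.pi / 3)
      push_cast at this; exact this
    have n2 : ‖exp (I * ((0 : ℕ) + 1) * β)‖ = 1 := by simp
    push_cast at n2 ⊢
    rw [n1, n2, one_mul, one_mul]; exact hg
  · rw [cubicInt_rotate 2 s hβ', norm_mul]
    have n2 : ‖exp (I * ((2 : ℕ) + 1) * β)‖ = 1 := by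
      have := norm_exp_I_mul_ofReal (3 * β)
      push_cast at this ⊢
      rw [← this]; congr 2; ring
    rw [n2, one_mul]
    exact norm_cubicInt_le 2 hd hκ hσre

/-- The saddle point form of the derivative of the Airy function. -/
lemma deriv_airyAi_saddle (c : ℂ) : 2 * c * (2 * Real.pi * I * deriv airyAi (c ^ 2)) =
    exp (-(2 / 3) * c ^ 3) * (-2 * c ^ 2 *
      (sixthRoot * cubicInt 0 (-1 / 3) (c * sixthRoot ^ 2) 0 -
        (1 - sixthRoot) * cubicInt 0 (-1 / 3) (c * (1 - sixthRoot) ^ 2) 0) +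
      (cubicInt 2 (-1 / 3) (c * (1 - sixthRoot) ^ 2) 0 -
        cubicInt 2 (-1 / 3) (c * sixthRoot ^ 2) 0)) := by
  have hJ : ∀ q : ℂ, HasDerivAt (fun c => cubicInt 0 (-1 / 3) (c * q ^ 2) 0)
      (q ^ 2 * cubicInt 2 (-1 / 3) (c * q ^ 2) 0) c := by
    intro q
    have h := hasDerivAt_cubicInt 0 (κ := fun _ => -1 / 3) (s := fun c => c * q ^ 2)
      (w := fun _ => 0) (by fun_prop) (by fun_prop) (by fun_prop) (z₀ := c) (by norm_num)
    refine h.congr_deriv ?_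
    simp
  have hE : HasDerivAt (fun c : ℂ => exp (-(2 / 3) * c ^ 3))
      (exp (-(2 / 3) * c ^ 3) * (-2 * c ^ 2)) c := by
    refine HasDerivAt.cexp (((hasDerivAt_pow 3 c).const_mul _).congr_deriv ?_)
    norm_num; ring
  have hL : HasDerivAt (fun c : ℂ => 2 * Real.pi * I * airyAi (c ^ 2))
      (2 * Real.pi * I * (deriv airyAi (c ^ 2) * (2 * c))) c := by
    have h := (differentiable_airyAi (c ^ 2)).hasDerivAt
    have h2 : HasDerivAt (fun c : ℂ => c ^ 2) (2 * c) c := by simpa using hasDerivAt_pow 2 c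
    exact (h.comp c h2).const_mul _
  -- Differentiating the saddle identity in c gives the derivative of the Airy function without a
  -- second contour computation; each half-line integral contributes its second moment.
  rw [funext airyAi_saddle] at hL
  have hR := hE.mul (((hJ sixthRoot).const_mul sixthRoot).sub
    ((hJ (1 - sixthRoot)).const_mul (1 - sixthRoot)))
  have := hL.unique hR
  simp only [Pi.sub_apply] at this
  have e : (1 - sixthRoot) ^ 3 = -1 := by
    linear_combination (-sixthRoot + 2) * sixthRoot_sq
  linear_combination this + exp (-(2 / 3) * c ^ 3) *
    (sixthRoot_cube * cubicInt 2 (-1 / 3) (c * sixthRoot ^ 2) 0 -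
      e * cubicInt 2 (-1 / 3) (c * (1 - sixthRoot) ^ 2) 0)

/-- Asymptotics of the Airy function and its derivative at `exp L`, for `|Im L| ≤ 2π/3`. -/
lemma airyAi_asymptotics (ρ : ℝ) : ∃ C : ℝ, 0 ≤ C ∧ ∀ L : ℂ, |L.im| ≤ 2 * Real.pi / 3 → ρ ≤ L.re →
    ‖2 * (Real.sqrt Real.pi : ℝ) * exp (L / 4) * exp (2 / 3 * exp (3 * L / 2)) *
        airyAi (exp L) - 1‖ ≤ C * Real.exp (-(3 / 4) * L.re) ∧
    ‖-2 * (Real.sqrt Real.pi : ℝ) * exp (-L / 4) * exp (2 / 3 * exp (3 * L / 2)) *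
        deriv airyAi (exp L) - 1‖ ≤ C * Real.exp (-(3 / 4) * L.re) := by
  have hpi := Real.pi_pos
  have hsp : 0 < Real.sqrt Real.pi := Real.sqrt_pos.2 hpi
  set σ := Real.sin (Real.pi / 18) with hσ
  have hσ0 : 0 < σ := Real.sin_pos_of_pos_of_lt_pi (by positivity) (by linarith)
  set K₀ : ℝ := σ ^ (-2 : ℝ) * (1 / 2) * Real.Gamma 2 with hK₀
  set K₂ : ℝ := σ ^ (-(((2 : ℕ) : ℝ) + 1) / 2) * (1 / 2) *
        Real.Gamma ((((2 : ℕ) : ℝ) + 1) / 2) with hK₂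
  have hK₀' : 0 ≤ K₀ := by
    have := Real.Gamma_pos_of_pos (s := 2) (by norm_num); positivity
  have hK₂' : 0 ≤ K₂ := by
    have := Real.Gamma_pos_of_pos (s := (((2 : ℕ) : ℝ) + 1) / 2) (by norm_num); positivity
  -- The first summand collects the Gaussian errors of the two rays. The second comes from the
  -- second moments in the derivative: they decay like exp(-(3/2) Re L), and half of that rate is
  -- given up using ρ ≤ Re L. The common rate |w|^{-3/4} is not optimal but will suffice.
  refine ⟨2 * K₀ / Real.sqrt Real.pi +
    K₂ / Real.sqrt Real.pi * Real.exp (-(3 / 4) * ρ), by positivity, fun L hL hρ => ?_⟩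
  set l : ℂ := L / 2 with hl
  have hre : l.re = L.re / 2 := by
    rw [hl, show (2 : ℂ) = ((2 : ℝ) : ℂ) by norm_num, div_ofReal_re]
  have him : |l.im| ≤ Real.pi / 3 := by
    rw [hl, show (2 : ℂ) = ((2 : ℝ) : ℂ) by norm_num, div_ofReal_im, abs_div, abs_two]; linarith
  obtain ⟨u1, u2⟩ := saddle_half (Or.inl rfl) him
  obtain ⟨d1, d2⟩ := saddle_half (Or.inr rfl) him
  have p1 : exp (I * (((1 : ℝ) : ℂ) * Real.pi / 3)) = sixthRoot := by
    rw [sixthRoot]; congr 1; push_cast; ring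
  have p2 : exp (I * (((-1 : ℝ) : ℂ) * Real.pi / 3)) = 1 - sixthRoot := by
    rw [← exp_neg_sixthRoot]; congr 1; push_cast; ring
  rw [p1] at u1 u2
  rw [p2] at d1 d2
  set c := exp l with hc
  have hc0 : c ≠ 0 := exp_ne_zero _
  set B₁ := cubicInt 0 (-1 / 3) (c * sixthRoot ^ 2) 0
  set B₂ := cubicInt 0 (-1 / 3) (c * (1 - sixthRoot) ^ 2) 0
  set D₁ := cubicInt 2 (-1 / 3) (c * sixthRoot ^ 2) 0
  set D₂ := cubicInt 2 (-1 / 3) (c * (1 - sixthRoot) ^ 2) 0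
  have s1 := airyAi_saddle c
  have s2 := deriv_airyAi_saddle c
  have hcL : exp L = c ^ 2 := by rw [hc, ← exp_nat_mul]; congr 1; rw [hl]; push_cast; ring
  have hcL3 : exp (3 * L / 2) = c ^ 3 := by
    rw [hc, ← exp_nat_mul]; congr 1; rw [hl]; push_cast; ring
  rw [hcL, hcL3]
  have hexp : exp (2 / 3 * c ^ 3) * exp (-(2 / 3) * c ^ 3) = 1 := by
    rw [← exp_add]; simp
  have bE : Real.exp l.re * σ > 0 := by positivity
  have r0 : (Real.exp l.re * σ) ^ (-2 : ℝ) * (1 / 2) * Real.Gamma 2 = K₀ * Real.exp (-L.re) := by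
    rw [Real.mul_rpow (Real.exp_pos _).le hσ0.le, ← Real.exp_mul, hre,
      show L.re / 2 * -2 = -L.re by ring, hK₀]; ring
  have r2 : (Real.exp l.re * σ) ^ (-(((2 : ℕ) : ℝ) + 1) / 2) * (1 / 2) *
        Real.Gamma ((((2 : ℕ) : ℝ) + 1) / 2) = K₂ * Real.exp (-(3 / 4) * L.re) := by
    rw [Real.mul_rpow (Real.exp_pos _).le hσ0.le, ← Real.exp_mul, hre,
      show L.re / 2 * (-(((2 : ℕ) : ℝ) + 1) / 2) = -(3 / 4) * L.re by push_cast; ring, hK₂]; ring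
  rw [r0] at u1 d1
  rw [r2] at u2 d2
  set G : ℂ := I * (Real.sqrt Real.pi / 2 : ℝ) * exp (-l / 2) with hG
  -- the common leading term
  have hsC : ((Real.sqrt Real.pi : ℝ) : ℂ) ≠ 0 := by exact_mod_cast hsp.ne'
  have hspi : ((Real.sqrt Real.pi : ℝ) : ℂ) * ((Real.sqrt Real.pi : ℝ) : ℂ) = (Real.pi : ℂ) := by
    rw [← ofReal_mul, Real.mul_self_sqrt hpi.le]
  -- All fractional powers become integer powers of Y (c = Y²), and what remains is field algebra.
  set Y : ℂ := exp (L / 4) with hY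
  have hY0 : Y ≠ 0 := exp_ne_zero _
  have hYl : exp (-l / 2) = Y⁻¹ := by rw [hY, ← exp_neg]; congr 1; rw [hl]; ring
  have hYL : exp (-L / 4) = Y⁻¹ := by rw [hY, ← exp_neg]; congr 1; ring
  have hcY : c = Y ^ 2 := by rw [hc, hY, ← exp_nat_mul]; congr 1; rw [hl]; push_cast; ring
  rw [hYl] at hG
  have hnY : ‖Y‖ = Real.exp (L.re / 4) := by
    rw [hY, norm_exp, show (4 : ℂ) = ((4 : ℝ) : ℂ) by norm_num, div_ofReal_re]
  set X := sixthRoot * B₁ - (1 - sixthRoot) * B₂ with hX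
  have hXb : ‖X - 2 * G‖ ≤ 2 * K₀ * Real.exp (-L.re) := by
    have : X - 2 * G = (sixthRoot * B₁ - ((1 : ℝ) : ℂ) * G) -
      ((1 - sixthRoot) * B₂ - ((-1 : ℝ) : ℂ) * G) := by rw [hX]; push_cast; ring
    rw [this]
    refine (norm_sub_le _ _).trans ?_
    linarith
  have hAi : 2 * (Real.sqrt Real.pi : ℝ) * Y * exp (2 / 3 * c ^ 3) * airyAi (c ^ 2) - 1 =
      Y / (I * (Real.sqrt Real.pi : ℝ)) * (X - 2 * G) := by
    have h2G : 2 * G = I * (Real.sqrt Real.pi : ℝ) * Y⁻¹ := by rw [hG]; push_cast; ring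
    have h1 : 2 * Real.pi * I * (exp (2 / 3 * c ^ 3) * airyAi (c ^ 2)) = X := by
      linear_combination exp (2 / 3 * c ^ 3) * s1 + X * hexp
    have h3 : exp (2 / 3 * c ^ 3) * airyAi (c ^ 2) = X / (2 * Real.pi * I) := by
      rw [← h1]; field_simp
    rw [h2G, mul_assoc, h3, ← hspi]
    field_simp
  have hAib : ‖2 * (Real.sqrt Real.pi : ℝ) * Y * exp (2 / 3 * c ^ 3) * airyAi (c ^ 2) - 1‖ ≤
      2 * K₀ / Real.sqrt Real.pi * Real.exp (-(3 / 4) * L.re) := by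
    rw [hAi, norm_mul, norm_div, norm_mul, norm_I, one_mul, norm_real,
      Real.norm_of_nonneg hsp.le, hnY]
    calc _ ≤ Real.exp (L.re / 4) / Real.sqrt Real.pi * (2 * K₀ * Real.exp (-L.re)) := by gcongr
      _ = 2 * K₀ / Real.sqrt Real.pi * (Real.exp (L.re / 4) * Real.exp (-L.re)) := by ring
      _ = _ := by rw [← Real.exp_add]; congr 2; ring
  have hAi' : -2 * (Real.sqrt Real.pi : ℝ) * Y⁻¹ * exp (2 / 3 * c ^ 3) * deriv airyAi (c ^ 2) =
      2 * (Real.sqrt Real.pi : ℝ) * Y * exp (2 / 3 * c ^ 3) * airyAi (c ^ 2) -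
        (D₂ - D₁) / (2 * I * (Real.sqrt Real.pi : ℝ) * Y ^ 3) := by
    have h1 : 2 * Real.pi * I * (exp (2 / 3 * c ^ 3) * airyAi (c ^ 2)) = X := by
      linear_combination exp (2 / 3 * c ^ 3) * s1 + X * hexp
    have h3 : exp (2 / 3 * c ^ 3) * airyAi (c ^ 2) = X / (2 * Real.pi * I) := by
      rw [← h1]; field_simp
    have h2 : 2 * c * (2 * Real.pi * I * (exp (2 / 3 * c ^ 3) * deriv airyAi (c ^ 2))) =
        -2 * c ^ 2 * X + (D₂ - D₁) := by
      linear_combination exp (2 / 3 * c ^ 3) * s2 + (-2 * c ^ 2 * X + (D₂ - D₁)) * hexp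
    have h4 : exp (2 / 3 * c ^ 3) * deriv airyAi (c ^ 2) =
        (-2 * c ^ 2 * X + (D₂ - D₁)) / (2 * c * (2 * Real.pi * I)) := by
      rw [← h2]; field_simp
    rw [mul_assoc _ (exp (2 / 3 * c ^ 3)), h4, mul_assoc _ (exp (2 / 3 * c ^ 3)), h3, hcY, ← hspi]
    field_simp
    ring
  constructor
  · refine hAib.trans ?_
    gcongr
    have : 0 ≤ K₂ / Real.sqrt Real.pi * Real.exp (-(3 / 4) * ρ) := by positivity
    linarith
  · rw [hYL, hAi', sub_right_comm]
    refine (norm_sub_le _ _).trans ?_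
    rw [add_mul]
    refine add_le_add hAib ?_
    rw [norm_div, norm_mul, norm_mul, norm_mul, norm_I, norm_pow, norm_real,
      Real.norm_of_nonneg hsp.le, hnY, Complex.norm_ofNat, mul_one, ← Real.exp_nat_mul]
    have h5 : ‖D₂ - D₁‖ ≤ 2 * (K₂ * Real.exp (-(3 / 4) * L.re)) :=
      (norm_sub_le _ _).trans (by linarith)
    have h6 : Real.exp (-(3 / 4) * L.re) ≤ Real.exp (-(3 / 4) * ρ) := by
      apply Real.exp_le_exp.2; linarith
    have h7 : (Real.exp (((3 : ℕ) : ℝ) * (L.re / 4)))⁻¹ = Real.exp (-(3 / 4) * L.re) := by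
      rw [← Real.exp_neg]; congr 1; push_cast; ring
    calc _ ≤ 2 * (K₂ * Real.exp (-(3 / 4) * ρ)) /
        (2 * Real.sqrt Real.pi * Real.exp (((3 : ℕ) : ℝ) * (L.re / 4))) := by
          gcongr; exact h5.trans (by gcongr)
      _ = K₂ / Real.sqrt Real.pi * Real.exp (-(3 / 4) * ρ) *
        (Real.exp (((3 : ℕ) : ℝ) * (L.re / 4)))⁻¹ := by field_simp
      _ = _ := by rw [h7]

/-! ### The Airy matrix: asymptotic frame and determinant -/

/-- The constant `(3/4)^{2/3}`. -/
def airyScale : ℂ := (((3 / 4 : ℝ) ^ (2 / 3 : ℝ) : ℝ) : ℂ)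
/-- The constant `(32/3)^{1/6} √π`. -/
def airyC₁ : ℂ := (((32 / 3 : ℝ) ^ (1 / 6 : ℝ) * Real.sqrt Real.pi : ℝ) : ℂ)
/-- The constant `6^{1/6} √π`. -/
def airyC₂ : ℂ := (((6 : ℝ) ^ (1 / 6 : ℝ) * Real.sqrt Real.pi : ℝ) : ℂ)

lemma Tsector_eq (ζ : ℂ) : Tsector ζ =
    !![exp (7 * I * Real.pi / 12) * airyC₁ * deriv airyAi (airyScale * ζ * exp (-(I * Real.pi / 3))),
      exp (5 * I * Real.pi / 4) * airyC₁ * deriv airyAi (-(airyScale * ζ));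
    -exp (-(I * Real.pi / 12)) * airyC₂ * airyAi (airyScale * ζ * exp (-(I * Real.pi / 3))),
      exp (I * Real.pi / 4) * airyC₂ * airyAi (-(airyScale * ζ))] := rfl

lemma airyScale_eq : airyScale = exp ((2 / 3 * Real.log (3 / 4) : ℝ) : ℂ) := by
  rw [airyScale, Real.rpow_def_of_pos (by norm_num), ← ofReal_exp]; congr 2; ring

lemma sqrt_two_eq : Real.sqrt 2 = Real.exp (Real.log 2 / 2) := by
  rw [Real.sqrt_eq_rpow, Real.rpow_def_of_pos (by norm_num)]; congr 1; ring

/-- The constant is 2√π/√2 divided by the fourth root of `airyScale`: it compensates the w^{1/4}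
growth of Ai' at the rescaled argument and leaves the bare factor 1/√2 of the frame. For Ai the
power of the scale is inverted. -/
lemma airyC₁_eq : airyC₁ * exp ((2 / 3 * Real.log (3 / 4) : ℝ) / 4 : ℂ) =
    2 * (Real.sqrt Real.pi : ℝ) * (1 / (Real.sqrt 2 : ℂ)) := by
  have e : (32 / 3 : ℝ) ^ (1 / 6 : ℝ) * Real.exp (2 / 3 * Real.log (3 / 4) / 4) * Real.sqrt 2 = 2 := by
    rw [Real.rpow_def_of_pos (by norm_num), sqrt_two_eq, ← Real.exp_add, ← Real.exp_add,
      Real.log_div (by norm_num) (by norm_num), Real.log_div (by norm_num) (by norm_num),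
      show (32 : ℝ) = 2 ^ 5 by norm_num, show (4 : ℝ) = 2 ^ 2 by norm_num, Real.log_pow, Real.log_pow]
    push_cast
    rw [show (5 * Real.log 2 - Real.log 3) * (1 / 6) + 2 / 3 * (Real.log 3 - 2 * Real.log 2) / 2 ^ 2 +
      Real.log 2 / 2 = Real.log 2 by ring, Real.exp_log (by norm_num)]
  have h2 : ((Real.sqrt 2 : ℝ) : ℂ) ≠ 0 := by simp
  rw [airyC₁, mul_one_div, eq_div_iff h2]
  have e' : (((32 / 3 : ℝ) ^ (1 / 6 : ℝ) : ℝ) : ℂ) * exp ((2 / 3 * Real.log (3 / 4) : ℝ) / 4 : ℂ) *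
      (Real.sqrt 2 : ℝ) = 2 := by
    rw [show ((2 / 3 * Real.log (3 / 4) : ℝ) / 4 : ℂ) = ((2 / 3 * Real.log (3 / 4) / 4 : ℝ) : ℂ) by
      push_cast; ring]
    exact_mod_cast congrArg (fun r : ℝ => (r : ℂ)) e
  rw [ofReal_mul]
  linear_combination ((Real.sqrt Real.pi : ℝ) : ℂ) * e'

lemma airyC₂_eq : airyC₂ * exp (-(2 / 3 * Real.log (3 / 4) : ℝ) / 4 : ℂ) =
    2 * (Real.sqrt Real.pi : ℝ) * (1 / (Real.sqrt 2 : ℂ)) := by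
  have e : (6 : ℝ) ^ (1 / 6 : ℝ) * Real.exp (-(2 / 3 * Real.log (3 / 4)) / 4) * Real.sqrt 2 = 2 := by
    rw [Real.rpow_def_of_pos (by norm_num), sqrt_two_eq, ← Real.exp_add, ← Real.exp_add,
      Real.log_div (by norm_num) (by norm_num), show (6 : ℝ) = 2 * 3 by norm_num,
      Real.log_mul (by norm_num) (by norm_num),
      show (4 : ℝ) = 2 ^ 2 by norm_num, Real.log_pow]
    push_cast
    rw [show (Real.log 2 + Real.log 3) * (1 / (2 * 3)) + -(2 / 3 * (Real.log 3 - 2 * Real.log 2)) / 2 ^ 2 +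
      Real.log 2 / 2 = Real.log 2 by ring, Real.exp_log (by norm_num)]
  have h2 : ((Real.sqrt 2 : ℝ) : ℂ) ≠ 0 := by simp
  rw [airyC₂, mul_one_div, eq_div_iff h2]
  have e' : (((6 : ℝ) ^ (1 / 6 : ℝ) : ℝ) : ℂ) * exp (-(2 / 3 * Real.log (3 / 4) : ℝ) / 4 : ℂ) *
      (Real.sqrt 2 : ℝ) = 2 := by
    rw [show (-(2 / 3 * Real.log (3 / 4) : ℝ) / 4 : ℂ) = ((-(2 / 3 * Real.log (3 / 4)) / 4 : ℝ) : ℂ) by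
      push_cast; ring]
    exact_mod_cast congrArg (fun r : ℝ => (r : ℂ)) e
  rw [ofReal_mul]
  linear_combination ((Real.sqrt Real.pi : ℝ) : ℂ) * e'

/-- Asymptotics of the scaled Airy functions at `k exp (l + iδ)`. -/
lemma scaled_airy_asymptotics (ρ : ℝ) : ∃ C : ℝ, 0 ≤ C ∧ ∀ (l : ℂ) (δ : ℝ),
    |l.im + δ| ≤ 2 * Real.pi / 3 → ρ ≤ l.re →
    ∃ ε₁ ε₂ : ℂ, ‖ε₁‖ ≤ C * Real.exp (-(3 / 4) * l.re) ∧ ‖ε₂‖ ≤ C * Real.exp (-(3 / 4) * l.re) ∧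
      airyC₁ * deriv airyAi (airyScale * exp (l + I * δ)) =
        -(1 / (Real.sqrt 2 : ℂ)) * exp (l / 4) * exp (I * δ / 4) *
          exp (-(exp (3 * l / 2) * exp (3 * I * δ / 2) / 2)) * (1 + ε₁) ∧
      airyC₂ * airyAi (airyScale * exp (l + I * δ)) =
        1 / (Real.sqrt 2 : ℂ) * exp (-l / 4) * exp (-(I * δ / 4)) *
          exp (-(exp (3 * l / 2) * exp (3 * I * δ / 2) / 2)) * (1 + ε₂) := by
  set κ : ℝ := 2 / 3 * Real.log (3 / 4) with hκ
  obtain ⟨C, hC, H⟩ := airyAi_asymptotics (ρ + κ)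
  refine ⟨C * Real.exp (-(3 / 4) * κ), by positivity, fun l δ h1 h2 => ?_⟩
  set L : ℂ := κ + l + I * δ with hL
  have hLre : L.re = κ + l.re := by rw [hL]; simp
  have hLim : L.im = l.im + δ := by rw [hL]; simp
  obtain ⟨a1, a2⟩ := H L (by rwa [hLim]) (by rw [hLre]; linarith)
  have hw : airyScale * exp (l + I * δ) = exp L := by
    rw [airyScale_eq, ← exp_add]; congr 1; rw [hL]; ring
  -- Since the scale is (3/4)^{2/3}, the Airy exponent (2/3)w^{3/2} becomes one half of the
  -- three-halves power.
  have hX : 2 / 3 * exp (3 * L / 2) = exp (3 * l / 2) * exp (3 * I * δ / 2) / 2 := by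
    have : exp (3 * L / 2) = exp ((Real.log (3 / 4) : ℝ) : ℂ) * (exp (3 * l / 2) * exp (3 * I * δ / 2)) := by
      rw [← exp_add, ← exp_add]; congr 1; rw [hL, hκ]; push_cast; ring
    rw [this, ← ofReal_exp, Real.exp_log (by norm_num)]; push_cast; ring
  rw [hX] at a1 a2
  rw [hw]
  have hb : C * Real.exp (-(3 / 4) * L.re) = C * Real.exp (-(3 / 4) * κ) * Real.exp (-(3 / 4) * l.re) := by
    rw [hLre, mul_assoc, ← Real.exp_add]; congr 2; ring
  rw [hb] at a1 a2
  set E := exp (3 * l / 2) * exp (3 * I * δ / 2) / 2 with hE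
  have hEE : exp (-E) * exp E = 1 := by rw [← exp_add]; simp
  refine ⟨_, _, a2, a1, ?_, ?_⟩
  · have e1 : exp (l / 4) * exp (I * δ / 4) * exp ((κ : ℂ) / 4) * exp (-L / 4) = 1 := by
      rw [← exp_add, ← exp_add, ← exp_add, hL]
      rw [show l / 4 + I * δ / 4 + (κ : ℂ) / 4 + -(κ + l + I * δ) / 4 = 0 by ring, exp_zero]
    have h := airyC₁_eq
    rw [← hκ] at h
    have e2 : exp (-((κ : ℂ) / 4)) * exp ((κ : ℂ) / 4) = 1 := by rw [← exp_add]; simp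
    have e3 : airyC₁ = 2 * (Real.sqrt Real.pi : ℝ) * (1 / (Real.sqrt 2 : ℂ)) * exp (-((κ : ℂ) / 4)) := by
      linear_combination exp (-((κ : ℂ) / 4)) * h - airyC₁ * e2
    rw [e3]
    set P := exp (l / 4) * exp (I * δ / 4)
    set Q := exp (-((κ : ℂ) / 4))
    set R' := exp ((κ : ℂ) / 4)
    set S' := exp (-L / 4)
    set s := (1 / (Real.sqrt 2 : ℂ))
    set sp := ((Real.sqrt Real.pi : ℝ) : ℂ)
    set dA := deriv airyAi (exp L)
    have e4 : P * S' = Q := by linear_combination Q * e1 - P * S' * e2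
    linear_combination (-2 * sp * s * dA) * e4 - 2 * sp * s * dA * P * S' * hEE
  · have e1 : exp (-l / 4) * exp (-(I * δ / 4)) * exp (-(κ : ℂ) / 4) * exp (L / 4) = 1 := by
      rw [← exp_add, ← exp_add, ← exp_add, hL]
      rw [show -l / 4 + -(I * δ / 4) + -(κ : ℂ) / 4 + (κ + l + I * δ) / 4 = 0 by ring, exp_zero]
    have h := airyC₂_eq
    rw [← hκ] at h
    have e2 : exp ((κ : ℂ) / 4) * exp (-(κ : ℂ) / 4) = 1 := by
      rw [← exp_add, show (κ : ℂ) / 4 + -(κ : ℂ) / 4 = 0 by ring, exp_zero]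
    have e3 : airyC₂ = 2 * (Real.sqrt Real.pi : ℝ) * (1 / (Real.sqrt 2 : ℂ)) * exp ((κ : ℂ) / 4) := by
      linear_combination exp ((κ : ℂ) / 4) * h - airyC₂ * e2
    rw [e3]
    set P := exp (-l / 4) * exp (-(I * δ / 4))
    set Q := exp ((κ : ℂ) / 4)
    set R' := exp (-(κ : ℂ) / 4)
    set S' := exp (L / 4)
    set s := (1 / (Real.sqrt 2 : ℂ))
    set sp := ((Real.sqrt Real.pi : ℝ) : ℂ)
    set dA := airyAi (exp L)
    have e4 : P * S' = Q := by linear_combination Q * e1 - P * S' * e2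
    linear_combination (-2 * sp * s * dA) * e4 - 2 * sp * s * dA * P * S' * hEE

/-- `S` agrees with the frame `2^{-1/2} (-ζ)^{σ₃/4} [1 1; -1 1]`, `-ζ = exp l`, up to relative
errors `η` in the entries. -/
def NearFrame (η : ℝ) (l : ℂ) (S : Mat) : Prop :=
  ∃ a b c d : ℂ, ‖a‖ ≤ η ∧ ‖b‖ ≤ η ∧ ‖c‖ ≤ η ∧ ‖d‖ ≤ η ∧
    S = !![1 / (Real.sqrt 2 : ℂ) * exp (l / 4) * (1 + a), 1 / (Real.sqrt 2 : ℂ) * exp (l / 4) * (1 + b);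
      -(1 / (Real.sqrt 2 : ℂ) * exp (-l / 4) * (1 + c)), 1 / (Real.sqrt 2 : ℂ) * exp (-l / 4) * (1 + d)]

/-- The exponential factor of the Airy model, as a function of `X = (-ζ)^{3/2}`. -/
def airyDiag (X : ℂ) : Mat :=
  !![exp (-X / 2 + I * Real.pi / 4), 0; 0, exp (X / 2 - I * Real.pi / 4)]

lemma Sloc_eq (ζ : ℂ) : Sloc ζ = T ζ * airyDiag ((-ζ) ^ (3 / 2 : ℂ)) := rfl

lemma sixthRoot_pow (n : ℕ) : sixthRoot ^ n = exp (n * (I * Real.pi / 3)) := by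
  rw [sixthRoot, ← exp_nat_mul]

/-- This is the connection formula: adding the columns replaces the Airy function at -kζ by the one
at kζe^{iπ/3}. The change is needed near the positive ray, where -kζ leaves the sector |arg| ≤ 2π/3
in which the asymptotics are available. -/
lemma Tsector_mul_upper (ζ : ℂ) : Tsector ζ * !![1, 1; 0, 1] =
    !![exp (7 * I * Real.pi / 12) * airyC₁ * deriv airyAi (airyScale * ζ * exp (-(I * Real.pi / 3))),
      exp (11 * I * Real.pi / 12) * airyC₁ * deriv airyAi (airyScale * ζ * exp (I * Real.pi / 3));
    -exp (-(I * Real.pi / 12)) * airyC₂ * airyAi (airyScale * ζ * exp (-(I * Real.pi / 3))),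
      exp (7 * I * Real.pi / 12) * airyC₂ * airyAi (airyScale * ζ * exp (I * Real.pi / 3))] := by
  set w := -(airyScale * ζ) with hw
  have c1 := airyAi_connection w
  have c2 := airyAi_connection_deriv w
  have e1 : sixthRoot ^ 2 * w = airyScale * ζ * exp (-(I * Real.pi / 3)) := by
    rw [exp_neg_sixthRoot, hw]; linear_combination -(airyScale * ζ) * sixthRoot_sq
  have e2 : -sixthRoot * w = airyScale * ζ * exp (I * Real.pi / 3) := by
    rw [hw, sixthRoot]; ring
  rw [e1, e2] at c1 c2
  rw [Tsector_eq, ← hw]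
  set A₁ := deriv airyAi (airyScale * ζ * exp (-(I * Real.pi / 3)))
  set B₁ := airyAi (airyScale * ζ * exp (-(I * Real.pi / 3)))
  set A₂ := deriv airyAi (airyScale * ζ * exp (I * Real.pi / 3))
  set B₂ := airyAi (airyScale * ζ * exp (I * Real.pi / 3))
  have p1 : exp (5 * I * Real.pi / 4) * sixthRoot ^ 4 = exp (7 * I * Real.pi / 12) := by
    rw [sixthRoot_pow, ← exp_add, exp_eq_exp_iff_exists_int]
    exact ⟨1, by push_cast; ring⟩
  have p2 : exp (5 * I * Real.pi / 4) * sixthRoot ^ 2 = -exp (11 * I * Real.pi / 12) := by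
    rw [sixthRoot_pow, ← exp_add, neg_eq_neg_one_mul, ← exp_pi_mul_I, ← exp_add,
      exp_eq_exp_iff_exists_int]
    exact ⟨0, by push_cast; ring⟩
  have p3 : exp (I * Real.pi / 4) * sixthRoot ^ 2 = -exp (-(I * Real.pi / 12)) := by
    rw [sixthRoot_pow, ← exp_add, neg_eq_neg_one_mul, ← exp_pi_mul_I, ← exp_add,
      exp_eq_exp_iff_exists_int]
    exact ⟨0, by push_cast; ring⟩
  have p4 : exp (I * Real.pi / 4) * sixthRoot = exp (7 * I * Real.pi / 12) := by
    rw [sixthRoot, ← exp_add]; congr 1; ring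
  ext i j
  fin_cases i <;> fin_cases j <;> simp [Matrix.mul_apply, Fin.sum_univ_two]
  · linear_combination airyC₁ * exp (5 * I * Real.pi / 4) * c2 - airyC₁ * A₁ * p1 - airyC₁ * A₂ * p2
  · linear_combination airyC₂ * exp (I * Real.pi / 4) * c1 - airyC₂ * B₁ * p3 + airyC₂ * B₂ * p4

/-- The diagonal exponential cancels the Airy exponential exactly, and only unit phases are left to
multiply out. The parameter σ records on which branch the Airy exponent is evaluated. -/
lemma frame_column {α γ A B X E s t t' δ₁ δ₂ ε₁ ε₂ p σ τ : ℂ}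
    (hA : A = -s * t * δ₁ * exp (-(X * σ / 2)) * (1 + ε₁))
    (hB : B = s * t' * δ₂ * exp (-(X * σ / 2)) * (1 + ε₂))
    (hE : E = exp (X * σ / 2) * p) (hα : α * δ₁ * p = -1) (hγ : γ * δ₂ * p = τ) :
    α * A * E = s * t * (1 + ε₁) ∧ γ * B * E = τ * (s * t' * (1 + ε₂)) := by
  have h : exp (-(X * σ / 2)) * exp (X * σ / 2) = 1 := by rw [← exp_add]; simp
  subst hE
  constructor
  · rw [hA]
    linear_combination (-s * t * (1 + ε₁)) * (α * δ₁ * p * h + hα)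
  · rw [hB]
    linear_combination (s * t' * (1 + ε₂)) * (γ * δ₂ * p * h + hγ)

lemma exp_eq_one_of {x : ℂ} (n : ℤ) (h : x = n * (2 * Real.pi * I)) : exp x = 1 :=
  exp_eq_one_iff.2 ⟨n, h⟩

lemma exp_eq_neg_one_of {x : ℂ} (n : ℤ) (h : x = Real.pi * I + n * (2 * Real.pi * I)) :
    exp x = -1 := by
  rw [h, exp_add, exp_pi_mul_I, exp_eq_one_of n rfl, mul_one]

lemma cpow_three_halves_eq {z : ℂ} (hz : z ≠ 0) : z ^ (3 / 2 : ℂ) = exp (3 * log z / 2) := by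
  rw [cpow_def_of_ne_zero hz]; congr 1; ring

/-- The Airy model agrees with its outer frame up to `O(|ζ|^{-3/4})`. -/
lemma Sloc_nearFrame (ρ : ℝ) : ∃ C : ℝ, 0 ≤ C ∧ ∀ ζ : ℂ, ζ ≠ 0 → ζ.arg ≠ 0 → ρ ≤ Real.log ‖ζ‖ →
    NearFrame (C * Real.exp (-(3 / 4) * Real.log ‖ζ‖)) (log (-ζ)) (Sloc ζ) := by
  obtain ⟨C, hC, H⟩ := scaled_airy_asymptotics ρ
  refine ⟨C, hC, fun ζ hζ harg hρ => ?_⟩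
  have hpi := Real.pi_pos
  set l := log (-ζ) with hl
  have hlre : l.re = Real.log ‖ζ‖ := by rw [hl, log_re, norm_neg]
  have hexp : exp l = -ζ := exp_log (neg_ne_zero.2 hζ)
  rw [← hlre] at hρ ⊢
  have hX : (-ζ) ^ (3 / 2 : ℂ) = exp (3 * l / 2) := cpow_three_halves_eq (neg_ne_zero.2 hζ)
  set X := exp (3 * l / 2) with hXd
  have w0 : airyScale * exp (l + I * (0 : ℝ)) = -(airyScale * ζ) := by
    rw [ofReal_zero, mul_zero, add_zero, hexp]; ring
  have wgen : ∀ (δ : ℝ) (x : ℂ), exp (I * δ) = -exp x →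
      airyScale * exp (l + I * δ) = airyScale * ζ * exp x := by
    intro δ x h; rw [exp_add, hexp, h]; ring
  have w1 : airyScale * exp (l + I * (2 * Real.pi / 3 : ℝ)) =
      airyScale * ζ * exp (-(I * Real.pi / 3)) := by
    refine wgen _ _ ?_
    rw [neg_eq_neg_one_mul, ← exp_pi_mul_I, ← exp_add]; congr 1; push_cast; ring
  -- The same point as in `w1`, reached by a different rotation. The asymptotics require |Im l + δ|
  -- ≤ 2π/3, and just below the positive ray Im l is close to π.
  have w1' : airyScale * exp (l + I * (-(4 * Real.pi / 3) : ℝ)) =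
      airyScale * ζ * exp (-(I * Real.pi / 3)) := by
    refine wgen _ _ ?_
    rw [neg_eq_neg_one_mul (exp _), ← exp_neg_pi_mul_I, ← exp_add]; congr 1; push_cast; ring
  have w2 : airyScale * exp (l + I * (4 * Real.pi / 3 : ℝ)) =
      airyScale * ζ * exp (I * Real.pi / 3) := by
    refine wgen _ _ ?_
    rw [neg_eq_neg_one_mul, ← exp_pi_mul_I, ← exp_add]; congr 1; push_cast; ring
  have w2' : airyScale * exp (l + I * (-(2 * Real.pi / 3) : ℝ)) =
      airyScale * ζ * exp (I * Real.pi / 3) := by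
    refine wgen _ _ ?_
    rw [neg_eq_neg_one_mul (exp _), ← exp_neg_pi_mul_I, ← exp_add]; congr 1; push_cast; ring
  have E1 : exp (-X / 2 + I * Real.pi / 4) = exp (X * (-1) / 2) * exp (I * Real.pi / 4) := by
    rw [← exp_add]; congr 1; ring
  have E2 : exp (X / 2 - I * Real.pi / 4) = exp (X * 1 / 2) * exp (-(I * Real.pi / 4)) := by
    rw [← exp_add]; congr 1; ring
  -- column 1 from the argument rotated by `2π/3`
  have colA : |l.im + 2 * Real.pi / 3| ≤ 2 * Real.pi / 3 → ∃ ε₁ ε₂ : ℂ,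
      ‖ε₁‖ ≤ C * Real.exp (-(3 / 4) * l.re) ∧ ‖ε₂‖ ≤ C * Real.exp (-(3 / 4) * l.re) ∧
      exp (7 * I * Real.pi / 12) * airyC₁ * deriv airyAi (airyScale * ζ * exp (-(I * Real.pi / 3))) *
        exp (-X / 2 + I * Real.pi / 4) = 1 / (Real.sqrt 2 : ℂ) * exp (l / 4) * (1 + ε₁) ∧
      -exp (-(I * Real.pi / 12)) * airyC₂ * airyAi (airyScale * ζ * exp (-(I * Real.pi / 3))) *
        exp (-X / 2 + I * Real.pi / 4) = -(1 / (Real.sqrt 2 : ℂ) * exp (-l / 4) * (1 + ε₂)) := by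
    intro h
    obtain ⟨ε₁, ε₂, n1, n2, hA, hB⟩ := H l (2 * Real.pi / 3) h hρ
    rw [w1] at hA hB
    have hs : exp (3 * I * (2 * Real.pi / 3 : ℝ) / 2) = -1 :=
      exp_eq_neg_one_of 0 (by push_cast; ring)
    rw [hs] at hA hB
    obtain ⟨r1, r2⟩ := frame_column (α := exp (7 * I * Real.pi / 12))
      (γ := -exp (-(I * Real.pi / 12))) (τ := -1) (s := 1 / (Real.sqrt 2 : ℂ)) hA hB E1
      (by rw [← exp_add, ← exp_add]; exact exp_eq_neg_one_of 0 (by push_cast; ring))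
      (by rw [neg_mul, neg_mul, ← exp_add, ← exp_add, exp_eq_one_of 0 (by push_cast; ring)])
    exact ⟨ε₁, ε₂, n1, n2, by rw [← r1]; ring, by linear_combination r2⟩
  have colB : |l.im + 0| ≤ 2 * Real.pi / 3 → ∃ ε₁ ε₂ : ℂ,
      ‖ε₁‖ ≤ C * Real.exp (-(3 / 4) * l.re) ∧ ‖ε₂‖ ≤ C * Real.exp (-(3 / 4) * l.re) ∧
      exp (5 * I * Real.pi / 4) * airyC₁ * deriv airyAi (-(airyScale * ζ)) *
        exp (X / 2 - I * Real.pi / 4) = 1 / (Real.sqrt 2 : ℂ) * exp (l / 4) * (1 + ε₁) ∧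
      exp (I * Real.pi / 4) * airyC₂ * airyAi (-(airyScale * ζ)) *
        exp (X / 2 - I * Real.pi / 4) = 1 / (Real.sqrt 2 : ℂ) * exp (-l / 4) * (1 + ε₂) := by
    intro h
    obtain ⟨ε₁, ε₂, n1, n2, hA, hB⟩ := H l 0 h hρ
    rw [w0] at hA hB
    have hs : exp (3 * I * (0 : ℝ) / 2) = 1 := by simp
    rw [hs] at hA hB
    obtain ⟨r1, r2⟩ := frame_column (α := exp (5 * I * Real.pi / 4))
      (γ := exp (I * Real.pi / 4)) (τ := 1) (s := 1 / (Real.sqrt 2 : ℂ)) hA hB E2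
      (by rw [← exp_add, ← exp_add]; exact exp_eq_neg_one_of 0 (by push_cast; ring))
      (by rw [← exp_add, ← exp_add]; exact exp_eq_one_of 0 (by push_cast; ring))
    exact ⟨ε₁, ε₂, n1, n2, by rw [← r1]; ring, by linear_combination r2⟩
  have colC : |l.im + 4 * Real.pi / 3| ≤ 2 * Real.pi / 3 → ∃ ε₁ ε₂ : ℂ,
      ‖ε₁‖ ≤ C * Real.exp (-(3 / 4) * l.re) ∧ ‖ε₂‖ ≤ C * Real.exp (-(3 / 4) * l.re) ∧
      exp (11 * I * Real.pi / 12) * airyC₁ * deriv airyAi (airyScale * ζ * exp (I * Real.pi / 3)) *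
        exp (X / 2 - I * Real.pi / 4) = 1 / (Real.sqrt 2 : ℂ) * exp (l / 4) * (1 + ε₁) ∧
      exp (7 * I * Real.pi / 12) * airyC₂ * airyAi (airyScale * ζ * exp (I * Real.pi / 3)) *
        exp (X / 2 - I * Real.pi / 4) = 1 / (Real.sqrt 2 : ℂ) * exp (-l / 4) * (1 + ε₂) := by
    intro h
    obtain ⟨ε₁, ε₂, n1, n2, hA, hB⟩ := H l (4 * Real.pi / 3) h hρ
    rw [w2] at hA hB
    have hs : exp (3 * I * (4 * Real.pi / 3 : ℝ) / 2) = 1 := exp_eq_one_of 1 (by push_cast; ring)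
    rw [hs] at hA hB
    obtain ⟨r1, r2⟩ := frame_column (α := exp (11 * I * Real.pi / 12))
      (γ := exp (7 * I * Real.pi / 12)) (τ := 1) (s := 1 / (Real.sqrt 2 : ℂ)) hA hB E2
      (by rw [← exp_add, ← exp_add]; exact exp_eq_neg_one_of 0 (by push_cast; ring))
      (by rw [← exp_add, ← exp_add]; exact exp_eq_one_of 0 (by push_cast; ring))
    exact ⟨ε₁, ε₂, n1, n2, by rw [← r1]; ring, by linear_combination r2⟩
  have colD : |l.im + -(2 * Real.pi / 3)| ≤ 2 * Real.pi / 3 → ∃ ε₁ ε₂ : ℂ,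
      ‖ε₁‖ ≤ C * Real.exp (-(3 / 4) * l.re) ∧ ‖ε₂‖ ≤ C * Real.exp (-(3 / 4) * l.re) ∧
      exp (11 * I * Real.pi / 12) * airyC₁ * deriv airyAi (airyScale * ζ * exp (I * Real.pi / 3)) *
        exp (-X / 2 + I * Real.pi / 4) = 1 / (Real.sqrt 2 : ℂ) * exp (l / 4) * (1 + ε₁) ∧
      exp (7 * I * Real.pi / 12) * airyC₂ * airyAi (airyScale * ζ * exp (I * Real.pi / 3)) *
        exp (-X / 2 + I * Real.pi / 4) = -(1 / (Real.sqrt 2 : ℂ) * exp (-l / 4) * (1 + ε₂)) := by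
    intro h
    obtain ⟨ε₁, ε₂, n1, n2, hA, hB⟩ := H l (-(2 * Real.pi / 3)) h hρ
    rw [w2'] at hA hB
    have hs : exp (3 * I * (-(2 * Real.pi / 3) : ℝ) / 2) = -1 :=
      exp_eq_neg_one_of (-1) (by push_cast; ring)
    rw [hs] at hA hB
    obtain ⟨r1, r2⟩ := frame_column (α := exp (11 * I * Real.pi / 12))
      (γ := exp (7 * I * Real.pi / 12)) (τ := -1) (s := 1 / (Real.sqrt 2 : ℂ)) hA hB E1
      (by rw [← exp_add, ← exp_add]; exact exp_eq_neg_one_of 0 (by push_cast; ring))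
      (by rw [← exp_add, ← exp_add]; exact exp_eq_neg_one_of 0 (by push_cast; ring))
    exact ⟨ε₁, ε₂, n1, n2, by rw [← r1]; ring, by linear_combination r2⟩
  have colE : |l.im + -(4 * Real.pi / 3)| ≤ 2 * Real.pi / 3 → ∃ ε₁ ε₂ : ℂ,
      ‖ε₁‖ ≤ C * Real.exp (-(3 / 4) * l.re) ∧ ‖ε₂‖ ≤ C * Real.exp (-(3 / 4) * l.re) ∧
      -(exp (7 * I * Real.pi / 12) * airyC₁ * deriv airyAi (airyScale * ζ * exp (-(I * Real.pi / 3)))) *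
        exp (X / 2 - I * Real.pi / 4) = 1 / (Real.sqrt 2 : ℂ) * exp (l / 4) * (1 + ε₁) ∧
      -(-exp (-(I * Real.pi / 12)) * airyC₂ * airyAi (airyScale * ζ * exp (-(I * Real.pi / 3)))) *
        exp (X / 2 - I * Real.pi / 4) = 1 / (Real.sqrt 2 : ℂ) * exp (-l / 4) * (1 + ε₂) := by
    intro h
    obtain ⟨ε₁, ε₂, n1, n2, hA, hB⟩ := H l (-(4 * Real.pi / 3)) h hρ
    rw [w1'] at hA hB
    have hs : exp (3 * I * (-(4 * Real.pi / 3) : ℝ) / 2) = 1 :=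
      exp_eq_one_of (-1) (by push_cast; ring)
    rw [hs] at hA hB
    obtain ⟨r1, r2⟩ := frame_column (α := -exp (7 * I * Real.pi / 12))
      (γ := exp (-(I * Real.pi / 12))) (τ := 1) (s := 1 / (Real.sqrt 2 : ℂ)) hA hB E2
      (by rw [neg_mul, neg_mul, ← exp_add, ← exp_add, exp_eq_one_of 0 (by push_cast; ring)])
      (by rw [← exp_add, ← exp_add]; exact exp_eq_one_of 0 (by push_cast; ring))
    exact ⟨ε₁, ε₂, n1, n2, by rw [← r1]; ring, by linear_combination r2⟩
  clear H w0 w1 w1' w2 w2' wgen E1 E2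
  have hUW : ∀ M : Mat, M * !![0, -1; 1, 0] = !![M 0 1, -M 0 0; M 1 1, -M 1 0] := by
    intro M; ext i j; fin_cases i <;> fin_cases j <;> simp [Matrix.mul_apply, Fin.sum_univ_two]
  have hUWU : ∀ M : Mat, M * !![1, 1; 0, 1] * !![0, -1; 1, 0] * !![1, 1; 0, 1] =
      !![(M * !![1, 1; 0, 1] : Mat) 0 1, M 0 1; (M * !![1, 1; 0, 1] : Mat) 1 1, M 1 1] := by
    intro M; ext i j
    fin_cases i <;> fin_cases j <;> simp [Matrix.mul_apply, Fin.sum_univ_two]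
  have hD : ∀ p q r s : ℂ, (!![p, q; r, s] : Mat) * airyDiag X =
      !![p * exp (-X / 2 + I * Real.pi / 4), q * exp (X / 2 - I * Real.pi / 4);
        r * exp (-X / 2 + I * Real.pi / 4), s * exp (X / 2 - I * Real.pi / 4)] := by
    intro p q r s; ext i j
    fin_cases i <;> fin_cases j <;> simp [airyDiag, Matrix.mul_apply, Fin.sum_univ_two]
  have assemble : ∀ p q r s : ℂ, (∃ ε₁ ε₂ : ℂ, ‖ε₁‖ ≤ C * Real.exp (-(3 / 4) * l.re) ∧
      ‖ε₂‖ ≤ C * Real.exp (-(3 / 4) * l.re) ∧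
      p * exp (-X / 2 + I * Real.pi / 4) = 1 / (Real.sqrt 2 : ℂ) * exp (l / 4) * (1 + ε₁) ∧
      r * exp (-X / 2 + I * Real.pi / 4) = -(1 / (Real.sqrt 2 : ℂ) * exp (-l / 4) * (1 + ε₂))) →
      (∃ ε₁ ε₂ : ℂ, ‖ε₁‖ ≤ C * Real.exp (-(3 / 4) * l.re) ∧
      ‖ε₂‖ ≤ C * Real.exp (-(3 / 4) * l.re) ∧
      q * exp (X / 2 - I * Real.pi / 4) = 1 / (Real.sqrt 2 : ℂ) * exp (l / 4) * (1 + ε₁) ∧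
      s * exp (X / 2 - I * Real.pi / 4) = 1 / (Real.sqrt 2 : ℂ) * exp (-l / 4) * (1 + ε₂)) →
      NearFrame (C * Real.exp (-(3 / 4) * l.re)) l (!![p, q; r, s] * airyDiag X) := by
    rintro p q r s ⟨ε₁, ε₂, n1, n2, h1, h2⟩ ⟨ε₃, ε₄, n3, n4, h3, h4⟩
    exact ⟨ε₁, ε₃, ε₂, ε₄, n1, n3, n2, n4, by rw [hD, h1, h2, h3, h4]⟩
  rw [Sloc_eq, hX, T]
  have him : l.im = (-ζ).arg := by rw [hl, log_im]
  have hle := arg_le_pi ζ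
  have hgt := neg_pi_lt_arg ζ
  have hupper : 0 < ζ.arg → l.im = ζ.arg - Real.pi := by
    intro h0
    rw [him]
    rcases hle.lt_or_eq with h | h
    · have : 0 < ζ.im := by
        rcases (arg_nonneg_iff.1 h0.le).lt_or_eq with h' | h'
        · exact h'
        · exfalso
          rcases le_or_gt 0 ζ.re with h'' | h''
          · exact harg (arg_eq_zero_iff.2 ⟨h'', h'.symm⟩)
          · exact h.ne (arg_eq_pi_iff.2 ⟨h'', h'.symm⟩)
      exact arg_neg_eq_arg_sub_pi_of_im_pos this
    · obtain ⟨h1, h2⟩ := arg_eq_pi_iff.1 h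
      rw [h, sub_self, arg_eq_zero_iff]
      exact ⟨by rw [neg_re]; linarith, by rw [neg_im, h2, neg_zero]⟩
  have hlower : ζ.arg < 0 → l.im = ζ.arg + Real.pi := by
    intro h0
    rw [him]
    exact arg_neg_eq_arg_add_pi_of_im_neg (arg_neg_iff.1 h0)
  -- Each sector uses the two columns whose rotated arguments stay within 2π/3: `colA` above the
  -- axis, `colD` below it, `colB` in the two outer sectors, `colC` and `colE` in the two inner
  -- ones.
  split_ifs with h1 h2 h3
  · have := hupper (by linarith)
    rw [Tsector_eq]
    refine assemble _ _ _ _ (colA ?_) (colB ?_) <;> rw [this, abs_le] <;> constructor <;> linarith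
  · have h0 : 0 < ζ.arg := lt_of_le_of_ne h2 (Ne.symm harg)
    have := hupper h0
    rw [Tsector_mul_upper]
    refine assemble _ _ _ _ (colA ?_) (colC ?_) <;> rw [this, abs_le] <;> constructor <;> linarith
  · have := hlower (by linarith)
    rw [hUW, Tsector_mul_upper]
    refine assemble _ _ _ _ (colD ?_) (colE ?_) <;> rw [this, abs_le] <;> constructor <;> linarith
  · have := hlower (by linarith)
    rw [hUWU, Tsector_mul_upper, Tsector_eq]
    refine assemble _ _ _ _ (colD ?_) (colB ?_) <;> rw [this, abs_le] <;> constructor <;> linarith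

lemma log_neg_of_arg_pos {ζ : ℂ} (h0 : 0 < ζ.arg) : log (-ζ) = log ζ - Real.pi * I := by
  have hle := arg_le_pi ζ
  apply Complex.ext
  · simp [log_re]
  · rw [log_im, sub_im, log_im, mul_im]
    simp only [ofReal_re, I_im, ofReal_im, I_re, mul_one, mul_zero, add_zero]
    rcases hle.lt_or_eq with h | h
    · have : 0 < ζ.im := by
        rcases (arg_nonneg_iff.1 h0.le).lt_or_eq with h' | h'
        · exact h'
        · exfalso
          rcases le_or_gt 0 ζ.re with h'' | h''
          · exact h0.ne' (arg_eq_zero_iff.2 ⟨h'', h'.symm⟩)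
          · exact h.ne (arg_eq_pi_iff.2 ⟨h'', h'.symm⟩)
      exact arg_neg_eq_arg_sub_pi_of_im_pos this
    · obtain ⟨h1, h2⟩ := arg_eq_pi_iff.1 h
      rw [h, sub_self, arg_eq_zero_iff]
      exact ⟨by rw [neg_re]; linarith, by rw [neg_im, h2, neg_zero]⟩

lemma log_neg_of_arg_neg {ζ : ℂ} (h0 : ζ.arg < 0) : log (-ζ) = log ζ + Real.pi * I := by
  apply Complex.ext
  · simp [log_re]
  · rw [log_im, add_im, log_im, mul_im]
    simp only [ofReal_re, I_im, ofReal_im, I_re, mul_one, mul_zero, add_zero]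
    exact arg_neg_eq_arg_add_pi_of_im_neg (arg_neg_iff.1 h0)

lemma neg_cpow_three_halves_of_arg_pos {ζ : ℂ} (h0 : 0 < ζ.arg) :
    (-ζ) ^ (3 / 2 : ℂ) = I * ζ ^ (3 / 2 : ℂ) := by
  have hζ : ζ ≠ 0 := by rintro rfl; simp at h0
  rw [cpow_three_halves_eq hζ, cpow_three_halves_eq (neg_ne_zero.2 hζ), log_neg_of_arg_pos h0]
  nth_rewrite 2 [← exp_pi_div_two_mul_I]
  rw [← exp_add, exp_eq_exp_iff_exists_int]
  exact ⟨-1, by push_cast; ring⟩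

lemma neg_cpow_three_halves_of_arg_neg {ζ : ℂ} (h0 : ζ.arg < 0) :
    (-ζ) ^ (3 / 2 : ℂ) = -I * ζ ^ (3 / 2 : ℂ) := by
  have hζ : ζ ≠ 0 := by rintro rfl; simp at h0
  rw [cpow_three_halves_eq hζ, cpow_three_halves_eq (neg_ne_zero.2 hζ), log_neg_of_arg_neg h0,
    ← exp_neg_pi_div_two_mul_I]
  rw [← exp_add, exp_eq_exp_iff_exists_int]
  exact ⟨1, by push_cast; ring⟩

lemma det_airyDiag (X : ℂ) : (airyDiag X).det = 1 := by
  rw [airyDiag, Matrix.det_fin_two_of, ← exp_add]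
  simp only [mul_zero, sub_zero]
  rw [show -X / 2 + I * Real.pi / 4 + (X / 2 - I * Real.pi / 4) = 0 by ring, exp_zero]

/-- The unperturbed frame has determinant 1. The estimate serves to identify the constant in
`det_Tsector`. -/
lemma NearFrame.norm_det_sub_one_le {η : ℝ} {l : ℂ} {S : Mat} (h : NearFrame η l S) :
    ‖S.det - 1‖ ≤ 2 * η + η ^ 2 := by
  obtain ⟨a, b, c, d, ha, hb, hc, hd, rfl⟩ := h
  have hη : 0 ≤ η := (norm_nonneg a).trans ha
  have h2 : (1 / (Real.sqrt 2 : ℂ)) * (1 / (Real.sqrt 2 : ℂ)) = 1 / 2 := by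
    rw [div_mul_div_comm, ← ofReal_mul, Real.mul_self_sqrt (by norm_num)]; norm_num
  have hE : exp (l / 4) * exp (-l / 4) = 1 := by
    rw [← exp_add, show l / 4 + -l / 4 = 0 by ring, exp_zero]
  rw [Matrix.det_fin_two_of]
  have : 1 / (Real.sqrt 2 : ℂ) * exp (l / 4) * (1 + a) * (1 / (Real.sqrt 2 : ℂ) * exp (-l / 4) * (1 + d)) -
      1 / (Real.sqrt 2 : ℂ) * exp (l / 4) * (1 + b) * -(1 / (Real.sqrt 2 : ℂ) * exp (-l / 4) * (1 + c)) - 1 =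
      (a + d + a * d + (b + c + b * c)) / 2 := by
    set s := 1 / (Real.sqrt 2 : ℂ)
    linear_combination s * s * ((1 + a) * (1 + d) + (1 + b) * (1 + c)) * hE +
      ((1 + a) * (1 + d) + (1 + b) * (1 + c)) * h2
  rw [this, norm_div, Complex.norm_ofNat]
  have n1 : ‖a * d‖ ≤ η * η := by rw [norm_mul]; gcongr
  have n2 : ‖b * c‖ ≤ η * η := by rw [norm_mul]; gcongr
  have n3 : ‖a + d + a * d + (b + c + b * c)‖ ≤ (η + η + η * η) + (η + η + η * η) :=
    (norm_add_le _ _).trans (add_le_add (norm_add₃_le.trans (by linarith))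
      (norm_add₃_le.trans (by linarith)))
  linarith

lemma differentiable_deriv_airyAi : Differentiable ℂ (deriv airyAi) := fun w =>
  (hasDerivAt_deriv_airyAi w).differentiableAt

/-- The determinant is a Wronskian of two rotated Airy functions, hence constant by Airy's equation;
the asymptotic frame along the negative axis shows that the constant is 1. -/
lemma det_Tsector (ζ : ℂ) : (Tsector ζ).det = 1 := by
  set q := airyScale * exp (-(I * Real.pi / 3)) with hq
  set k := airyScale with hk
  set a := exp (7 * I * Real.pi / 12) * airyC₁ * (exp (I * Real.pi / 4) * airyC₂) with ha
  set b := exp (5 * I * Real.pi / 4) * airyC₁ * (exp (-(I * Real.pi / 12)) * airyC₂) with hb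
  have hdet : ∀ ζ, (Tsector ζ).det = a * (deriv airyAi (q * ζ) * airyAi (-k * ζ)) +
      b * (deriv airyAi (-k * ζ) * airyAi (q * ζ)) := by
    intro ζ
    rw [Tsector_eq, Matrix.det_fin_two_of, show k * ζ * exp (-(I * Real.pi / 3)) = q * ζ by
      rw [hq]; ring, show -(k * ζ) = -k * ζ by ring, ha, hb]
    ring
  have lin : ∀ c z : ℂ, HasDerivAt (fun z : ℂ => c * z) c z := fun c z => by
    simpa using (hasDerivAt_id z).const_mul c
  have d0 : ∀ c z : ℂ, HasDerivAt (fun z => airyAi (c * z)) (deriv airyAi (c * z) * c) z :=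
    fun c z => (differentiable_airyAi (c * z)).hasDerivAt.comp z (lin c z)
  have d1 : ∀ c z : ℂ, HasDerivAt (fun z => deriv airyAi (c * z)) (c * z * airyAi (c * z) * c) z :=
    fun c z => (hasDerivAt_deriv_airyAi (c * z)).comp z (lin c z)
  have hab : a * k = b * q := by
    have : exp (7 * I * Real.pi / 12) * exp (I * Real.pi / 4) =
      exp (5 * I * Real.pi / 4) * exp (-(I * Real.pi / 12)) * exp (-(I * Real.pi / 3)) := by
      rw [← exp_add, ← exp_add, ← exp_add]; congr 1; ring
    rw [ha, hb, hq]; linear_combination airyC₁ * airyC₂ * k * this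
  have hq3 : q ^ 3 = -k ^ 3 := by
    have : exp (-(I * Real.pi / 3)) ^ 3 = -1 := by
      rw [← exp_nat_mul]; exact exp_eq_neg_one_of (-1) (by push_cast; ring)
    rw [hq, mul_pow, this]; ring
  have hk0 : k ≠ 0 := by rw [hk, airyScale_eq]; exact exp_ne_zero _
  have hz : ∀ z, HasDerivAt (fun ζ => (Tsector ζ).det) 0 z := by
    intro z
    rw [funext hdet]
    refine ((((d1 q z).mul (d0 (-k) z)).const_mul a).add
      (((d1 (-k) z).mul (d0 q z)).const_mul b)).congr_deriv ?_
    -- In the derivative the Ai·Ai terms cancel because q³ = -k³, and the Ai'·Ai' terms because ak =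
    -- bq.
    have h2 : a * q ^ 2 + b * k ^ 2 = 0 := by
      have : k * (a * q ^ 2 + b * k ^ 2) = 0 := by linear_combination q ^ 2 * hab + b * hq3
      exact (mul_eq_zero.1 this).resolve_left hk0
    linear_combination (z * airyAi (q * z) * airyAi (-k * z)) * h2 -
      (deriv airyAi (q * z) * deriv airyAi (-k * z)) * hab
  have hconst := fun x => is_const_of_deriv_eq_zero (fun z => (hz z).differentiableAt)
    (fun z => (hz z).deriv) ζ x
  obtain ⟨C, hC, H⟩ := Sloc_nearFrame 0
  have key : ∀ t : ℝ, 0 ≤ t → ‖(Tsector ζ).det - 1‖ ≤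
      2 * (C * Real.exp (-(3 / 4) * t)) + (C * Real.exp (-(3 / 4) * t)) ^ 2 := by
    intro t ht
    set x : ℝ := Real.exp t
    have hx : 0 < x := Real.exp_pos t
    have harg : (-(x : ℂ)).arg = Real.pi := by
      rw [← ofReal_neg]; exact arg_ofReal_of_neg (by linarith)
    have hn : ‖-(x : ℂ)‖ = x := by rw [norm_neg, norm_real, Real.norm_of_nonneg hx.le]
    have := (H (-(x : ℂ)) (by simpa using hx.ne') (by rw [harg]; exact Real.pi_ne_zero)
      (by rw [hn, Real.log_exp]; exact ht)).norm_det_sub_one_le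
    rw [Sloc_eq, Matrix.det_mul, det_airyDiag, mul_one, T, if_pos (by
      rw [harg]; linarith [Real.pi_pos]), hn, Real.log_exp] at this
    rw [hconst (-(x : ℂ))]; exact this
  have lim0 : Tendsto (fun t : ℝ => C * Real.exp (-(3 / 4) * t)) atTop (𝓝 0) := by
    have : Tendsto (fun t : ℝ => -(3 / 4) * t) atTop atBot :=
      tendsto_id.const_mul_atTop_of_neg (by norm_num)
    simpa using (Real.tendsto_exp_atBot.comp this).const_mul C
  have lim : Tendsto (fun t : ℝ => 2 * (C * Real.exp (-(3 / 4) * t)) +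
      (C * Real.exp (-(3 / 4) * t)) ^ 2) atTop (𝓝 0) := by
    simpa using (lim0.const_mul 2).add (lim0.pow 2)
  have := ge_of_tendsto lim (by filter_upwards [eventually_ge_atTop 0] with t ht using key t ht)
  exact sub_eq_zero.1 (norm_le_zero_iff.1 this)

/-- The entries of `S^loc (S̃^loc)⁻¹ - 1`. -/
lemma Sloc_match (ρ : ℝ) : ∃ C : ℝ, 0 ≤ C ∧ ∀ ζ : ℂ, ζ ≠ 0 → ζ.arg ≠ 0 → ρ ≤ Real.log ‖ζ‖ →
    ∃ a b c d : ℂ, Sloc ζ * (StildeLoc ζ)⁻¹ - 1 = !![a, b; c, d] ∧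
      ‖a‖ ≤ C * ‖ζ‖ ^ (-(3 / 4) : ℝ) ∧ ‖b‖ ≤ C * ‖ζ‖ ^ (-(1 / 4) : ℝ) ∧
      ‖c‖ ≤ C * ‖ζ‖ ^ (-(5 / 4) : ℝ) ∧ ‖d‖ ≤ C * ‖ζ‖ ^ (-(3 / 4) : ℝ) := by
  obtain ⟨C, hC, H⟩ := Sloc_nearFrame ρ
  refine ⟨C, hC, fun ζ hζ harg hρ => ?_⟩
  obtain ⟨a, b, c, d, ha, hb, hc, hd, hS⟩ := H ζ hζ harg hρ
  set l := log (-ζ) with hl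
  have hn : 0 < ‖ζ‖ := norm_pos_iff.2 hζ
  have hlre : l.re = Real.log ‖ζ‖ := by rw [hl, log_re, norm_neg]
  have h2 : (1 / (Real.sqrt 2 : ℂ)) * (1 / (Real.sqrt 2 : ℂ)) = 1 / 2 := by
    rw [div_mul_div_comm, ← ofReal_mul, Real.mul_self_sqrt (by norm_num)]; norm_num
  have hE : exp (l / 4) * exp (-l / 4) = 1 := by
    rw [← exp_add, show l / 4 + -l / 4 = 0 by ring, exp_zero]
  have hSt : StildeLoc ζ = !![1 / (Real.sqrt 2 : ℂ) * exp (l / 4), 1 / (Real.sqrt 2 : ℂ) * exp (l / 4);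
      -(1 / (Real.sqrt 2 : ℂ) * exp (-l / 4)), 1 / (Real.sqrt 2 : ℂ) * exp (-l / 4)] := by
    have e1 : (-ζ) ^ (1 / 4 : ℂ) = exp (l / 4) := by
      rw [cpow_def_of_ne_zero (neg_ne_zero.2 hζ)]; congr 1; ring
    have e2 : (-ζ) ^ (-(1 / 4) : ℂ) = exp (-l / 4) := by
      rw [cpow_def_of_ne_zero (neg_ne_zero.2 hζ)]; congr 1; ring
    rw [StildeLoc, e1, e2]
    ext i j; fin_cases i <;> fin_cases j <;> simp
  have hdet : (StildeLoc ζ).det = 1 := by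
    rw [hSt, Matrix.det_fin_two_of]
    linear_combination 2 * (1 / (Real.sqrt 2 : ℂ)) * (1 / (Real.sqrt 2 : ℂ)) * hE + 2 * h2
  have hinv : (StildeLoc ζ)⁻¹ = !![1 / (Real.sqrt 2 : ℂ) * exp (-l / 4), -(1 / (Real.sqrt 2 : ℂ) * exp (l / 4));
      1 / (Real.sqrt 2 : ℂ) * exp (-l / 4), 1 / (Real.sqrt 2 : ℂ) * exp (l / 4)] := by
    rw [Matrix.inv_def, hdet, Ring.inverse_one, one_smul, hSt, Matrix.adjugate_fin_two_of, neg_neg]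
  have hE2 : exp (l / 4) * exp (l / 4) = exp (l / 2) := by
    rw [← exp_add]; congr 1; ring
  have hE3 : exp (-l / 4) * exp (-l / 4) = exp (-l / 2) := by
    rw [← exp_add]; congr 1; ring
  -- The product with the inverse frame is computed exactly from the relative errors. The
  -- off-diagonal entries pick up (-ζ)^{±1/2}, which turns the rate -3/4 into -1/4 and -5/4.
  refine ⟨(a + b) / 2, exp (l / 2) * (b - a) / 2, exp (-l / 2) * (d - c) / 2, (c + d) / 2, ?_, ?_⟩
  · rw [hS, hinv]
    set s := 1 / (Real.sqrt 2 : ℂ)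
    ext i j
    fin_cases i <;> fin_cases j <;> simp
    · linear_combination s * s * (2 + a + b) * hE + (2 + a + b) * h2
    · linear_combination s * s * (b - a) * hE2 + exp (l / 2) * (b - a) * h2
    · linear_combination s * s * (d - c) * hE3 + exp (-l / 2) * (d - c) * h2
    · linear_combination s * s * (2 + c + d) * hE + (2 + c + d) * h2
  · have r : ∀ p : ℝ, ‖ζ‖ ^ p = Real.exp (p * l.re) := fun p => by
      rw [Real.rpow_def_of_pos hn, hlre, mul_comm]
    simp only [r]
    rw [← hlre] at ha hb hc hd
    have np : ‖exp (l / 2)‖ = Real.exp (l.re / 2) := by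
      rw [norm_exp, show (2 : ℂ) = ((2 : ℝ) : ℂ) by norm_num, div_ofReal_re]
    have nm : ‖exp (-l / 2)‖ = Real.exp (-l.re / 2) := by
      rw [norm_exp, show (2 : ℂ) = ((2 : ℝ) : ℂ) by norm_num, div_ofReal_re, neg_re]
    refine ⟨?_, ?_, ?_, ?_⟩
    · rw [norm_div, Complex.norm_ofNat]; linarith [norm_add_le a b]
    · rw [norm_div, norm_mul, np, Complex.norm_ofNat,
        show -(1 / 4 : ℝ) * l.re = l.re / 2 + -(3 / 4) * l.re by ring, Real.exp_add]
      have : ‖b - a‖ ≤ 2 * (C * Real.exp (-(3 / 4) * l.re)) := by linarith [norm_sub_le b a]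
      nlinarith [mul_le_mul_of_nonneg_left this (Real.exp_pos (l.re / 2)).le]
    · rw [norm_div, norm_mul, nm, Complex.norm_ofNat,
        show -(5 / 4 : ℝ) * l.re = -l.re / 2 + -(3 / 4) * l.re by ring, Real.exp_add]
      have : ‖d - c‖ ≤ 2 * (C * Real.exp (-(3 / 4) * l.re)) := by linarith [norm_sub_le d c]
      nlinarith [mul_le_mul_of_nonneg_left this (Real.exp_pos (-l.re / 2)).le]
    · rw [norm_div, Complex.norm_ofNat]; linarith [norm_add_le c d]

/-! ### The Airy matrix: analyticity, jumps, normalization, growth -/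

lemma differentiable_Tsector (i j : Fin 2) : Differentiable ℂ fun ζ => Tsector ζ i j := by
  have h1 : Differentiable ℂ fun ζ : ℂ => airyScale * ζ * exp (-(I * Real.pi / 3)) := by fun_prop
  have h2 : Differentiable ℂ fun ζ : ℂ => -(airyScale * ζ) := by fun_prop
  have a1 := differentiable_airyAi.comp h1
  have a2 := differentiable_airyAi.comp h2
  have b1 := differentiable_deriv_airyAi.comp h1
  have b2 := differentiable_deriv_airyAi.comp h2
  rw [funext Tsector_eq]
  fin_cases i <;> fin_cases j
  · exact b1.const_mul _
  · exact b2.const_mul _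
  · exact a1.const_mul _
  · exact a2.const_mul _

lemma continuous_Tsector : Continuous Tsector :=
  continuous_matrix fun i j => (differentiable_Tsector i j).continuous

lemma differentiable_airyDiag (i j : Fin 2) : Differentiable ℂ fun X => airyDiag X i j := by
  fin_cases i <;> fin_cases j
  · change Differentiable ℂ fun X : ℂ => exp (-X / 2 + I * Real.pi / 4); fun_prop
  · change Differentiable ℂ fun X : ℂ => (0 : ℂ); fun_prop
  · change Differentiable ℂ fun X : ℂ => (0 : ℂ); fun_prop
  · change Differentiable ℂ fun X : ℂ => exp (X / 2 - I * Real.pi / 4); fun_prop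

lemma continuous_airyDiag : Continuous airyDiag :=
  continuous_matrix fun i j => (differentiable_airyDiag i j).continuous

lemma analyticAt_mul_entries {F G : ℂ → Mat} {z : ℂ} (hF : ∀ i j, AnalyticAt ℂ (fun z => F z i j) z)
    (hG : ∀ i j, AnalyticAt ℂ (fun z => G z i j) z) (i j : Fin 2) :
    AnalyticAt ℂ (fun z => (F z * G z) i j) z := by
  simp only [Matrix.mul_apply, Fin.sum_univ_two]
  exact ((hF i 0).mul (hG 0 j)).add ((hF i 1).mul (hG 1 j))

lemma analyticAt_airyDiag_cpow {ζ : ℂ} (hζ : -ζ ∈ slitPlane) (i j : Fin 2) :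
    AnalyticAt ℂ (fun ζ => airyDiag ((-ζ) ^ (3 / 2 : ℂ)) i j) ζ :=
  AnalyticAt.comp ((differentiable_airyDiag i j).analyticAt _)
    (analyticAt_id.neg.cpow analyticAt_const hζ)

/-- The value of `T` in the four sectors. -/
lemma T_of_le {ζ : ℂ} (h : Real.pi / 3 ≤ ζ.arg) : T ζ = Tsector ζ := if_pos h

lemma T_of_mem_upper {ζ : ℂ} (h : 0 ≤ ζ.arg) (h' : ζ.arg < Real.pi / 3) :
    T ζ = Tsector ζ * !![1, 1; 0, 1] := by
  rw [T, if_neg (not_le.2 h'), if_pos h]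

lemma T_of_mem_lower {ζ : ℂ} (h : -(Real.pi / 3) < ζ.arg) (h' : ζ.arg < 0) :
    T ζ = Tsector ζ * !![1, -1; 1, 0] := by
  rw [T, if_neg (by linarith [Real.pi_pos]), if_neg (not_le.2 h'), if_pos h, mul_assoc]
  congr 1
  ext i j; fin_cases i <;> fin_cases j <;> simp [Matrix.mul_apply, Fin.sum_univ_two]

lemma T_of_le_neg {ζ : ℂ} (h : ζ.arg ≤ -(Real.pi / 3)) : T ζ = Tsector ζ * !![1, 0; 1, 1] := by
  have := Real.pi_pos
  rw [T, if_neg (by linarith), if_neg (by linarith), if_neg (by linarith), mul_assoc, mul_assoc]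
  congr 1
  ext i j; fin_cases i <;> fin_cases j <;> simp [Matrix.mul_apply, Fin.sum_univ_two]

/-- A constant jump becomes oscillatory or exponential on passing through the diagonal factor. The
quotient of the two diagonal entries is -i e^X, the phase coming from the shifts ±iπ/4. -/
lemma airyDiag_mul_upper (X : ℂ) :
    (!![1, 1; 0, 1] : Mat) * airyDiag X = airyDiag X * !![1, -I * exp X; 0, 1] := by
  have h : exp (X / 2 - I * Real.pi / 4) = exp (-X / 2 + I * Real.pi / 4) * (-I * exp X) := by
    rw [← exp_neg_pi_div_two_mul_I, ← exp_add, ← exp_add]; congr 1; ring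
  ext i j; fin_cases i <;> fin_cases j <;>
    simp [airyDiag, Matrix.mul_apply, Fin.sum_univ_two]
  simpa using h

lemma airyDiag_mul_lower (X : ℂ) :
    (!![1, 0; 1, 1] : Mat) * airyDiag X = airyDiag X * !![1, 0; I * exp (-X), 1] := by
  have h : exp (-X / 2 + I * Real.pi / 4) = exp (X / 2 - I * Real.pi / 4) * (I * exp (-X)) := by
    nth_rewrite 3 [← exp_pi_div_two_mul_I]
    rw [← exp_add, ← exp_add]; congr 1; ring
  ext i j; fin_cases i <;> fin_cases j <;>
    simp [airyDiag, Matrix.mul_apply, Fin.sum_univ_two]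
  simpa using h

/-- Across the positive ray the principal value of (-ζ)^{3/2} changes sign, which exchanges the
diagonal entries up to unit phases. This is how the constant rotation becomes the twist on arg ζ =
0. -/
lemma airyDiag_rotate (X : ℂ) :
    (!![0, -1; 1, 0] : Mat) * airyDiag (-X) = airyDiag X * !![0, I; I, 0] := by
  have h1 : -exp (-X / 2 - I * Real.pi / 4) = exp (-X / 2 + I * Real.pi / 4) * I := by
    nth_rewrite 3 [← exp_pi_div_two_mul_I]
    rw [neg_eq_neg_one_mul (exp _), ← exp_pi_mul_I, ← exp_add, ← exp_add]; congr 1; ring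
  have h2 : exp (X / 2 + I * Real.pi / 4) = exp (X / 2 - I * Real.pi / 4) * I := by
    nth_rewrite 3 [← exp_pi_div_two_mul_I]
    rw [← exp_add]; congr 1; ring
  ext i j; fin_cases i <;> fin_cases j <;>
    simp [airyDiag, Matrix.mul_apply, Fin.sum_univ_two]
  · simpa using h1
  · simpa using h2

lemma eventually_arg_mem {ζ : ℂ} {a b : ℝ} (hs : ζ ∈ slitPlane) (ha : a < ζ.arg) (hb : ζ.arg < b) :
    ∀ᶠ ξ in 𝓝 ζ, a < ξ.arg ∧ ξ.arg < b :=
  (continuousAt_arg hs).eventually (Ioo_mem_nhds ha hb)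

/-- Inside a sector T is an entire matrix times a constant one, so only the cut of (-ζ)^{3/2} has to
be avoided. -/
lemma analyticAt_Sloc_of_eventuallyEq {ζ : ℂ} (M : Mat) (hζ : -ζ ∈ slitPlane)
    (h : ∀ᶠ ξ in 𝓝 ζ, T ξ = Tsector ξ * M) (i j : Fin 2) :
    AnalyticAt ℂ (fun ζ => Sloc ζ i j) ζ := by
  have h1 := analyticAt_mul_entries (F := fun ζ => Tsector ζ * M)
    (G := fun ζ => airyDiag ((-ζ) ^ (3 / 2 : ℂ)))
    (analyticAt_mul_entries (F := Tsector) (G := fun _ => M)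
      (fun i j => (differentiable_Tsector i j).analyticAt ζ) (fun i j => analyticAt_const))
    (fun i j => analyticAt_airyDiag_cpow hζ i j) i j
  refine h1.congr ?_
  filter_upwards [h] with ξ hξ
  rw [Sloc_eq, hξ]

lemma neg_mem_slitPlane_of_arg_ne_zero {ζ : ℂ} (h : ζ.arg ≠ 0) : -ζ ∈ slitPlane := by
  rw [mem_slitPlane_iff]
  by_contra hc
  rw [not_or, not_lt, not_not, neg_re, neg_im, neg_eq_zero] at hc
  exact h (arg_eq_zero_iff.2 ⟨by linarith [hc.1], hc.2⟩)

lemma mem_slitPlane_of_arg_lt_pi {ζ : ℂ} (h0 : ζ ≠ 0) (h : ζ.arg < Real.pi) : ζ ∈ slitPlane :=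
  mem_slitPlane_iff_arg.2 ⟨h.ne, h0⟩

lemma analyticOn_Sloc (i j : Fin 2) : AnalyticOnNhd ℂ (fun ζ => Sloc ζ i j) offContour := by
  have hpi := Real.pi_pos
  rintro ζ (((⟨h0, h1, h2⟩ | ⟨h0, h1, h2⟩) | ⟨h0, h1, h2⟩) | ⟨h0, h1, h2⟩)
  · refine analyticAt_Sloc_of_eventuallyEq !![1, 1; 0, 1]
      (neg_mem_slitPlane_of_arg_ne_zero h1.ne') ?_ i j
    filter_upwards [eventually_arg_mem (mem_slitPlane_of_arg_lt_pi h0 (by linarith)) h1 h2] with ξ hξ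
    exact T_of_mem_upper hξ.1.le hξ.2
  · refine analyticAt_Sloc_of_eventuallyEq 1
      (neg_mem_slitPlane_of_arg_ne_zero (by linarith)) ?_ i j
    filter_upwards [eventually_arg_mem (mem_slitPlane_of_arg_lt_pi h0 (by linarith)) h1 h2] with ξ hξ
    rw [T_of_le hξ.1.le, mul_one]
  · refine analyticAt_Sloc_of_eventuallyEq !![1, 0; 1, 1]
      (neg_mem_slitPlane_of_arg_ne_zero (by linarith)) ?_ i j
    filter_upwards [eventually_arg_mem (mem_slitPlane_of_arg_lt_pi h0 (by linarith)) h1 h2] with ξ hξ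
    exact T_of_le_neg hξ.2.le
  · refine analyticAt_Sloc_of_eventuallyEq !![1, -1; 1, 0]
      (neg_mem_slitPlane_of_arg_ne_zero h2.ne) ?_ i j
    filter_upwards [eventually_arg_mem (mem_slitPlane_of_arg_lt_pi h0 (by linarith)) h1 h2] with ξ hξ
    exact T_of_mem_lower hξ.1 hξ.2

/-- The exponent being positive, continuity also holds at the origin; the closed sectors can thus be
treated with their common vertex included. -/
lemma continuousAt_cpow_three_halves {ζ : ℂ} (h : 0 ≤ ζ.re ∨ ζ.im ≠ 0) :
    ContinuousAt (fun z : ℂ => z ^ (3 / 2 : ℂ)) ζ :=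
  continuousAt_cpow_const_of_re_pos h (by norm_num)

lemma continuousOn_sheet (M : Mat) {f : ℂ → ℂ} {s : Set ℂ} (hf : ContinuousOn f s) :
    ContinuousOn (fun ζ => Tsector ζ * M * airyDiag (f ζ)) s := by
  refine continuousOn_pi.2 fun i => continuousOn_pi.2 fun j => ?_
  have hT : ∀ i j, ContinuousOn (fun ζ => Tsector ζ i j) s := fun i j =>
    (differentiable_Tsector i j).continuous.continuousOn
  have hD : ∀ i j, ContinuousOn (fun ζ => airyDiag (f ζ) i j) s := fun i j =>
    (differentiable_airyDiag i j).continuous.comp_continuousOn hf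
  simp only [Matrix.mul_apply, Fin.sum_univ_two]
  exact ((((hT i 0).mul continuousOn_const).add ((hT i 1).mul continuousOn_const)).mul (hD 0 j)).add
    ((((hT i 0).mul continuousOn_const).add ((hT i 1).mul continuousOn_const)).mul (hD 1 j))

lemma closure_sector_subset_re {a b : ℝ} (ha : -(Real.pi / 3) ≤ a) (hb : b ≤ Real.pi / 3) :
    closure (sector a b) ⊆ {ζ | 0 ≤ ζ.re} := by
  have := Real.pi_pos
  refine closure_minimal ?_ (isClosed_le continuous_const continuous_re)
  rintro ζ ⟨_, h1, h2⟩
  exact (abs_arg_le_pi_div_two_iff.1 (abs_le.2 ⟨by linarith, by linarith⟩) : 0 ≤ ζ.re)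

lemma arg_sin_cos (ζ : ℂ) : ζ.re = ‖ζ‖ * Real.cos ζ.arg ∧ ζ.im = ‖ζ‖ * Real.sin ζ.arg :=
  ⟨(norm_mul_cos_arg ζ).symm, (norm_mul_sin_arg ζ).symm⟩

/-- The right-hand side is the half-plane Im(e^{-iπ/3}ζ) ≥ 0. What matters is that it meets the real
axis only in nonpositive points, so that -ζ stays off the cut. -/
lemma closure_sector_upper : closure (sector (Real.pi / 3) Real.pi) ⊆
    {ζ | 0 ≤ ζ.im - Real.sqrt 3 * ζ.re} := by
  refine closure_minimal ?_ (isClosed_le continuous_const (by fun_prop))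
  rintro ζ ⟨_, h1, h2⟩
  obtain ⟨e1, e2⟩ := arg_sin_cos ζ
  have : ζ.im - Real.sqrt 3 * ζ.re = 2 * ‖ζ‖ * Real.sin (ζ.arg - Real.pi / 3) := by
    rw [Real.sin_sub, Real.cos_pi_div_three, Real.sin_pi_div_three, e1, e2, ← e1, ← e2]
    ring_nf
    linear_combination e2 - Real.sqrt 3 * e1
  have h3 := Real.sin_nonneg_of_nonneg_of_le_pi (x := ζ.arg - Real.pi / 3) (by linarith)
    (by linarith [Real.pi_pos])
  change 0 ≤ ζ.im - Real.sqrt 3 * ζ.re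
  rw [this]; positivity

lemma closure_sector_lower : closure (sector (-Real.pi) (-(Real.pi / 3))) ⊆
    {ζ | 0 ≤ -ζ.im - Real.sqrt 3 * ζ.re} := by
  refine closure_minimal ?_ (isClosed_le continuous_const (by fun_prop))
  rintro ζ ⟨_, h1, h2⟩
  obtain ⟨e1, e2⟩ := arg_sin_cos ζ
  have : -ζ.im - Real.sqrt 3 * ζ.re = 2 * ‖ζ‖ * Real.sin (-ζ.arg - Real.pi / 3) := by
    rw [Real.sin_sub, Real.cos_pi_div_three, Real.sin_pi_div_three, Real.sin_neg, Real.cos_neg]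
    linear_combination -e2 - Real.sqrt 3 * e1
  have h3 := Real.sin_nonneg_of_nonneg_of_le_pi (x := -ζ.arg - Real.pi / 3) (by linarith)
    (by linarith [Real.pi_pos])
  change 0 ≤ -ζ.im - Real.sqrt 3 * ζ.re
  rw [this]; positivity

lemma re_nonpos_of_upper {ζ : ℂ} (h : 0 ≤ ζ.im - Real.sqrt 3 * ζ.re ∨ 0 ≤ -ζ.im - Real.sqrt 3 * ζ.re) :
    0 ≤ (-ζ).re ∨ (-ζ).im ≠ 0 := by
  by_cases hz : ζ.im = 0
  · left
    have h3 : 0 < Real.sqrt 3 := by positivity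
    rw [neg_re]
    rcases h with h | h <;> rw [hz] at h <;> nlinarith
  · right; rwa [neg_im, neg_ne_zero]

lemma Sloc_normalization : Tendsto (fun ζ => Sloc ζ * (StildeLoc ζ)⁻¹)
    (Bornology.cobounded ℂ ⊓ 𝓟 offContour) (𝓝 1) := by
  obtain ⟨C, hC, H⟩ := Sloc_match 0
  have hpow : ∀ p : ℝ, p < 0 → Tendsto (fun ζ : ℂ => C * ‖ζ‖ ^ p)
      (Bornology.cobounded ℂ ⊓ 𝓟 offContour) (𝓝 0) := by
    intro p hp
    have := ((tendsto_rpow_neg_atTop (y := -p) (by linarith)).comp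
      (tendsto_norm_cobounded_atTop (E := ℂ))).const_mul C
    simpa [Function.comp_def] using this.mono_left inf_le_left
  have hev : ∀ᶠ ζ in Bornology.cobounded ℂ ⊓ 𝓟 offContour,
      ζ ≠ 0 ∧ ζ.arg ≠ 0 ∧ 0 ≤ Real.log ‖ζ‖ := by
    have h1 : ∀ᶠ ζ in Bornology.cobounded ℂ ⊓ 𝓟 offContour, 1 ≤ ‖ζ‖ :=
      ((tendsto_norm_cobounded_atTop (E := ℂ)).eventually (eventually_ge_atTop 1)).filter_mono
        inf_le_left
    have h2 : ∀ᶠ ζ in Bornology.cobounded ℂ ⊓ 𝓟 offContour, ζ ∈ offContour :=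
      (eventually_principal.2 fun x hx => hx).filter_mono inf_le_right
    filter_upwards [h1, h2] with ζ h1 h2
    have hpi := Real.pi_pos
    refine ⟨by rintro rfl; norm_num at h1, ?_, Real.log_nonneg h1⟩
    rcases h2 with ((⟨_, h1, h2⟩ | ⟨_, h1, h2⟩) | ⟨_, h1, h2⟩) | ⟨_, h1, h2⟩ <;>
      intro h <;> rw [h] at h1 h2 <;> linarith
  refine tendsto_pi_nhds.2 fun i => tendsto_pi_nhds.2 fun j => ?_
  rw [← tendsto_sub_nhds_zero_iff]
  have hb : ∀ i j, ∃ p : ℝ, p < 0 ∧ ∀ᶠ ζ in Bornology.cobounded ℂ ⊓ 𝓟 offContour,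
      ‖(Sloc ζ * (StildeLoc ζ)⁻¹) i j - (1 : Mat) i j‖ ≤ C * ‖ζ‖ ^ p := by
    intro i j
    fin_cases i <;> fin_cases j
    · refine ⟨-(3 / 4), by norm_num, ?_⟩
      filter_upwards [hev] with ζ ⟨h1, h2, h3⟩
      obtain ⟨a, b, c, d, he, ha, hb, hc, hd⟩ := H ζ h1 h2 h3
      rw [← Matrix.sub_apply, he]; exact ha
    · refine ⟨-(1 / 4), by norm_num, ?_⟩
      filter_upwards [hev] with ζ ⟨h1, h2, h3⟩
      obtain ⟨a, b, c, d, he, ha, hb, hc, hd⟩ := H ζ h1 h2 h3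
      rw [← Matrix.sub_apply, he]; exact hb
    · refine ⟨-(5 / 4), by norm_num, ?_⟩
      filter_upwards [hev] with ζ ⟨h1, h2, h3⟩
      obtain ⟨a, b, c, d, he, ha, hb, hc, hd⟩ := H ζ h1 h2 h3
      rw [← Matrix.sub_apply, he]; exact hc
    · refine ⟨-(3 / 4), by norm_num, ?_⟩
      filter_upwards [hev] with ζ ⟨h1, h2, h3⟩
      obtain ⟨a, b, c, d, he, ha, hb, hc, hd⟩ := H ζ h1 h2 h3
      rw [← Matrix.sub_apply, he]; exact hd
  obtain ⟨p, hp, hb⟩ := hb i j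
  exact squeeze_zero_norm' hb (hpow p hp)

theorem isAiryModel_Sloc : IsAiryModel Sloc := by
  have hpi := Real.pi_pos
  -- Each extension uses the branch of (-ζ)^{3/2} continuous on its closed sector: ±iζ^{3/2} next to
  -- the positive ray, the principal power next to the negative one. The jumps are then algebraic
  -- identities between these formulas.
  refine ⟨analyticOn_Sloc, ⟨fun ζ => Tsector ζ * !![1, 1; 0, 1] * airyDiag (I * ζ ^ (3 / 2 : ℂ)),
    fun ζ => Tsector ζ * 1 * airyDiag ((-ζ) ^ (3 / 2 : ℂ)),
    fun ζ => Tsector ζ * !![1, 0; 1, 1] * airyDiag ((-ζ) ^ (3 / 2 : ℂ)),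
    fun ζ => Tsector ζ * !![1, -1; 1, 0] * airyDiag (-I * ζ ^ (3 / 2 : ℂ)),
    ⟨?_, ?_⟩, ⟨?_, ?_⟩, ⟨?_, ?_⟩, ⟨?_, ?_⟩, ?_, ?_, ?_, ?_⟩, Sloc_normalization⟩
  · rintro ζ ⟨h0, h1, h2⟩
    simp only [Sloc_eq, T_of_mem_upper h1.le h2, neg_cpow_three_halves_of_arg_pos h1]
  · refine continuousOn_sheet _ fun ζ hζ => (ContinuousAt.continuousWithinAt ?_)
    exact continuousAt_const.mul (continuousAt_cpow_three_halves
      (Or.inl (closure_sector_subset_re (by linarith) le_rfl hζ)))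
  · rintro ζ ⟨h0, h1, h2⟩
    simp only [Sloc_eq, T_of_le h1.le, mul_one]
  · refine continuousOn_sheet _ fun ζ hζ => (ContinuousAt.continuousWithinAt ?_)
    exact (continuousAt_cpow_three_halves (re_nonpos_of_upper
      (Or.inl (closure_sector_upper hζ)))).comp continuousAt_neg
  · rintro ζ ⟨h0, h1, h2⟩
    simp only [Sloc_eq, T_of_le_neg h2.le]
  · refine continuousOn_sheet _ fun ζ hζ => (ContinuousAt.continuousWithinAt ?_)
    exact (continuousAt_cpow_three_halves (re_nonpos_of_upper
      (Or.inr (closure_sector_lower hζ)))).comp continuousAt_neg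
  · rintro ζ ⟨h0, h1, h2⟩
    simp only [Sloc_eq, T_of_mem_lower h1 h2, neg_cpow_three_halves_of_arg_neg h2]
  · refine continuousOn_sheet _ fun ζ hζ => (ContinuousAt.continuousWithinAt ?_)
    exact continuousAt_const.mul (continuousAt_cpow_three_halves
      (Or.inl (closure_sector_subset_re le_rfl (by linarith) hζ)))
  · intro ζ h0 h
    have e : (!![1, -1; 1, 0] : Mat) = !![1, 1; 0, 1] * !![0, -1; 1, 0] := by
      ext i j; fin_cases i <;> fin_cases j <;> simp [Matrix.mul_apply, Fin.sum_univ_two]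
    simp only
    rw [e, neg_mul, ← mul_assoc (Tsector ζ), mul_assoc _ !![0, -1; 1, 0], airyDiag_rotate, ← mul_assoc]
  · intro ζ h
    have e : (!![1, 0; 1, 1] : Mat) = !![1, -1; 1, 0] * !![1, 1; 0, 1] := by
      ext i j; fin_cases i <;> fin_cases j <;> simp [Matrix.mul_apply, Fin.sum_univ_two]
    simp only
    rw [neg_cpow_three_halves_of_arg_neg (by linarith), e, ← mul_assoc (Tsector ζ),
      mul_assoc _ !![1, 1; 0, 1], airyDiag_mul_upper, ← mul_assoc, ← neg_mul]
  · intro ζ h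
    simp only
    rw [neg_cpow_three_halves_of_arg_pos (by linarith), mul_assoc (Tsector ζ), airyDiag_mul_upper,
      mul_one, ← mul_assoc]
  · intro ζ h
    simp only
    rw [mul_assoc (Tsector ζ), airyDiag_mul_lower, mul_one, ← mul_assoc]

/-- The Airy model grows at most like `|ζ|^{1/4}`. -/
lemma Sloc_bound : ∃ C : ℝ, 0 ≤ C ∧ ∀ ζ : ℂ, ζ ≠ 0 → ζ.arg ≠ 0 → ∀ i j,
    ‖Sloc ζ i j‖ ≤ C * (1 + ‖ζ‖) ^ (1 / 4 : ℝ) := by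
  obtain ⟨C₁, hC₁, H⟩ := Sloc_nearFrame 0
  -- For |ζ| ≤ 1 also |(-ζ)^{3/2}| ≤ 1. Treating the power as an independent variable X permits a
  -- compactness argument in spite of its discontinuity.
  have hK : ∃ C₂ : ℝ, ∀ ζ X : ℂ, ‖ζ‖ ≤ 1 → ‖X‖ ≤ 1 → ∀ M ∈ ({1, !![1, 1; 0, 1], !![1, -1; 1, 0],
      !![1, 0; 1, 1]} : Set Mat), ∀ i j, ‖(Tsector ζ * M * airyDiag X) i j‖ ≤ C₂ := by
    have hc : ∀ M : Mat, ∀ i j, ∃ C, ∀ ζ X : ℂ, ‖ζ‖ ≤ 1 → ‖X‖ ≤ 1 →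
        ‖(Tsector ζ * M * airyDiag X) i j‖ ≤ C := by
      intro M i j
      have h1 : Continuous fun p : ℂ × ℂ => (Tsector p.1 * M * airyDiag p.2) i j :=
        (((continuous_Tsector.comp continuous_fst).matrix_mul continuous_const).matrix_mul
          (continuous_airyDiag.comp continuous_snd)).matrix_elem i j
      obtain ⟨C, hC⟩ := ((isCompact_closedBall (0 : ℂ) 1).prod
        (isCompact_closedBall (0 : ℂ) 1)).exists_bound_of_continuousOn h1.continuousOn
      exact ⟨C, fun ζ X hζ hX => hC (ζ, X) ⟨by simpa using hζ, by simpa using hX⟩⟩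
    choose c hc using hc
    refine ⟨∑ i, ∑ j, (|c 1 i j| + |c !![1, 1; 0, 1] i j| + |c !![1, -1; 1, 0] i j| +
      |c !![1, 0; 1, 1] i j|), fun ζ X hζ hX M hM i j => ?_⟩
    refine (hc M i j ζ X hζ hX).trans ?_
    have h2 : |c 1 i j| + |c !![1, 1; 0, 1] i j| + |c !![1, -1; 1, 0] i j| +
      |c !![1, 0; 1, 1] i j| ≤ ∑ i, ∑ j, (|c 1 i j| + |c !![1, 1; 0, 1] i j| + |c !![1, -1; 1, 0] i j| +
      |c !![1, 0; 1, 1] i j|) :=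
      (Finset.single_le_sum (f := fun j => |c 1 i j| + |c !![1, 1; 0, 1] i j| +
        |c !![1, -1; 1, 0] i j| + |c !![1, 0; 1, 1] i j|) (fun j _ => by positivity)
        (Finset.mem_univ j)).trans
      (Finset.single_le_sum (f := fun i => ∑ j, (|c 1 i j| + |c !![1, 1; 0, 1] i j| +
        |c !![1, -1; 1, 0] i j| + |c !![1, 0; 1, 1] i j|)) (fun i _ => by positivity)
        (Finset.mem_univ i))
    refine le_trans ?_ h2
    have n1 := abs_nonneg (c 1 i j)
    have n2 := abs_nonneg (c !![1, 1; 0, 1] i j)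
    have n3 := abs_nonneg (c !![1, -1; 1, 0] i j)
    have n4 := abs_nonneg (c !![1, 0; 1, 1] i j)
    rcases hM with rfl | rfl | rfl | rfl
    · linarith [le_abs_self (c 1 i j)]
    · linarith [le_abs_self (c !![1, 1; 0, 1] i j)]
    · linarith [le_abs_self (c !![1, -1; 1, 0] i j)]
    · linarith [le_abs_self (c !![1, 0; 1, 1] i j)]
  obtain ⟨C₂, hC₂⟩ := hK
  have hC₂0 : 0 ≤ C₂ := (norm_nonneg _).trans
    (hC₂ 0 0 (by simp) (by simp) 1 (by simp) 0 0)
  refine ⟨C₂ + (1 + C₁), by positivity, fun ζ hζ harg i j => ?_⟩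
  have hn : 0 < ‖ζ‖ := norm_pos_iff.2 hζ
  have h1p : 1 ≤ (1 + ‖ζ‖) ^ (1 / 4 : ℝ) := Real.one_le_rpow (by linarith) (by norm_num)
  rcases le_or_gt ‖ζ‖ 1 with h | h
  · have hX : ‖(-ζ) ^ (3 / 2 : ℂ)‖ ≤ 1 := by
      rw [show (3 / 2 : ℂ) = ((3 / 2 : ℝ) : ℂ) by norm_num, norm_cpow_real, norm_neg]
      exact Real.rpow_le_one hn.le h (by norm_num)
    have : ‖Sloc ζ i j‖ ≤ C₂ := by
      rw [Sloc_eq]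
      rcases le_or_gt (Real.pi / 3) ζ.arg with a1 | a1
      · rw [T_of_le a1]
        have := hC₂ ζ _ h hX 1 (by simp) i j
        rwa [mul_one] at this
      rcases le_or_gt 0 ζ.arg with a2 | a2
      · rw [T_of_mem_upper a2 a1]; exact hC₂ ζ _ h hX _ (by simp) i j
      rcases lt_or_ge (-(Real.pi / 3)) ζ.arg with a3 | a3
      · rw [T_of_mem_lower a3 a2]; exact hC₂ ζ _ h hX _ (by simp) i j
      · rw [T_of_le_neg a3]; exact hC₂ ζ _ h hX _ (by simp) i j
    nlinarith
  · obtain ⟨a, b, c, d, ha, hb, hc, hd, hS⟩ := H ζ hζ harg (Real.log_nonneg h.le)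
    set l := log (-ζ) with hl
    have hlre : l.re = Real.log ‖ζ‖ := by rw [hl, log_re, norm_neg]
    have hl0 : 0 ≤ l.re := by rw [hlre]; exact Real.log_nonneg h.le
    have hη : C₁ * Real.exp (-(3 / 4) * Real.log ‖ζ‖) ≤ C₁ := by
      refine mul_le_of_le_one_right hC₁ (Real.exp_le_one_iff.2 ?_)
      rw [← hlre]; linarith
    have np : ‖exp (l / 4)‖ ≤ (1 + ‖ζ‖) ^ (1 / 4 : ℝ) := by
      rw [norm_exp, show (4 : ℂ) = ((4 : ℝ) : ℂ) by norm_num, div_ofReal_re, hlre,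
        show Real.log ‖ζ‖ / 4 = Real.log ‖ζ‖ * (1 / 4) by ring, ← Real.rpow_def_of_pos hn]
      gcongr; linarith
    have nm : ‖exp (-l / 4)‖ ≤ (1 + ‖ζ‖) ^ (1 / 4 : ℝ) := by
      refine le_trans ?_ h1p
      rw [norm_exp, show (4 : ℂ) = ((4 : ℝ) : ℂ) by norm_num, div_ofReal_re, neg_re]
      exact Real.exp_le_one_iff.2 (by linarith)
    have ns : ‖1 / (Real.sqrt 2 : ℂ)‖ ≤ 1 := by
      rw [norm_div, norm_one, norm_real, Real.norm_of_nonneg (Real.sqrt_nonneg _)]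
      rw [div_le_one (by positivity)]
      exact Real.one_le_sqrt.2 (by norm_num)
    have gen : ∀ E x : ℂ, ‖E‖ ≤ (1 + ‖ζ‖) ^ (1 / 4 : ℝ) →
        ‖x‖ ≤ C₁ * Real.exp (-(3 / 4) * Real.log ‖ζ‖) →
        ‖1 / (Real.sqrt 2 : ℂ) * E * (1 + x)‖ ≤ (C₂ + (1 + C₁)) * (1 + ‖ζ‖) ^ (1 / 4 : ℝ) := by
      intro E x hE hx
      have hx1 : ‖1 + x‖ ≤ 1 + C₁ := (norm_add_le _ _).trans (by rw [norm_one]; linarith)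
      rw [norm_mul, norm_mul]
      calc _ ≤ 1 * (1 + ‖ζ‖) ^ (1 / 4 : ℝ) * (1 + C₁) := by gcongr
        _ ≤ _ := by nlinarith
    rw [hS]
    fin_cases i <;> fin_cases j
    · exact gen _ _ np ha
    · exact gen _ _ np hb
    · exact (norm_neg _).trans_le (gen _ _ nm hc)
    · exact gen _ _ nm hd

/-! ### Abel kernels and arcsine integrals -/

/-- A nonnegative derivative of a function continuous up to the endpoints is automatically
integrable, so inverse square root singularities at the ends need no separate estimate. -/
lemma integral_Ioo_of_deriv_nonneg {f f' : ℝ → ℝ} {a b : ℝ} (hab : a ≤ b)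
    (hc : ContinuousOn f (Set.Icc a b)) (hd : ∀ x ∈ Set.Ioo a b, HasDerivAt f (f' x) x)
    (h0 : ∀ x ∈ Set.Ioo a b, 0 ≤ f' x) :
    IntegrableOn f' (Set.Ioo a b) ∧ ∫ x in Set.Ioo a b, f' x = f b - f a := by
  have hi : IntegrableOn f' (Set.Ioc a b) :=
    intervalIntegral.integrableOn_deriv_of_nonneg hc hd h0
  refine ⟨hi.mono_set Set.Ioo_subset_Ioc_self, ?_⟩
  rw [← integral_Ioc_eq_integral_Ioo, ← intervalIntegral.integral_of_le hab]
  exact intervalIntegral.integral_eq_sub_of_hasDerivAt_of_le hab hc hd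
    ((intervalIntegrable_iff_integrableOn_Ioc_of_le hab).2 hi)

/-- The primitive is needed in two forms: the arctangent is easy to differentiate, the arcsine stays
continuous where p vanishes. -/
lemma arcsin_eq_arctan_sqrt {m p q : ℝ} (hp : 0 < p) (hq : 0 < q) :
    Real.arcsin (m * Real.sqrt q / Real.sqrt (p + m ^ 2 * q)) =
      Real.arctan (m * Real.sqrt q / Real.sqrt p) := by
  have a1 := Real.sqrt_pos.2 hp
  have a3 : 0 < p + m ^ 2 * q := by positivity
  have a2 := Real.sqrt_pos.2 a3
  rw [Real.arctan_eq_arcsin, div_pow, mul_pow, Real.sq_sqrt hq.le, Real.sq_sqrt hp.le,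
    show 1 + m ^ 2 * q / p = (p + m ^ 2 * q) / p by rw [add_div, div_self hp.ne'],
    Real.sqrt_div a3.le, div_div_div_cancel_right₀ a1.ne']

lemma hasDerivAt_arcsine_primitive {v α m s : ℝ} (f1 : 0 < α ^ 2 - s ^ 2) (f2 : 0 < s ^ 2 - v ^ 2) :
    HasDerivAt (fun t => Real.arctan (m * Real.sqrt (t ^ 2 - v ^ 2) / Real.sqrt (α ^ 2 - t ^ 2)))
      (m * s * (α ^ 2 - v ^ 2) / (Real.sqrt (α ^ 2 - s ^ 2) *
        Real.sqrt (s ^ 2 - v ^ 2) * ((α ^ 2 - s ^ 2) + m ^ 2 * (s ^ 2 - v ^ 2)))) s := by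
  have q1 := Real.sqrt_pos.2 f1
  have q2 := Real.sqrt_pos.2 f2
  have d2 : HasDerivAt (fun t => Real.sqrt (t ^ 2 - v ^ 2)) (s / Real.sqrt (s ^ 2 - v ^ 2)) s := by
    refine (((hasDerivAt_pow 2 s).sub_const (v ^ 2)).sqrt f2.ne').congr_deriv ?_
    rw [Nat.cast_ofNat, pow_one, mul_div_mul_left _ _ two_ne_zero]
  have d1 : HasDerivAt (fun t => Real.sqrt (α ^ 2 - t ^ 2)) (-(s / Real.sqrt (α ^ 2 - s ^ 2))) s := by
    refine (((hasDerivAt_pow 2 s).const_sub (α ^ 2)).sqrt f1.ne').congr_deriv ?_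
    rw [Nat.cast_ofNat, pow_one, neg_div, mul_div_mul_left _ _ two_ne_zero]
  refine (((d2.const_mul m).div d1 q1.ne').arctan).congr_deriv ?_
  have hPQ : α ^ 2 - v ^ 2 = (α ^ 2 - s ^ 2) + (s ^ 2 - v ^ 2) := by ring
  simp only [Pi.div_apply]
  rw [hPQ]
  have hP2 := Real.sq_sqrt f1.le
  have hQ2 := Real.sq_sqrt f2.le
  generalize Real.sqrt (α ^ 2 - s ^ 2) = P at *
  generalize Real.sqrt (s ^ 2 - v ^ 2) = Q at *
  rw [← hP2, ← hQ2]
  clear f1 f2 d1 d2 hPQ hP2 hQ2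
  have h3 : 0 < P ^ 2 + m ^ 2 * Q ^ 2 := by positivity
  have h4 : 1 + (m * Q / P) ^ 2 = (P ^ 2 + m ^ 2 * Q ^ 2) / P ^ 2 := by
    rw [eq_div_iff (by positivity), div_pow]; field_simp
  rw [h4]
  field_simp
  ring

/-- The arcsine integral, with a parameter `m`. -/
lemma integral_arcsine {v α m : ℝ} (hv : 0 ≤ v) (hvα : v < α) (hm : 0 < m) :
    IntegrableOn (fun s => m * s * (α ^ 2 - v ^ 2) / (Real.sqrt (α ^ 2 - s ^ 2) *
        Real.sqrt (s ^ 2 - v ^ 2) * ((α ^ 2 - s ^ 2) + m ^ 2 * (s ^ 2 - v ^ 2)))) (Set.Ioo v α) ∧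
    ∫ s in Set.Ioo v α, m * s * (α ^ 2 - v ^ 2) / (Real.sqrt (α ^ 2 - s ^ 2) *
        Real.sqrt (s ^ 2 - v ^ 2) * ((α ^ 2 - s ^ 2) + m ^ 2 * (s ^ 2 - v ^ 2))) = Real.pi / 2 := by
  have hα : 0 < α := by linarith
  have hpos : ∀ s ∈ Set.Icc v α, 0 < (α ^ 2 - s ^ 2) + m ^ 2 * (s ^ 2 - v ^ 2) := by
    rintro s ⟨h1, h2⟩
    have e1 : 0 ≤ α ^ 2 - s ^ 2 := by nlinarith
    have e2 : 0 ≤ s ^ 2 - v ^ 2 := by nlinarith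
    rcases h1.eq_or_lt with h | h
    · subst h; nlinarith
    · have : 0 < s ^ 2 - v ^ 2 := by nlinarith
      positivity
  set Φ : ℝ → ℝ := fun s => Real.arcsin (m * Real.sqrt (s ^ 2 - v ^ 2) /
    Real.sqrt ((α ^ 2 - s ^ 2) + m ^ 2 * (s ^ 2 - v ^ 2))) with hΦ
  have hc : ContinuousOn Φ (Set.Icc v α) := by
    refine Real.continuous_arcsin.comp_continuousOn (ContinuousOn.div (by fun_prop) (by fun_prop) ?_)
    intro s hs; exact (Real.sqrt_pos.2 (hpos s hs)).ne'
  have hd : ∀ s ∈ Set.Ioo v α, HasDerivAt Φ (m * s * (α ^ 2 - v ^ 2) / (Real.sqrt (α ^ 2 - s ^ 2) *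
        Real.sqrt (s ^ 2 - v ^ 2) * ((α ^ 2 - s ^ 2) + m ^ 2 * (s ^ 2 - v ^ 2)))) s := by
    intro s hs
    have e1 : ∀ t ∈ Set.Ioo v α, 0 < α ^ 2 - t ^ 2 := fun t ht => by nlinarith [ht.1, ht.2]
    have e2 : ∀ t ∈ Set.Ioo v α, 0 < t ^ 2 - v ^ 2 := fun t ht => by nlinarith [ht.1, ht.2]
    refine (hasDerivAt_arcsine_primitive (m := m) (e1 s hs) (e2 s hs)).congr_of_eventuallyEq ?_
    filter_upwards [Ioo_mem_nhds hs.1 hs.2] with t ht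
    exact arcsin_eq_arctan_sqrt (e1 t ht) (e2 t ht)
  have h0 : ∀ s ∈ Set.Ioo v α, 0 ≤ m * s * (α ^ 2 - v ^ 2) / (Real.sqrt (α ^ 2 - s ^ 2) *
        Real.sqrt (s ^ 2 - v ^ 2) * ((α ^ 2 - s ^ 2) + m ^ 2 * (s ^ 2 - v ^ 2))) := by
    intro s hs
    have := hpos s ⟨hs.1.le, hs.2.le⟩
    have : 0 ≤ s := hv.trans hs.1.le
    have : 0 ≤ α ^ 2 - v ^ 2 := by nlinarith
    positivity
  obtain ⟨h1, h2⟩ := integral_Ioo_of_deriv_nonneg hvα.le hc hd h0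
  refine ⟨h1, h2.trans ?_⟩
  have hαv : 0 < α ^ 2 - v ^ 2 := by nlinarith
  have s1 : Real.sqrt (m ^ 2 * (α ^ 2 - v ^ 2)) = m * Real.sqrt (α ^ 2 - v ^ 2) := by
    rw [Real.sqrt_mul (sq_nonneg m), Real.sqrt_sq hm.le]
  have s2 : 0 < m * Real.sqrt (α ^ 2 - v ^ 2) := mul_pos hm (Real.sqrt_pos.2 hαv)
  simp only [hΦ, sub_self, zero_add, Real.sqrt_zero, mul_zero, zero_div, Real.arcsin_zero, sub_zero,
    s1, div_self s2.ne', Real.arcsin_one]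

/-- `1 / √(α² - s²)` for `s < α`, and `0` otherwise. -/
def abelKernel (α s : ℝ) : ℝ := (Real.sqrt (α ^ 2 - s ^ 2))⁻¹

lemma abelKernel_nonneg (α s : ℝ) : 0 ≤ abelKernel α s := by unfold abelKernel; positivity

lemma abelKernel_of_le {α s : ℝ} (hα : 0 ≤ α) (h : α ≤ s) : abelKernel α s = 0 := by
  rw [abelKernel, Real.sqrt_eq_zero_of_nonpos (by nlinarith), inv_zero]

lemma abelKernel_pos {α s : ℝ} (hs : 0 ≤ s) (h : s < α) : 0 < abelKernel α s :=
  inv_pos.2 (Real.sqrt_pos.2 (by nlinarith))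

lemma measurable_abelKernel : Measurable fun p : ℝ × ℝ => abelKernel p.1 p.2 := by
  unfold abelKernel; fun_prop

lemma abel_integral_eq {v α : ℝ} (hv : 0 ≤ v) (hvα : v < α) :
    IntegrableOn (fun s => s * abelKernel α s * abelKernel s v) (Set.Ioi 0) ∧
    ∫ s in Set.Ioi 0, s * abelKernel α s * abelKernel s v = Real.pi / 2 := by
  obtain ⟨h1, h2⟩ := integral_arcsine hv hvα one_pos
  have hαv : 0 < α ^ 2 - v ^ 2 := by nlinarith
  have he : Set.EqOn (fun s => 1 * s * (α ^ 2 - v ^ 2) / (Real.sqrt (α ^ 2 - s ^ 2) *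
        Real.sqrt (s ^ 2 - v ^ 2) * ((α ^ 2 - s ^ 2) + 1 ^ 2 * (s ^ 2 - v ^ 2))))
      (fun s => s * abelKernel α s * abelKernel s v) (Set.Ioo v α) := by
    intro s hs
    simp only [abelKernel]
    rw [show α ^ 2 - s ^ 2 + 1 ^ 2 * (s ^ 2 - v ^ 2) = α ^ 2 - v ^ 2 by ring]
    have q1 : 0 < Real.sqrt (α ^ 2 - s ^ 2) := Real.sqrt_pos.2 (by nlinarith [hs.1, hs.2])
    have q2 : 0 < Real.sqrt (s ^ 2 - v ^ 2) := Real.sqrt_pos.2 (by nlinarith [hs.1, hs.2])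
    field_simp
  have hz : ∀ s ∈ Set.Ioi (0 : ℝ) \ Set.Ioo v α, s * abelKernel α s * abelKernel s v = 0 := by
    rintro s ⟨hs0, hs⟩
    have hs0 : 0 < s := hs0
    rcases le_or_gt s v with h | h
    · rw [abelKernel_of_le hs0.le h, mul_zero]
    · have : α ≤ s := by by_contra hc; exact hs ⟨h, by linarith⟩
      rw [abelKernel_of_le (by linarith) this, mul_zero, zero_mul]
  have hsub : Set.Ioo v α ⊆ Set.Ioi 0 := fun s hs => lt_of_le_of_lt hv hs.1
  constructor
  · exact (h1.congr_fun he measurableSet_Ioo).of_forall_sdiff_eq_zero measurableSet_Ioi hz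
  · rw [setIntegral_eq_of_subset_of_forall_sdiff_eq_zero measurableSet_Ioi hsub hz, ← h2]
    exact setIntegral_congr_fun measurableSet_Ioo fun s hs => (he hs).symm

/-- The arcsine integral with a Cauchy factor. -/
lemma abel_cauchy_integral_eq {y a α : ℝ} (hy : 0 ≤ y) (hya : y < a) (haα : a < α) :
    IntegrableOn (fun s => s * abelKernel α s * (abelKernel s a / (s ^ 2 - y ^ 2))) (Set.Ioi 0) ∧
    ∫ s in Set.Ioi 0, s * abelKernel α s * (abelKernel s a / (s ^ 2 - y ^ 2)) =
      Real.pi / 2 * (abelKernel a y * abelKernel α y) := by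
  have ha : 0 < a := by linarith
  have g1 : 0 < a ^ 2 - y ^ 2 := by nlinarith
  have g2 : 0 < α ^ 2 - y ^ 2 := by nlinarith
  have g3 : 0 < α ^ 2 - a ^ 2 := by nlinarith
  set P := Real.sqrt (a ^ 2 - y ^ 2) with hP
  set Q := Real.sqrt (α ^ 2 - y ^ 2) with hQ
  have hP0 : 0 < P := Real.sqrt_pos.2 g1
  have hQ0 : 0 < Q := Real.sqrt_pos.2 g2
  have hP2 : P ^ 2 = a ^ 2 - y ^ 2 := Real.sq_sqrt g1.le
  have hQ2 : Q ^ 2 = α ^ 2 - y ^ 2 := Real.sq_sqrt g2.le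
  -- The choice m = Q/P makes the last denominator factor as (α² - a²)(s² - y²)/P², which produces
  -- the Cauchy factor.
  obtain ⟨h1, h2⟩ := integral_arcsine ha.le haα (div_pos hQ0 hP0)
  have he : Set.EqOn (fun s => (P * Q)⁻¹ * (Q / P * s * (α ^ 2 - a ^ 2) / (Real.sqrt (α ^ 2 - s ^ 2) *
        Real.sqrt (s ^ 2 - a ^ 2) * ((α ^ 2 - s ^ 2) + (Q / P) ^ 2 * (s ^ 2 - a ^ 2)))))
      (fun s => s * abelKernel α s * (abelKernel s a / (s ^ 2 - y ^ 2))) (Set.Ioo a α) := by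
    intro s hs
    simp only [abelKernel]
    have q1 : 0 < Real.sqrt (α ^ 2 - s ^ 2) := Real.sqrt_pos.2 (by nlinarith [hs.1, hs.2])
    have q2 : 0 < Real.sqrt (s ^ 2 - a ^ 2) := Real.sqrt_pos.2 (by nlinarith [hs.1, hs.2])
    have q3 : 0 < s ^ 2 - y ^ 2 := by nlinarith [hs.1, hs.2]
    have e : (α ^ 2 - s ^ 2) + (Q / P) ^ 2 * (s ^ 2 - a ^ 2) =
        (α ^ 2 - a ^ 2) * (s ^ 2 - y ^ 2) / P ^ 2 := by
      rw [div_pow, eq_div_iff (by positivity), add_mul, hP2, hQ2]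
      field_simp
      ring
    rw [e]
    field_simp
  have hz : ∀ s ∈ Set.Ioi (0 : ℝ) \ Set.Ioo a α,
      s * abelKernel α s * (abelKernel s a / (s ^ 2 - y ^ 2)) = 0 := by
    rintro s ⟨hs0, hs⟩
    have hs0 : 0 < s := hs0
    rcases le_or_gt s a with h | h
    · rw [abelKernel_of_le hs0.le h, zero_div, mul_zero]
    · have : α ≤ s := by by_contra hc; exact hs ⟨h, by linarith⟩
      rw [abelKernel_of_le (by linarith) this, mul_zero, zero_mul]
  have hsub : Set.Ioo a α ⊆ Set.Ioi 0 := fun s hs => ha.trans hs.1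
  constructor
  · exact (IntegrableOn.congr_fun (h1.const_mul (P * Q)⁻¹) he measurableSet_Ioo).of_forall_sdiff_eq_zero
      measurableSet_Ioi hz
  · rw [setIntegral_eq_of_subset_of_forall_sdiff_eq_zero measurableSet_Ioi hsub hz,
      ← setIntegral_congr_fun measurableSet_Ioo he, integral_const_mul, h2]
    simp only [abelKernel, ← hP, ← hQ]
    field_simp

lemma abel_cauchy_integral_of_le {y a α : ℝ} (hα : 0 ≤ α) (h : α ≤ a) (s : ℝ) (hs : 0 < s) :
    s * abelKernel α s * (abelKernel s a / (s ^ 2 - y ^ 2)) = 0 := by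
  rcases le_or_gt s a with h' | h'
  · rw [abelKernel_of_le hs.le h', zero_div, mul_zero]
  · rw [abelKernel_of_le hα (by linarith), mul_zero, zero_mul]

/-- `∫₀^α s / √(α² - s²) ds = α`. -/
lemma integral_id_mul_abelKernel {y α : ℝ} (hα : 0 ≤ α) (hy : 0 ≤ y) :
    IntegrableOn (fun v => v * abelKernel y v) (Set.Ioo 0 α) ∧
    ∫ v in Set.Ioo 0 α, v * abelKernel y v = y - Real.sqrt (y ^ 2 - α ^ 2) := by
  obtain ⟨h1, h2⟩ := integral_Ioo_of_deriv_nonneg (f := fun v => -Real.sqrt (y ^ 2 - v ^ 2))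
    (f' := fun v => v * abelKernel y v) (a := 0) (b := min y α) (le_min hy hα) (by fun_prop)
    (fun v hv => by
      have hv2 : v < y := hv.2.trans_le (min_le_left _ _)
      have f1 : 0 < y ^ 2 - v ^ 2 := by nlinarith [hv.1]
      have := (((hasDerivAt_pow 2 v).const_sub (y ^ 2)).sqrt f1.ne').neg
      refine this.congr_deriv ?_
      simp only [abelKernel]
      have := Real.sqrt_pos.2 f1
      norm_num; field_simp)
    (fun v hv => mul_nonneg hv.1.le (abelKernel_nonneg _ _))
  have hz : ∀ v ∈ Set.Ioo 0 α \ Set.Ioo 0 (min y α), v * abelKernel y v = 0 := by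
    rintro v ⟨hv, hv'⟩
    have : y ≤ v := by
      by_contra hc; exact hv' ⟨hv.1, lt_min (by linarith) hv.2⟩
    rw [abelKernel_of_le hy this, mul_zero]
  have hsub : Set.Ioo 0 (min y α) ⊆ Set.Ioo 0 α := Set.Ioo_subset_Ioo_right (min_le_right _ _)
  constructor
  · exact h1.of_forall_sdiff_eq_zero measurableSet_Ioo hz
  · rw [setIntegral_eq_of_subset_of_forall_sdiff_eq_zero measurableSet_Ioo hsub hz, h2]
    rw [zero_pow (by norm_num), sub_zero, Real.sqrt_sq hy]
    rcases le_total y α with h | h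
    · rw [min_eq_left h, sub_self, Real.sqrt_zero, Real.sqrt_eq_zero_of_nonpos (by nlinarith)]; ring
    · rw [min_eq_right h]; ring

lemma hasDerivAt_sqrt_sq_sub {s v : ℝ} (h : 0 < s ^ 2 - v ^ 2) :
    HasDerivAt (fun t => Real.sqrt (s ^ 2 - t ^ 2)) (-(v * abelKernel s v)) v := by
  refine (((hasDerivAt_pow 2 v).const_sub (s ^ 2)).sqrt h.ne').congr_deriv ?_
  rw [Nat.cast_ofNat, pow_one, neg_div, mul_div_mul_left _ _ two_ne_zero, abelKernel, div_eq_mul_inv]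

/-- The primitive is -log(√(s² - v²) + √(y² - v²)); since s < y its argument stays positive up to v
= s. -/
lemma log_kernel_of_lt {s y : ℝ} (hs : 0 < s) (hsy : s < y) :
    IntegrableOn (fun v => v * abelKernel y v * abelKernel s v) (Set.Ioi 0) ∧
    ∫ v in Set.Ioi 0, v * abelKernel y v * abelKernel s v =
      (Real.log (y + s) - Real.log (y - s)) / 2 := by
  have hy : 0 < y := hs.trans hsy
  obtain ⟨h1, h2⟩ := integral_Ioo_of_deriv_nonneg (a := 0) (b := s)
    (f := fun v => -Real.log (Real.sqrt (s ^ 2 - v ^ 2) + Real.sqrt (y ^ 2 - v ^ 2)))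
    (f' := fun v => v * abelKernel y v * abelKernel s v) hs.le
    (by
      refine ContinuousOn.neg (ContinuousOn.log (by fun_prop) fun v hv => ?_)
      have : 0 < Real.sqrt (y ^ 2 - v ^ 2) := Real.sqrt_pos.2 (by nlinarith [hv.1, hv.2])
      positivity)
    (fun v hv => by
      have f1 : 0 < s ^ 2 - v ^ 2 := by nlinarith [hv.1, hv.2]
      have f2 : 0 < y ^ 2 - v ^ 2 := by nlinarith [hv.1, hv.2]
      have q1 := Real.sqrt_pos.2 f1
      have q2 := Real.sqrt_pos.2 f2
      refine (((hasDerivAt_sqrt_sq_sub f1).add (hasDerivAt_sqrt_sq_sub f2)).log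
        (add_pos q1 q2).ne').neg.congr_deriv ?_
      simp only [abelKernel, Pi.add_apply]
      field_simp
      ring)
    (fun v hv => mul_nonneg (mul_nonneg hv.1.le (abelKernel_nonneg _ _)) (abelKernel_nonneg _ _))
  have hz : ∀ v ∈ Set.Ioi (0 : ℝ) \ Set.Ioo 0 s, v * abelKernel y v * abelKernel s v = 0 := by
    rintro v ⟨hv, hv'⟩
    have : s ≤ v := by by_contra hc; exact hv' ⟨hv, by linarith⟩
    rw [abelKernel_of_le hs.le this, mul_zero]
  refine ⟨h1.of_forall_sdiff_eq_zero measurableSet_Ioi hz, ?_⟩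
  rw [setIntegral_eq_of_subset_of_forall_sdiff_eq_zero measurableSet_Ioi
    Set.Ioo_subset_Ioi_self hz, h2]
  have e1 : y ^ 2 - s ^ 2 = (y - s) * (y + s) := by ring
  rw [sub_self, Real.sqrt_zero, zero_add, zero_pow two_ne_zero, sub_zero, sub_zero, Real.sqrt_sq hs.le,
    Real.sqrt_sq hy.le, Real.log_sqrt (by nlinarith), e1, Real.log_mul (by linarith) (by linarith),
    add_comm s y]
  ring

/-- The logarithmic kernel as a superposition of Abel kernels. -/
lemma log_kernel {s y : ℝ} (hs : 0 < s) (hy : 0 < y) (hne : s ≠ y) :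
    ∫ v in Set.Ioi 0, v * abelKernel y v * abelKernel s v =
      (Real.log (y + s) - Real.log (y - s)) / 2 := by
  rcases lt_or_gt_of_ne hne with h | h
  · exact (log_kernel_of_lt hs h).2
  -- The real logarithm ignores signs, which makes the formula symmetric in s and y.
  · rw [show y - s = -(s - y) by ring, Real.log_neg_eq_log, add_comm y s,
      ← (log_kernel_of_lt hy h).2]
    refine setIntegral_congr_fun measurableSet_Ioi fun v _ => ?_
    ring

/-! ### The complex logarithmic kernel and Abel inversion -/

/-- The square root of `w² - v²` in the upper half plane which is asymptotic to `w`. -/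
def upperRoot (w : ℂ) (v : ℝ) : ℂ := exp ((log (w - v) + log (w + v)) / 2)

lemma sub_ofReal_mem_slitPlane {w : ℂ} (hw : 0 < w.im) (v : ℝ) : w - v ∈ slitPlane := by
  rw [mem_slitPlane_iff]; right; simp [hw.ne']

lemma add_ofReal_mem_slitPlane {w : ℂ} (hw : 0 < w.im) (v : ℝ) : w + v ∈ slitPlane := by
  rw [mem_slitPlane_iff]; right; simp [hw.ne']

lemma log_im_mem {w : ℂ} (hw : 0 < w.im) : 0 < (log w).im ∧ (log w).im < Real.pi := by
  rw [log_im]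
  refine ⟨lt_of_le_of_ne (arg_nonneg_iff.2 hw.le) fun h => ?_, lt_of_le_of_ne (arg_le_pi _) fun h => ?_⟩
  · exact hw.ne' (arg_eq_zero_iff.1 h.symm).2
  · exact hw.ne' (arg_eq_pi_iff.1 h).2

lemma upperRoot_exponent_im {w : ℂ} (hw : 0 < w.im) (v : ℝ) :
    0 < ((log (w - v) + log (w + v)) / 2).im ∧ ((log (w - v) + log (w + v)) / 2).im < Real.pi := by
  obtain ⟨a, b⟩ := log_im_mem (w := w - v) (by simpa using hw)
  obtain ⟨c, d⟩ := log_im_mem (w := w + v) (by simpa using hw)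
  rw [show (2 : ℂ) = ((2 : ℝ) : ℂ) by norm_num, div_ofReal_im, add_im]
  constructor <;> linarith

lemma upperRoot_im_pos {w : ℂ} (hw : 0 < w.im) (v : ℝ) : 0 < (upperRoot w v).im := by
  obtain ⟨a, b⟩ := upperRoot_exponent_im hw v
  rw [upperRoot, exp_im]
  exact mul_pos (Real.exp_pos _) (Real.sin_pos_of_pos_of_lt_pi a b)

lemma upperRoot_ne_zero (w : ℂ) (v : ℝ) : upperRoot w v ≠ 0 := exp_ne_zero _

lemma upperRoot_sq {w : ℂ} (hw : 0 < w.im) (v : ℝ) : upperRoot w v ^ 2 = w ^ 2 - v ^ 2 := by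
  rw [upperRoot, ← exp_nat_mul, show ((2 : ℕ) : ℂ) * ((log (w - v) + log (w + v)) / 2) =
    log (w - v) + log (w + v) by push_cast; ring, exp_add,
    exp_log (slitPlane_ne_zero (sub_ofReal_mem_slitPlane hw v)),
    exp_log (slitPlane_ne_zero (add_ofReal_mem_slitPlane hw v))]
  ring

lemma upperRoot_zero {w : ℂ} (hw : 0 < w.im) : upperRoot w 0 = w := by
  rw [upperRoot, ofReal_zero, sub_zero, add_zero, add_self_div_two, exp_log]
  rintro rfl; simp at hw

lemma hasDerivAt_upperRoot {w : ℂ} (hw : 0 < w.im) (v : ℝ) :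
    HasDerivAt (fun v : ℝ => upperRoot w v) (-(v / upperRoot w v)) v := by
  have h1 : HasDerivAt (fun v : ℝ => w - (v : ℂ)) (-1) v := by
    simpa using (hasDerivAt_id v).ofReal_comp.const_sub w
  have h2 : HasDerivAt (fun v : ℝ => w + (v : ℂ)) 1 v := by
    simpa using (hasDerivAt_id v).ofReal_comp.const_add w
  have s1 := sub_ofReal_mem_slitPlane hw v
  have s2 := add_ofReal_mem_slitPlane hw v
  refine (((h1.clog_real s1).add (h2.clog_real s2)).div_const 2).cexp.congr_deriv ?_
  change upperRoot w v * _ = _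
  have := slitPlane_ne_zero s1
  have := slitPlane_ne_zero s2
  have h0 := upperRoot_ne_zero w v
  have hsq := upperRoot_sq hw v
  rw [eq_neg_iff_add_eq_zero]
  field_simp
  rw [hsq]
  ring

lemma continuous_upperRoot {w : ℂ} (hw : 0 < w.im) : Continuous fun v : ℝ => upperRoot w v :=
  continuous_iff_continuousAt.2 fun v => (hasDerivAt_upperRoot hw v).continuousAt

lemma integral_div_upperRoot {w : ℂ} (hw : 0 < w.im) {α : ℝ} (hα : 0 ≤ α) :
    IntegrableOn (fun v : ℝ => (v : ℂ) * (upperRoot w v)⁻¹) (Set.Ioo 0 α) ∧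
    ∫ v in Set.Ioo 0 α, (v : ℂ) * (upperRoot w v)⁻¹ = w - upperRoot w α := by
  have hc : Continuous fun v : ℝ => (v : ℂ) * (upperRoot w v)⁻¹ :=
    continuous_ofReal.mul ((continuous_upperRoot hw).inv₀ fun v => upperRoot_ne_zero w v)
  refine ⟨hc.integrableOn_Icc.mono_set Set.Ioo_subset_Icc_self, ?_⟩
  rw [← integral_Ioc_eq_integral_Ioo, ← intervalIntegral.integral_of_le hα]
  rw [intervalIntegral.integral_eq_sub_of_hasDerivAt (f := fun v => -upperRoot w v)
    (fun v _ => (hasDerivAt_upperRoot hw v).neg.congr_deriv (by rw [neg_neg, div_eq_mul_inv]))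
    (hc.intervalIntegrable _ _), upperRoot_zero hw]
  ring

/-- The complex logarithmic kernel as a superposition of Abel kernels. -/
lemma log_kernel_complex {w : ℂ} (hw : 0 < w.im) {s : ℝ} (hs : 0 < s) :
    ∫ v in Set.Ioi (0 : ℝ), (v : ℂ) * (upperRoot w v)⁻¹ * abelKernel s v =
      (log (w + s) - log (w - s)) / 2 := by
  have hz : ∀ v ∈ Set.Ioi (0 : ℝ) \ Set.Ioo 0 s,
      (v : ℂ) * (upperRoot w v)⁻¹ * abelKernel s v = 0 := by
    rintro v ⟨hv, hv'⟩
    have : s ≤ v := by by_contra hc; exact hv' ⟨hv, by linarith⟩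
    rw [abelKernel_of_le hs.le this, ofReal_zero, mul_zero]
  rw [setIntegral_eq_of_subset_of_forall_sdiff_eq_zero measurableSet_Ioi
    Set.Ioo_subset_Ioi_self hz, ← integral_Ioc_eq_integral_Ioo, ← intervalIntegral.integral_of_le hs.le]
  -- The same primitive as in the real case. Its argument has positive imaginary part, so the
  -- principal logarithm is smooth along it; the singularity of the kernel at v = s is integrable by
  -- comparison with the real Abel kernel.
  set f : ℝ → ℂ := fun v => -log (Real.sqrt (s ^ 2 - v ^ 2) + upperRoot w v) with hf
  have hcr := continuous_upperRoot hw
  have hslit : ∀ v : ℝ, (Real.sqrt (s ^ 2 - v ^ 2) : ℂ) + upperRoot w v ∈ slitPlane := by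
    intro v
    rw [mem_slitPlane_iff]; right
    rw [add_im, ofReal_im, zero_add]; exact (upperRoot_im_pos hw v).ne'
  have hc : ContinuousOn f (Set.Icc 0 s) := by
    refine ContinuousOn.neg (ContinuousOn.clog ?_ fun v _ => hslit v)
    exact ((continuous_ofReal.comp (by fun_prop)).add hcr).continuousOn
  have hd : ∀ v ∈ Set.Ioo 0 s, HasDerivAt f ((v : ℂ) * (upperRoot w v)⁻¹ * abelKernel s v) v := by
    intro v hv
    have f1 : 0 < s ^ 2 - v ^ 2 := by nlinarith [hv.1, hv.2]
    have q1 := Real.sqrt_pos.2 f1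
    refine (((hasDerivAt_sqrt_sq_sub f1).ofReal_comp.add
      (hasDerivAt_upperRoot hw v)).clog_real (hslit v)).neg.congr_deriv ?_
    have h0 := upperRoot_ne_zero w v
    have h1 := slitPlane_ne_zero (hslit v)
    have h2 : ((Real.sqrt (s ^ 2 - v ^ 2) : ℝ) : ℂ) ≠ 0 := by exact_mod_cast q1.ne'
    simp only [abelKernel, Pi.add_apply]
    push_cast
    field_simp
    ring
  have hi : IntervalIntegrable (fun v : ℝ => (v : ℂ) * (upperRoot w v)⁻¹ * abelKernel s v) volume 0 s := by
    rw [intervalIntegrable_iff_integrableOn_Ioo_of_le hs.le]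
    have h1 := (integral_id_mul_abelKernel hs.le hs.le).1
    have hb : ContinuousOn (fun v : ℝ => (upperRoot w v)⁻¹) (Set.Icc 0 s) :=
      (hcr.inv₀ fun v => upperRoot_ne_zero w v).continuousOn
    obtain ⟨C, hC⟩ := isCompact_Icc.exists_bound_of_continuousOn hb
    have h2 : IntegrableOn (fun v : ℝ => ((v * abelKernel s v : ℝ) : ℂ)) (Set.Ioo 0 s) := h1.ofReal
    have h3 := h2.mul_bdd (c := C) (g := fun v : ℝ => (upperRoot w v)⁻¹) (hcr.inv₀ fun v => upperRoot_ne_zero w v).aestronglyMeasurable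
      (by filter_upwards [self_mem_ae_restrict measurableSet_Ioo] with v hv
          exact hC v ⟨hv.1.le, hv.2.le⟩)
    refine h3.congr (Eventually.of_forall fun v => ?_)
    simp only; push_cast; ring
  rw [intervalIntegral.integral_eq_sub_of_hasDerivAt_of_le hs.le hc hd hi]
  obtain ⟨i1, i2⟩ := upperRoot_exponent_im hw s
  have hlog : log (upperRoot w s) = (log (w - s) + log (w + s)) / 2 := by
    rw [upperRoot, log_exp (by linarith [Real.pi_pos]) i2.le]
  simp only [hf, sub_self, Real.sqrt_zero, ofReal_zero, zero_add, zero_pow two_ne_zero, sub_zero,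
    Real.sqrt_sq hs.le, upperRoot_zero hw, hlog, add_comm (s : ℂ) w]
  ring

/-- Inverting the Abel kernel. -/
lemma abel_inversion {c : ℝ → ℂ} (hc : Measurable c) {α : ℝ} (hα : 0 < α)
    (hi : IntegrableOn (fun v : ℝ => (v : ℂ) * c v) (Set.Ioo 0 α)) :
    IntegrableOn (fun s : ℝ => ((s * abelKernel α s : ℝ) : ℂ) *
      ∫ v in Set.Ioi (0 : ℝ), (v : ℂ) * c v * abelKernel s v) (Set.Ioi 0) ∧
    ∫ s in Set.Ioi (0 : ℝ), ‖((s * abelKernel α s : ℝ) : ℂ) *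
      ∫ v in Set.Ioi (0 : ℝ), (v : ℂ) * c v * abelKernel s v‖ ≤
      Real.pi / 2 * ∫ v in Set.Ioo 0 α, ‖(v : ℂ) * c v‖ ∧
    ∫ s in Set.Ioi (0 : ℝ), ((s * abelKernel α s : ℝ) : ℂ) *
      ∫ v in Set.Ioi (0 : ℝ), (v : ℂ) * c v * abelKernel s v =
      Real.pi / 2 * ∫ v in Set.Ioo 0 α, (v : ℂ) * c v := by
  set μ := volume.restrict (Set.Ioi (0 : ℝ)) with hμ
  -- Fubini: integrating the product of the two Abel kernels over s gives π/2 for v < α and 0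
  -- otherwise, so the two transforms compose to integration over (0, α).
  set F : ℝ → ℝ → ℂ := fun s v => ((s * abelKernel α s * abelKernel s v : ℝ) : ℂ) * (v * c v) with hF
  have hm : Measurable (Function.uncurry F) := by
    have h1 : Measurable fun p : ℝ × ℝ => abelKernel α p.1 :=
      measurable_abelKernel.comp (measurable_const.prodMk measurable_fst)
    have h2 : Measurable fun p : ℝ × ℝ => p.1 * abelKernel α p.1 * abelKernel p.1 p.2 :=
      (measurable_fst.mul h1).mul measurable_abelKernel
    exact (measurable_ofReal.comp h2).mul
      ((measurable_ofReal.comp measurable_snd).mul (hc.comp measurable_snd))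
  have sec : ∀ v ∈ Set.Ioi (0 : ℝ), IntegrableOn (fun s => s * abelKernel α s * abelKernel s v) (Set.Ioi 0) ∧
      ∫ s in Set.Ioi 0, s * abelKernel α s * abelKernel s v =
        Set.indicator (Set.Ioo 0 α) (fun _ => Real.pi / 2) v := by
    intro v hv
    rcases lt_or_ge v α with h | h
    · rw [Set.indicator_of_mem (show v ∈ Set.Ioo 0 α from ⟨hv, h⟩)]
      exact abel_integral_eq (le_of_lt hv) h
    · rw [Set.indicator_of_notMem (fun h' => absurd h'.2 (not_lt.2 h))]
      have hz : ∀ s ∈ Set.Ioi (0 : ℝ), s * abelKernel α s * abelKernel s v = 0 := by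
        intro s hs
        rcases le_or_gt s v with h' | h'
        · rw [abelKernel_of_le (le_of_lt hs) h', mul_zero]
        · rw [abelKernel_of_le hα.le (by linarith), mul_zero, zero_mul]
      exact ⟨integrableOn_zero.congr_fun (fun s hs => (hz s hs).symm) measurableSet_Ioi,
        setIntegral_eq_zero_of_forall_eq_zero hz⟩
  have norm_sec : ∀ v ∈ Set.Ioi (0 : ℝ), ∫ s, ‖F s v‖ ∂μ =
      Real.pi / 2 * Set.indicator (Set.Ioo 0 α) (fun v : ℝ => ‖(v : ℂ) * c v‖) v := by
    intro v hv
    have : ∀ s ∈ Set.Ioi (0 : ℝ), ‖F s v‖ = s * abelKernel α s * abelKernel s v * ‖(v : ℂ) * c v‖ := by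
      intro s hs
      have h0 : 0 ≤ s * abelKernel α s * abelKernel s v :=
        mul_nonneg (mul_nonneg (le_of_lt hs) (abelKernel_nonneg _ _)) (abelKernel_nonneg _ _)
      simp only [hF]
      rw [Complex.norm_mul, Complex.norm_real, Real.norm_of_nonneg h0]
    rw [hμ, setIntegral_congr_fun measurableSet_Ioi this, integral_mul_const, (sec v hv).2]
    by_cases h : v ∈ Set.Ioo 0 α
    · rw [Set.indicator_of_mem h, Set.indicator_of_mem h]
    · rw [Set.indicator_of_notMem h, Set.indicator_of_notMem h, zero_mul, mul_zero]
  have hsub : Set.Ioo 0 α ⊆ Set.Ioi (0 : ℝ) := Set.Ioo_subset_Ioi_self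
  have hInt : Integrable (Function.uncurry F) (μ.prod μ) := by
    rw [integrable_prod_iff' hm.aestronglyMeasurable]
    constructor
    · rw [hμ]
      filter_upwards [self_mem_ae_restrict measurableSet_Ioi] with v hv
      have h1 : IntegrableOn (fun s => ((s * abelKernel α s * abelKernel s v : ℝ) : ℂ)) (Set.Ioi 0) :=
        (sec v hv).1.ofReal
      exact h1.mul_const ((v : ℂ) * c v)
    · have h1 : IntegrableOn (fun v : ℝ => Real.pi / 2 *
          Set.indicator (Set.Ioo 0 α) (fun v : ℝ => ‖(v : ℂ) * c v‖) v) (Set.Ioi 0) := by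
        refine Integrable.const_mul ?_ _
        exact ((integrable_indicator_iff measurableSet_Ioo).2 hi.norm).integrableOn
      exact h1.congr_fun (fun v hv => (norm_sec v hv).symm) measurableSet_Ioi
  have hinner : ∀ s, ∫ v, F s v ∂μ = ((s * abelKernel α s : ℝ) : ℂ) *
      ∫ v in Set.Ioi (0 : ℝ), (v : ℂ) * c v * abelKernel s v := by
    intro s
    rw [← integral_const_mul]
    refine integral_congr_ae (Eventually.of_forall fun v => ?_)
    simp only [hF]; push_cast; ring
  refine ⟨?_, ?_, ?_⟩
  · have := hInt.integral_prod_left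
    exact this.congr (Eventually.of_forall fun s => hinner s)
  · have h1 : ∫ s, ‖∫ v, F s v ∂μ‖ ∂μ ≤ ∫ s, ∫ v, ‖F s v‖ ∂μ ∂μ :=
      integral_mono_of_nonneg (Eventually.of_forall fun s => norm_nonneg _)
        hInt.norm.integral_prod_left (Eventually.of_forall fun s => norm_integral_le_integral_norm _)
    simp only [hinner] at h1
    refine h1.trans_eq ?_
    rw [integral_integral_swap (f := fun s v => ‖F s v‖) hInt.norm]
    rw [hμ, setIntegral_congr_fun measurableSet_Ioi norm_sec, integral_const_mul,
      setIntegral_indicator measurableSet_Ioo, Set.inter_eq_self_of_subset_right hsub]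
  · rw [← integral_congr_ae (Eventually.of_forall hinner), integral_integral_swap hInt]
    have : ∀ v ∈ Set.Ioi (0 : ℝ), ∫ s, F s v ∂μ =
        Set.indicator (Set.Ioo 0 α) (fun v : ℝ => Real.pi / 2 * ((v : ℂ) * c v)) v := by
      intro v hv
      simp only [hF]
      rw [integral_mul_const, integral_complex_ofReal, hμ, (sec v hv).2]
      by_cases h : v ∈ Set.Ioo 0 α
      · rw [Set.indicator_of_mem h, Set.indicator_of_mem h]; push_cast; rfl
      · rw [Set.indicator_of_notMem h, Set.indicator_of_notMem h, ofReal_zero, zero_mul]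
    rw [hμ, setIntegral_congr_fun measurableSet_Ioi this, setIntegral_indicator measurableSet_Ioo,
      Set.inter_eq_self_of_subset_right hsub, integral_const_mul]

lemma sub_sqrt_le {y α : ℝ} (hα : 0 ≤ α) : y - Real.sqrt (y ^ 2 - α ^ 2) ≤ α := by
  rcases le_or_gt y α with h | h
  · linarith [Real.sqrt_nonneg (y ^ 2 - α ^ 2)]
  · have : y - α ≤ Real.sqrt (y ^ 2 - α ^ 2) := Real.le_sqrt_of_sq_le (by nlinarith)
    linarith

/-- The Abel transform of the logarithmic kernel. -/
lemma abel_log_kernel {y α : ℝ} (hy : 0 < y) (hα : 0 < α) :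
    IntegrableOn (fun s : ℝ => ((s * abelKernel α s : ℝ) : ℂ) *
      ((Real.log (y + s) - Real.log (y - s) : ℝ) : ℂ)) (Set.Ioi 0) ∧
    ∫ s in Set.Ioi (0 : ℝ), ‖((s * abelKernel α s : ℝ) : ℂ) *
      ((Real.log (y + s) - Real.log (y - s) : ℝ) : ℂ)‖ ≤ Real.pi * α ∧
    ∫ s in Set.Ioi (0 : ℝ), ((s * abelKernel α s : ℝ) : ℂ) *
      ((Real.log (y + s) - Real.log (y - s) : ℝ) : ℂ) =
      Real.pi * ((y - Real.sqrt (y ^ 2 - α ^ 2) : ℝ) : ℂ) := by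
  obtain ⟨j1, j2⟩ := integral_id_mul_abelKernel hα.le hy.le
  have hc : Measurable fun v : ℝ => ((abelKernel y v : ℝ) : ℂ) :=
    measurable_ofReal.comp (measurable_abelKernel.comp (measurable_const.prodMk measurable_id))
  have j1' : IntegrableOn (fun v : ℝ => (v : ℂ) * (abelKernel y v : ℂ)) (Set.Ioo 0 α) := by
    have : IntegrableOn (fun v : ℝ => ((v * abelKernel y v : ℝ) : ℂ)) (Set.Ioo 0 α) := j1.ofReal
    exact this.congr (Eventually.of_forall fun v => by push_cast; rfl)
  obtain ⟨h1, h2, h3⟩ := abel_inversion hc hα j1'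
  -- The logarithmic kernel is twice an Abel transform, except at the single point s = y.
  have key : ∀ᵐ s ∂(volume.restrict (Set.Ioi (0 : ℝ))), ((s * abelKernel α s : ℝ) : ℂ) *
      ((Real.log (y + s) - Real.log (y - s) : ℝ) : ℂ) = 2 * (((s * abelKernel α s : ℝ) : ℂ) *
      ∫ v in Set.Ioi (0 : ℝ), (v : ℂ) * (abelKernel y v : ℂ) * abelKernel s v) := by
    have hne : ∀ᵐ s ∂(volume.restrict (Set.Ioi (0 : ℝ))), s ≠ y :=
      ae_restrict_of_ae (Measure.ae_ne volume y)
    filter_upwards [self_mem_ae_restrict measurableSet_Ioi, hne] with s hs hsy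
    have := log_kernel hs hy hsy
    have h4 : ∫ v in Set.Ioi (0 : ℝ), (v : ℂ) * (abelKernel y v : ℂ) * abelKernel s v =
        (((Real.log (y + s) - Real.log (y - s)) / 2 : ℝ) : ℂ) := by
      rw [← this, ← integral_complex_ofReal]
      refine integral_congr_ae (Eventually.of_forall fun v => ?_)
      push_cast; rfl
    rw [h4]; push_cast; ring
  refine ⟨(h1.const_mul 2).congr (key.mono fun s hs => hs.symm), ?_, ?_⟩
  · rw [integral_congr_ae (key.mono fun s hs => by rw [hs, Complex.norm_mul, Complex.norm_two]),
      integral_const_mul]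
    have h5 : ∫ v in Set.Ioo 0 α, ‖(v : ℂ) * (abelKernel y v : ℂ)‖ = y - Real.sqrt (y ^ 2 - α ^ 2) := by
      rw [← j2]
      refine setIntegral_congr_fun measurableSet_Ioo fun v hv => ?_
      rw [← ofReal_mul, Complex.norm_real, Real.norm_of_nonneg (mul_nonneg hv.1.le (abelKernel_nonneg _ _))]
    rw [h5] at h2
    have := sub_sqrt_le (y := y) hα.le
    nlinarith [Real.pi_pos]
  · rw [integral_congr_ae key, integral_const_mul, h3]
    have h5 : ∫ v in Set.Ioo 0 α, (v : ℂ) * (abelKernel y v : ℂ) =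
        ((y - Real.sqrt (y ^ 2 - α ^ 2) : ℝ) : ℂ) := by
      rw [← j2, ← integral_complex_ofReal]
      refine integral_congr_ae (Eventually.of_forall fun v => ?_)
      push_cast; rfl
    rw [h5]; ring

lemma im_le_norm_upperRoot {w : ℂ} (hw : 0 < w.im) (v : ℝ) : w.im ≤ ‖upperRoot w v‖ := by
  have h1 : ‖upperRoot w v‖ ^ 2 = ‖w - v‖ * ‖w + v‖ := by
    rw [← norm_pow, upperRoot_sq hw, ← Complex.norm_mul]; congr 1; ring
  have h2 : w.im ≤ ‖w - v‖ := by
    have := abs_im_le_norm (w - v); simp only [sub_im, ofReal_im, sub_zero] at this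
    exact (le_abs_self _).trans this
  have h3 : w.im ≤ ‖w + v‖ := by
    have := abs_im_le_norm (w + v); simp only [add_im, ofReal_im, add_zero] at this
    exact (le_abs_self _).trans this
  refine le_of_sq_le_sq ?_ (norm_nonneg _)
  rw [h1, sq]
  exact mul_le_mul h2 h3 hw.le (norm_nonneg _)

/-- The Abel transform of the complex logarithmic kernel. -/
lemma abel_log_kernel_complex {w : ℂ} (hw : 0 < w.im) {α : ℝ} (hα : 0 < α) :
    IntegrableOn (fun s : ℝ => ((s * abelKernel α s : ℝ) : ℂ) *
      (log (w + s) - log (w - s))) (Set.Ioi 0) ∧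
    ∫ s in Set.Ioi (0 : ℝ), ‖((s * abelKernel α s : ℝ) : ℂ) *
      (log (w + s) - log (w - s))‖ ≤ Real.pi * (α / w.im) * α ∧
    ∫ s in Set.Ioi (0 : ℝ), ((s * abelKernel α s : ℝ) : ℂ) *
      (log (w + s) - log (w - s)) = Real.pi * (w - upperRoot w α) := by
  obtain ⟨j1, j2⟩ := integral_div_upperRoot hw hα.le
  have hc : Measurable fun v : ℝ => (upperRoot w v)⁻¹ :=
    ((continuous_upperRoot hw).inv₀ fun v => upperRoot_ne_zero w v).measurable
  obtain ⟨h1, h2, h3⟩ := abel_inversion hc hα j1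
  have key : ∀ᵐ s ∂(volume.restrict (Set.Ioi (0 : ℝ))), ((s * abelKernel α s : ℝ) : ℂ) *
      (log (w + s) - log (w - s)) = 2 * (((s * abelKernel α s : ℝ) : ℂ) *
      ∫ v in Set.Ioi (0 : ℝ), (v : ℂ) * (upperRoot w v)⁻¹ * abelKernel s v) := by
    filter_upwards [self_mem_ae_restrict measurableSet_Ioi] with s hs
    rw [log_kernel_complex hw hs]; ring
  refine ⟨(h1.const_mul 2).congr (key.mono fun s hs => hs.symm), ?_, ?_⟩
  · rw [integral_congr_ae (key.mono fun s hs => by rw [hs, Complex.norm_mul, Complex.norm_two]),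
      integral_const_mul]
    have h5 : ∫ v in Set.Ioo 0 α, ‖(v : ℂ) * (upperRoot w v)⁻¹‖ ≤ α / w.im * α := by
      have h6 : ∀ v ∈ Set.Ioo 0 α, ‖(v : ℂ) * (upperRoot w v)⁻¹‖ ≤ α / w.im := by
        intro v hv
        rw [Complex.norm_mul, norm_inv, Complex.norm_real, Real.norm_of_nonneg hv.1.le, ← div_eq_mul_inv]
        exact div_le_div₀ hα.le hv.2.le hw (im_le_norm_upperRoot hw v)
      have h7 := setIntegral_mono_on j1.norm (integrableOn_const (by simp)) measurableSet_Ioo h6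
      refine h7.trans_eq ?_
      rw [setIntegral_const, Real.volume_real_Ioo_of_le hα.le, sub_zero, smul_eq_mul, mul_comm]
    nlinarith [Real.pi_pos]
  · rw [integral_congr_ae key, integral_const_mul, h3, j2]; ring

lemma upperRoot_re_pos {w : ℂ} (hw : 0 < w.im) (hr : 0 < w.re) (v : ℝ) : 0 < (upperRoot w v).re := by
  have h1 := congrArg Complex.im (upperRoot_sq hw v)
  have h2 := upperRoot_im_pos hw v
  have h3 : 0 < w.re * w.im := mul_pos hr hw
  rw [← ofReal_pow] at h1
  simp only [sq, mul_im, sub_im, ofReal_im] at h1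
  by_contra hc
  nlinarith

/-- With σ the root, (w - σ)(w + σ) = α², and |w - σ| ≤ |w + σ| because both w and σ lie in the
first quadrant. The bound does not depend on w and provides the majorant for the boundary values of
g. -/
lemma norm_sub_upperRoot_le {w : ℂ} (hw : 0 < w.im) (hr : 0 < w.re) {α : ℝ} (hα : 0 ≤ α) :
    ‖w - upperRoot w α‖ ≤ α := by
  set σ := upperRoot w α with hσ
  have h1 : (w - σ) * (w + σ) = (α : ℂ) ^ 2 := by
    have := upperRoot_sq hw α
    rw [← hσ] at this
    linear_combination -this
  have h2 : ‖w - σ‖ ≤ ‖w + σ‖ := by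
    refine le_of_sq_le_sq ?_ (norm_nonneg _)
    rw [← normSq_eq_norm_sq, ← normSq_eq_norm_sq, normSq_apply, normSq_apply]
    have a1 := mul_pos hr (upperRoot_re_pos hw hr α)
    have a2 := mul_pos hw (upperRoot_im_pos hw α)
    rw [← hσ] at a1 a2
    simp only [sub_re, sub_im, add_re, add_im]
    nlinarith
  have h3 : ‖w - σ‖ * ‖w + σ‖ = α ^ 2 := by
    rw [← Complex.norm_mul, h1, norm_pow, Complex.norm_real, Real.norm_of_nonneg hα]
  refine le_of_sq_le_sq ?_ hα
  rw [← h3, sq]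
  exact mul_le_mul_of_nonneg_left h2 (norm_nonneg _)

/-- In the open first quadrant the root is given by a formula continuous up to the boundary. -/
lemma upperRoot_eq {w : ℂ} (hw : 0 < w.im) (hr : 0 < w.re) (α : ℝ) :
    upperRoot w α = (Real.sqrt ((‖w ^ 2 - (α : ℂ) ^ 2‖ + (w ^ 2 - (α : ℂ) ^ 2).re) / 2) : ℂ) +
      Real.sqrt ((‖w ^ 2 - (α : ℂ) ^ 2‖ - (w ^ 2 - (α : ℂ) ^ 2).re) / 2) * I := by
  have h1 := upperRoot_re_pos hw hr α
  have h2 := upperRoot_im_pos hw α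
  rw [← upperRoot_sq hw α, norm_pow, ← normSq_eq_norm_sq, normSq_apply]
  have e1 : (upperRoot w α ^ 2).re = (upperRoot w α).re ^ 2 - (upperRoot w α).im ^ 2 := by
    rw [sq, mul_re]; ring
  rw [e1]
  have e2 : ((upperRoot w α).re * (upperRoot w α).re + (upperRoot w α).im * (upperRoot w α).im +
    ((upperRoot w α).re ^ 2 - (upperRoot w α).im ^ 2)) / 2 = (upperRoot w α).re ^ 2 := by ring
  have e3 : ((upperRoot w α).re * (upperRoot w α).re + (upperRoot w α).im * (upperRoot w α).im -
    ((upperRoot w α).re ^ 2 - (upperRoot w α).im ^ 2)) / 2 = (upperRoot w α).im ^ 2 := by ring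
  rw [e2, e3, Real.sqrt_sq h1.le, Real.sqrt_sq h2.le, re_add_im]

lemma sqrt_abs_add_half (t : ℝ) : Real.sqrt ((|t| + t) / 2) = Real.sqrt t := by
  rcases le_total 0 t with h | h
  · rw [abs_of_nonneg h]; congr 1; ring
  · rw [abs_of_nonpos h, Real.sqrt_eq_zero_of_nonpos h]; simp

/-- The real square root vanishes on negative numbers, so one expression covers y on either side of
α, at most one of the two terms being nonzero. -/
lemma tendsto_upperRoot {y : ℝ} (hy : 0 < y) (α : ℝ) :
    Tendsto (fun w => upperRoot w α) (𝓝[{w : ℂ | 0 < w.im}] (y : ℂ))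
      (𝓝 ((Real.sqrt (y ^ 2 - α ^ 2) : ℂ) + Real.sqrt (α ^ 2 - y ^ 2) * I)) := by
  have hF : Continuous fun w : ℂ =>
      (Real.sqrt ((‖w ^ 2 - (α : ℂ) ^ 2‖ + (w ^ 2 - (α : ℂ) ^ 2).re) / 2) : ℂ) +
      Real.sqrt ((‖w ^ 2 - (α : ℂ) ^ 2‖ - (w ^ 2 - (α : ℂ) ^ 2).re) / 2) * I := by fun_prop
  have h1 := (hF.tendsto (y : ℂ)).mono_left (nhdsWithin_le_nhds (s := {w : ℂ | 0 < w.im}))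
  have e : (y : ℂ) ^ 2 - (α : ℂ) ^ 2 = ((y ^ 2 - α ^ 2 : ℝ) : ℂ) := by push_cast; rfl
  rw [e, Complex.norm_real, ofReal_re, Real.norm_eq_abs, sqrt_abs_add_half,
    show (|y ^ 2 - α ^ 2| - (y ^ 2 - α ^ 2)) / 2 = (|α ^ 2 - y ^ 2| + (α ^ 2 - y ^ 2)) / 2 by
      rw [abs_sub_comm]; ring, sqrt_abs_add_half] at h1
  refine h1.congr' ?_
  have hre : ∀ᶠ w : ℂ in 𝓝 (y : ℂ), 0 < w.re :=
    (isOpen_lt continuous_const continuous_re).mem_nhds (by simpa using hy)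
  filter_upwards [self_mem_nhdsWithin, nhdsWithin_le_nhds hre] with w hw hr
  exact (upperRoot_eq hw hr α).symm

/-! ### The profile and its WKB density -/

namespace IsProfile
variable {A : ℝ → ℝ}

lemma differentiable (hA : IsProfile A) : Differentiable ℝ A := fun x =>
  (hA.analytic x (Set.mem_univ x)).differentiableAt

lemma continuous (hA : IsProfile A) : Continuous A := hA.differentiable.continuous

lemma strictAntiOn (hA : IsProfile A) : StrictAntiOn A (Set.Ici 0) := by
  refine strictAntiOn_of_deriv_neg (convex_Ici 0) hA.continuous.continuousOn fun x hx => ?_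
  rw [interior_Ici] at hx
  exact hA.decreasing x hx

lemma abs_eq (hA : IsProfile A) (x : ℝ) : A |x| = A x := by
  rcases abs_choice x with h | h <;> rw [h]
  exact hA.even x

lemma lt_iff (hA : IsProfile A) (x u : ℝ) : A x < A u ↔ |u| < |x| := by
  rw [← hA.abs_eq x, ← hA.abs_eq u]
  exact hA.strictAntiOn.lt_iff_gt (abs_nonneg x) (abs_nonneg u)

lemma le_zero (hA : IsProfile A) (u : ℝ) : A u ≤ A 0 := by
  rw [← not_lt, hA.lt_iff, abs_zero, not_lt]
  exact abs_nonneg u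

lemma integral_pos (hA : IsProfile A) : 0 < ∫ x, A x := by
  rw [integral_pos_iff_support_of_nonneg (fun x => (hA.pos x).le) hA.integrable,
    Function.support_eq_univ fun x => (hA.pos x).ne']
  simp

end IsProfile

lemma hbar_pos {A : ℝ → ℝ} (hA : IsProfile A) {N : ℕ} (hN : 1 ≤ N) : 0 < hbar A N := by
  have : (0 : ℝ) < N := by exact_mod_cast hN
  exact mul_pos (by positivity) hA.integral_pos

lemma hbar_le {A : ℝ → ℝ} (hA : IsProfile A) {N : ℕ} (hN : 1 ≤ N) : hbar A N ≤ hbar A 1 := by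
  have : (1 : ℝ) ≤ N := by exact_mod_cast hN
  refine mul_le_mul_of_nonneg_right ?_ hA.integral_pos.le
  rw [Nat.cast_one, one_mul]
  exact one_div_le_one_div_of_le Real.pi_pos (by nlinarith [Real.pi_pos])

/-- The part of the WKB density which comes from the set `U`. -/
def abelDensity (A : ℝ → ℝ) (U : Set ℝ) (s : ℝ) : ℝ := s / Real.pi * ∫ u in U, abelKernel (A u) s

/-- Interchanging the integrations in an integral against the density. -/
lemma abelDensity_fubini {A : ℝ → ℝ} (hA : IsProfile A) (U : Set ℝ)
    {k : ℝ → ℂ} (hk : Measurable k) {C : ℝ}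
    (h : ∀ α, 0 < α → α ≤ A 0 →
      IntegrableOn (fun s : ℝ => ((s * abelKernel α s : ℝ) : ℂ) * k s) (Set.Ioi 0) ∧
      ∫ s in Set.Ioi (0 : ℝ), ‖((s * abelKernel α s : ℝ) : ℂ) * k s‖ ≤ C * α) :
    IntegrableOn (fun s : ℝ => (abelDensity A U s : ℂ) * k s) (Set.Ioi 0) ∧
    ∫ s in Set.Ioi (0 : ℝ), (abelDensity A U s : ℂ) * k s =
      (Real.pi : ℂ)⁻¹ * ∫ u in U, ∫ s in Set.Ioi (0 : ℝ), ((s * abelKernel (A u) s : ℝ) : ℂ) * k s := by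
  set μ := volume.restrict U with hμ
  set ν := volume.restrict (Set.Ioi (0 : ℝ)) with hν
  set F : ℝ → ℝ → ℂ := fun s u => ((s * abelKernel (A u) s : ℝ) : ℂ) * k s with hF
  have hm : Measurable (Function.uncurry F) := by
    have h1 : Measurable fun p : ℝ × ℝ => abelKernel (A p.2) p.1 :=
      measurable_abelKernel.comp ((hA.continuous.measurable.comp measurable_snd).prodMk measurable_fst)
    exact (measurable_ofReal.comp (measurable_fst.mul h1)).mul (hk.comp measurable_fst)
  -- The section at u has norm at most C·A(u), and A is integrable.
  have hInt : Integrable (Function.uncurry F) (ν.prod μ) := by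
    rw [integrable_prod_iff' hm.aestronglyMeasurable]
    refine ⟨Eventually.of_forall fun u => (h (A u) (hA.pos u) (hA.le_zero u)).1, ?_⟩
    refine ((hA.integrable.restrict (s := U)).const_mul C).mono' ?_ (Eventually.of_forall fun u => ?_)
    · exact ((hm.norm.comp measurable_swap).aestronglyMeasurable (μ := μ.prod ν)).integral_prod_right'
    · rw [Real.norm_of_nonneg (integral_nonneg fun s => norm_nonneg _)]
      exact (h (A u) (hA.pos u) (hA.le_zero u)).2
  have hin : ∀ s, ∫ u, F s u ∂μ = Real.pi * ((abelDensity A U s : ℂ) * k s) := by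
    intro s
    have : ∀ u, F s u = ((abelKernel (A u) s : ℝ) : ℂ) * (s * k s) := fun u => by
      simp only [hF]; push_cast; ring
    simp only [this]
    rw [integral_mul_const, integral_complex_ofReal, abelDensity]
    have : (Real.pi : ℂ) ≠ 0 := by exact_mod_cast Real.pi_ne_zero
    push_cast
    field_simp
    rw [← hμ]
    ring
  have hpi : (Real.pi : ℂ) ≠ 0 := by exact_mod_cast Real.pi_ne_zero
  have hin' : ∀ s, (abelDensity A U s : ℂ) * k s = (Real.pi : ℂ)⁻¹ * ∫ u, F s u ∂μ := fun s => by
    rw [hin]; field_simp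
  refine ⟨?_, ?_⟩
  · exact (hInt.integral_prod_left.const_mul (Real.pi : ℂ)⁻¹).congr
      (Eventually.of_forall fun s => (hin' s).symm)
  · rw [integral_congr_ae (Eventually.of_forall hin'), integral_const_mul,
      integral_integral_swap hInt]

/-- Weighted by s, the section at u has total mass A(u), so Tonelli makes almost every section in
the other variable integrable. This is what allows the density to be split into an inner and an
outer part. -/
lemma abelKernel_sections_integrable {A : ℝ → ℝ} (hA : IsProfile A) :
    ∀ᵐ s ∂(volume.restrict (Set.Ioi (0 : ℝ))), Integrable fun u => abelKernel (A u) s := by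
  set ν := volume.restrict (Set.Ioi (0 : ℝ)) with hν
  set F : ℝ → ℝ → ℝ := fun s u => s * abelKernel (A u) s with hF
  have hm : Measurable (Function.uncurry F) := by
    have h1 : Measurable fun p : ℝ × ℝ => abelKernel (A p.2) p.1 :=
      measurable_abelKernel.comp ((hA.continuous.measurable.comp measurable_snd).prodMk measurable_fst)
    exact measurable_fst.mul h1
  have hsec : ∀ α, 0 < α → IntegrableOn (fun s => s * abelKernel α s) (Set.Ioi 0) ∧
      ∫ s in Set.Ioi 0, ‖s * abelKernel α s‖ = α := by
    intro α hα
    obtain ⟨h1, h2⟩ := integral_id_mul_abelKernel hα.le hα.le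
    have hz : ∀ v ∈ Set.Ioi (0 : ℝ) \ Set.Ioo 0 α, v * abelKernel α v = 0 := by
      rintro v ⟨hv, hv'⟩
      have : α ≤ v := by by_contra hc; exact hv' ⟨hv, by linarith⟩
      rw [abelKernel_of_le hα.le this, mul_zero]
    refine ⟨h1.of_forall_sdiff_eq_zero measurableSet_Ioi hz, ?_⟩
    rw [setIntegral_congr_fun (g := fun v => v * abelKernel α v) measurableSet_Ioi fun v hv =>
      Real.norm_of_nonneg (mul_nonneg (le_of_lt hv) (abelKernel_nonneg _ _)),
      setIntegral_eq_of_subset_of_forall_sdiff_eq_zero measurableSet_Ioi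
        Set.Ioo_subset_Ioi_self hz, h2, sub_self, Real.sqrt_zero, sub_zero]
  have hInt : Integrable (Function.uncurry F) (ν.prod volume) := by
    rw [integrable_prod_iff' hm.aestronglyMeasurable]
    refine ⟨Eventually.of_forall fun u => (hsec (A u) (hA.pos u)).1, ?_⟩
    exact hA.integrable.congr (Eventually.of_forall fun u => (hsec (A u) (hA.pos u)).2.symm)
  filter_upwards [hInt.prod_right_ae, self_mem_ae_restrict measurableSet_Ioi] with s h1 hs
  have hs' : s ≠ 0 := ne_of_gt hs
  refine (h1.const_mul s⁻¹).congr (Eventually.of_forall fun u => ?_)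
  simp only [Function.uncurry_apply_pair, hF]
  field_simp

/-! ### Boundary values and the density ρ -/

lemma neBot_left {z : ℂ} (hz : z.re = 0) : (𝓝[{w : ℂ | w.re < 0}] z).NeBot := by
  rw [← mem_closure_iff_nhdsWithin_neBot, Complex.closure_setOfPred_re_lt]
  exact hz.le

lemma neBot_right {z : ℂ} (hz : z.re = 0) : (𝓝[{w : ℂ | 0 < w.re}] z).NeBot := by
  rw [← mem_closure_iff_nhdsWithin_neBot, Complex.closure_setOfPred_lt_re]
  exact hz.ge

lemma leftBV_eq {E : Type*} [TopologicalSpace E] [T2Space E] [Nonempty E] {f : ℂ → E} {z : ℂ} {l : E}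
    (hz : z.re = 0) (h : Tendsto f (𝓝[{w : ℂ | w.re < 0}] z) (𝓝 l)) : leftBV f z = l :=
  haveI := neBot_left hz
  h.limUnder_eq

lemma rightBV_eq {E : Type*} [TopologicalSpace E] [T2Space E] [Nonempty E] {f : ℂ → E} {z : ℂ} {l : E}
    (hz : z.re = 0) (h : Tendsto f (𝓝[{w : ℂ | 0 < w.re}] z) (𝓝 l)) : rightBV f z = l :=
  haveI := neBot_right hz
  h.limUnder_eq

/-- The rotation `z ↦ -i z` maps the left half plane to the upper half plane. -/
lemma tendsto_rotate_left (y : ℝ) :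
    Tendsto (fun z : ℂ => -I * z) (𝓝[{w : ℂ | w.re < 0}] (y * I)) (𝓝[{w : ℂ | 0 < w.im}] (y : ℂ)) := by
  refine tendsto_nhdsWithin_iff.2 ⟨?_, ?_⟩
  · have h : Continuous fun z : ℂ => -I * z := by fun_prop
    have := h.tendsto (y * I)
    rw [show -I * (y * I) = (y : ℂ) by linear_combination -(y : ℂ) * I_mul_I] at this
    exact this.mono_left nhdsWithin_le_nhds
  · filter_upwards [self_mem_nhdsWithin] with z hz
    simpa using hz

/-- Both sides have the same square. In the open first quadrant the quantity under the power has
positive imaginary part, so its principal root lies in the first quadrant as well; this makes the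
imaginary part of the left side positive and fixes the sign. -/
lemma root_eq_upperRoot {w : ℂ} (hw : 0 < w.im) (hr : 0 < w.re) {a : ℝ} (ha : 0 < a) :
    w * (1 - a ^ 2 / w ^ 2) ^ (1 / 2 : ℂ) = upperRoot w a := by
  have hw0 : w ≠ 0 := by rintro rfl; simp at hw
  set ξ : ℂ := 1 - a ^ 2 / w ^ 2 with hξ
  have hξim : 0 < ξ.im := by
    have h1 : (a : ℂ) ^ 2 / w ^ 2 = ((a ^ 2 : ℝ) : ℂ) * (w ^ 2)⁻¹ := by push_cast; rw [div_eq_mul_inv]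
    have h2 : 0 < normSq (w ^ 2) := normSq_pos.2 (pow_ne_zero 2 hw0)
    have h3 : (w ^ 2).im = 2 * (w.re * w.im) := by rw [sq, mul_im]; ring
    rw [hξ, sub_im, one_im, h1, im_ofReal_mul, inv_im, h3, zero_sub, ← mul_neg, ← neg_div, neg_neg]
    have := mul_pos hr hw
    positivity
  have hξ0 : ξ ≠ 0 := by intro h; rw [h] at hξim; simp at hξim
  set s : ℂ := ξ ^ (1 / 2 : ℂ) with hs
  have hs2 : s ^ 2 = ξ := by
    rw [hs, ← cpow_nat_mul]; norm_num
  obtain ⟨l1, l2⟩ := log_im_mem hξim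
  have hsl : s = exp (log ξ / 2) := by rw [hs, cpow_def_of_ne_zero hξ0]; congr 1; ring
  have hl : (log ξ / 2).im = (log ξ).im / 2 := by
    rw [show (2 : ℂ) = ((2 : ℝ) : ℂ) by norm_num, div_ofReal_im]
  have sre : 0 < s.re := by
    rw [hsl, exp_re, hl]
    exact mul_pos (Real.exp_pos _) (Real.cos_pos_of_mem_Ioo ⟨by linarith, by linarith⟩)
  have sim : 0 < s.im := by
    rw [hsl, exp_im, hl]
    exact mul_pos (Real.exp_pos _) (Real.sin_pos_of_pos_of_lt_pi (by linarith) (by linarith))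
  have h2 : (w * s) ^ 2 = upperRoot w a ^ 2 := by
    rw [upperRoot_sq hw, mul_pow, hs2, hξ]; field_simp
  rcases sq_eq_sq_iff_eq_or_eq_neg.1 h2 with h | h
  · exact h
  · exfalso
    have h3 := congrArg Complex.im h
    rw [mul_im, neg_im] at h3
    nlinarith [upperRoot_im_pos hw a, mul_pos hr sim, mul_pos hw sre]

lemma R_rotate (a : ℝ) (z : ℂ) :
    R a z = -I * ((-I * z) * (1 - a ^ 2 / (-I * z) ^ 2) ^ (1 / 2 : ℂ)) := by
  rw [R, mul_pow, neg_sq, I_sq, neg_one_mul, div_neg, sub_neg_eq_add]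
  linear_combination z * (1 + (a : ℂ) ^ 2 / z ^ 2) ^ (1 / 2 : ℂ) * (-I_mul_I)

lemma leftBV_R {a y : ℝ} (hy : 0 < y) (hya : y < a) :
    leftBV (R a) (y * I) = Real.sqrt (a ^ 2 - y ^ 2) := by
  refine leftBV_eq (by simp) ?_
  have h1 := ((tendsto_upperRoot hy a).comp (tendsto_rotate_left y)).const_mul (-I)
  rw [Real.sqrt_eq_zero_of_nonpos (show y ^ 2 - a ^ 2 ≤ 0 by nlinarith), ofReal_zero, zero_add,
    show -I * (Real.sqrt (a ^ 2 - y ^ 2) * I) = (Real.sqrt (a ^ 2 - y ^ 2) : ℂ) by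
      linear_combination -(Real.sqrt (a ^ 2 - y ^ 2) : ℂ) * I_mul_I] at h1
  refine h1.congr' ?_
  have him : ∀ᶠ z : ℂ in 𝓝 (y * I), 0 < z.im :=
    (isOpen_lt continuous_const continuous_im).mem_nhds (by simpa using hy)
  filter_upwards [self_mem_nhdsWithin, nhdsWithin_le_nhds him] with z hz him
  rw [R_rotate, Function.comp, root_eq_upperRoot (by simpa using hz) (by simpa using him) (by linarith)]

lemma R_of_abs_gt {a s : ℝ} (ha : 0 < a) (h : a < |s|) :
    R a (s * I) = -(s * I) * Real.sqrt (1 - a ^ 2 / s ^ 2) := by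
  have hs : s ≠ 0 := by rintro rfl; simp at h; linarith
  have h1 : (1 : ℂ) + (a : ℂ) ^ 2 / (s * I) ^ 2 = ((1 - a ^ 2 / s ^ 2 : ℝ) : ℂ) := by
    rw [mul_pow, I_sq]; push_cast; ring
  have h2 : 0 ≤ 1 - a ^ 2 / s ^ 2 := by
    rw [sub_nonneg, div_le_one (by positivity)]
    exact sq_le_sq' (by linarith [abs_nonneg s]) h.le |>.trans_eq (sq_abs s)
  rw [R, h1, Real.sqrt_eq_rpow, ofReal_cpow h2]
  norm_num

lemma R_above {a s : ℝ} (ha : 0 < a) (h : a < s) : R a (s * I) = -(I * Real.sqrt (s ^ 2 - a ^ 2)) := by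
  have hs : 0 < s := ha.trans h
  rw [R_of_abs_gt ha (h.trans_le (le_abs_self s)), show s ^ 2 - a ^ 2 = s ^ 2 * (1 - a ^ 2 / s ^ 2) by
    field_simp, Real.sqrt_mul (sq_nonneg s), Real.sqrt_sq hs.le]
  push_cast; ring

lemma R_below {a s : ℝ} (ha : 0 < a) (h : a < s) :
    R a (((-s : ℝ) : ℂ) * I) = I * Real.sqrt (s ^ 2 - a ^ 2) := by
  have hs : 0 < s := ha.trans h
  rw [R_of_abs_gt ha (by rw [abs_neg]; exact h.trans_le (le_abs_self s)),
    show s ^ 2 - a ^ 2 = s ^ 2 * (1 - a ^ 2 / s ^ 2) by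
    field_simp, Real.sqrt_mul (sq_nonneg s), Real.sqrt_sq hs.le, neg_sq]
  push_cast; ring

lemma rho0_eq {A : ℝ → ℝ} (hA : IsProfile A) (s : ℝ) :
    rho0 A (s * I) = I * abelDensity A Set.univ s := by
  have h1 : ∫ u in {u : ℝ | (s * I : ℂ).im < A u}, 1 / Real.sqrt (A u ^ 2 - (s * I : ℂ).im ^ 2) =
      ∫ u, abelKernel (A u) s := by
    rw [show (s * I : ℂ).im = s by simp, ← setIntegral_univ (f := fun u => abelKernel (A u) s),
      setIntegral_eq_of_subset_of_forall_sdiff_eq_zero (f := fun u => abelKernel (A u) s)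
      MeasurableSet.univ (Set.subset_univ {u : ℝ | s < A u})]
    · refine integral_congr_ae (Eventually.of_forall fun u => ?_)
      simp only [abelKernel, one_div]
    · rintro u ⟨_, hu⟩
      exact abelKernel_of_le (hA.pos u).le (not_lt.1 hu)
  rw [rho0, h1, abelDensity, setIntegral_univ]
  push_cast; ring

lemma conj_rho0_eq {A : ℝ → ℝ} (hA : IsProfile A) (s : ℝ) :
    (starRingEnd ℂ) (rho0 A ((starRingEnd ℂ) (((-s : ℝ) : ℂ) * I))) = -(I * abelDensity A Set.univ s) := by
  have : (starRingEnd ℂ) (((-s : ℝ) : ℂ) * I) = s * I := by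
    rw [map_mul, conj_ofReal, conj_I]; push_cast; ring
  rw [this, rho0_eq hA s, map_mul, conj_I, conj_ofReal, neg_mul]

lemma abelDensity_of_le {A : ℝ → ℝ} (hA : IsProfile A) {U : Set ℝ} {s : ℝ}
    (h : ∀ u ∈ U, A u ≤ s) : abelDensity A U s = 0 := by
  rw [abelDensity, setIntegral_eq_zero_of_forall_eq_zero, mul_zero]
  exact fun u hu => abelKernel_of_le (hA.pos u).le (h u hu)

lemma measurable_abelKernel_left (a : ℝ) : Measurable fun s => abelKernel s a :=
  measurable_abelKernel.comp (measurable_id.prodMk measurable_const)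

/-- The Cauchy type integral of the WKB density which enters the definition of `ρ`. -/
lemma abelDensity_cauchy {A : ℝ → ℝ} (hA : IsProfile A) {a y : ℝ} (hy : 0 < y) (hya : y < a) :
    IntegrableOn (fun s : ℝ => (abelDensity A Set.univ s : ℂ) *
      ((abelKernel s a / (s ^ 2 - y ^ 2) : ℝ) : ℂ)) (Set.Ioi 0) ∧
    ∫ s in Set.Ioi (0 : ℝ), (abelDensity A Set.univ s : ℂ) *
      ((abelKernel s a / (s ^ 2 - y ^ 2) : ℝ) : ℂ) =
      ((abelKernel a y / 2 * ∫ u in {u | a < A u}, abelKernel (A u) y : ℝ) : ℂ) := by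
  have ha : 0 < a := hy.trans hya
  have hk : Measurable fun s : ℝ => ((abelKernel s a / (s ^ 2 - y ^ 2) : ℝ) : ℂ) :=
    measurable_ofReal.comp ((measurable_abelKernel_left a).div (by fun_prop))
  have key : ∀ α, 0 < α →
      IntegrableOn (fun s : ℝ => ((s * abelKernel α s : ℝ) : ℂ) *
        ((abelKernel s a / (s ^ 2 - y ^ 2) : ℝ) : ℂ)) (Set.Ioi 0) ∧
      ∫ s in Set.Ioi (0 : ℝ), ‖((s * abelKernel α s : ℝ) : ℂ) *
        ((abelKernel s a / (s ^ 2 - y ^ 2) : ℝ) : ℂ)‖ =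
        Set.indicator {α | a < α} (fun α => Real.pi / 2 * (abelKernel a y * abelKernel α y)) α ∧
      ∫ s in Set.Ioi (0 : ℝ), ((s * abelKernel α s : ℝ) : ℂ) *
        ((abelKernel s a / (s ^ 2 - y ^ 2) : ℝ) : ℂ) =
        ((Set.indicator {α | a < α} (fun α => Real.pi / 2 * (abelKernel a y * abelKernel α y)) α : ℝ) : ℂ) := by
    intro α hα
    simp only [← ofReal_mul]
    rw [integral_complex_ofReal]
    have hnn : ∀ s ∈ Set.Ioi (0 : ℝ), 0 ≤ s * abelKernel α s * (abelKernel s a / (s ^ 2 - y ^ 2)) := by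
      intro s hs
      rcases le_or_gt s a with h | h
      · rw [abelKernel_of_le (le_of_lt hs) h, zero_div, mul_zero]
      · exact mul_nonneg (mul_nonneg (le_of_lt hs) (abelKernel_nonneg _ _))
          (div_nonneg (abelKernel_nonneg _ _) (by nlinarith))
    have hnorm : ∀ s ∈ Set.Ioi (0 : ℝ),
        ‖((s * abelKernel α s * (abelKernel s a / (s ^ 2 - y ^ 2)) : ℝ) : ℂ)‖ =
        s * abelKernel α s * (abelKernel s a / (s ^ 2 - y ^ 2)) := fun s hs => by
      rw [Complex.norm_real, Real.norm_of_nonneg (hnn s hs)]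
    rw [setIntegral_congr_fun measurableSet_Ioi hnorm]
    rcases lt_or_ge a α with h | h
    · obtain ⟨h1, h2⟩ := abel_cauchy_integral_eq hy.le hya h
      rw [Set.indicator_of_mem (show α ∈ {α | a < α} from h), h2]
      exact ⟨h1.ofReal, rfl, rfl⟩
    · have hz : ∀ s ∈ Set.Ioi (0 : ℝ), s * abelKernel α s * (abelKernel s a / (s ^ 2 - y ^ 2)) = 0 :=
        fun s hs => abel_cauchy_integral_of_le (y := y) hα.le h s hs
      rw [Set.indicator_of_notMem (show α ∉ {α | a < α} from not_lt.2 h),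
        setIntegral_eq_zero_of_forall_eq_zero hz]
      refine ⟨integrableOn_zero.congr_fun (fun s hs => ?_) measurableSet_Ioi, rfl, rfl⟩
      simp only
      rw [hz s hs, ofReal_zero]
  set K := abelKernel a y with hK
  have hK0 : 0 < K := abelKernel_pos hy.le hya
  have hKα : ∀ α, a < α → abelKernel α y ≤ K := by
    intro α h
    refine inv_anti₀ (Real.sqrt_pos.2 (by nlinarith)) (Real.sqrt_le_sqrt (by nlinarith))
  -- Only α > a matters. There the kernel at α is at most K and 1 ≤ α/a, which makes the constant
  -- bound linear in α.
  obtain ⟨h1, h2⟩ := abelDensity_fubini hA Set.univ hk (C := Real.pi / 2 * (K * K) / a)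
    fun α hα _ => ⟨(key α hα).1, by
      rw [(key α hα).2.1]
      rcases lt_or_ge a α with h | h
      · rw [Set.indicator_of_mem (show α ∈ {α | a < α} from h)]
        have e1 : K * abelKernel α y ≤ K * K := mul_le_mul_of_nonneg_left (hKα α h) hK0.le
        have e2 : 1 ≤ α / a := (one_le_div ha).2 h.le
        have e3 : Real.pi / 2 * (K * abelKernel α y) ≤ Real.pi / 2 * (K * K) :=
          mul_le_mul_of_nonneg_left e1 (by positivity)
        refine (e3.trans (le_mul_of_one_le_right (by positivity) e2)).trans_eq ?_
        ring
      · rw [Set.indicator_of_notMem (show α ∉ {α | a < α} from not_lt.2 h)]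
        positivity⟩
  refine ⟨h1, ?_⟩
  rw [h2, setIntegral_univ, integral_congr_ae (Eventually.of_forall fun u => (key (A u) (hA.pos u)).2.2),
    integral_complex_ofReal]
  have hmeas : MeasurableSet {u | a < A u} := measurableSet_lt measurable_const hA.continuous.measurable
  have e : ∀ u, Set.indicator {α | a < α} (fun α => Real.pi / 2 * (K * abelKernel α y)) (A u) =
      Set.indicator {u | a < A u} (fun u => Real.pi / 2 * (K * abelKernel (A u) y)) u := fun u => rfl
  simp only [e]
  rw [integral_indicator hmeas, integral_const_mul, integral_const_mul]
  have hpi : (Real.pi : ℂ) ≠ 0 := by exact_mod_cast Real.pi_ne_zero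
  push_cast
  field_simp

lemma imInt_of_le (f : ℂ → ℂ) {a b : ℝ} (h : a ≤ b) :
    imInt f a b = ∫ s in Set.Ioc a b, f (s * I) * I := intervalIntegral.integral_of_le h

lemma imInt_neg (f : ℂ → ℂ) (a b : ℝ) :
    imInt f (-b) (-a) = ∫ s in a..b, f (((-s : ℝ) : ℂ) * I) * I := by
  rw [imInt, ← intervalIntegral.integral_comp_neg (fun s : ℝ => f ((s : ℂ) * I) * I)]

/-- The density `ρ` is the part of `ρ⁰` which comes from outside `[-|x|, |x|]`. -/
lemma rho_eq {A : ℝ → ℝ} (hA : IsProfile A) {x : ℝ} {y : ℝ} (hy : 0 < y) (hya : y < A x)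
    (hint : Integrable fun u => abelKernel (A u) y) :
    rho A x (y * I) = I * abelDensity A {u | A u ≤ A x} y := by
  set a := A x with ha'
  have ha : 0 < a := hy.trans hya
  have haA : a ≤ A 0 := hA.le_zero x
  set f : ℝ → ℂ := fun s => (abelDensity A Set.univ s : ℂ) with hf
  set k : ℝ → ℂ := fun s => ((abelKernel s a / (s ^ 2 - y ^ 2) : ℝ) : ℂ) with hk
  obtain ⟨h1, h2⟩ := abelDensity_cauchy hA hy hya
  have hsub : Set.Ioc a (A 0) ⊆ Set.Ioi 0 := fun s hs => ha.trans hs.1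
  have hz : ∀ s ∈ Set.Ioi (0 : ℝ) \ Set.Ioc a (A 0), f s * k s = 0 := by
    rintro s ⟨hs, hs'⟩
    rcases le_or_gt s a with h | h
    · simp only [hk]; rw [abelKernel_of_le (le_of_lt hs) h, zero_div, ofReal_zero, mul_zero]
    · have : A 0 < s := by by_contra hc; exact hs' ⟨h, not_lt.1 hc⟩
      simp only [hf]
      rw [abelDensity_of_le hA fun u _ => (hA.le_zero u).trans this.le, ofReal_zero, zero_mul]
  have h1' : IntegrableOn (fun s => f s * k s) (Set.Ioc a (A 0)) := h1.mono_set hsub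
  have h2' : ∫ s in Set.Ioc a (A 0), f s * k s =
      ((abelKernel a y / 2 * ∫ u in {u | a < A u}, abelKernel (A u) y : ℝ) : ℂ) := by
    rw [← h2]
    exact (setIntegral_eq_of_subset_of_forall_sdiff_eq_zero measurableSet_Ioi hsub hz).symm
  have hk1 : ∀ s ∈ Set.Ioc a (A 0), (k s : ℂ) =
      1 / ((s - y) * (s + y) * Real.sqrt (s ^ 2 - a ^ 2)) := by
    intro s hs
    simp only [hk, abelKernel]
    push_cast
    rw [show ((s : ℂ) - y) * (s + y) = (s : ℂ) ^ 2 - y ^ 2 by ring, ← one_div, div_div, mul_comm]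
  have hI1 : imInt (fun s => rho0 A s / ((y * I - s) * R a s)) a (A 0) =
      ∫ s in Set.Ioc a (A 0), f s * k s * (s + y) := by
    rw [imInt_of_le _ haA]
    refine setIntegral_congr_fun measurableSet_Ioc fun s hs => ?_
    have e1 : (s : ℂ) - y ≠ 0 := by
      rw [← ofReal_sub]; exact_mod_cast (sub_pos.2 (hya.trans hs.1)).ne'
    have e2 : (s : ℂ) + y ≠ 0 := by
      rw [← ofReal_add]; exact_mod_cast (add_pos (hsub hs) hy).ne'
    have e3 : (Real.sqrt (s ^ 2 - a ^ 2) : ℂ) ≠ 0 := by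
      have hs1 := hs.1
      exact_mod_cast (Real.sqrt_pos.2 (by nlinarith)).ne'
    have e4 : (y : ℂ) - s ≠ 0 := by rw [← neg_sub]; exact neg_ne_zero.2 e1
    rw [hk1 s hs, rho0_eq hA, R_above ha hs.1, show (y * I - s * I : ℂ) = -(s - y) * I by ring]
    simp only [hf]
    have := I_ne_zero
    field_simp
  have hI2 : imInt (fun s => (starRingEnd ℂ) (rho0 A ((starRingEnd ℂ) s)) / ((y * I - s) * R a s))
      (-A 0) (-a) = -∫ s in Set.Ioc a (A 0), f s * k s * (s - y) := by
    rw [imInt_neg, intervalIntegral.integral_of_le haA, ← integral_neg]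
    refine setIntegral_congr_fun measurableSet_Ioc fun s hs => ?_
    have e1 : (s : ℂ) - y ≠ 0 := by
      rw [← ofReal_sub]; exact_mod_cast (sub_pos.2 (hya.trans hs.1)).ne'
    have e2 : (s : ℂ) + y ≠ 0 := by
      rw [← ofReal_add]; exact_mod_cast (add_pos (hsub hs) hy).ne'
    have e3 : (Real.sqrt (s ^ 2 - a ^ 2) : ℂ) ≠ 0 := by
      have hs1 := hs.1
      exact_mod_cast (Real.sqrt_pos.2 (by nlinarith)).ne'
    rw [hk1 s hs, conj_rho0_eq hA, R_below ha hs.1,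
      show ((y : ℂ) * I - ((-s : ℝ) : ℂ) * I : ℂ) = (s + y) * I by push_cast; ring]
    simp only [hf]
    have := I_ne_zero
    field_simp
  have hbd : ∀ c : ℂ, Integrable (fun s : ℝ => f s * k s * (s + c)) (volume.restrict (Set.Ioc a (A 0))) := by
    intro c
    refine h1'.mul_bdd (c := A 0 + ‖c‖) (by fun_prop) ?_
    filter_upwards [self_mem_ae_restrict measurableSet_Ioc] with s hs
    refine (norm_add_le _ _).trans (add_le_add_left ?_ _)
    rw [Complex.norm_real, Real.norm_of_nonneg (le_of_lt (hsub hs))]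
    exact hs.2
  -- The two conjugate Cauchy integrals combine through (s + y) - (s - y) = 2y into the even kernel
  -- evaluated in `abelDensity_cauchy`.
  have hdiff : (∫ s in Set.Ioc a (A 0), f s * k s * (s + y)) - ∫ s in Set.Ioc a (A 0), f s * k s * (s - y) =
      2 * y * ∫ s in Set.Ioc a (A 0), f s * k s := by
    rw [← integral_sub (hbd y) (by simpa [sub_eq_add_neg] using hbd (-y)), ← integral_const_mul]
    refine integral_congr_ae (Eventually.of_forall fun s => ?_)
    simp only; ring
  -- The boundary value √(a² - y²) of R cancels the factor `abelKernel a y`. The correction in ρ is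
  -- then minus the contribution of {A > a}, and only the outer part of the density survives.
  have hsplit : abelDensity A Set.univ y = y / Real.pi * (∫ u in {u | a < A u}, abelKernel (A u) y) +
      abelDensity A {u | A u ≤ a} y := by
    have hmeas : MeasurableSet {u | a < A u} := measurableSet_lt measurable_const hA.continuous.measurable
    have hc : {u | a < A u}ᶜ = {u | A u ≤ a} := by ext u; simp
    rw [abelDensity, abelDensity, setIntegral_univ, ← integral_add_compl hmeas hint, hc]
    ring
  have hsq : (Real.sqrt (a ^ 2 - y ^ 2) : ℂ) * (abelKernel a y : ℂ) = 1 := by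
    rw [← ofReal_mul, abelKernel, mul_inv_cancel₀ (Real.sqrt_pos.2 (by nlinarith)).ne', ofReal_one]
  have hpi : (Real.pi : ℂ) ≠ 0 := by exact_mod_cast Real.pi_ne_zero
  rw [rho, ← ha', leftBV_R hy hya, hI1, hI2, rho0_eq hA, hsplit]
  rw [h2'] at hdiff
  push_cast at hdiff ⊢
  generalize (∫ s in Set.Ioc a (A 0), f s * k s * (s + y)) = P at *
  generalize (∫ s in Set.Ioc a (A 0), f s * k s * (s - y)) = Q at *
  generalize ((∫ u in {u | a < A u}, abelKernel (A u) y : ℝ) : ℂ) = W at *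
  have hI0 := I_ne_zero
  have hinv : (Real.sqrt (a ^ 2 - y ^ 2) : ℂ) / (Real.pi * I) = -(I * Real.sqrt (a ^ 2 - y ^ 2) / Real.pi) := by
    rw [div_eq_iff (mul_ne_zero hpi hI0)]
    field_simp
    rw [I_sq]; ring
  rw [hinv]
  have hP : P = Q + y * ((abelKernel a y : ℂ) * W) := by linear_combination hdiff
  rw [hP]
  field_simp
  linear_combination (-(y : ℂ) * W) * hsq

lemma abelDensity_integrable {A : ℝ → ℝ} (hA : IsProfile A) (U : Set ℝ) :
    IntegrableOn (fun s : ℝ => (abelDensity A U s : ℂ)) (Set.Ioi 0) := by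
  have hsec : ∀ α, 0 < α → IntegrableOn (fun s => s * abelKernel α s) (Set.Ioi 0) ∧
      ∫ s in Set.Ioi 0, s * abelKernel α s = α := by
    intro α hα
    obtain ⟨h1, h2⟩ := integral_id_mul_abelKernel hα.le hα.le
    have hz : ∀ v ∈ Set.Ioi (0 : ℝ) \ Set.Ioo 0 α, v * abelKernel α v = 0 := by
      rintro v ⟨hv, hv'⟩
      have : α ≤ v := by by_contra hc; exact hv' ⟨hv, by linarith⟩
      rw [abelKernel_of_le hα.le this, mul_zero]
    refine ⟨h1.of_forall_sdiff_eq_zero measurableSet_Ioi hz, ?_⟩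
    rw [setIntegral_eq_of_subset_of_forall_sdiff_eq_zero measurableSet_Ioi
        Set.Ioo_subset_Ioi_self hz, h2, sub_self, Real.sqrt_zero, sub_zero]
  have h := (abelDensity_fubini hA U (k := fun _ => 1) measurable_const (C := 1) fun α hα _ => by
    simp only [mul_one, one_mul]
    have hn : ∀ s ∈ Set.Ioi (0 : ℝ), ‖((s * abelKernel α s : ℝ) : ℂ)‖ = s * abelKernel α s := fun s hs => by
      rw [Complex.norm_real, Real.norm_of_nonneg (mul_nonneg (le_of_lt hs) (abelKernel_nonneg _ _))]
    rw [setIntegral_congr_fun measurableSet_Ioi hn, (hsec α hα).2]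
    exact ⟨(hsec α hα).1.ofReal, le_rfl⟩).1
  simpa only [mul_one] using h

/-- An almost everywhere identity suffices, since ρ enters g only under an integral. -/
lemma rho_ae_eq {A : ℝ → ℝ} (hA : IsProfile A) (x : ℝ) :
    ∀ᵐ s : ℝ ∂(volume.restrict (Set.Ioc 0 (A x))),
      rho A x (s * I) = I * abelDensity A {u | A u ≤ A x} s := by
  have h1 : ∀ᵐ s : ℝ ∂(volume.restrict (Set.Ioc 0 (A x))), Integrable fun u => abelKernel (A u) s :=
    ae_restrict_of_ae_restrict_of_subset Set.Ioc_subset_Ioi_self (abelKernel_sections_integrable hA)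
  have h2 : ∀ᵐ s : ℝ ∂(volume.restrict (Set.Ioc 0 (A x))), s ≠ A x :=
    ae_restrict_of_ae (Measure.ae_ne volume _)
  filter_upwards [h1, h2, self_mem_ae_restrict measurableSet_Ioc] with s h1 h2 hs
  exact rho_eq hA hs.1 (lt_of_le_of_ne hs.2 h2) h1

/-! ### The phases g, θ and φ̃ as explicit integrals -/

lemma im_ne_of_rotate {z : ℂ} (hz : z.re ≠ 0) : (-I * z).im ≠ 0 := by simpa using hz

/-- `g` as a logarithmic potential. -/
lemma g_eq_log {A : ℝ → ℝ} (hA : IsProfile A) (x : ℝ) {z : ℂ} (hz : z.re ≠ 0) :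
    g A x z = J x / 2 * ∫ s in Set.Ioi (0 : ℝ), (abelDensity A {u | A u ≤ A x} s : ℂ) *
      (log (-I * z + s) - log (-I * z - s)) := by
  set w := -I * z with hw
  have hwi : w.im ≠ 0 := im_ne_of_rotate hz
  set a := A x with ha'
  have ha : 0 < a := hA.pos x
  set q : ℝ → ℂ := fun s => (abelDensity A {u | A u ≤ a} s : ℂ) with hq
  have hqi : IntegrableOn q (Set.Icc 0 a) := by
    refine (integrableOn_Icc_iff_integrableOn_Ioc).2 ?_
    exact (abelDensity_integrable hA _).mono_set Set.Ioc_subset_Ioi_self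
  have c1 : Continuous fun s : ℝ => log (w + s) + I * Real.pi / 2 := by
    refine Continuous.add (Continuous.clog (by fun_prop) fun s => ?_) continuous_const
    rw [mem_slitPlane_iff]; right; simpa using hwi
  have c2 : Continuous fun s : ℝ => log (w - s) + I * Real.pi / 2 := by
    refine Continuous.add (Continuous.clog (by fun_prop) fun s => ?_) continuous_const
    rw [mem_slitPlane_iff]; right; simpa using hwi
  have i1 : IntegrableOn (fun s : ℝ => q s * (log (w + s) + I * Real.pi / 2)) (Set.Ioc 0 a) :=
    (hqi.mul_continuousOn c1.continuousOn isCompact_Icc).mono_set Set.Ioc_subset_Icc_self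
  have i2 : IntegrableOn (fun s : ℝ => q s * (log (w - s) + I * Real.pi / 2)) (Set.Ioc 0 a) :=
    (hqi.mul_continuousOn c2.continuousOn isCompact_Icc).mono_set Set.Ioc_subset_Icc_self
  have e1 : imInt (fun η => L0 η z * (starRingEnd ℂ) (rho A x ((starRingEnd ℂ) η))) (-a) 0 =
      ∫ s in Set.Ioc 0 a, q s * (log (w + s) + I * Real.pi / 2) := by
    have h := imInt_neg (fun η => L0 η z * (starRingEnd ℂ) (rho A x ((starRingEnd ℂ) η))) 0 a
    rw [neg_zero] at h
    rw [h, intervalIntegral.integral_of_le ha.le]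
    refine integral_congr_ae ((rho_ae_eq hA x).mono fun s hs => ?_)
    have hc : (starRingEnd ℂ) (((-s : ℝ) : ℂ) * I) = s * I := by
      rw [map_mul, conj_ofReal, conj_I]; push_cast; ring
    simp only
    rw [hc, hs, map_mul, conj_I, conj_ofReal, L0,
      show -I * (z - ((-s : ℝ) : ℂ) * I) = w + s by
        rw [hw]; push_cast; linear_combination (-(s : ℂ)) * I_mul_I]
    simp only [hq]
    linear_combination (-(log (w + s) + I * Real.pi / 2) * (abelDensity A {u | A u ≤ a} s : ℂ)) * I_mul_I
  have e2 : imInt (fun η => L0 η z * rho A x η) 0 a =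
      -∫ s in Set.Ioc 0 a, q s * (log (w - s) + I * Real.pi / 2) := by
    rw [imInt_of_le _ ha.le, ← integral_neg]
    refine integral_congr_ae ((rho_ae_eq hA x).mono fun s hs => ?_)
    simp only
    rw [hs, L0, show -I * (z - s * I) = w - s by rw [hw]; linear_combination (s : ℂ) * I_mul_I]
    simp only [hq]
    linear_combination ((log (w - s) + I * Real.pi / 2) * (abelDensity A {u | A u ≤ a} s : ℂ)) * I_mul_I
  -- The two halves of the contour enter with opposite signs, which cancels the constants iπ/2 in
  -- the logarithms.
  rw [g, ← ha', e1, e2, ← mul_add, ← sub_eq_add_neg, ← integral_sub i1 i2]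
  congr 1
  have hz0 : ∀ s ∈ Set.Ioi (0 : ℝ) \ Set.Ioc 0 a, q s * (log (w + s) - log (w - s)) = 0 := by
    rintro s ⟨hs, hs'⟩
    have : a < s := by by_contra hc; exact hs' ⟨hs, not_lt.1 hc⟩
    simp only [hq]
    have hU : ∀ u ∈ {u | A u ≤ a}, A u ≤ s := fun u hu => le_trans hu this.le
    rw [abelDensity_of_le hA hU, ofReal_zero, zero_mul]
  rw [setIntegral_eq_of_subset_of_forall_sdiff_eq_zero measurableSet_Ioi Set.Ioc_subset_Ioi_self hz0]
  refine integral_congr_ae (Eventually.of_forall fun s => ?_)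
  simp only
  ring

lemma measurable_log_kernel (w : ℂ) : Measurable fun s : ℝ => log (w + s) - log (w - s) :=
  (measurable_log.comp (by fun_prop)).sub (measurable_log.comp (by fun_prop))

/-- Interchange the u- and s-integrations and apply the complex Abel inversion for each height A(u).
-/
lemma g_eq_left {A : ℝ → ℝ} (hA : IsProfile A) (x : ℝ) {z : ℂ} (hz : z.re < 0) :
    g A x z = J x / 2 * ∫ u in {u | A u ≤ A x}, (-I * z - upperRoot (-I * z) (A u)) := by
  have hw : 0 < (-I * z).im := by simpa using hz
  rw [g_eq_log hA x hz.ne]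
  congr 1
  have h := (abelDensity_fubini hA {u | A u ≤ A x} (measurable_log_kernel (-I * z))
    (C := Real.pi * (A 0 / (-I * z).im)) fun α hα hα0 => by
      obtain ⟨h1, h2, -⟩ := abel_log_kernel_complex hw hα
      refine ⟨h1, h2.trans ?_⟩
      have : α / (-I * z).im ≤ A 0 / (-I * z).im := by gcongr
      exact mul_le_mul_of_nonneg_right (mul_le_mul_of_nonneg_left this Real.pi_pos.le) hα.le).2
  rw [h, ← integral_const_mul]
  refine integral_congr_ae (Eventually.of_forall fun u => ?_)
  have hpi : (Real.pi : ℂ) ≠ 0 := by exact_mod_cast Real.pi_ne_zero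
  simp only
  rw [(abel_log_kernel_complex hw (hA.pos u)).2.2]
  field_simp

lemma conj_J (x : ℝ) : (starRingEnd ℂ) (J x) = J x := conj_ofReal _

lemma J_mul_J {x : ℝ} (hx : x ≠ 0) : J x * J x = 1 := by
  rcases Real.sign_apply_eq_of_ne_zero x hx with h | h <;> rw [J, h] <;> norm_num

/-- The density is real and the reflection across the imaginary axis becomes conjugation of w = -iz.
The boundary value from the right is therefore the conjugate of that from the left, which separates
θ and φ̃ into imaginary and real parts. -/
lemma g_conj {A : ℝ → ℝ} (hA : IsProfile A) (x : ℝ) {z : ℂ} (hz : z.re ≠ 0) :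
    g A x z = (starRingEnd ℂ) (g A x (-(starRingEnd ℂ) z)) := by
  have hz' : (-(starRingEnd ℂ) z).re ≠ 0 := by simpa using hz
  rw [g_eq_log hA x hz, g_eq_log hA x hz', map_mul, map_div₀, conj_J, ← integral_conj]
  have h2 : (starRingEnd ℂ) 2 = (2 : ℂ) := Complex.conj_ofNat 2
  rw [h2]
  congr 1
  refine integral_congr_ae (Eventually.of_forall fun s => ?_)
  have hwi := im_ne_of_rotate hz'
  simp only
  rw [map_mul, map_sub, conj_ofReal, ← log_conj, ← log_conj]
  · simp only [map_add, map_sub, map_mul, map_neg, conj_I, conj_ofReal, conj_conj]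
    ring_nf
  · intro h
    exact hwi (by simpa using (arg_eq_pi_iff.1 h).2)
  · intro h
    exact hwi (by simpa using (arg_eq_pi_iff.1 h).2)

/-- The boundary value of the integrand of `g` from the left. -/
def gKernel (y α : ℝ) : ℂ :=
  y - ((Real.sqrt (y ^ 2 - α ^ 2) : ℂ) + Real.sqrt (α ^ 2 - y ^ 2) * I)

/-- Dominated convergence with majorant A(u), supplied by `norm_sub_upperRoot_le` once w is in the
first quadrant. -/
lemma tendsto_g_left {A : ℝ → ℝ} (hA : IsProfile A) (x : ℝ) {y : ℝ} (hy : 0 < y) :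
    Tendsto (g A x) (𝓝[{w : ℂ | w.re < 0}] (y * I))
      (𝓝 (J x / 2 * ∫ u in {u | A u ≤ A x}, gKernel y (A u))) := by
  have hrot := tendsto_rotate_left y
  have h1 : Tendsto (fun w : ℂ => ∫ u in {u | A u ≤ A x}, (w - upperRoot w (A u)))
      (𝓝[{w : ℂ | 0 < w.im}] (y : ℂ)) (𝓝 (∫ u in {u | A u ≤ A x}, gKernel y (A u))) := by
    refine tendsto_integral_filter_of_dominated_convergence (fun u => A u) ?_ ?_
      hA.integrable.restrict ?_
    · filter_upwards [self_mem_nhdsWithin] with w hw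
      exact (continuous_const.sub ((continuous_upperRoot hw).comp hA.continuous)).aestronglyMeasurable
    · have hre : ∀ᶠ w : ℂ in 𝓝 (y : ℂ), 0 < w.re :=
        (isOpen_lt continuous_const continuous_re).mem_nhds (by simpa using hy)
      filter_upwards [self_mem_nhdsWithin, nhdsWithin_le_nhds hre] with w hw hr
      exact Eventually.of_forall fun u => norm_sub_upperRoot_le hw hr (hA.pos u).le
    · refine Eventually.of_forall fun u => ?_
      exact (tendsto_id.mono_left nhdsWithin_le_nhds).sub (tendsto_upperRoot hy (A u))
  refine ((h1.comp hrot).const_mul (J x / 2)).congr' ?_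
  filter_upwards [self_mem_nhdsWithin] with z hz
  exact (g_eq_left hA x hz).symm

lemma tendsto_reflect (y : ℝ) :
    Tendsto (fun z : ℂ => -(starRingEnd ℂ) z) (𝓝[{w : ℂ | 0 < w.re}] (y * I))
      (𝓝[{w : ℂ | w.re < 0}] (y * I)) := by
  refine tendsto_nhdsWithin_iff.2 ⟨?_, ?_⟩
  · have h : Continuous fun z : ℂ => -(starRingEnd ℂ) z := continuous_conj.neg
    have := h.tendsto (y * I)
    simp only [map_mul, conj_ofReal, conj_I, mul_neg, neg_neg] at this
    exact this.mono_left nhdsWithin_le_nhds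
  · filter_upwards [self_mem_nhdsWithin] with z hz
    simpa using hz

lemma tendsto_g_right {A : ℝ → ℝ} (hA : IsProfile A) (x : ℝ) {y : ℝ} (hy : 0 < y) :
    Tendsto (g A x) (𝓝[{w : ℂ | 0 < w.re}] (y * I))
      (𝓝 ((starRingEnd ℂ) (J x / 2 * ∫ u in {u | A u ≤ A x}, gKernel y (A u)))) := by
  refine (((continuous_conj.tendsto _).comp (tendsto_g_left hA x hy)).comp (tendsto_reflect y)).congr' ?_
  filter_upwards [self_mem_nhdsWithin] with z hz
  exact (g_conj hA x (ne_of_gt hz)).symm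

lemma integrable_sub_sqrt {A : ℝ → ℝ} (hA : IsProfile A) {y : ℝ} (hy : 0 < y) :
    Integrable fun u => y - Real.sqrt (y ^ 2 - A u ^ 2) := by
  have := hA.continuous
  refine hA.integrable.mono' (by fun_prop) (Eventually.of_forall fun u => ?_)
  rw [Real.norm_of_nonneg]
  · exact sub_sqrt_le (hA.pos u).le
  · rw [sub_nonneg]
    exact Real.sqrt_le_iff.2 ⟨hy.le, by nlinarith [sq_nonneg (A u)]⟩

lemma integrable_sqrt {A : ℝ → ℝ} (hA : IsProfile A) (y : ℝ) :
    Integrable fun u => Real.sqrt (A u ^ 2 - y ^ 2) := by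
  have := hA.continuous
  refine hA.integrable.mono' (by fun_prop) (Eventually.of_forall fun u => ?_)
  rw [Real.norm_of_nonneg (Real.sqrt_nonneg _)]
  exact Real.sqrt_le_iff.2 ⟨(hA.pos u).le, by nlinarith [sq_nonneg y]⟩

lemma integral_gKernel {A : ℝ → ℝ} (hA : IsProfile A) (U : Set ℝ) {y : ℝ} (hy : 0 < y) :
    ∫ u in U, gKernel y (A u) = ((∫ u in U, (y - Real.sqrt (y ^ 2 - A u ^ 2)) : ℝ) : ℂ) -
      ((∫ u in U, Real.sqrt (A u ^ 2 - y ^ 2) : ℝ) : ℂ) * I := by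
  rw [← integral_complex_ofReal, ← integral_complex_ofReal, ← integral_mul_const, ← integral_sub]
  · refine integral_congr_ae (Eventually.of_forall fun u => ?_)
    simp only [gKernel]; push_cast; ring
  · exact ((integrable_sub_sqrt hA hy).restrict (s := U)).ofReal
  · have : Integrable (fun u => ((Real.sqrt (A u ^ 2 - y ^ 2) : ℝ) : ℂ)) (volume.restrict U) :=
      ((integrable_sqrt hA y).restrict (s := U)).ofReal
    exact this.mul_const I

/-- The phase `θ` on the positive imaginary axis. -/
lemma theta_eq_integral {A : ℝ → ℝ} (hA : IsProfile A) {x : ℝ} (hx : x ≠ 0) {y : ℝ} (hy : 0 < y) :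
    theta A x (y * I) = ((∫ u in {u | A u ≤ A x}, Real.sqrt (A u ^ 2 - y ^ 2) : ℝ) : ℂ) := by
  rw [theta, leftBV_eq (by simp) (tendsto_g_left hA x hy), rightBV_eq (by simp) (tendsto_g_right hA x hy),
    map_mul, map_div₀, conj_J, show (starRingEnd ℂ) 2 = (2 : ℂ) from Complex.conj_ofNat 2,
    integral_gKernel hA _ hy, map_sub, map_mul, conj_I, conj_ofReal, conj_ofReal]
  have := J_mul_J hx
  linear_combination (-(I * I) * ((∫ u in {u | A u ≤ A x}, Real.sqrt (A u ^ 2 - y ^ 2) : ℝ) : ℂ)) * this -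
    ((∫ u in {u | A u ≤ A x}, Real.sqrt (A u ^ 2 - y ^ 2) : ℝ) : ℂ) * I_mul_I

/-- On the imaginary axis, the average of the boundary values of the logarithm. -/
lemma L0avg_eq {s y : ℝ} (h : y ≠ s) :
    L0avg (s * I) (y * I) = (Real.log (y - s) : ℂ) + I * Real.pi / 2 := by
  have hL : ∀ z, L0 (s * I) z = log (-I * z - s) + I * Real.pi / 2 := fun z => by
    rw [L0, show -I * (z - s * I) = -I * z - s by linear_combination (s : ℂ) * I_mul_I]
  have hc : Tendsto (fun z : ℂ => -I * z - s) (𝓝 (y * I)) (𝓝 ((y - s : ℝ) : ℂ)) := by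
    have : Continuous fun z : ℂ => -I * z - s := by fun_prop
    have h1 := this.tendsto (y * I)
    rwa [show -I * (y * I) - s = ((y - s : ℝ) : ℂ) by
      push_cast; linear_combination -(y : ℂ) * I_mul_I] at h1
  rcases lt_or_gt_of_ne h with h | h
  -- Here the point lies on the cut. The two boundary values differ from log|y - s| + iπ/2 by ±iπ,
  -- which the average removes.
  · have hneg : y - s < 0 := by linarith
    have hl : Tendsto (fun z : ℂ => -I * z - s) (𝓝[{w : ℂ | w.re < 0}] (y * I))
        (𝓝[{w : ℂ | 0 ≤ w.im}] ((y - s : ℝ) : ℂ)) := by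
      refine tendsto_nhdsWithin_iff.2 ⟨hc.mono_left nhdsWithin_le_nhds, ?_⟩
      filter_upwards [self_mem_nhdsWithin] with z hz
      have hz' : z.re < 0 := hz
      simpa using hz'.le
    have hr : Tendsto (fun z : ℂ => -I * z - s) (𝓝[{w : ℂ | 0 < w.re}] (y * I))
        (𝓝[{w : ℂ | w.im < 0}] ((y - s : ℝ) : ℂ)) := by
      refine tendsto_nhdsWithin_iff.2 ⟨hc.mono_left nhdsWithin_le_nhds, ?_⟩
      filter_upwards [self_mem_nhdsWithin] with z hz
      have hz' : 0 < z.re := hz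
      simpa using hz'
    have t1 := ((tendsto_log_nhdsWithin_im_nonneg_of_re_neg_of_im_zero
      (z := ((y - s : ℝ) : ℂ)) (by simpa using hneg) (by simp)).comp hl).add_const (I * Real.pi / 2)
    have t2 := ((tendsto_log_nhdsWithin_im_neg_of_re_neg_of_im_zero
      (z := ((y - s : ℝ) : ℂ)) (by simpa using hneg) (by simp)).comp hr).add_const (I * Real.pi / 2)
    rw [L0avg, leftBV_eq (by simp) (t1.congr fun z => (hL z).symm),
      rightBV_eq (by simp) (t2.congr fun z => (hL z).symm), Complex.norm_real, Real.norm_eq_abs,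
      Real.log_abs]
    ring
  · have hsl : ((y - s : ℝ) : ℂ) ∈ slitPlane := by
      rw [ofReal_mem_slitPlane]; linarith
    have t : Tendsto (L0 (s * I)) (𝓝 (y * I)) (𝓝 (log ((y - s : ℝ) : ℂ) + I * Real.pi / 2)) :=
      (((continuousAt_clog hsl).tendsto.comp hc).add_const _).congr fun z => (hL z).symm
    rw [L0avg, leftBV_eq (by simp) (t.mono_left nhdsWithin_le_nhds),
      rightBV_eq (by simp) (t.mono_left nhdsWithin_le_nhds), ofReal_log (by linarith)]
    ring

/-- The phase `φ̃` on the positive imaginary axis. -/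
lemma phiTilde_eq_integral {A : ℝ → ℝ} (hA : IsProfile A) {x : ℝ} (hx : x ≠ 0) {y : ℝ} (hy : 0 < y) :
    phiTilde A x (y * I) = -((∫ u in {u | A x < A u}, Real.sqrt (y ^ 2 - A u ^ 2) : ℝ) : ℂ) := by
  have hA0 := hA.pos 0
  set f : ℝ → ℂ := fun s => (abelDensity A Set.univ s : ℂ) with hf
  have hfi : IntegrableOn f (Set.Ioi 0) := abelDensity_integrable hA _
  set k : ℝ → ℂ := fun s => ((Real.log (y + s) - Real.log (y - s) : ℝ) : ℂ) with hk
  have hkm : Measurable k := by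
    refine measurable_ofReal.comp (Measurable.sub ?_ ?_) <;> exact Real.measurable_log.comp (by fun_prop)
  obtain ⟨h1, h2⟩ := abelDensity_fubini hA Set.univ hkm (C := Real.pi) fun α hα _ => by
    obtain ⟨a1, a2, -⟩ := abel_log_kernel hy hα
    exact ⟨a1, a2⟩
  have h3 : ∫ s in Set.Ioi (0 : ℝ), f s * k s = ((∫ u, (y - Real.sqrt (y ^ 2 - A u ^ 2)) : ℝ) : ℂ) := by
    rw [h2, setIntegral_univ, integral_congr_ae (Eventually.of_forall fun u =>
      (abel_log_kernel hy (hA.pos u)).2.2), integral_const_mul, integral_complex_ofReal]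
    have hpi : (Real.pi : ℂ) ≠ 0 := by exact_mod_cast Real.pi_ne_zero
    field_simp
  have hsub : Set.Ioc 0 (A 0) ⊆ Set.Ioi 0 := Set.Ioc_subset_Ioi_self
  have h4 : ∫ s in Set.Ioi (0 : ℝ), f s * k s = ∫ s in Set.Ioc 0 (A 0), f s * k s := by
    refine setIntegral_eq_of_subset_of_forall_sdiff_eq_zero measurableSet_Ioi hsub ?_
    rintro s ⟨hs, hs'⟩
    have : A 0 < s := by by_contra hc; exact hs' ⟨hs, not_lt.1 hc⟩
    simp only [hf]
    rw [abelDensity_of_le hA fun u _ => (hA.le_zero u).trans this.le, ofReal_zero, zero_mul]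
  have ip : IntegrableOn (fun s : ℝ => f s * ((Real.log (y + s) : ℝ) + I * Real.pi / 2))
      (Set.Ioc 0 (A 0)) := by
    have : IntegrableOn f (Set.Icc 0 (A 0)) :=
      (integrableOn_Icc_iff_integrableOn_Ioc).2 (hfi.mono_set hsub)
    refine (this.mul_continuousOn ?_ isCompact_Icc).mono_set Set.Ioc_subset_Icc_self
    refine ContinuousOn.add ?_ continuousOn_const
    refine continuous_ofReal.comp_continuousOn (ContinuousOn.log (by fun_prop) fun s hs => ?_)
    have := hs.1
    positivity
  have im : IntegrableOn (fun s : ℝ => f s * ((Real.log (y - s) : ℝ) + I * Real.pi / 2))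
      (Set.Ioc 0 (A 0)) := by
    refine (ip.sub (h1.mono_set hsub)).congr (Eventually.of_forall fun s => ?_)
    simp only [hk, Pi.sub_apply]; push_cast; ring
  have hne : ∀ᵐ s : ℝ ∂(volume.restrict (Set.Ioc 0 (A 0))), s ≠ y :=
    ae_restrict_of_ae (Measure.ae_ne volume y)
  have e1 : imInt (fun η => L0avg η (y * I) * rho0 A η) 0 (A 0) =
      -∫ s in Set.Ioc 0 (A 0), f s * ((Real.log (y - s) : ℝ) + I * Real.pi / 2) := by
    rw [imInt_of_le _ hA0.le, ← integral_neg]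
    refine integral_congr_ae (hne.mono fun s hs => ?_)
    simp only
    rw [L0avg_eq hs.symm, rho0_eq hA]
    simp only [hf]
    linear_combination (((Real.log (y - s) : ℝ) + I * Real.pi / 2) * (abelDensity A Set.univ s : ℂ)) * I_mul_I
  have e2 : imInt (fun η => L0avg η (y * I) * (starRingEnd ℂ) (rho0 A ((starRingEnd ℂ) η))) (-A 0) 0 =
      ∫ s in Set.Ioc 0 (A 0), f s * ((Real.log (y + s) : ℝ) + I * Real.pi / 2) := by
    have h := imInt_neg (fun η => L0avg η (y * I) * (starRingEnd ℂ) (rho0 A ((starRingEnd ℂ) η))) 0 (A 0)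
    rw [neg_zero] at h
    rw [h, intervalIntegral.integral_of_le hA0.le]
    refine setIntegral_congr_fun measurableSet_Ioc fun s hs => ?_
    have : y ≠ -s := by have := hs.1; linarith
    rw [L0avg_eq this, conj_rho0_eq hA, sub_neg_eq_add]
    simp only [hf]
    linear_combination (-((Real.log (y + s) : ℝ) + I * Real.pi / 2) * (abelDensity A Set.univ s : ℂ)) * I_mul_I
  have e3 : (∫ s in Set.Ioc 0 (A 0), f s * ((Real.log (y + s) : ℝ) + I * Real.pi / 2)) -
      ∫ s in Set.Ioc 0 (A 0), f s * ((Real.log (y - s) : ℝ) + I * Real.pi / 2) =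
      ((∫ u, (y - Real.sqrt (y ^ 2 - A u ^ 2)) : ℝ) : ℂ) := by
    rw [← h3, h4, ← integral_sub ip im]
    refine integral_congr_ae (Eventually.of_forall fun s => ?_)
    simp only [hk]; push_cast; ring
  have hmeas : MeasurableSet {u | A x < A u} := measurableSet_lt measurable_const hA.continuous.measurable
  have hc : {u | A x < A u}ᶜ = {u | A u ≤ A x} := by ext u; simp
  have hset : {u | A x < A u} = Set.Ioo (-|x|) |x| := by
    ext u
    rw [Set.mem_ofPred_eq, hA.lt_iff, abs_lt, Set.mem_Ioo]
  have hfin : IntegrableOn (fun _ : ℝ => y) {u | A x < A u} := by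
    rw [hset]; exact integrableOn_const (by simp)
  have hs : IntegrableOn (fun u => Real.sqrt (y ^ 2 - A u ^ 2)) {u | A x < A u} := by
    refine (hfin.sub (integrable_sub_sqrt hA hy).integrableOn).congr (Eventually.of_forall fun u => ?_)
    simp
  -- On |u| < |x| the constant y contributes 2|x|y, which cancels the term 2iλ|x| at λ = iy; the
  -- outer integral cancels against the two boundary values of g.
  have e4 : ∫ u, (y - Real.sqrt (y ^ 2 - A u ^ 2)) = 2 * |x| * y -
      (∫ u in {u | A x < A u}, Real.sqrt (y ^ 2 - A u ^ 2)) +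
      ∫ u in {u | A u ≤ A x}, (y - Real.sqrt (y ^ 2 - A u ^ 2)) := by
    rw [← integral_add_compl hmeas (integrable_sub_sqrt hA hy), hc, integral_sub hfin hs, setIntegral_const,
      hset, Real.volume_real_Ioo_of_le (by linarith [abs_nonneg x]), smul_eq_mul]
    ring
  rw [phiTilde, leftBV_eq (by simp) (tendsto_g_left hA x hy), rightBV_eq (by simp) (tendsto_g_right hA x hy),
    map_mul, map_div₀, conj_J, show (starRingEnd ℂ) 2 = (2 : ℂ) from Complex.conj_ofNat 2,
    integral_gKernel hA _ hy, map_sub, map_mul, conj_I, conj_ofReal, conj_ofReal, e1, e2]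
  have e5 := congrArg (fun t : ℝ => (t : ℂ)) e4
  rw [← e3] at e5
  push_cast at e5 ⊢
  have hJ := J_mul_J hx
  linear_combination e5 + 2 * y * ((|x| : ℝ) : ℂ) * I_mul_I -
    ((∫ u in {u | A u ≤ A x}, (y - Real.sqrt (y ^ 2 - A u ^ 2)) : ℝ) : ℂ) * hJ

/-! ### The phases near the turning value -/

/-- A real-analytic function extends to a holomorphic function on a complex disk. -/
lemma exists_holomorphic_extension {f : ℝ → ℝ} {a : ℝ} (hf : AnalyticAt ℝ f a) :
    ∃ δ > 0, ∃ G : ℂ → ℂ, DifferentiableOn ℂ G (Metric.ball (a : ℂ) δ) ∧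
      ∀ v : ℝ, |v - a| < δ → G v = f v := by
  obtain ⟨p, r, hp⟩ := hf
  obtain ⟨R, hR0, hRr⟩ := ENNReal.lt_iff_exists_nnreal_btwn.1 hp.r_pos
  have hR0' : 0 < (R : ℝ) := by exact_mod_cast hR0
  have hRp : (R : ENNReal) < p.radius := hRr.trans_le hp.r_le
  refine ⟨R, hR0', fun w => ∑' n : ℕ, (p.coeff n : ℂ) * (w - a) ^ n, ?_, ?_⟩
  · refine differentiableOn_tsum_of_summable_norm (p.summable_norm_mul_pow hRp) ?_ Metric.isOpen_ball ?_
    · intro n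
      fun_prop
    · intro n w hw
      rw [Complex.norm_mul, norm_pow, Complex.norm_real, FormalMultilinearSeries.norm_apply_eq_norm_coef]
      rw [mem_ball_iff_norm] at hw
      gcongr
  · intro v hv
    have h1 := hp.hasSum_sub (y := v) (by
      rw [Metric.mem_eball, edist_dist, Real.dist_eq]
      refine lt_trans ?_ hRr
      rw [← ENNReal.ofReal_coe_nnreal]
      exact (ENNReal.ofReal_lt_ofReal_iff hR0').2 hv)
    have h2 := (Complex.hasSum_ofReal.2 h1).tsum_eq
    rw [← h2]
    refine tsum_congr fun n => ?_
    rw [FormalMultilinearSeries.apply_eq_pow_smul_coeff, smul_eq_mul]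
    push_cast; ring

/-- The local inverse of the profile at a positive point. -/
lemma exists_profile_inverse {A : ℝ → ℝ} (hA : IsProfile A) {b : ℝ} (hb : 0 < b) :
    ∃ δ > 0, ∃ X : ℝ → ℝ, X (A b) = b ∧ AnalyticAt ℝ (deriv X) (A b) ∧ deriv X (A b) < 0 ∧
      ∀ v, |v - A b| < δ → A (X v) = v ∧ 0 < X v ∧ HasDerivAt X (deriv X v) v ∧
        ContinuousAt (deriv X) v := by
  have hAb := hA.analytic b (Set.mem_univ b)
  have hd := hA.decreasing b hb
  set X := hAb.hasStrictDerivAt.localInverse _ _ _ hd.ne with hX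
  have hXa : AnalyticAt ℝ X (A b) := hAb.analyticAt_localInverse hd.ne
  have hXb : X (A b) = b := HasStrictFDerivAt.localInverse_apply_image ..
  have hXd : deriv X (A b) = (deriv A b)⁻¹ :=
    (hAb.hasStrictDerivAt.to_localInverse hd.ne).hasDerivAt.deriv
  have e1 : ∀ᶠ v in 𝓝 (A b), A (X v) = v := HasStrictDerivAt.eventually_right_inverse ..
  have e2 : ∀ᶠ v in 𝓝 (A b), 0 < X v := by
    refine hXa.continuousAt.eventually (lt_mem_nhds ?_)
    rwa [hXb]
  obtain ⟨δ, hδ, h⟩ := Metric.eventually_nhds_iff.1 (e1.and (e2.and hXa.eventually_analyticAt))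
  refine ⟨δ, hδ, X, hXb, hXa.deriv, by rw [hXd]; exact inv_lt_zero.2 hd, fun v hv => ?_⟩
  obtain ⟨h1, h2, h3⟩ := h (show dist v (A b) < δ from hv)
  exact ⟨h1, h2, h3.differentiableAt.hasDerivAt, h3.deriv.continuousAt⟩

/-- The phase integral from outside of `[-b, b]`, in terms of the inverse of the profile. -/
lemma outer_phase_integral {A : ℝ → ℝ} (hA : IsProfile A) {b c y : ℝ} (hb : 0 < b) (hbc : b ≤ c)
    (hy : A c = y) (hy0 : 0 < y) :
    ∫ u in {u | A u ≤ A b}, Real.sqrt (A u ^ 2 - y ^ 2) =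
      2 * ∫ u in b..c, Real.sqrt (A u ^ 2 - y ^ 2) := by
  have hm : MeasurableSet {u | A u ≤ A b} := measurableSet_le hA.continuous.measurable measurable_const
  -- By evenness the integrand depends on |u| only, and beyond c the radicand is negative, so the
  -- real square root is zero.
  have h1 : ∀ u, Set.indicator {u | A u ≤ A b} (fun u => Real.sqrt (A u ^ 2 - y ^ 2)) u =
      Set.indicator (Set.Icc b c) (fun u => Real.sqrt (A u ^ 2 - y ^ 2)) |u| := by
    intro u
    have hu : A u ≤ A b ↔ b ≤ |u| := by
      rw [← not_lt, hA.lt_iff, abs_of_pos hb, not_lt]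
    by_cases h : b ≤ |u|
    · rw [Set.indicator_of_mem (show u ∈ {u | A u ≤ A b} from hu.2 h)]
      by_cases h' : |u| ≤ c
      · rw [Set.indicator_of_mem (show |u| ∈ Set.Icc b c from ⟨h, h'⟩), hA.abs_eq]
      · rw [Set.indicator_of_notMem (fun hh => h' hh.2)]
        have : A u < y := by
          rw [← hy, hA.lt_iff, abs_of_pos (hb.trans_le hbc)]; exact not_le.1 h'
        have := hA.pos u
        exact Real.sqrt_eq_zero_of_nonpos (by nlinarith)
    · rw [Set.indicator_of_notMem (show u ∉ {u | A u ≤ A b} from fun hh => h (hu.1 hh)),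
        Set.indicator_of_notMem (fun hh => h hh.1)]
  have hsub : Set.Icc b c ⊆ Set.Ioi 0 := fun u hu => hb.trans_le hu.1
  rw [← integral_indicator hm, integral_congr_ae (Eventually.of_forall h1),
    integral_comp_abs (f := Set.indicator (Set.Icc b c) fun u => Real.sqrt (A u ^ 2 - y ^ 2)),
    setIntegral_indicator measurableSet_Icc, Set.inter_eq_self_of_subset_right hsub, integral_Icc_eq_integral_Ioc,
    intervalIntegral.integral_of_le hbc]

/-- The phase integral from `[-b, b]`, in terms of the inverse of the profile. -/
lemma inner_phase_integral {A : ℝ → ℝ} (hA : IsProfile A) {b c y : ℝ} (hc : 0 < c) (hcb : c ≤ b)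
    (hy : A c = y) :
    ∫ u in {u | A b < A u}, Real.sqrt (y ^ 2 - A u ^ 2) =
      2 * ∫ u in c..b, Real.sqrt (y ^ 2 - A u ^ 2) := by
  have hb : 0 < b := hc.trans_le hcb
  have hm : MeasurableSet {u | A b < A u} := measurableSet_lt measurable_const hA.continuous.measurable
  have h1 : ∀ u, Set.indicator {u | A b < A u} (fun u => Real.sqrt (y ^ 2 - A u ^ 2)) u =
      Set.indicator (Set.Ico c b) (fun u => Real.sqrt (y ^ 2 - A u ^ 2)) |u| := by
    intro u
    have hu : A b < A u ↔ |u| < b := by rw [hA.lt_iff, abs_of_pos hb]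
    by_cases h : |u| < b
    · rw [Set.indicator_of_mem (show u ∈ {u | A b < A u} from hu.2 h)]
      by_cases h' : c ≤ |u|
      · rw [Set.indicator_of_mem (show |u| ∈ Set.Ico c b from ⟨h', h⟩), hA.abs_eq]
      · rw [Set.indicator_of_notMem (fun hh => h' hh.1)]
        have : y < A u := by
          rw [← hy, hA.lt_iff, abs_of_pos hc]; exact not_le.1 h'
        have := hA.pos c
        exact Real.sqrt_eq_zero_of_nonpos (by nlinarith)
    · rw [Set.indicator_of_notMem (show u ∉ {u | A b < A u} from fun hh => h (hu.1 hh)),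
        Set.indicator_of_notMem (fun hh => h hh.2)]
  have hsub : Set.Ico c b ⊆ Set.Ioi 0 := fun u hu => hc.trans_le hu.1
  rw [← integral_indicator hm, integral_congr_ae (Eventually.of_forall h1),
    integral_comp_abs (f := Set.indicator (Set.Ico c b) fun u => Real.sqrt (y ^ 2 - A u ^ 2)),
    setIntegral_indicator measurableSet_Ico, Set.inter_eq_self_of_subset_right hsub, integral_Ico_eq_integral_Ioc,
    intervalIntegral.integral_of_le hcb]

/-- Both phases near the turning value, as fractional powers times one smooth function. -/
lemma exists_phase_density {A : ℝ → ℝ} (hA : IsProfile A) {b : ℝ} (hb : 0 < b) :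
    ∃ δ > 0, ∃ (G₀ : ℝ → ℝ) (G : ℂ → ℂ), DifferentiableOn ℂ G (Metric.ball (A b : ℂ) δ) ∧
      (∀ v : ℝ, |v - A b| < δ → G v = G₀ v) ∧ 0 < G₀ (A b) ∧ δ ≤ A b ∧
      (∀ y, A b - δ < y → y < A b → ∫ u in {u | A u ≤ A b}, Real.sqrt (A u ^ 2 - y ^ 2) =
        (A b - y) ^ (3 / 2 : ℝ) * (2 * ∫ τ in (0 : ℝ)..1, Real.sqrt τ *
          Real.sqrt (2 * y + (A b - y) * τ) * G₀ (y + (A b - y) * τ))) ∧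
      (∀ y, A b < y → y < A b + δ → ∫ u in {u | A b < A u}, Real.sqrt (y ^ 2 - A u ^ 2) =
        (y - A b) ^ (3 / 2 : ℝ) * (2 * ∫ τ in (0 : ℝ)..1, Real.sqrt τ *
          Real.sqrt (2 * y + (A b - y) * τ) * G₀ (y + (A b - y) * τ))) := by
  obtain ⟨δ₁, hδ₁, X, hXb, hXa, hXd, hX⟩ := exists_profile_inverse hA hb
  obtain ⟨δ₂, hδ₂, G, hG, hGr⟩ := exists_holomorphic_extension hXa.neg
  have ha := hA.pos b
  set a := A b with ha'
  have hpow : ∀ t : ℝ, 0 < t → t ^ (3 / 2 : ℝ) = t * Real.sqrt t := fun t ht => by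
    rw [show (3 / 2 : ℝ) = 1 + 1 / 2 by norm_num, Real.rpow_add ht, Real.rpow_one, Real.sqrt_eq_rpow]
  have hXlt : ∀ v v', |v - a| < δ₁ → |v' - a| < δ₁ → v < v' → X v' < X v := fun v v' hv hv' h => by
    have := (hA.lt_iff (X v) (X v')).1 (by rw [(hX v hv).1, (hX v' hv').1]; exact h)
    rwa [abs_of_pos (hX v hv).2.1, abs_of_pos (hX v' hv').2.1] at this
  refine ⟨min (min δ₁ δ₂) a, by positivity, fun v => -deriv X v, G,
    hG.mono (Metric.ball_subset_ball ((min_le_left _ _).trans (min_le_right _ _))), fun v hv => ?_,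
    by simpa using hXd, min_le_right _ _, fun y hy1 hy2 => ?_, fun y hy1 hy2 => ?_⟩
  · exact hGr v (hv.trans_le ((min_le_left _ _).trans (min_le_right _ _)))
  · have hd : |y - a| < min (min δ₁ δ₂) a := by rw [abs_of_neg (by linarith)]; linarith
    have hd1 : |y - a| < δ₁ := hd.trans_le ((min_le_left _ _).trans (min_le_left _ _))
    have hy0 : 0 < y := by
      have := hd.trans_le (min_le_right _ _)
      rw [abs_of_neg (by linarith)] at this; linarith
    have hmem : ∀ v ∈ Set.uIcc a y, |v - a| < δ₁ := by
      intro v hv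
      rw [Set.uIcc_of_ge hy2.le] at hv
      refine lt_of_le_of_lt ?_ hd1
      rw [abs_of_nonpos (by linarith [hv.2]), abs_of_neg (by linarith)]; linarith [hv.1]
    have hbc : b ≤ X y := by
      have := hXlt y a hd1 (by simpa using hδ₁) hy2
      rw [hXb] at this; exact this.le
    rw [outer_phase_integral hA hb hbc (hX y hd1).1 hy0]
    -- Substitute v = A(u), then v = y + (a - y)τ. The radicand factors as (a - y)τ(2y + (a - y)τ),
    -- which together with dv exposes the power 3/2; the remaining density -X' is analytic at a.
    have hcv := intervalIntegral.integral_comp_mul_deriv (a := a) (b := y)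
      (g := fun u => Real.sqrt (A u ^ 2 - y ^ 2)) (fun v hv => (hX v (hmem v hv)).2.2.1)
      (fun v hv => (hX v (hmem v hv)).2.2.2.continuousWithinAt)
      (by have := hA.continuous; fun_prop)
    rw [hXb] at hcv
    rw [← hcv, intervalIntegral.integral_symm, ← intervalIntegral.integral_neg]
    have hsc := intervalIntegral.smul_integral_comp_add_mul (a := 0) (b := 1)
      (fun v => -(((fun u => Real.sqrt (A u ^ 2 - y ^ 2)) ∘ X) v * deriv X v)) (a - y) y
    rw [mul_zero, add_zero, mul_one, add_sub_cancel] at hsc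
    rw [← hsc, smul_eq_mul, hpow _ (by linarith)]
    have : ∀ τ ∈ Set.uIcc (0 : ℝ) 1,
        -(((fun u => Real.sqrt (A u ^ 2 - y ^ 2)) ∘ X) (y + (a - y) * τ) * deriv X (y + (a - y) * τ)) =
        Real.sqrt (a - y) * (Real.sqrt τ *
          Real.sqrt (2 * y + (a - y) * τ) * -deriv X (y + (a - y) * τ)) := by
      intro τ hτ
      rw [Set.uIcc_of_le zero_le_one] at hτ
      have hv : |y + (a - y) * τ - a| < δ₁ := by
        refine lt_of_le_of_lt ?_ hd1
        rw [show y + (a - y) * τ - a = (y - a) * (1 - τ) by ring, abs_mul, abs_of_nonneg (by linarith [hτ.2] : 0 ≤ 1 - τ)]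
        exact mul_le_of_le_one_right (abs_nonneg _) (by linarith [hτ.1])
      have hay : 0 ≤ a - y := by linarith
      simp only [Function.comp_apply]
      rw [(hX _ hv).1, show (y + (a - y) * τ) ^ 2 - y ^ 2 = ((a - y) * τ) * (2 * y + (a - y) * τ) by ring,
        Real.sqrt_mul (mul_nonneg hay hτ.1), Real.sqrt_mul hay]
      ring
    rw [intervalIntegral.integral_congr this, intervalIntegral.integral_const_mul]
    ring
  · have hd : |y - a| < min (min δ₁ δ₂) a := by rw [abs_of_pos (by linarith)]; linarith
    have hd1 : |y - a| < δ₁ := hd.trans_le ((min_le_left _ _).trans (min_le_left _ _))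
    have hmem : ∀ v ∈ Set.uIcc y a, |v - a| < δ₁ := by
      intro v hv
      rw [Set.uIcc_of_ge hy1.le] at hv
      refine lt_of_le_of_lt ?_ hd1
      rw [abs_of_nonneg (by linarith [hv.1]), abs_of_pos (by linarith)]; linarith [hv.2]
    have hcb : X y ≤ b := by
      have := hXlt a y (by simpa using hδ₁) hd1 hy1
      rw [hXb] at this; exact this.le
    rw [inner_phase_integral hA (hX y hd1).2.1 hcb (hX y hd1).1]
    -- The same substitutions above the turning value. Now y - a is factored out, while the
    -- remaining function of y is unchanged; hence a single coordinate serves both phases.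
    have hcv := intervalIntegral.integral_comp_mul_deriv (a := y) (b := a)
      (g := fun u => Real.sqrt (y ^ 2 - A u ^ 2)) (fun v hv => (hX v (hmem v hv)).2.2.1)
      (fun v hv => (hX v (hmem v hv)).2.2.2.continuousWithinAt)
      (by have := hA.continuous; fun_prop)
    rw [hXb] at hcv
    rw [← hcv]
    have hsc := intervalIntegral.smul_integral_comp_add_mul (a := 0) (b := 1)
      (fun v => ((fun u => Real.sqrt (y ^ 2 - A u ^ 2)) ∘ X) v * deriv X v) (a - y) y
    rw [mul_zero, add_zero, mul_one, add_sub_cancel] at hsc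
    rw [← hsc, smul_eq_mul, hpow _ (by linarith)]
    have : ∀ τ ∈ Set.uIcc (0 : ℝ) 1,
        (((fun u => Real.sqrt (y ^ 2 - A u ^ 2)) ∘ X) (y + (a - y) * τ) * deriv X (y + (a - y) * τ)) =
        -Real.sqrt (y - a) * (Real.sqrt τ *
          Real.sqrt (2 * y + (a - y) * τ) * -deriv X (y + (a - y) * τ)) := by
      intro τ hτ
      rw [Set.uIcc_of_le zero_le_one] at hτ
      have hv : |y + (a - y) * τ - a| < δ₁ := by
        refine lt_of_le_of_lt ?_ hd1
        rw [show y + (a - y) * τ - a = (y - a) * (1 - τ) by ring, abs_mul, abs_of_nonneg (by linarith [hτ.2] : 0 ≤ 1 - τ)]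
        exact mul_le_of_le_one_right (abs_nonneg _) (by linarith [hτ.1])
      have hay : 0 ≤ y - a := by linarith
      simp only [Function.comp_apply]
      rw [(hX _ hv).1, show y ^ 2 - (y + (a - y) * τ) ^ 2 = ((y - a) * τ) * (2 * y + (a - y) * τ) by ring,
        Real.sqrt_mul (mul_nonneg hay hτ.1), Real.sqrt_mul hay]
      ring
    rw [intervalIntegral.integral_congr this, intervalIntegral.integral_const_mul]
    ring

/-- The smooth factor of the phase at the turning value `a`. -/
def phaseFactor (G : ℂ → ℂ) (a : ℝ) (w : ℂ) : ℂ :=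
  2 * ∫ τ in (0 : ℝ)..1, (Real.sqrt τ : ℂ) * (2 * w + (a - w) * τ) ^ (1 / 2 : ℂ) * G (w + (a - w) * τ)

lemma mem_ball_segment {a δ : ℝ} {w : ℂ} (hw : w ∈ Metric.ball (a : ℂ) δ) {τ : ℝ}
    (hτ : τ ∈ Set.Icc (0 : ℝ) 1) : w + (a - w) * τ ∈ Metric.ball (a : ℂ) δ := by
  rw [mem_ball_iff_norm] at hw ⊢
  rw [show w + (a - w) * τ - a = (w - a) * ((1 - τ : ℝ) : ℂ) by push_cast; ring, Complex.norm_mul,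
    Complex.norm_real, Real.norm_of_nonneg (by linarith [hτ.2])]
  exact (mul_le_of_le_one_right (norm_nonneg _) (by linarith [hτ.1])).trans_lt hw

lemma re_pos_of_mem_ball {a δ : ℝ} (hδ : δ ≤ a) {w : ℂ} (hw : w ∈ Metric.ball (a : ℂ) δ) : 0 < w.re := by
  rw [mem_ball_iff_norm] at hw
  have := (abs_re_le_norm (w - a)).trans_lt hw
  rw [sub_re, ofReal_re, abs_lt] at this
  linarith

/-- The point is the sum of w and a point of the segment from w to a, both in the right half-plane.
-/
lemma segment_mem_slitPlane {a δ : ℝ} (hδ : δ ≤ a) {w : ℂ} (hw : w ∈ Metric.ball (a : ℂ) δ) {τ : ℝ}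
    (hτ : τ ∈ Set.Icc (0 : ℝ) 1) : 2 * w + (a - w) * τ ∈ slitPlane := by
  rw [mem_slitPlane_iff]; left
  have h1 := re_pos_of_mem_ball hδ hw
  have h2 := re_pos_of_mem_ball hδ (mem_ball_segment hw hτ)
  rw [show 2 * w + (a - w) * τ = w + (w + (a - w) * τ) by ring, add_re]
  linarith

/-- Differentiation under the integral sign, with a bound from compactness of a closed ball times
[0, 1]. The parameter τ has turned the moving endpoint y and the square root singularity there into
a fixed interval and a fixed weight √τ. -/
lemma differentiableOn_phaseFactor {G : ℂ → ℂ} {a δ : ℝ} (hδ : δ ≤ a)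
    (hG : DifferentiableOn ℂ G (Metric.ball (a : ℂ) δ)) :
    DifferentiableOn ℂ (phaseFactor G a) (Metric.ball (a : ℂ) δ) := by
  intro w₀ hw₀
  obtain ⟨ε, hε, hεsub⟩ := Metric.nhds_basis_closedBall.mem_iff.1 (Metric.isOpen_ball.mem_nhds hw₀)
  have hG' : ContinuousOn (deriv G) (Metric.ball (a : ℂ) δ) :=
    (hG.deriv Metric.isOpen_ball).continuousOn
  set K : Set (ℂ × ℝ) := Metric.closedBall w₀ ε ×ˢ Set.Icc (0 : ℝ) 1 with hK
  have hKc : IsCompact K := (isCompact_closedBall _ _).prod isCompact_Icc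
  set F : ℂ → ℝ → ℂ := fun w τ =>
    (Real.sqrt τ : ℂ) * (2 * w + (a - w) * τ) ^ (1 / 2 : ℂ) * G (w + (a - w) * τ) with hF
  set F' : ℂ → ℝ → ℂ := fun w τ =>
    (Real.sqrt τ : ℂ) * ((1 / 2 : ℂ) * (2 * w + (a - w) * τ) ^ ((1 / 2 : ℂ) - 1) * (2 - τ)) *
      G (w + (a - w) * τ) + (Real.sqrt τ : ℂ) * (2 * w + (a - w) * τ) ^ (1 / 2 : ℂ) *
      (deriv G (w + (a - w) * τ) * (1 - τ)) with hF'
  have hmaps : Set.MapsTo (fun p : ℂ × ℝ => p.1 + (a - p.1) * (p.2 : ℂ)) K (Metric.ball (a : ℂ) δ) :=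
    fun p hp => mem_ball_segment (hεsub hp.1) hp.2
  have c0 : ContinuousOn (fun p : ℂ × ℝ => p.1 + (a - p.1) * (p.2 : ℂ)) K := by fun_prop
  have cs : ContinuousOn (fun p : ℂ × ℝ => (Real.sqrt p.2 : ℂ)) K := by fun_prop
  have cp : ∀ c : ℂ, ContinuousOn (fun p : ℂ × ℝ => (2 * p.1 + (a - p.1) * (p.2 : ℂ)) ^ c) K := fun c =>
    ContinuousOn.cpow_const (by fun_prop) fun p hp => segment_mem_slitPlane hδ (hεsub hp.1) hp.2
  have cF : ContinuousOn (fun p : ℂ × ℝ => F p.1 p.2) K :=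
    (cs.mul (cp _)).mul (hG.continuousOn.comp c0 hmaps)
  have cF' : ContinuousOn (fun p : ℂ × ℝ => F' p.1 p.2) K := by
    refine ((cs.mul ((continuousOn_const.mul (cp _)).mul ?_)).mul (hG.continuousOn.comp c0 hmaps)).add
      ((cs.mul (cp _)).mul ((hG'.comp c0 hmaps).mul ?_)) <;> fun_prop
  obtain ⟨M, hM⟩ := hKc.exists_bound_of_continuousOn cF'
  have hsec : ∀ w ∈ Metric.closedBall w₀ ε, ContinuousOn (F w) (Set.Icc 0 1) := fun w hw =>
    cF.comp (f := fun τ : ℝ => (w, τ)) (by fun_prop) fun τ hτ => ⟨hw, hτ⟩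
  have hsec' : ContinuousOn (F' w₀) (Set.Icc 0 1) :=
    cF'.comp (f := fun τ : ℝ => (w₀, τ)) (by fun_prop) fun τ hτ => ⟨Metric.mem_closedBall_self hε.le, hτ⟩
  have huI : Set.uIoc (0 : ℝ) 1 ⊆ Set.Icc 0 1 := by
    rw [Set.uIoc_of_le zero_le_one]; exact Set.Ioc_subset_Icc_self
  have main := (intervalIntegral.hasDerivAt_integral_of_dominated_loc_of_deriv_le (F := F) (F' := F')
    (x₀ := w₀) (a := 0) (b := 1) (μ := volume) (bound := fun _ => M) (Metric.closedBall_mem_nhds w₀ hε)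
    (by
      filter_upwards [Metric.closedBall_mem_nhds w₀ hε] with w hw
      exact ((hsec w hw).mono huI).aestronglyMeasurable measurableSet_uIoc)
    ((hsec w₀ (Metric.mem_closedBall_self hε.le)).intervalIntegrable_of_Icc zero_le_one)
    ((hsec'.mono huI).aestronglyMeasurable measurableSet_uIoc)
    (Eventually.of_forall fun τ hτ w hw => hM (w, τ) ⟨hw, huI hτ⟩)
    intervalIntegrable_const
    (Eventually.of_forall fun τ hτ w hw => by
      have hs := segment_mem_slitPlane hδ (hεsub hw) (huI hτ)
      have hb := mem_ball_segment (hεsub hw) (huI hτ)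
      have d1 : HasDerivAt (fun w : ℂ => 2 * w + (a - w) * τ) (2 - τ) w :=
        (((hasDerivAt_id w).const_mul 2).add (((hasDerivAt_id w).const_sub (a : ℂ)).mul_const (τ : ℂ))).congr_deriv
          (by ring)
      have d2 : HasDerivAt (fun w : ℂ => w + (a - w) * τ) (1 - τ) w :=
        ((hasDerivAt_id w).add (((hasDerivAt_id w).const_sub (a : ℂ)).mul_const (τ : ℂ))).congr_deriv
          (by ring)
      have d3 : HasDerivAt G (deriv G (w + (a - w) * τ)) (w + (a - w) * τ) :=
        (hG.differentiableAt (Metric.isOpen_ball.mem_nhds hb)).hasDerivAt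
      exact ((d1.cpow_const (c := (1 / 2 : ℂ)) hs).const_mul (Real.sqrt τ : ℂ)).mul
        (d3.comp w d2))).2
  exact (main.const_mul 2).differentiableAt.differentiableWithinAt

lemma phaseFactor_ofReal {G : ℂ → ℂ} {G₀ : ℝ → ℝ} {a δ : ℝ} (hδ : δ ≤ a)
    (hG : ∀ v : ℝ, |v - a| < δ → G v = G₀ v) {y : ℝ} (hy : |y - a| < δ) :
    phaseFactor G a y = ((2 * ∫ τ in (0 : ℝ)..1, Real.sqrt τ *
          Real.sqrt (2 * y + (a - y) * τ) * G₀ (y + (a - y) * τ) : ℝ) : ℂ) := by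
  rw [phaseFactor, ofReal_mul, ← intervalIntegral.integral_ofReal, ofReal_ofNat]
  congr 1
  refine intervalIntegral.integral_congr fun τ hτ => ?_
  rw [Set.uIcc_of_le zero_le_one] at hτ
  have hb : (y : ℂ) ∈ Metric.ball (a : ℂ) δ := by
    rw [mem_ball_iff_norm, ← ofReal_sub, Complex.norm_real]; exact hy
  have h1 := mem_ball_segment hb hτ
  have h2 := re_pos_of_mem_ball hδ hb
  have h3 := re_pos_of_mem_ball hδ h1
  have e1 : (y : ℂ) + (a - y) * τ = ((y + (a - y) * τ : ℝ) : ℂ) := by push_cast; ring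
  have e2 : 2 * (y : ℂ) + (a - y) * τ = ((2 * y + (a - y) * τ : ℝ) : ℂ) := by push_cast; ring
  rw [e1, mem_ball_iff_norm, ← ofReal_sub, Complex.norm_real] at h1
  rw [e1, ofReal_re] at h3
  rw [ofReal_re] at h2
  rw [e1, e2, hG _ h1, Real.sqrt_eq_rpow (2 * y + _), ofReal_mul, ofReal_mul, ofReal_cpow (by linarith)]
  norm_num

/-- At w = a everything but √τ becomes constant in τ, and the value is a positive multiple of √(2a)
G₀(a). -/
lemma phaseFactor_self_pos {G : ℂ → ℂ} {G₀ : ℝ → ℝ} {a δ : ℝ} (hδ0 : 0 < δ) (hδ : δ ≤ a)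
    (hG : ∀ v : ℝ, |v - a| < δ → G v = G₀ v) (h0 : 0 < G₀ a) :
    0 < (phaseFactor G a a).re ∧ (phaseFactor G a a).im = 0 := by
  rw [phaseFactor_ofReal hδ hG (by simpa using hδ0), ofReal_re, ofReal_im]
  refine ⟨?_, rfl⟩
  have ha : 0 < a := by linarith
  simp only [sub_self, zero_mul, add_zero, mul_assoc]
  rw [intervalIntegral.integral_mul_const]
  have : 0 < ∫ τ in (0 : ℝ)..1, Real.sqrt τ :=
    intervalIntegral.intervalIntegral_pos_of_pos_on (Real.continuous_sqrt.intervalIntegrable _ _)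
      (fun τ hτ => Real.sqrt_pos.2 hτ.1) zero_lt_one
  positivity

/-! ### The conformal coordinate -/

/-- The conformal coordinate in the rotated variable. -/
def coordinate (H : ℂ → ℂ) (a : ℝ) (w : ℂ) : ℂ := (a - w) * exp (2 / 3 * log (H w))

lemma hasDerivAt_coordinate {H : ℂ → ℂ} {a : ℝ} {w : ℂ} (hd : DifferentiableAt ℂ H w)
    (hs : H w ∈ slitPlane) :
    HasDerivAt (coordinate H a) (-exp (2 / 3 * log (H w)) +
      (a - w) * (exp (2 / 3 * log (H w)) * (2 / 3 * (deriv H w / H w)))) w := by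
  refine (((hasDerivAt_id w).const_sub (a : ℂ)).mul
    (((hd.hasDerivAt.clog hs).const_mul (2 / 3 : ℂ)).cexp)).congr_deriv ?_
  simp only [id_eq, neg_one_mul]

/-- A holomorphic map which is real on the real axis, and whose derivative has negative real part,
reverses the sign of the imaginary part. -/
lemma im_neg_of_deriv_re_neg {ψ : ℂ → ℂ} {a r : ℝ} (hψ : DifferentiableOn ℂ ψ (Metric.ball (a : ℂ) r))
    (hd : ∀ w ∈ Metric.ball (a : ℂ) r, (deriv ψ w).re < 0)
    (hreal : ∀ v : ℝ, |v - a| < r → (ψ v).im = 0) {w : ℂ} (hw : w ∈ Metric.ball (a : ℂ) r) :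
    (0 < w.im → (ψ w).im < 0) ∧ (w.im < 0 → 0 < (ψ w).im) := by
  -- The vertical chord through w. Along it the derivative of Im ψ is Re ψ' < 0, and Im ψ vanishes
  -- where the chord meets the real axis.
  set S : Set ℝ := {t | (w.re : ℂ) + t * I ∈ Metric.ball (a : ℂ) r} with hS
  have hline : ∀ t : ℝ, t ∈ S ↔ (w.re - a) ^ 2 + t ^ 2 < r ^ 2 ∧ 0 < r := by
    intro t
    have e : ‖(w.re : ℂ) + t * I - a‖ ^ 2 = (w.re - a) ^ 2 + t ^ 2 := by
      rw [← normSq_eq_norm_sq, normSq_apply]; simp; ring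
    rw [hS, Set.mem_ofPred_eq, mem_ball_iff_norm, ← e]
    constructor
    · intro h
      have h0 := norm_nonneg ((w.re : ℂ) + t * I - a)
      exact ⟨by nlinarith, by linarith⟩
    · rintro ⟨h, h0⟩
      exact lt_of_pow_lt_pow_left₀ 2 h0.le h
  have hwS : w.im ∈ S := by rw [hS, Set.mem_ofPred_eq, re_add_im]; exact hw
  have hmono : ∀ t s : ℝ, s ∈ S → |t| ≤ |s| → t ∈ S := by
    intro t s hs hts
    rw [hline] at hs ⊢
    have := sq_le_sq.2 hts
    exact ⟨by linarith [hs.1], hs.2⟩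
  have h0S : (0 : ℝ) ∈ S := hmono 0 _ hwS (by simp)
  have hder : ∀ t ∈ S, HasDerivAt (fun t : ℝ => (ψ ((w.re : ℂ) + t * I)).im)
      (deriv ψ ((w.re : ℂ) + t * I)).re t := by
    intro t ht
    have h1 : HasDerivAt (fun t : ℝ => (w.re : ℂ) + t * I) (1 * I) t :=
      (((hasDerivAt_id t).ofReal_comp).mul_const I).const_add _
    have h2 := (hψ.differentiableAt (Metric.isOpen_ball.mem_nhds ht)).hasDerivAt.comp t h1
    have h3 := (imCLM.hasFDerivAt.comp_hasDerivAt t h2)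
    refine h3.congr_deriv ?_
    simp
  have hz : (ψ ((w.re : ℂ) + (0 : ℝ) * I)).im = 0 := by
    rw [ofReal_zero, zero_mul, add_zero]
    refine hreal _ ?_
    have := h0S
    rw [hS, Set.mem_ofPred_eq, ofReal_zero, zero_mul, add_zero, mem_ball_iff_norm, ← ofReal_sub,
      Complex.norm_real] at this
    exact this
  have hconv : Convex ℝ S := by
    intro s hs t ht α β hα hβ hαβ
    rw [hline] at hs ht ⊢
    refine ⟨?_, hs.2⟩
    simp only [smul_eq_mul]
    have : (α * s + β * t) ^ 2 ≤ α * s ^ 2 + β * t ^ 2 := by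
      have hb : β = 1 - α := by linarith
      subst hb
      nlinarith [mul_nonneg hα hβ, sq_nonneg (s - t), mul_nonneg (mul_nonneg hα hβ) (sq_nonneg (s - t))]
    have h5 := mul_le_mul_of_nonneg_left hs.1.le hα
    have hα1 : α * ((w.re - a) ^ 2 + s ^ 2) + β * ((w.re - a) ^ 2 + t ^ 2) < r ^ 2 := by
      rcases eq_or_lt_of_le hα with h | h
      · rw [← h] at hαβ ⊢; rw [zero_add] at hαβ; rw [hαβ]; linarith [ht.1]
      · have := mul_lt_mul_of_pos_left hs.1 h
        have := mul_le_mul_of_nonneg_left ht.1.le hβ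
        nlinarith
    have : (α + β) * (w.re - a) ^ 2 = (w.re - a) ^ 2 := by rw [hαβ, one_mul]
    nlinarith
  have hanti : StrictAntiOn (fun t : ℝ => (ψ ((w.re : ℂ) + t * I)).im) S := by
    refine strictAntiOn_of_deriv_neg hconv (fun t ht => (hder t ht).continuousAt.continuousWithinAt) ?_
    intro t ht
    have ht' : t ∈ S := interior_subset ht
    rw [(hder t ht').deriv]
    exact hd _ ht'
  constructor
  · intro h
    have := hanti h0S hwS h
    simp only [hz, re_add_im] at this
    exact this
  · intro h
    have := hanti hwS h0S h
    simp only [hz, re_add_im] at this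
    exact this

/-- Near a real point where `H` is positive, the coordinate is conformal. -/
lemma exists_coordinate_ball {H : ℂ → ℂ} {a δ M : ℝ} (hδ : 0 < δ) (hM : 0 < M)
    (hH : DifferentiableOn ℂ H (Metric.ball (a : ℂ) δ)) (hHa : 0 < (H a).re) (hHa' : (H a).im = 0)
    (hreal : ∀ v : ℝ, |v - a| < δ → (H v).im = 0) :
    ∃ r > 0, r ≤ δ ∧ r < M ∧ (∀ w ∈ Metric.ball (a : ℂ) r, 0 < (H w).re ∧ |(H w).arg| < Real.pi / 4) ∧
      DifferentiableOn ℂ (coordinate H a) (Metric.ball (a : ℂ) r) ∧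
      Set.InjOn (coordinate H a) (Metric.ball (a : ℂ) r) ∧
      ∀ w ∈ Metric.ball (a : ℂ) r, (0 < w.im → (coordinate H a w).im < 0) ∧
        (w.im < 0 → 0 < (coordinate H a w).im) := by
  have hHd : DifferentiableAt ℂ H a := hH.differentiableAt (Metric.ball_mem_nhds _ hδ)
  have hHc := hHd.continuousAt
  have hs : H a ∈ slitPlane := by rw [mem_slitPlane_iff]; left; exact hHa
  have harg : (H a).arg = 0 := arg_eq_zero_iff.2 ⟨hHa.le, hHa'⟩
  have e1 : ∀ᶠ w in 𝓝 (a : ℂ), 0 < (H w).re :=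
    (continuous_re.continuousAt.comp hHc).eventually (lt_mem_nhds hHa)
  have e2 : ∀ᶠ w in 𝓝 (a : ℂ), |(H w).arg| < Real.pi / 4 := by
    have : ContinuousAt (fun w => |(H w).arg|) a := ((continuousAt_arg hs).comp hHc).abs
    refine this.eventually (gt_mem_nhds ?_)
    simp only [harg, abs_zero]; positivity
  have e3 : ∀ᶠ w in 𝓝 (a : ℂ), DifferentiableAt ℂ (coordinate H a) w := by
    filter_upwards [e1, Metric.ball_mem_nhds _ hδ] with w h1 h2
    exact (hasDerivAt_coordinate (hH.differentiableAt (Metric.isOpen_ball.mem_nhds h2))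
      (mem_slitPlane_iff.2 (Or.inl h1))).differentiableAt
  have hAn : AnalyticAt ℂ (coordinate H a) a := analyticAt_iff_eventually_differentiableAt.2 e3
  have hda : deriv (coordinate H a) a = -exp (2 / 3 * log (H a)) := by
    rw [(hasDerivAt_coordinate hHd hs).deriv, sub_self, zero_mul, add_zero]
  have hda' : (deriv (coordinate H a) a).re < 0 := by
    have : (2 / 3 * log (H a) : ℂ).im = 0 := by
      rw [show (2 / 3 : ℂ) = ((2 / 3 : ℝ) : ℂ) by push_cast; rfl, im_ofReal_mul, log_im, harg, mul_zero]
    rw [hda, neg_re, exp_re, this, Real.cos_zero, mul_one, neg_lt_zero]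
    exact Real.exp_pos _
  have hne : deriv (coordinate H a) a ≠ 0 := by intro h; rw [h] at hda'; simp at hda'
  have e4 : ∀ᶠ w in 𝓝 (a : ℂ), (deriv (coordinate H a) w).re < 0 :=
    (continuous_re.continuousAt.comp hAn.deriv.continuousAt).eventually (gt_mem_nhds hda')
  -- A local left inverse, valid on a whole neighbourhood, gives injectivity on the ball.
  have e5 : ∀ᶠ w in 𝓝 (a : ℂ),
      hAn.hasStrictDerivAt.localInverse _ _ _ hne (coordinate H a w) = w :=
    HasStrictDerivAt.eventually_left_inverse ..
  obtain ⟨ε, hε, h⟩ := Metric.eventually_nhds_iff_ball.1 (e1.and (e2.and (e3.and (e4.and e5))))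
  -- Halving M makes the required inequality r < M strict.
  have hsub : Metric.ball (a : ℂ) (min (min ε δ) (M / 2)) ⊆ Metric.ball (a : ℂ) ε :=
    Metric.ball_subset_ball ((min_le_left _ _).trans (min_le_left _ _))
  have hdiff : DifferentiableOn ℂ (coordinate H a) (Metric.ball (a : ℂ) (min (min ε δ) (M / 2))) :=
    fun w hw => (h w (hsub hw)).2.2.1.differentiableWithinAt
  refine ⟨min (min ε δ) (M / 2), by positivity, (min_le_left _ _).trans (min_le_right _ _),
    (min_le_right _ _).trans_lt (by linarith), fun w hw => ⟨(h w (hsub hw)).1, (h w (hsub hw)).2.1⟩,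
    hdiff, fun w hw w' hw' heq => ?_, fun w hw => im_neg_of_deriv_re_neg hdiff
      (fun w hw => (h w (hsub hw)).2.2.2.1) (fun v hv => ?_) hw⟩
  · rw [← (h w (hsub hw)).2.2.2.2, heq, (h w' (hsub hw')).2.2.2.2]
  · have hv' : (v : ℂ) ∈ Metric.ball (a : ℂ) ε := hsub (by
      rw [mem_ball_iff_norm, ← ofReal_sub, Complex.norm_real]; exact hv)
    have him := hreal v (hv.trans_le ((min_le_left _ _).trans (min_le_right _ _)))
    have hre := (h v hv').1
    have : H v = ((H v).re : ℂ) := by rw [← re_add_im (H v), him]; simp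
    rw [coordinate, this, ← ofReal_log hre.le, ← ofReal_sub,
      show (2 / 3 : ℂ) = ((2 / 3 : ℝ) : ℂ) by push_cast; rfl, ← ofReal_mul, ← ofReal_exp, ← ofReal_mul,
      ofReal_im]

/-! ### The outer model near the endpoint -/

lemma abs_arg_sub_arg_lt {p q : ℂ} (h : 0 < p.im ∧ 0 < q.im ∨ p.im < 0 ∧ q.im < 0) :
    |p.arg - q.arg| < Real.pi := by
  rcases h with ⟨hp, hq⟩ | ⟨hp, hq⟩
  · have h1 := log_im_mem hp
    have h2 := log_im_mem hq
    rw [log_im] at h1 h2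
    rw [abs_lt]; constructor <;> linarith
  · have h1 := arg_neg_iff.2 hp
    have h2 := arg_neg_iff.2 hq
    have h3 := neg_pi_lt_arg p
    have h4 := neg_pi_lt_arg q
    rw [abs_lt]; constructor <;> linarith

/-- Two points of the same open half-plane have arguments less than π apart, so no multiple of 2πi
intervenes. -/
lemma log_div_of_im {p q : ℂ} (h : 0 < p.im ∧ 0 < q.im ∨ p.im < 0 ∧ q.im < 0) :
    log (p / q) = log p - log q := by
  have hp : p ≠ 0 := by rintro rfl; simp at h
  have hq : q ≠ 0 := by rintro rfl; simp at h
  have h1 := abs_lt.1 (abs_arg_sub_arg_lt h)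
  have e : p / q = exp (log p - log q) := by rw [exp_sub, exp_log hp, exp_log hq]
  rw [e, log_exp]
  · rw [sub_im, log_im, log_im]; exact h1.1
  · rw [sub_im, log_im, log_im]; exact h1.2.le

lemma im_sub_add_sign {w : ℂ} (hw : w.im ≠ 0) (a : ℝ) :
    0 < (w + a).im ∧ 0 < (w - a).im ∨ (w + a).im < 0 ∧ (w - a).im < 0 := by
  rcases lt_or_gt_of_ne hw with h | h
  · right; simpa using h
  · left; simpa using h

lemma eq_I_mul_rotate (z : ℂ) : z = I * (-I * z) := by linear_combination z * I_mul_I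

lemma beta_eq_exp (a : ℝ) {z : ℂ} (hz : z.re ≠ 0) :
    beta a z = exp ((log (-I * z + a) - log (-I * z - a)) / 4) := by
  have hw := im_ne_of_rotate hz
  have hs := im_sub_add_sign hw a
  set w := -I * z with hwdef
  have hp : w + a ≠ 0 := by intro h; rw [h] at hs; simp at hs
  have hq : w - a ≠ 0 := by intro h; rw [h] at hs; simp at hs
  have e : (z + I * a) / (z - I * a) = (w + a) / (w - a) := by
    rw [eq_I_mul_rotate z, ← hwdef, ← mul_add, ← mul_sub, mul_div_mul_left _ _ I_ne_zero]
  rw [beta, e, cpow_def_of_ne_zero (div_ne_zero hp hq), log_div_of_im hs]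
  congr 1; ring

lemma upperRoot_conj {w : ℂ} (hw : w.im ≠ 0) (v : ℝ) :
    upperRoot ((starRingEnd ℂ) w) v = (starRingEnd ℂ) (upperRoot w v) := by
  have h1 : (w - v).arg ≠ Real.pi := fun h => hw (by simpa using (arg_eq_pi_iff.1 h).2)
  have h2 : (w + v).arg ≠ Real.pi := fun h => hw (by simpa using (arg_eq_pi_iff.1 h).2)
  rw [upperRoot, upperRoot, ← exp_conj, map_div₀, map_add, ← log_conj _ h1, ← log_conj _ h2, map_sub,
    map_add, conj_ofReal, show (starRingEnd ℂ) 2 = (2 : ℂ) from Complex.conj_ofNat 2]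

/-- To the left of the imaginary axis w = -iz lies in the first quadrant and `root_eq_upperRoot`
applies. To the right it is conjugated there; the principal power commutes with conjugation because
its base is not real. -/
lemma R_eq_upperRoot {a : ℝ} (ha : 0 < a) {z : ℂ} (hz : z.re ≠ 0) (hi : 0 < z.im) :
    R a z = -I * upperRoot (-I * z) a := by
  rw [R_rotate]
  set w := -I * z with hwdef
  have hr : 0 < w.re := by simpa [hwdef] using hi
  have hw : w.im ≠ 0 := im_ne_of_rotate hz
  congr 1
  rcases lt_or_gt_of_ne hw with h | h
  · have h1 := root_eq_upperRoot (w := (starRingEnd ℂ) w) (by simpa using h) (by simpa using hr) ha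
    rw [upperRoot_conj hw] at h1
    have h2 := congrArg (starRingEnd ℂ) h1
    have hhalf : (starRingEnd ℂ) (1 / 2 : ℂ) = 1 / 2 := by
      rw [map_div₀, map_one, Complex.conj_ofNat]
    rw [conj_conj, map_mul, conj_conj, ← hhalf, ← conj_cpow] at h2
    · rw [← h2]
      simp only [map_sub, map_one, map_div₀, map_pow, conj_ofReal, conj_conj]
    · intro h3
      have h4 := (arg_eq_pi_iff.1 h3).2
      have h5 : (1 - (a : ℂ) ^ 2 / (starRingEnd ℂ) w ^ 2).im =
          a ^ 2 * (((starRingEnd ℂ) w ^ 2).im / normSq ((starRingEnd ℂ) w ^ 2)) := by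
        rw [sub_im, one_im, div_eq_mul_inv, ← ofReal_pow, im_ofReal_mul, inv_im]; ring
      rw [h5] at h4
      have hw0 : (starRingEnd ℂ) w ≠ 0 := by
        rw [Ne, map_eq_zero]; rintro h6; rw [h6] at hr; simp at hr
      have h7 : 0 < normSq ((starRingEnd ℂ) w ^ 2) := normSq_pos.2 (pow_ne_zero 2 hw0)
      have h8 : 0 < ((starRingEnd ℂ) w ^ 2).im := by
        rw [sq, mul_im, conj_re, conj_im]; nlinarith [mul_pos hr (neg_pos.2 h)]
      have : 0 < a ^ 2 * (((starRingEnd ℂ) w ^ 2).im / normSq ((starRingEnd ℂ) w ^ 2)) := by positivity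
      linarith
  · exact root_eq_upperRoot h hr ha

/-- The logarithms in β² and R add up so that β²R = -(z + ia). This eliminates R, and only β and its
inverse remain. -/
lemma Otilde_eq {a : ℝ} (ha : 0 < a) {z : ℂ} (hz : z.re ≠ 0) (hi : 0 < z.im) :
    Otilde a z = (1 / 2 : ℂ) • !![(beta a z)⁻¹ + beta a z, (beta a z)⁻¹ - beta a z;
      (beta a z)⁻¹ - beta a z, (beta a z)⁻¹ + beta a z] ∧ beta a z ≠ 0 := by
  have hb0 : beta a z ≠ 0 := by rw [beta_eq_exp a hz]; exact exp_ne_zero _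
  have hR0 : R a z ≠ 0 := by
    rw [R_eq_upperRoot ha hz hi]
    exact mul_ne_zero (neg_ne_zero.2 I_ne_zero) (upperRoot_ne_zero _ _)
  have hs := im_sub_add_sign (im_ne_of_rotate hz) a
  have hp : -I * z + a ≠ 0 := by intro h; rw [h] at hs; simp at hs
  have hb2 : beta a z ^ 2 * R a z = -(z + I * a) := by
    rw [beta_eq_exp a hz, ← exp_nat_mul, R_eq_upperRoot ha hz hi, upperRoot, mul_left_comm, ← exp_add,
      show ((2 : ℕ) : ℂ) * ((log (-I * z + a) - log (-I * z - a)) / 4) +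
        (log (-I * z - a) + log (-I * z + a)) / 2 = log (-I * z + a) by push_cast; ring, exp_log hp]
    linear_combination z * I_mul_I
  refine ⟨?_, hb0⟩
  have e1 : z + I * a = -(beta a z ^ 2 * R a z) := by rw [hb2, neg_neg]
  have e2 : R a z - z - I * a = R a z + beta a z ^ 2 * R a z := by linear_combination -e1
  have e3 : R a z + z + I * a = R a z - beta a z ^ 2 * R a z := by linear_combination e1
  rw [Otilde, e2, e3]
  ext i j
  fin_cases i <;> fin_cases j <;> simp <;> field_simp

/-! ### Construction of the endpoint data -/

/-- The data of the local analysis at the endpoint. -/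
structure EndpointData (A : ℝ → ℝ) (x r : ℝ) (Θ φ e : ℂ → ℂ) : Prop where
  map : IsEndpointMap A x r Θ φ
  im_neg : ∀ z ∈ Metric.ball (I * A x) r, z.re < 0 → (φ z).im < 0
  im_pos : ∀ z ∈ Metric.ball (I * A x) r, 0 < z.re → 0 < (φ z).im
  differentiable : DifferentiableOn ℂ e (Metric.ball (I * A x) r)
  ne_zero : ∀ z, e z ≠ 0
  beta_mul : ∀ z ∈ Metric.ball (I * A x) r, z.re ≠ 0 → beta (A x) z * exp (log (-φ z) / 4) = e z
  theta_eq_cpow : ∀ z ∈ Metric.ball (I * A x) r, z.re ≠ 0 → |(φ z).arg| < Real.pi / 3 →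
    Θ z = φ z ^ (3 / 2 : ℂ)
  boundary : ∀ y : ℝ, |y - A x| < r → ∃ t : ℝ, φ (y * I) = t ∧
    theta A x (y * I) = ((max t 0 ^ (3 / 2 : ℝ) : ℝ) : ℂ) ∧
    phiTilde A x (y * I) = ((-max (-t) 0 ^ (3 / 2 : ℝ) : ℝ) : ℂ)
  center : φ (I * A x) = 0

lemma rotate_mem_ball {a r : ℝ} {z : ℂ} : -I * z ∈ Metric.ball (a : ℂ) r ↔ z ∈ Metric.ball (I * a) r := by
  rw [mem_ball_iff_norm, mem_ball_iff_norm]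
  have : -I * z - a = -I * (z - I * a) := by linear_combination -(a : ℂ) * I_mul_I
  rw [this, Complex.norm_mul, norm_neg, norm_I, one_mul]

/-- With w = -iλ the choices are φ = (a - w)H^{2/3}, Θ = (a - w)^{3/2}H and e = (w +
a)^{1/4}H^{1/6}. The last is what remains of β(-φ)^{1/4} when the powers of w - a cancel; the
logarithmic branches have to be matched on both sides of the axis, and the sign of Im φ decides
them. -/
lemma exists_endpointData {A : ℝ → ℝ} (hA : IsProfile A) {x : ℝ} (hx : x ≠ 0) :
    ∃ (r : ℝ) (Θ φ e : ℂ → ℂ), EndpointData A x r Θ φ e := by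
  have hb : 0 < |x| := abs_pos.2 hx
  obtain ⟨δ, hδ, G₀, G, hG, hGr, hG0, hδa, hth, hph⟩ := exists_phase_density hA hb
  rw [hA.abs_eq] at hG hGr hG0 hδa hth hph
  have hAtop : A x < A 0 := (hA.lt_iff x 0).2 (by simpa using hb)
  set a := A x with ha'
  have ha : 0 < a := hA.pos x
  set H := phaseFactor G a with hH
  have hHd := differentiableOn_phaseFactor hδa hG
  obtain ⟨hH1, hH2⟩ := phaseFactor_self_pos hδ hδa hGr hG0
  obtain ⟨r, hr, hrδ, hrM, hHarg, hcd, hcinj, hcim⟩ := exists_coordinate_ball (M := min a (A 0 - a)) hδ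
    (lt_min ha (by linarith)) hHd hH1 hH2 (fun v hv => by
      rw [phaseFactor_ofReal hδa hGr hv, ofReal_im])
  rw [← hH] at hHarg hcd hcinj hcim
  have hra : r < a := hrM.trans_le (min_le_left _ _)
  set W : ℂ → ℂ := fun z => -I * z with hW
  have hWd : Differentiable ℂ W := by fun_prop
  have hWI : ∀ y : ℝ, W (y * I) = y := fun y => by
    simp only [hW]; linear_combination -(y : ℂ) * I_mul_I
  have hHdr : DifferentiableOn ℂ H (Metric.ball (a : ℂ) r) := hHd.mono (Metric.ball_subset_ball hrδ)
  have hHs : ∀ w ∈ Metric.ball (a : ℂ) r, H w ∈ slitPlane := fun w hw =>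
    mem_slitPlane_iff.2 (Or.inl (hHarg w hw).1)
  have hmaps : Set.MapsTo W (Metric.ball (I * a) r) (Metric.ball (a : ℂ) r) := fun z hz =>
    rotate_mem_ball.2 hz
  have hwre : ∀ w ∈ Metric.ball (a : ℂ) r, 0 < w.re := fun w hw => re_pos_of_mem_ball hra.le hw
  have hHy : ∀ y : ℝ, |y - a| < r → ∃ h : ℝ, 0 < h ∧ H y = h ∧ h = 2 * ∫ τ in (0 : ℝ)..1, Real.sqrt τ *
          Real.sqrt (2 * y + (a - y) * τ) * G₀ (y + (a - y) * τ) := fun y hy => by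
    have h1 := phaseFactor_ofReal hδa hGr (hy.trans_le hrδ)
    have h2 := (hHarg y (by rw [mem_ball_iff_norm, ← ofReal_sub, Complex.norm_real]; exact hy)).1
    refine ⟨_, ?_, h1, rfl⟩
    rw [hH, h1, ofReal_re] at h2
    exact h2
  have hcy : ∀ y : ℝ, ∀ h : ℝ, 0 < h → H y = h →
      coordinate H a y = (((a - y) * h ^ (2 / 3 : ℝ) : ℝ) : ℂ) := fun y h hh hy => by
    rw [coordinate, hy, ← ofReal_log hh.le, Real.rpow_def_of_pos hh]
    push_cast
    ring_nf
  have hpow : ∀ t h : ℝ, 0 ≤ t → 0 < h → (t * h ^ (2 / 3 : ℝ)) ^ (3 / 2 : ℝ) = t ^ (3 / 2 : ℝ) * h :=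
    fun t h ht hh => by
      rw [Real.mul_rpow ht (by positivity), ← Real.rpow_mul hh.le]; norm_num
  have htheta0 : ∀ y : ℝ, a ≤ y → theta A x (y * I) = 0 := fun y hy => by
    rw [theta_eq_integral hA hx (ha.trans_le hy), setIntegral_eq_zero_of_forall_eq_zero, ofReal_zero]
    intro u hu
    have hu' : A u ≤ y := le_trans hu hy
    have := hA.pos u
    exact Real.sqrt_eq_zero_of_nonpos (by nlinarith)
  have hphi0 : ∀ y : ℝ, 0 < y → y ≤ a → phiTilde A x (y * I) = 0 := fun y hy0 hy => by
    rw [phiTilde_eq_integral hA hx hy0, setIntegral_eq_zero_of_forall_eq_zero, ofReal_zero, neg_zero]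
    intro u hu
    have hu' : y < A u := lt_of_le_of_lt hy hu
    exact Real.sqrt_eq_zero_of_nonpos (by nlinarith)
  have hthetay : ∀ y : ℝ, a - r < y → y < a → ∀ h : ℝ, h = (2 * ∫ τ in (0 : ℝ)..1, Real.sqrt τ *
          Real.sqrt (2 * y + (a - y) * τ) * G₀ (y + (a - y) * τ)) →
      theta A x (y * I) = (((a - y) ^ (3 / 2 : ℝ) * h : ℝ) : ℂ) := fun y hy1 hy2 h hh => by
    rw [theta_eq_integral hA hx (by linarith), hth y (by linarith) hy2, hh]
  have habs : ∀ y : ℝ, a - r < y → y < a → |y - a| < r := fun y h1 h2 => by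
    rw [abs_of_neg (by linarith)]; linarith
  have hΘy : ∀ y : ℝ, y < a → ∀ h : ℝ, H y = h →
      ((a : ℂ) - y) ^ (3 / 2 : ℂ) * H y = (((a - y) ^ (3 / 2 : ℝ) * h : ℝ) : ℂ) := fun y hy h hh => by
    rw [hh, ← ofReal_sub, show (3 / 2 : ℂ) = ((3 / 2 : ℝ) : ℂ) by push_cast; rfl,
      ← ofReal_cpow (by linarith), ← ofReal_mul]
  have hcut : ∀ z ∈ Metric.ball (I * a) r \ {z | z.re = 0 ∧ a ≤ z.im}, (a : ℂ) - W z ∈ slitPlane := by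
    rintro z ⟨-, hz⟩
    rw [mem_slitPlane_iff]
    by_contra hc
    push Not at hc
    refine hz ⟨?_, ?_⟩
    · simpa [hW] using hc.2
    · simpa [hW] using hc.1
  refine ⟨r, fun z => ((a : ℂ) - W z) ^ (3 / 2 : ℂ) * H (W z), fun z => coordinate H a (W z),
    fun z => exp (log (W z + a) / 4 + log (H (W z)) / 6), ?_⟩
  constructor
  · refine ⟨hr, hra, hrM.trans_le (min_le_right _ _), ?_, ?_, ?_, ?_, ?_, ?_⟩
    · intro z hz
      have h1 : AnalyticAt ℂ H (W z) := hHdr.analyticAt (Metric.isOpen_ball.mem_nhds (hmaps hz.1))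
      exact (((analyticAt_const.sub (hWd.analyticAt z)).cpow analyticAt_const (hcut z hz))).mul
        (h1.comp (hWd.analyticAt z))
    · intro y hy1 hy2
      obtain ⟨h, hh0, hh1, hh2⟩ := hHy y (habs y hy1 hy2)
      simp only [mul_comm I (y : ℂ), hWI]
      rw [hthetay y hy1 hy2 h hh2, hΘy y hy2 h hh1]
    · exact (hcd.comp hWd.differentiableOn hmaps).analyticOnNhd Metric.isOpen_ball
    · intro z hz z' hz' h
      have := hcinj (hmaps hz) (hmaps hz') h
      exact mul_left_cancel₀ (neg_ne_zero.2 I_ne_zero) this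
    · intro y hy1 hy2
      obtain ⟨h, hh0, hh1, hh2⟩ := hHy y (habs y hy1 hy2)
      simp only [mul_comm I (y : ℂ), hWI]
      have : 0 ≤ a - y := by linarith
      rw [hthetay y hy1 hy2 h hh2, hcy y h hh0 hh1, show (2 / 3 : ℂ) = ((2 / 3 : ℝ) : ℂ) by push_cast; rfl,
        ← ofReal_cpow (by positivity), Real.mul_rpow (by positivity) hh0.le, ← Real.rpow_mul this]
      norm_num
    · intro z hz
      have hs := slitPlane_ne_zero (hHs _ (hmaps hz.1))
      have h0 := slitPlane_ne_zero (hcut z hz)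
      simp only [coordinate]
      rw [mul_pow, mul_pow, ← exp_nat_mul, ← cpow_nat_mul, show ((3 : ℕ) : ℂ) * (2 / 3 * log (H (W z))) =
        ((2 : ℕ) : ℂ) * log (H (W z)) by push_cast; ring, exp_nat_mul, exp_log hs,
        show ((2 : ℕ) : ℂ) * (3 / 2 : ℂ) = ((3 : ℕ) : ℂ) by push_cast; norm_num, cpow_natCast]
  · intro z hz h
    exact (hcim _ (hmaps hz)).1 (by simpa [hW] using h)
  · intro z hz h
    exact (hcim _ (hmaps hz)).2 (by simpa [hW] using h)
  · refine DifferentiableOn.cexp (DifferentiableOn.add (DifferentiableOn.div_const (DifferentiableOn.clog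
      (by fun_prop) fun z hz => ?_) _) (DifferentiableOn.div_const (DifferentiableOn.clog
      (hHdr.comp hWd.differentiableOn hmaps) fun z hz => hHs _ (hmaps hz)) _))
    rw [mem_slitPlane_iff]; left
    have := hwre _ (hmaps hz)
    rw [add_re, ofReal_re]; linarith
  · intro z; exact exp_ne_zero _
  · intro z hz hzr
    have hw := im_ne_of_rotate hzr
    have hb := hmaps hz
    have hsg := im_sub_add_sign hw a
    have harg := abs_lt.1 (hHarg _ hb).2
    have hq : W z - a ≠ 0 := by intro h; simp only [hW] at h; rw [h] at hsg; simp at hsg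
    have hexp : -coordinate H a (W z) = exp (log (W z - a) + 2 / 3 * log (H (W z))) := by
      rw [exp_add, exp_log hq, coordinate]; ring
    have him : (log (W z - a) + 2 / 3 * log (H (W z))).im = (W z - a).arg + 2 / 3 * (H (W z)).arg := by
      rw [show (2 / 3 : ℂ) = ((2 / 3 : ℝ) : ℂ) by push_cast; rfl, add_im, im_ofReal_mul, log_im, log_im]
    -- The sum of arguments could leave (-π, π] only by less than π/6, near the cut of log(w - a).
    -- The sine of the sum would then contradict the sign of Im φ given by `hcim`.
    have hlog : log (-coordinate H a (W z)) = log (W z - a) + 2 / 3 * log (H (W z)) := by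
      have h1 := congrArg Complex.im hexp
      rw [neg_im, exp_im, him] at h1
      have hpos := Real.exp_pos (log (W z - a) + 2 / 3 * log (H (W z))).re
      rw [hexp, log_exp]
      · rw [him]
        by_contra hc
        push Not at hc
        have h5 := neg_pi_lt_arg (W z - a)
        have hwneg : (W z).im < 0 := by
          rcases hsg with h | h
          · have := arg_nonneg_iff.2 h.2.le; simp only [hW] at hc; linarith [Real.pi_pos]
          · simpa [hW] using h.2
        have h2 := (hcim _ hb).2 hwneg
        have h3 : 0 ≤ Real.sin ((W z - a).arg + 2 / 3 * (H (W z)).arg) := by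
          rw [← Real.sin_add_two_pi]
          exact Real.sin_nonneg_of_nonneg_of_le_pi (by linarith) (by linarith)
        have := mul_nonneg hpos.le h3
        linarith
      · rw [him]
        by_contra hc
        push Not at hc
        have hwpos : 0 < (W z).im := by
          rcases hsg with h | h
          · simpa [hW] using h.2
          · have := arg_neg_iff.2 h.2; simp only [hW] at hc; linarith [Real.pi_pos]
        have h2 := (hcim _ hb).1 hwpos
        have h5 := arg_le_pi (W z - a)
        have h3 : Real.sin ((W z - a).arg + 2 / 3 * (H (W z)).arg) ≤ 0 := by
          rw [← Real.sin_sub_two_pi]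
          exact Real.sin_nonpos_of_nonpos_of_neg_pi_le (by linarith) (by linarith)
        have := mul_nonpos_of_nonneg_of_nonpos hpos.le h3
        linarith
    rw [beta_eq_exp a hzr, hlog, ← exp_add]
    congr 1
    simp only [hW]
    ring
  · intro z hz hzr h
    have hb := hmaps hz
    have harg := abs_lt.1 (hHarg _ hb).2
    have hs := slitPlane_ne_zero (hHs _ hb)
    have hφ0 : coordinate H a (W z) ≠ 0 := by
      intro h0
      rcases lt_or_gt_of_ne (show (W z).im ≠ 0 from im_ne_of_rotate hzr) with h1 | h1
      · have := (hcim _ hb).2 h1; rw [h0] at this; simp at this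
      · have := (hcim _ hb).1 h1; rw [h0] at this; simp at this
    have hexp : (a : ℂ) - W z = exp (log (coordinate H a (W z)) - 2 / 3 * log (H (W z))) := by
      rw [exp_sub, exp_log hφ0, coordinate, mul_div_assoc, div_self (exp_ne_zero _), mul_one]
    have him : (log (coordinate H a (W z)) - 2 / 3 * log (H (W z))).im =
        (coordinate H a (W z)).arg - 2 / 3 * (H (W z)).arg := by
      rw [show (2 / 3 : ℂ) = ((2 / 3 : ℝ) : ℂ) by push_cast; rfl, sub_im, im_ofReal_mul, log_im, log_im]
    have h' := abs_lt.1 h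
    -- With |arg φ| < π/3 and |arg H| < π/4 the total argument stays below π/2, so no branch is
    -- crossed.
    have hlog : log ((a : ℂ) - W z) = log (coordinate H a (W z)) - 2 / 3 * log (H (W z)) := by
      rw [hexp, log_exp]
      · rw [him]; linarith
      · rw [him]; linarith
    have h0 : (a : ℂ) - W z ≠ 0 := by rw [hexp]; exact exp_ne_zero _
    rw [cpow_def_of_ne_zero h0, cpow_def_of_ne_zero hφ0, hlog]
    rw [show (log (coordinate H a (W z)) - 2 / 3 * log (H (W z))) * (3 / 2) =
      log (coordinate H a (W z)) * (3 / 2) - log (H (W z)) by ring, exp_sub, exp_log hs,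
      div_mul_cancel₀ _ hs]
  · intro y hy
    obtain ⟨h, hh0, hh1, hh2⟩ := hHy y hy
    have hy' := abs_lt.1 hy
    have hh' : 0 < h ^ (2 / 3 : ℝ) := Real.rpow_pos_of_pos hh0 _
    -- The one real number φ(iy) encodes both phases: its positive part carries θ, its negative part
    -- φ̃.
    refine ⟨(a - y) * h ^ (2 / 3 : ℝ), by simp only [hWI]; exact hcy y h hh0 hh1, ?_, ?_⟩
    · rcases lt_or_ge y a with hlt | hge
      · rw [max_eq_left (by have := sub_pos.2 hlt; positivity), hpow _ _ (by linarith) hh0,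
          hthetay y (by linarith) hlt h hh2]
      · rw [htheta0 y hge, max_eq_right (mul_nonpos_of_nonpos_of_nonneg (by linarith) hh'.le),
          Real.zero_rpow (by norm_num), ofReal_zero]
    · rcases le_or_gt y a with hle | hgt
      · rw [hphi0 y (by linarith) hle, max_eq_right, Real.zero_rpow (by norm_num), neg_zero, ofReal_zero]
        rw [neg_nonpos]; exact mul_nonneg (by linarith) hh'.le
      · rw [← neg_mul, neg_sub, max_eq_left (by have := sub_pos.2 hgt; positivity),
          hpow _ _ (by linarith) hh0, phiTilde_eq_integral hA hx (by linarith), hph y hgt (by linarith), hh2,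
          ofReal_neg]
  · rw [mul_comm I (a : ℂ), hWI, coordinate, sub_self, zero_mul]

/-! ### Matrix algebra of the prefactor -/

lemma sig_mul_sig (x : ℝ) : sig x * sig x = 1 := by
  rw [sig]
  split_ifs
  · rw [one_mul]
  · ext i j; fin_cases i <;> fin_cases j <;> simp [Matrix.mul_apply, Fin.sum_univ_two]

lemma sig_cancel (x : ℝ) (M : Mat) : sig x * (sig x * M) = M := by
  rw [← mul_assoc, sig_mul_sig, one_mul]

lemma isUnit_det_sig (x : ℝ) : IsUnit (sig x).det := by
  have h := congrArg Matrix.det (sig_mul_sig x)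
  rw [Matrix.det_mul, Matrix.det_one] at h
  exact IsUnit.of_mul_eq_one _ h

lemma norm_sig_mul_mul_sig_le {x B : ℝ} {M : Mat} (h : ∀ i j, ‖M i j‖ ≤ B) (i j : Fin 2) :
    ‖(sig x * M * sig x) i j‖ ≤ B := by
  rw [sig]
  split_ifs
  · rw [one_mul, mul_one]; exact h i j
  · have h1 := h 0 0
    have h2 := h 0 1
    have h3 := h 1 0
    have h4 := h 1 1
    have e : (!![0, 1; 1, 0] : Mat) * M * !![0, 1; 1, 0] = !![M 1 1, M 1 0; M 0 1, M 0 0] := by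
      rw [Matrix.eta_fin_two M, Matrix.mul_fin_two, Matrix.mul_fin_two]
      simp
    rw [e]
    fin_cases i <;> fin_cases j <;> assumption

lemma norm_mul_entry_le {M N : Mat} {a b : ℝ} (ha : 0 ≤ a) (hM : ∀ i j, ‖M i j‖ ≤ a)
    (hN : ∀ i j, ‖N i j‖ ≤ b) (i j : Fin 2) : ‖(M * N) i j‖ ≤ 2 * (a * b) := by
  rw [Matrix.mul_apply, Fin.sum_univ_two]
  refine (norm_add_le _ _).trans ?_
  rw [Complex.norm_mul, Complex.norm_mul]
  have h1 := mul_le_mul (hM i 0) (hN 0 j) (norm_nonneg _) ha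
  have h2 := mul_le_mul (hM i 1) (hN 1 j) (norm_nonneg _) ha
  linarith

/-- The holomorphic prefactor as a function of one scalar. -/
def prefactor (E : ℂ) : Mat := (1 / (Real.sqrt 2 : ℂ)) • !![E⁻¹, -E; E⁻¹, E]

lemma one_div_sqrt_two_mul_self : (1 / (Real.sqrt 2 : ℂ)) * (1 / (Real.sqrt 2 : ℂ)) = 1 / 2 := by
  rw [div_mul_div_comm, one_mul, ← ofReal_mul, Real.mul_self_sqrt (by norm_num), ofReal_ofNat]

/-- The inverse of the prefactor. -/
def prefactorInv (E : ℂ) : Mat := (1 / (Real.sqrt 2 : ℂ)) • !![E, E; -E⁻¹, E⁻¹]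

lemma prefactor_mul_inv {E : ℂ} (hE : E ≠ 0) : prefactor E * prefactorInv E = 1 := by
  rw [prefactor, prefactorInv, Matrix.smul_mul, Matrix.mul_smul, smul_smul, one_div_sqrt_two_mul_self]
  ext i j
  fin_cases i <;> fin_cases j <;> simp [hE] <;> norm_num

lemma det_prefactor {E : ℂ} (hE : E ≠ 0) : (prefactor E).det = 1 := by
  rw [prefactor, Matrix.det_smul, Matrix.det_fin_two_of, Fintype.card_fin, sq, one_div_sqrt_two_mul_self]
  field_simp
  norm_num

/-- Conjugation by the prefactor. -/
lemma norm_prefactor_conj_le {E a b c d : ℂ} (hE : E ≠ 0) (i j : Fin 2) :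
    ‖(prefactor E * !![a, b; c, d] * (prefactor E)⁻¹) i j‖ ≤
      ‖a‖ + ‖b‖ * ‖E‖ ^ (-2 : ℤ) + ‖c‖ * ‖E‖ ^ 2 + ‖d‖ := by
  have hinv : (prefactor E)⁻¹ = prefactorInv E := Matrix.inv_eq_right_inv (prefactor_mul_inv hE)
  -- Conjugation mixes the error entries with weights 1 on the diagonal, E^{-2} on the upper right
  -- and E² on the lower left, which balances the different decay rates in `Sloc_match`.
  have e : prefactor E * !![a, b; c, d] * prefactorInv E = (1 / 2 : ℂ) •
      !![a - b * E ^ (-2 : ℤ) - c * E ^ 2 + d, a + b * E ^ (-2 : ℤ) - c * E ^ 2 - d;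
        a - b * E ^ (-2 : ℤ) + c * E ^ 2 - d, a + b * E ^ (-2 : ℤ) + c * E ^ 2 + d] := by
    rw [prefactor, prefactorInv, Matrix.smul_mul, Matrix.smul_mul, Matrix.mul_smul, smul_smul,
      one_div_sqrt_two_mul_self]
    congr 1
    ext i j
    fin_cases i <;> fin_cases j <;> simp [Matrix.mul_apply, Fin.sum_univ_two] <;> field_simp <;> ring
  have hn2 : ‖b * E ^ (-2 : ℤ)‖ = ‖b‖ * ‖E‖ ^ (-2 : ℤ) := by rw [Complex.norm_mul, norm_zpow]
  have hn3 : ‖c * E ^ 2‖ = ‖c‖ * ‖E‖ ^ 2 := by rw [Complex.norm_mul, norm_pow]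
  rw [hinv, e, ← hn2, ← hn3]
  generalize b * E ^ (-2 : ℤ) = B
  generalize c * E ^ 2 = Cc
  have hhalf : ‖(1 / 2 : ℂ)‖ = 1 / 2 := by norm_num
  have t : ∀ p q r s : ℂ, ‖(1 / 2 : ℂ) * (p + q + r + s)‖ ≤ ‖p‖ + ‖q‖ + ‖r‖ + ‖s‖ := fun p q r s => by
    rw [Complex.norm_mul, hhalf]
    have h1 := norm_add_le (p + q + r) s
    have h2 := norm_add_le (p + q) r
    have h3 := norm_add_le p q
    have := norm_nonneg (p + q + r + s)
    linarith
  have t1 := t a (-B) (-Cc) d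
  have t2 := t a B (-Cc) (-d)
  have t3 := t a (-B) Cc (-d)
  have t4 := t a B Cc d
  simp only [norm_neg, ← sub_eq_add_neg] at t1 t2 t3 t4
  fin_cases i <;> fin_cases j <;> simp only [Matrix.smul_apply, smul_eq_mul]
  · exact t1
  · exact t2
  · exact t3
  · exact t4

lemma StildeLoc_eq {ζ : ℂ} (hζ : ζ ≠ 0) : StildeLoc ζ = (1 / (Real.sqrt 2 : ℂ)) •
    !![exp (log (-ζ) / 4), exp (log (-ζ) / 4); -(exp (log (-ζ) / 4))⁻¹, (exp (log (-ζ) / 4))⁻¹] := by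
  have h := neg_ne_zero.2 hζ
  rw [StildeLoc, cpow_def_of_ne_zero h, cpow_def_of_ne_zero h, ← exp_neg]
  have e1 : log (-ζ) * (1 / 4) = log (-ζ) / 4 := by ring
  have e2 : log (-ζ) * -(1 / 4) = -(log (-ζ) / 4) := by ring
  rw [e1, e2]

lemma StildeLoc_inv {ζ : ℂ} (hζ : ζ ≠ 0) : (StildeLoc ζ)⁻¹ = (1 / (Real.sqrt 2 : ℂ)) •
    !![(exp (log (-ζ) / 4))⁻¹, -exp (log (-ζ) / 4); (exp (log (-ζ) / 4))⁻¹, exp (log (-ζ) / 4)] := by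
  refine Matrix.inv_eq_right_inv ?_
  have h := exp_ne_zero (log (-ζ) / 4)
  rw [StildeLoc_eq hζ, Matrix.smul_mul, Matrix.mul_smul, smul_smul, one_div_sqrt_two_mul_self]
  ext i j
  fin_cases i <;> fin_cases j <;> simp <;> norm_num

lemma isUnit_det_StildeLoc {ζ : ℂ} (hζ : ζ ≠ 0) : IsUnit (StildeLoc ζ).det := by
  have h := exp_ne_zero (log (-ζ) / 4)
  have : (StildeLoc ζ).det = 1 := by
    rw [StildeLoc_eq hζ, Matrix.det_smul, Matrix.det_fin_two_of, Fintype.card_fin, sq,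
      one_div_sqrt_two_mul_self]
    field_simp
    norm_num
  rw [this]; exact isUnit_one

/-- In terms of β the outer matrix has equal diagonal and equal off-diagonal entries, so swapping
both rows and columns changes nothing: the sign of x plays no role in the prefactor. -/
lemma sig_Otilde_sig {a : ℝ} (ha : 0 < a) (x : ℝ) {z : ℂ} (hz : z.re ≠ 0) (hi : 0 < z.im) :
    sig x * Otilde a z * sig x = Otilde a z := by
  rw [sig]
  split_ifs
  · rw [one_mul, mul_one]
  · rw [(Otilde_eq ha hz hi).1]
    ext i j; fin_cases i <;> fin_cases j <;> simp [Matrix.mul_apply, Fin.sum_univ_two]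

section Coordinate
variable {φ : ℂ → ℂ} {h : ℝ} {z : ℂ}

lemma rpow_neg_two_thirds_pos (hh : 0 < h) : 0 < h ^ (-(2 / 3) : ℝ) := Real.rpow_pos_of_pos hh _

lemma arg_zeta (hh : 0 < h) : (zeta φ h z).arg = (φ z).arg :=
  arg_real_mul _ (rpow_neg_two_thirds_pos hh)

lemma norm_zeta (hh : 0 < h) : ‖zeta φ h z‖ = h ^ (-(2 / 3) : ℝ) * ‖φ z‖ := by
  rw [zeta, Complex.norm_mul, Complex.norm_real, Real.norm_of_nonneg (rpow_neg_two_thirds_pos hh).le]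

lemma zeta_ne_zero (hh : 0 < h) (h0 : φ z ≠ 0) : zeta φ h z ≠ 0 :=
  mul_ne_zero (ofReal_ne_zero.2 (rpow_neg_two_thirds_pos hh).ne') h0

lemma exp_log_neg_zeta (hh : 0 < h) (h0 : φ z ≠ 0) :
    exp (log (-zeta φ h z) / 4) = ((h ^ (-(1 / 6) : ℝ) : ℝ) : ℂ) * exp (log (-φ z) / 4) := by
  have e : Real.log (h ^ (-(2 / 3) : ℝ)) / 4 = Real.log h * (-(1 / 6)) := by
    rw [Real.log_rpow hh]; ring
  rw [zeta, ← mul_neg, log_ofReal_mul (rpow_neg_two_thirds_pos hh) (neg_ne_zero.2 h0), add_div, exp_add,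
    Real.rpow_def_of_pos hh (-(1 / 6) : ℝ), ← e]
  push_cast; rfl

lemma zeta_cpow (hh : 0 < h) (h0 : φ z ≠ 0) :
    zeta φ h z ^ (3 / 2 : ℂ) = φ z ^ (3 / 2 : ℂ) / h := by
  have e : Real.log (h ^ (-(2 / 3) : ℝ)) * (3 / 2) = -Real.log h := by
    rw [Real.log_rpow hh]; ring
  have e' : ((Real.log (h ^ (-(2 / 3) : ℝ)) : ℝ) : ℂ) * (3 / 2) = ((-Real.log h : ℝ) : ℂ) := by
    rw [← e]; push_cast; rfl
  rw [cpow_def_of_ne_zero (zeta_ne_zero hh h0 : zeta φ h z ≠ 0), cpow_def_of_ne_zero h0, zeta,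
    log_ofReal_mul (rpow_neg_two_thirds_pos hh) h0, add_mul, exp_add, e', ← ofReal_exp, Real.exp_neg,
    Real.exp_log hh]
  push_cast; ring

end Coordinate

namespace EndpointData
variable {A : ℝ → ℝ} {x r : ℝ} {Θ φ e : ℂ → ℂ} {z : ℂ} {h : ℝ}

lemma phi_im_ne (D : EndpointData A x r Θ φ e) (hz : z ∈ Metric.ball (I * A x) r) (hr : z.re ≠ 0) :
    (φ z).im ≠ 0 := by
  rcases lt_or_gt_of_ne hr with h | h
  · exact (D.im_neg z hz h).ne
  · exact (D.im_pos z hz h).ne'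

lemma phi_ne_zero (D : EndpointData A x r Θ φ e) (hz : z ∈ Metric.ball (I * A x) r) (hr : z.re ≠ 0) :
    φ z ≠ 0 := fun h0 => D.phi_im_ne hz hr (by rw [h0, zero_im])

lemma im_pos_of_mem (D : EndpointData A x r Θ φ e) (hz : z ∈ Metric.ball (I * A x) r) : 0 < z.im := by
  have h1 := re_pos_of_mem_ball D.map.not_zero.le (rotate_mem_ball.2 hz)
  simpa using h1

/-- The scaled scalar of the prefactor. -/
def scaled (e : ℂ → ℂ) (h : ℝ) (z : ℂ) : ℂ := ((h ^ (-(1 / 6) : ℝ) : ℝ) : ℂ) * e z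

lemma scaled_ne_zero (D : EndpointData A x r Θ φ e) (hh : 0 < h) : scaled e h z ≠ 0 :=
  mul_ne_zero (ofReal_ne_zero.2 (Real.rpow_pos_of_pos hh _).ne') (D.ne_zero z)

/-- The product of a matrix built from β^{±1} with the inverse frame built from (-ζ)^{±1/4} depends
only on the product β(-ζ)^{1/4}, in which the branches cancel. The scale ħ^{-1/6} is the fourth root
of the factor ħ^{-2/3} in ζ. -/
lemma Shol_eq (D : EndpointData A x r Θ φ e) (hA : IsProfile A) (hh : 0 < h)
    (hz : z ∈ Metric.ball (I * A x) r) (hr : z.re ≠ 0) :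
    Shol A x φ h z = prefactor (scaled e h z) := by
  have hi := D.im_pos_of_mem hz
  have h0 := D.phi_ne_zero hz hr
  obtain ⟨hO, hb⟩ := Otilde_eq (hA.pos x) hr hi
  have hE : scaled e h z = beta (A x) z * exp (log (-zeta φ h z) / 4) := by
    rw [exp_log_neg_zeta hh h0, scaled, ← D.beta_mul z hz hr]; ring
  have hne := exp_ne_zero (log (-zeta φ h z) / 4)
  rw [Shol, sig_Otilde_sig (hA.pos x) x hr hi, hO, StildeLoc_inv (zeta_ne_zero hh h0), prefactor, hE,
    Matrix.smul_mul, Matrix.mul_smul, smul_smul, mul_comm, ← smul_smul]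
  congr 1
  ext i j
  fin_cases i <;> fin_cases j <;> simp <;> ring

lemma lens_arg (D : EndpointData A x r Θ φ e) (hh : 0 < h)
    (hz : z ∈ Metric.ball (I * A x) r) (hr : z.re ≠ 0) (ha : |(zeta φ h z).arg| < Real.pi / 3) :
    Θ z / h = zeta φ h z ^ (3 / 2 : ℂ) := by
  rw [arg_zeta hh] at ha
  rw [zeta_cpow hh (D.phi_ne_zero hz hr), D.theta_eq_cpow z hz hr ha]

end EndpointData

/-! ### Absorbing the lens; the jump of the endpoint model -/

/-- The Airy model with the lens factor absorbed, above the positive axis. -/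
lemma Sloc_mul_lens_of_arg_pos {ζ t : ℂ} (h : 0 < ζ.arg)
    (ht : |ζ.arg| < Real.pi / 3 → t = ζ ^ (3 / 2 : ℂ)) :
    Sloc ζ * lensFactor ζ t = Tsector ζ * airyDiag ((-ζ) ^ (3 / 2 : ℂ)) := by
  rw [Sloc_eq, lensFactor, if_neg (by rintro ⟨-, h1⟩; linarith)]
  rcases lt_or_ge ζ.arg (Real.pi / 3) with h1 | h1
  · have ht' := ht (by rw [abs_of_pos h]; exact h1)
    rw [if_pos ⟨h, h1⟩, T_of_mem_upper h.le h1, mul_assoc (Tsector ζ), airyDiag_mul_upper,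
      mul_assoc, mul_assoc, neg_cpow_three_halves_of_arg_pos h, ← ht']
    congr 1
    convert mul_one _
    ext i j
    fin_cases i <;> fin_cases j <;> simp [Matrix.mul_apply, Fin.sum_univ_two]
  · rw [if_neg (by rintro ⟨-, h2⟩; linarith), mul_one, T_of_le h1]

/-- The Airy model with the lens factor absorbed, below the positive axis. -/
lemma Sloc_mul_lens_of_arg_neg {ζ t : ℂ} (h : ζ.arg < 0)
    (ht : |ζ.arg| < Real.pi / 3 → t = ζ ^ (3 / 2 : ℂ)) :
    Sloc ζ * lensFactor ζ t = Tsector ζ * !![1, 0; 1, 1] * airyDiag ((-ζ) ^ (3 / 2 : ℂ)) := by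
  rw [Sloc_eq, lensFactor]
  rcases lt_or_ge (-(Real.pi / 3)) ζ.arg with h1 | h1
  · have ht' := ht (by rw [abs_of_neg h]; linarith)
    -- The constant matrix of the inner sector is that of the outer sector times the inverse of U;
    -- the lens factor then supplies exactly the missing U.
    have hf : (!![1, -1; 1, 0] : Mat) = !![1, 0; 1, 1] * !![1, -1; 0, 1] := by
      ext i j
      fin_cases i <;> fin_cases j <;> simp [Matrix.mul_apply, Fin.sum_univ_two]
    have hu : (!![1, -1; 0, 1] : Mat) * !![1, 1; 0, 1] = 1 := by
      ext i j
      fin_cases i <;> fin_cases j <;> simp [Matrix.mul_apply, Fin.sum_univ_two]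
    have key := airyDiag_mul_upper ((-ζ) ^ (3 / 2 : ℂ))
    rw [if_pos ⟨h1, h⟩, T_of_mem_lower h1 h, hf, mul_assoc, mul_assoc, mul_assoc, mul_assoc]
    congr 2
    have e : -(I * t) = (-ζ) ^ (3 / 2 : ℂ) := by
      rw [neg_cpow_three_halves_of_arg_neg h, ht']; ring
    rw [e, ← key, ← mul_assoc, hu, one_mul]
  · rw [if_neg (by rintro ⟨h2, -⟩; linarith), if_neg (by rintro ⟨h2, -⟩; linarith), mul_one, T_of_le_neg h1]

/-- The truncated powers treat both signs of τ, and τ = 0, at once. For τ > 0 the point lies on the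
cut, and the limit is that of -iζ^{3/2}. -/
lemma tendsto_neg_cpow_below (τ : ℝ) :
    Tendsto (fun w : ℂ => (-w) ^ (3 / 2 : ℂ)) (𝓝[{w : ℂ | w.im < 0}] (τ : ℂ))
      (𝓝 (((max (-τ) 0 ^ (3 / 2 : ℝ) : ℝ) : ℂ) - I * ((max τ 0 ^ (3 / 2 : ℝ) : ℝ) : ℂ))) := by
  have h32 : (3 / 2 : ℂ) = ((3 / 2 : ℝ) : ℂ) := by push_cast; rfl
  rcases le_or_gt τ 0 with h | h
  · rw [max_eq_left (by linarith), max_eq_right h, Real.zero_rpow (by norm_num), ofReal_zero, mul_zero,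
      sub_zero, ofReal_cpow (by linarith), ← h32]
    have h1 : ContinuousAt (fun w : ℂ => (-w) ^ (3 / 2 : ℂ)) (τ : ℂ) :=
      ContinuousAt.comp (g := fun z : ℂ => z ^ (3 / 2 : ℂ))
        (continuousAt_cpow_three_halves (Or.inl (by simpa using h))) continuous_neg.continuousAt
    have h2 := h1.tendsto.mono_left (nhdsWithin_le_nhds (s := {w : ℂ | w.im < 0}))
    rwa [← ofReal_neg] at h2
  · rw [max_eq_right (by linarith), max_eq_left h.le, Real.zero_rpow (by norm_num), ofReal_zero,
      zero_sub, ofReal_cpow h.le, ← h32, ← neg_mul]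
    have h1 : ContinuousAt (fun w : ℂ => w ^ (3 / 2 : ℂ)) (τ : ℂ) :=
      continuousAt_cpow_three_halves (Or.inl (by simpa using h.le))
    refine ((h1.tendsto.mono_left nhdsWithin_le_nhds).const_mul (-I)).congr' ?_
    filter_upwards [self_mem_nhdsWithin] with w hw
    exact (neg_cpow_three_halves_of_arg_neg (arg_neg_iff.2 hw)).symm

lemma arg_pos_of_im_pos {w : ℂ} (h : 0 < w.im) : 0 < w.arg := by
  have := (log_im_mem h).1
  rwa [log_im] at this

lemma tendsto_neg_cpow_above (τ : ℝ) :
    Tendsto (fun w : ℂ => (-w) ^ (3 / 2 : ℂ)) (𝓝[{w : ℂ | 0 < w.im}] (τ : ℂ))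
      (𝓝 (((max (-τ) 0 ^ (3 / 2 : ℝ) : ℝ) : ℂ) + I * ((max τ 0 ^ (3 / 2 : ℝ) : ℝ) : ℂ))) := by
  have h32 : (3 / 2 : ℂ) = ((3 / 2 : ℝ) : ℂ) := by push_cast; rfl
  rcases le_or_gt τ 0 with h | h
  · rw [max_eq_left (by linarith), max_eq_right h, Real.zero_rpow (by norm_num), ofReal_zero, mul_zero,
      add_zero, ofReal_cpow (by linarith), ← h32]
    have h1 : ContinuousAt (fun w : ℂ => (-w) ^ (3 / 2 : ℂ)) (τ : ℂ) :=
      ContinuousAt.comp (g := fun z : ℂ => z ^ (3 / 2 : ℂ))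
        (continuousAt_cpow_three_halves (Or.inl (by simpa using h))) continuous_neg.continuousAt
    have h2 := h1.tendsto.mono_left (nhdsWithin_le_nhds (s := {w : ℂ | 0 < w.im}))
    rwa [← ofReal_neg] at h2
  · rw [max_eq_right (by linarith), max_eq_left h.le, Real.zero_rpow (by norm_num), ofReal_zero,
      zero_add, ofReal_cpow h.le, ← h32]
    have h1 : ContinuousAt (fun w : ℂ => w ^ (3 / 2 : ℂ)) (τ : ℂ) :=
      continuousAt_cpow_three_halves (Or.inl (by simpa using h.le))
    refine ((h1.tendsto.mono_left nhdsWithin_le_nhds).const_mul I).congr' ?_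
    filter_upwards [self_mem_nhdsWithin] with w hw
    exact (neg_cpow_three_halves_of_arg_pos (arg_pos_of_im_pos hw)).symm

/-- The jump of the endpoint model, before conjugation. -/
lemma airyDiag_jump (p q : ℂ) :
    (!![1, 0; 1, 1] : Mat) * airyDiag (p - I * q) = airyDiag (p + I * q) *
      !![exp (I * q), 0; I * exp (-p), exp (-(I * q))] := by
  have h1 : exp (-(p - I * q) / 2 + I * Real.pi / 4) =
      exp (-(p + I * q) / 2 + I * Real.pi / 4) * exp (I * q) := by
    rw [← exp_add]; congr 1; ring
  have h2 : exp (-(p - I * q) / 2 + I * Real.pi / 4) =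
      exp ((p + I * q) / 2 - I * Real.pi / 4) * (I * exp (-p)) := by
    nth_rewrite 5 [← exp_pi_div_two_mul_I]
    rw [← exp_add, ← exp_add]; congr 1; ring
  have h3 : exp ((p - I * q) / 2 - I * Real.pi / 4) =
      exp ((p + I * q) / 2 - I * Real.pi / 4) * exp (-(I * q)) := by
    rw [← exp_add]; congr 1; ring
  rw [airyDiag, airyDiag, Matrix.mul_fin_two, Matrix.mul_fin_two]
  simp only [one_mul, zero_mul, mul_zero, add_zero, zero_add]
  rw [h3, ← h2, ← h1]

lemma continuous_prefactor_comp {X : Type*} [TopologicalSpace X] {E : X → ℂ} {u : X}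
    (hE : ContinuousAt E u) (h0 : E u ≠ 0) : ContinuousAt (fun u => prefactor (E u)) u := by
  refine continuousAt_pi.2 fun i => continuousAt_pi.2 fun j => ?_
  simp only [prefactor, Matrix.smul_apply, smul_eq_mul]
  refine continuousAt_const.mul ?_
  fin_cases i <;> fin_cases j
  · exact hE.inv₀ h0
  · exact hE.neg
  · exact hE.inv₀ h0
  · exact hE

/-- One branch of the endpoint model. -/
def sheet (x : ℝ) (φ e : ℂ → ℂ) (h : ℝ) (M : Mat) (z : ℂ) : Mat :=
  sig x * (prefactor (EndpointData.scaled e h z) *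
    (Tsector (zeta φ h z) * M * airyDiag ((-zeta φ h z) ^ (3 / 2 : ℂ)))) * sig x

namespace EndpointData
variable {A : ℝ → ℝ} {x r : ℝ} {Θ φ e : ℂ → ℂ} {z : ℂ} {h : ℝ}

/-- The lens factor merges two sectors of the Airy model into one expression, so the ray arg ζ = π/3
leaves no trace and analyticity in the half-disk is immediate. -/
lemma Nendpoint_right (D : EndpointData A x r Θ φ e) (hA : IsProfile A) (hh : 0 < h)
    (hz : z ∈ Metric.ball (I * A x) r) (hr : 0 < z.re) :
    Nendpoint A x Θ φ h z = sheet x φ e h 1 z := by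
  have harg : 0 < (zeta φ h z).arg := by
    rw [arg_zeta hh]; exact arg_pos_of_im_pos (D.im_pos z hz hr)
  rw [Nendpoint, Shat, sheet, D.Shol_eq hA hh hz hr.ne', mul_assoc (sig x), mul_assoc (prefactor _),
    Sloc_mul_lens_of_arg_pos harg fun h1 => D.lens_arg hh hz hr.ne' h1, mul_one]

lemma Nendpoint_left (D : EndpointData A x r Θ φ e) (hA : IsProfile A) (hh : 0 < h)
    (hz : z ∈ Metric.ball (I * A x) r) (hr : z.re < 0) :
    Nendpoint A x Θ φ h z = sheet x φ e h !![1, 0; 1, 1] z := by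
  have harg : (zeta φ h z).arg < 0 := by
    rw [arg_zeta hh]; exact arg_neg_iff.2 (D.im_neg z hz hr)
  rw [Nendpoint, Shat, sheet, D.Shol_eq hA hh hz hr.ne, mul_assoc (sig x), mul_assoc (prefactor _),
    Sloc_mul_lens_of_arg_neg harg fun h1 => D.lens_arg hh hz hr.ne h1]

lemma analyticAt_scaled (D : EndpointData A x r Θ φ e) (h : ℝ) (hz : z ∈ Metric.ball (I * A x) r) :
    AnalyticAt ℂ (scaled e h) z :=
  analyticAt_const.mul (D.differentiable.analyticAt (Metric.isOpen_ball.mem_nhds hz))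

lemma analyticAt_zeta (D : EndpointData A x r Θ φ e) (h : ℝ) (hz : z ∈ Metric.ball (I * A x) r) :
    AnalyticAt ℂ (zeta φ h) z :=
  analyticAt_const.mul (D.map.phi_analytic z hz)

lemma zeta_arg_ne_zero (D : EndpointData A x r Θ φ e) (hh : 0 < h)
    (hz : z ∈ Metric.ball (I * A x) r) (hr : z.re ≠ 0) : (zeta φ h z).arg ≠ 0 := by
  rw [arg_zeta hh]
  intro h0
  exact D.phi_im_ne hz hr (arg_eq_zero_iff.1 h0).2

lemma analyticAt_sheet (D : EndpointData A x r Θ φ e) (hh : 0 < h) (M : Mat)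
    (hz : z ∈ Metric.ball (I * A x) r) (hr : z.re ≠ 0) (i j : Fin 2) :
    AnalyticAt ℂ (fun z => sheet x φ e h M z i j) z := by
  have hE := D.analyticAt_scaled h hz
  have h0 := D.scaled_ne_zero (z := z) hh
  have hζ := D.analyticAt_zeta h hz
  have hs := neg_mem_slitPlane_of_arg_ne_zero (D.zeta_arg_ne_zero hh hz hr)
  have hP : ∀ i j, AnalyticAt ℂ (fun z => prefactor (scaled e h z) i j) z := by
    intro i j
    fin_cases i <;> fin_cases j <;> simp only [prefactor, Matrix.smul_apply, smul_eq_mul] <;>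
      refine analyticAt_const.mul ?_
    · exact hE.inv h0
    · exact hE.neg
    · exact hE.inv h0
    · exact hE
  have hT : ∀ i j, AnalyticAt ℂ (fun z => Tsector (zeta φ h z) i j) z := fun i j =>
    ((differentiable_Tsector i j).analyticAt _).comp hζ
  have hD : ∀ i j, AnalyticAt ℂ (fun z => airyDiag ((-zeta φ h z) ^ (3 / 2 : ℂ)) i j) z := fun i j =>
    (analyticAt_airyDiag_cpow hs i j).comp hζ
  have hc : ∀ (K : Mat) (i j : Fin 2), AnalyticAt ℂ (fun _ : ℂ => K i j) z := fun _ _ _ => analyticAt_const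
  exact analyticAt_mul_entries (G := fun _ => sig x) (analyticAt_mul_entries (F := fun _ => sig x) (hc _)
    (analyticAt_mul_entries hP (analyticAt_mul_entries
      (analyticAt_mul_entries (G := fun _ => M) hT (hc _)) hD))) (hc _) i j

lemma analyticOn_left (D : EndpointData A x r Θ φ e) (hA : IsProfile A) (hh : 0 < h) (i j : Fin 2) :
    AnalyticOnNhd ℂ (fun z => Nendpoint A x Θ φ h z i j)
      (Metric.ball (I * A x) r ∩ {z | z.re < 0}) := by
  intro z hz
  refine (D.analyticAt_sheet hh !![1, 0; 1, 1] hz.1 (ne_of_lt hz.2) i j).congr ?_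
  have ho : IsOpen (Metric.ball (I * A x) r ∩ {z | z.re < 0}) :=
    Metric.isOpen_ball.inter (isOpen_lt continuous_re continuous_const)
  filter_upwards [ho.mem_nhds hz] with w hw
  rw [D.Nendpoint_left hA hh hw.1 hw.2]

lemma analyticOn_right (D : EndpointData A x r Θ φ e) (hA : IsProfile A) (hh : 0 < h) (i j : Fin 2) :
    AnalyticOnNhd ℂ (fun z => Nendpoint A x Θ φ h z i j)
      (Metric.ball (I * A x) r ∩ {z | 0 < z.re}) := by
  intro z hz
  refine (D.analyticAt_sheet hh 1 hz.1 (ne_of_gt hz.2) i j).congr ?_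
  have ho : IsOpen (Metric.ball (I * A x) r ∩ {z | 0 < z.re}) :=
    Metric.isOpen_ball.inter (isOpen_lt continuous_const continuous_re)
  filter_upwards [ho.mem_nhds hz] with w hw
  rw [D.Nendpoint_right hA hh hw.1 hw.2]

lemma tendsto_sheet (D : EndpointData A x r Θ φ e) (hh : 0 < h) (M : Mat)
    (hz : z ∈ Metric.ball (I * A x) r) {s : Set ℂ} {E : ℂ}
    (hE : Tendsto (fun z => (-zeta φ h z) ^ (3 / 2 : ℂ)) (𝓝[s] z) (𝓝 E)) :
    Tendsto (sheet x φ e h M) (𝓝[s] z) (𝓝 (sig x * (prefactor (scaled e h z) *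
      (Tsector (zeta φ h z) * M * airyDiag E)) * sig x)) := by
  have h1 : Tendsto (fun z => prefactor (scaled e h z)) (𝓝[s] z) (𝓝 (prefactor (scaled e h z))) :=
    (continuous_prefactor_comp (D.analyticAt_scaled h hz).continuousAt
      (D.scaled_ne_zero hh)).tendsto.mono_left nhdsWithin_le_nhds
  have h2 : Tendsto (fun z => Tsector (zeta φ h z)) (𝓝[s] z) (𝓝 (Tsector (zeta φ h z))) :=
    (continuous_Tsector.continuousAt.comp (D.analyticAt_zeta h hz).continuousAt).tendsto.mono_left
      nhdsWithin_le_nhds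
  have h3 := (continuous_airyDiag.tendsto E).comp hE
  exact (tendsto_const_nhds.mul (h1.mul ((h2.mul tendsto_const_nhds).mul h3))).mul tendsto_const_nhds

/-- The jump of the endpoint model on the imaginary axis. -/
lemma hasJump (D : EndpointData A x r Θ φ e) (hA : IsProfile A) (hh : 0 < h)
    (hz : z ∈ Metric.ball (I * A x) r) (hr : z.re = 0) :
    HasJump (Nendpoint A x Θ φ h) z (continuumJump A x h z) := by
  have hzy : z = z.im * I := by
    conv_lhs => rw [← re_add_im z]
    rw [hr, ofReal_zero, zero_add]
  have hy : |z.im - A x| < r := by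
    have := hz
    rw [hzy, mem_ball_iff_norm, mul_comm I, ← sub_mul, Complex.norm_mul, norm_I, mul_one, ← ofReal_sub,
      Complex.norm_real] at this
    exact this
  obtain ⟨t, ht, hθ, hφ⟩ := D.boundary _ hy
  rw [← hzy] at ht hθ hφ
  set c := h ^ (-(2 / 3) : ℝ) with hc
  have hc0 : 0 < c := rpow_neg_two_thirds_pos hh
  have hζ : zeta φ h z = ((c * t : ℝ) : ℂ) := by rw [zeta, ht, ofReal_mul]
  have hcont := (D.analyticAt_zeta h hz).continuousAt.tendsto
  rw [hζ] at hcont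
  have hball := Metric.isOpen_ball.mem_nhds hz
  have him : ∀ w, (zeta φ h w).im = c * (φ w).im := fun w => by rw [zeta, im_ofReal_mul]
  -- The limits of (-ζ)^{3/2} from left and right are p - iq and p + iq. After rescaling, -p and q
  -- are φ̃/ħ and θ/ħ, so `airyDiag_jump` gives the prescribed jump on both sides of ia and at ia
  -- itself.
  set p : ℝ := max (-(c * t)) 0 ^ (3 / 2 : ℝ) with hp
  set q : ℝ := max (c * t) 0 ^ (3 / 2 : ℝ) with hq
  have hscale : ∀ u : ℝ, max (c * u) 0 ^ (3 / 2 : ℝ) = max u 0 ^ (3 / 2 : ℝ) / h := fun u => by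
    have h1 : max (c * u) 0 = c * max u 0 := by
      rw [mul_max_of_nonneg _ _ hc0.le, mul_zero]
    have h2 : c ^ (3 / 2 : ℝ) = h⁻¹ := by
      rw [hc, ← Real.rpow_mul hh.le, ← Real.rpow_neg_one]; norm_num
    rw [h1, Real.mul_rpow hc0.le (le_max_right _ _), h2]; ring
  have hθ' : theta A x z / h = q := by rw [hθ, hq, hscale, ofReal_div]
  have hφ' : phiTilde A x z / h = -p := by
    rw [hφ, hp, ← mul_neg, hscale]; push_cast; ring
  have hleft : Tendsto (fun z => (-zeta φ h z) ^ (3 / 2 : ℂ)) (𝓝[{w : ℂ | w.re < 0}] z)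
      (𝓝 ((p : ℂ) - I * q)) := by
    refine (tendsto_neg_cpow_below (c * t)).comp (tendsto_nhdsWithin_iff.2
      ⟨hcont.mono_left nhdsWithin_le_nhds, ?_⟩)
    filter_upwards [self_mem_nhdsWithin, nhdsWithin_le_nhds hball] with w hw hb
    have := D.im_neg w hb hw
    show (zeta φ h w).im < 0
    rw [him]; exact mul_neg_of_pos_of_neg hc0 this
  have hright : Tendsto (fun z => (-zeta φ h z) ^ (3 / 2 : ℂ)) (𝓝[{w : ℂ | 0 < w.re}] z)
      (𝓝 ((p : ℂ) + I * q)) := by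
    refine (tendsto_neg_cpow_above (c * t)).comp (tendsto_nhdsWithin_iff.2
      ⟨hcont.mono_left nhdsWithin_le_nhds, ?_⟩)
    filter_upwards [self_mem_nhdsWithin, nhdsWithin_le_nhds hball] with w hw hb
    have := D.im_pos w hb hw
    show 0 < (zeta φ h w).im
    rw [him]; exact mul_pos hc0 this
  have hdet : IsUnit (sig x * (prefactor (scaled e h z) *
      (Tsector (zeta φ h z) * 1 * airyDiag ((p : ℂ) + I * q))) * sig x).det := by
    rw [Matrix.det_mul, Matrix.det_mul, Matrix.det_mul, Matrix.det_mul, mul_one,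
      det_prefactor (D.scaled_ne_zero hh), det_Tsector, det_airyDiag, one_mul, one_mul, mul_one]
    exact (isUnit_det_sig x).mul (isUnit_det_sig x)
  refine ⟨_, _, (D.tendsto_sheet hh !![1, 0; 1, 1] hz hleft).congr' ?_,
    (D.tendsto_sheet hh 1 hz hright).congr' ?_, hdet, ?_⟩
  · filter_upwards [self_mem_nhdsWithin, nhdsWithin_le_nhds hball] with w hw hb
    exact (D.Nendpoint_left hA hh hb hw).symm
  · filter_upwards [self_mem_nhdsWithin, nhdsWithin_le_nhds hball] with w hw hb
    exact (D.Nendpoint_right hA hh hb hw).symm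
  · have hV : continuumJump A x h z = sig x * !![exp (I * q), 0; I * exp (-(p : ℂ)), exp (-(I * q))] *
        sig x := by
      rw [continuumJump, hφ', mul_div_assoc, hθ', neg_div, mul_div_assoc, hθ']
    have key := airyDiag_jump (p : ℂ) q
    have hF : sig x * (prefactor (scaled e h z) *
        (Tsector (zeta φ h z) * !![1, 0; 1, 1] * airyDiag ((p : ℂ) - I * q))) * sig x =
        (sig x * (prefactor (scaled e h z) *
        (Tsector (zeta φ h z) * 1 * airyDiag ((p : ℂ) + I * q))) * sig x) * continuumJump A x h z := by
      rw [hV, mul_one, mul_assoc (Tsector _), key]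
      simp only [mul_assoc, sig_cancel]
    rw [hF, Matrix.nonsing_inv_mul_cancel_left _ _ hdet]

end EndpointData

lemma HasJump.boundary_values {F : ℂ → Mat} {z : ℂ} {V : Mat} (hz : z.re = 0) (hF : HasJump F z V) :
    (rightBV F z)⁻¹ * leftBV F z = V := by
  obtain ⟨Fp, Fm, hp, hm, -, hV⟩ := hF
  rw [leftBV_eq hz hp, rightBV_eq hz hm, hV]

/-! ### Uniform bounds and matching -/

lemma det_lensFactor (ζ t : ℂ) : (lensFactor ζ t).det = 1 := by
  rw [lensFactor]
  split_ifs
  · simp [Matrix.det_fin_two]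
  · simp [Matrix.det_fin_two]
  · exact Matrix.det_one

lemma im_cpow_three_halves {ζ : ℂ} (h0 : ζ ≠ 0) :
    (ζ ^ (3 / 2 : ℂ)).im = Real.exp ((log ζ * (3 / 2)).re) * Real.sin (3 / 2 * ζ.arg) := by
  rw [cpow_def_of_ne_zero h0, exp_im]
  congr 2
  rw [show (3 / 2 : ℂ) = ((3 / 2 : ℝ) : ℂ) by push_cast; rfl, im_mul_ofReal, log_im, mul_comm]

/-- In the two halves of the lens (3/2) arg ζ lies in (-π/2, 0) or (0, π/2), and the sign in the
exponential is chosen so that it decays there. -/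
lemma norm_lensFactor_le {ζ t : ℂ} (h0 : ζ ≠ 0)
    (ht : |ζ.arg| < Real.pi / 3 → t = ζ ^ (3 / 2 : ℂ)) (i j : Fin 2) : ‖lensFactor ζ t i j‖ ≤ 1 := by
  have hpi := Real.pi_pos
  rw [lensFactor]
  split_ifs with h1 h2
  · have hi : t.im ≤ 0 := by
      rw [ht (by rw [abs_of_neg h1.2]; linarith), im_cpow_three_halves h0]
      refine mul_nonpos_of_nonneg_of_nonpos (Real.exp_pos _).le ?_
      exact Real.sin_nonpos_of_nonpos_of_neg_pi_le (by linarith) (by linarith)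
    fin_cases i <;> fin_cases j <;> simp
    rw [norm_exp]
    exact Real.exp_le_one_iff.2 (by simpa using hi)
  · have hi : 0 ≤ t.im := by
      rw [ht (by rw [abs_of_pos h2.1]; exact h2.2), im_cpow_three_halves h0]
      refine mul_nonneg (Real.exp_pos _).le ?_
      exact Real.sin_nonneg_of_nonneg_of_le_pi (by linarith) (by linarith)
    fin_cases i <;> fin_cases j <;> simp
    rw [norm_exp]
    exact Real.exp_le_one_iff.2 (by simpa using hi)
  · fin_cases i <;> fin_cases j <;> simp

lemma norm_prefactor_le {E : ℂ} {B : ℝ} (h1 : ‖E‖ ≤ B) (h2 : ‖E⁻¹‖ ≤ B) (i j : Fin 2) :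
    ‖prefactor E i j‖ ≤ B := by
  have hs : ‖(1 / (Real.sqrt 2 : ℂ))‖ ≤ 1 := by
    rw [norm_div, norm_one, Complex.norm_real, Real.norm_of_nonneg (Real.sqrt_nonneg _)]
    exact div_le_one_of_le₀ (Real.one_le_sqrt.2 (by norm_num)) (Real.sqrt_nonneg _)
  have key : ∀ w : ℂ, ‖w‖ ≤ B → ‖(1 / (Real.sqrt 2 : ℂ)) * w‖ ≤ B := fun w hw => by
    rw [Complex.norm_mul]
    exact (mul_le_of_le_one_left (norm_nonneg _) hs).trans hw
  simp only [prefactor, Matrix.smul_apply, smul_eq_mul]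
  refine key _ ?_
  fin_cases i <;> fin_cases j
  · exact h2
  · exact (norm_neg E).trans_le h1
  · exact h2
  · exact h1

/-- The quotient of two conjugated products with a common left factor and a common right factor. -/
lemma conj_mul_conj_inv_sub_one {σ P S Q L : Mat} (hσ : σ * σ = 1) (uP : IsUnit P.det)
    (uL : IsUnit L.det) :
    σ * (P * S) * L * σ * (σ * (P * Q) * σ * (σ * L * σ))⁻¹ - 1 =
      σ * (P * (S * Q⁻¹ - 1) * P⁻¹) * σ := by
  have hc : ∀ M : Mat, σ * (σ * M) = M := fun M => by rw [← mul_assoc, hσ, one_mul]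
  have hi : (σ * (P * Q) * σ * (σ * L * σ))⁻¹ = σ * (L⁻¹ * (Q⁻¹ * (P⁻¹ * σ))) := by
    simp only [Matrix.mul_inv_rev, Matrix.inv_eq_right_inv hσ, mul_assoc, hc]
  have e1 : (1 : Mat) = σ * (P * 1 * P⁻¹) * σ := by
    rw [mul_one, Matrix.mul_nonsing_inv _ uP, mul_one, hσ]
  rw [hi, mul_sub, sub_mul, mul_sub, sub_mul, ← e1]
  congr 1
  simp only [mul_assoc, hc, Matrix.mul_nonsing_inv_cancel_left _ _ uL]

namespace EndpointData
variable {A : ℝ → ℝ} {x r s : ℝ} {Θ φ e : ℂ → ℂ} {z : ℂ} {h : ℝ}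

lemma exists_bounds (D : EndpointData A x r Θ φ e) (hs : s < r) :
    ∃ M : ℝ, 1 ≤ M ∧ ∀ z ∈ Metric.closedBall (I * A x) s, ‖e z‖ ≤ M ∧ ‖(e z)⁻¹‖ ≤ M ∧ ‖φ z‖ ≤ M := by
  have hsub : Metric.closedBall (I * (A x : ℂ)) s ⊆ Metric.ball (I * A x) r :=
    Metric.closedBall_subset_ball hs
  have hK : IsCompact (Metric.closedBall (I * (A x : ℂ)) s) := isCompact_closedBall _ _
  have c1 : ContinuousOn e (Metric.closedBall (I * (A x : ℂ)) s) := D.differentiable.continuousOn.mono hsub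
  obtain ⟨M₁, h1⟩ := hK.exists_bound_of_continuousOn c1
  obtain ⟨M₂, h2⟩ := hK.exists_bound_of_continuousOn (c1.inv₀ fun z _ => D.ne_zero z)
  obtain ⟨M₃, h3⟩ := hK.exists_bound_of_continuousOn (D.map.phi_analytic.continuousOn.mono hsub)
  refine ⟨max (max M₁ M₂) (max M₃ 1), (le_max_right _ _).trans (le_max_right _ _), fun z hz => ⟨?_, ?_, ?_⟩⟩
  · exact (h1 z hz).trans ((le_max_left _ _).trans (le_max_left _ _))
  · exact (h2 z hz).trans ((le_max_right _ _).trans (le_max_left _ _))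
  · exact (h3 z hz).trans ((le_max_left _ _).trans (le_max_right _ _))

lemma norm_scaled (hh : 0 < h) : ‖scaled e h z‖ = h ^ (-(1 / 6) : ℝ) * ‖e z‖ := by
  rw [scaled, Complex.norm_mul, Complex.norm_real, Real.norm_of_nonneg (Real.rpow_pos_of_pos hh _).le]

/-- The bound for the endpoint model. -/
lemma norm_Nendpoint_le (D : EndpointData A x r Θ φ e) (hA : IsProfile A) (hs : s < r) (h₁ : ℝ) :
    ∃ C : ℝ, ∀ h, 0 < h → h ≤ h₁ → ∀ z ∈ Metric.ball (I * A x) s, z.re ≠ 0 → ∀ i j,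
      ‖Nendpoint A x Θ φ h z i j‖ ≤ C * h ^ (-(1 / 3) : ℝ) := by
  obtain ⟨M, hM1, hM⟩ := D.exists_bounds hs
  obtain ⟨C, hC, hS⟩ := Sloc_bound
  set K₁ := M * (1 + h₁ ^ (1 / 3 : ℝ)) with hK₁
  set K₂ := (h₁ ^ (2 / 3 : ℝ) + M) ^ (1 / 4 : ℝ) with hK₂
  refine ⟨2 * (2 * (K₁ * (C * K₂)) * 1), fun h hh hle z hz hr i j => ?_⟩
  have hz' : z ∈ Metric.ball (I * (A x : ℂ)) r := Metric.ball_subset_ball hs.le hz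
  obtain ⟨m1, m2, m3⟩ := hM z (Metric.ball_subset_closedBall hz)
  have hh1 : 0 < h₁ := hh.trans_le hle
  set k := h ^ (-(1 / 6) : ℝ) with hk
  have hk0 : 0 < k := Real.rpow_pos_of_pos hh _
  have hkk : k * k = h ^ (-(1 / 3) : ℝ) := by rw [hk, ← Real.rpow_add hh]; norm_num
  -- The inverse scalar is only O(h^{1/6}). The bound h ≤ h₁ lets it be absorbed into the same
  -- multiple of h^{-1/6}.
  have hkinv : k⁻¹ ≤ k * h₁ ^ (1 / 3 : ℝ) := by
    have : k⁻¹ = k * h ^ (1 / 3 : ℝ) := by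
      rw [hk, ← Real.rpow_neg hh.le, ← Real.rpow_add hh]; norm_num
    rw [this]
    exact mul_le_mul_of_nonneg_left (Real.rpow_le_rpow hh.le hle (by norm_num)) hk0.le
  have hp1 : 0 < h₁ ^ (1 / 3 : ℝ) := Real.rpow_pos_of_pos hh1 _
  have hp2 : 0 < h₁ ^ (2 / 3 : ℝ) := Real.rpow_pos_of_pos hh1 _
  have hK₁0 : 0 ≤ k * K₁ := by positivity
  have hP : ∀ i j, ‖prefactor (scaled e h z) i j‖ ≤ k * K₁ := by
    refine norm_prefactor_le ?_ ?_
    · rw [norm_scaled hh]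
      refine mul_le_mul_of_nonneg_left (m1.trans ?_) hk0.le
      rw [hK₁]; nlinarith
    · rw [norm_inv] at m2 ⊢
      rw [norm_scaled hh, mul_inv]
      refine (mul_le_mul hkinv m2 (inv_nonneg.2 (norm_nonneg _)) (by positivity)).trans ?_
      rw [hK₁]; nlinarith [mul_pos hk0 (zero_lt_one.trans_le hM1)]
  have h0 := D.phi_ne_zero hz' hr
  have hζ0 := zeta_ne_zero (φ := φ) (z := z) hh h0
  have hSb : ∀ i j, ‖Sloc (zeta φ h z) i j‖ ≤ k * (C * K₂) := by
    intro i j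
    refine (hS _ hζ0 (D.zeta_arg_ne_zero hh hz' hr) i j).trans ?_
    have e1 : 1 + ‖zeta φ h z‖ ≤ h ^ (-(2 / 3) : ℝ) * (h₁ ^ (2 / 3 : ℝ) + M) := by
      have e2 : 1 = h ^ (-(2 / 3) : ℝ) * h ^ (2 / 3 : ℝ) := by
        rw [← Real.rpow_add hh]; norm_num
      have e3 : h ^ (2 / 3 : ℝ) ≤ h₁ ^ (2 / 3 : ℝ) := Real.rpow_le_rpow hh.le hle (by norm_num)
      rw [norm_zeta hh, mul_add]
      nth_rewrite 1 [e2]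
      have hc := (rpow_neg_two_thirds_pos hh).le
      exact add_le_add (mul_le_mul_of_nonneg_left e3 hc) (mul_le_mul_of_nonneg_left m3 hc)
    have e4 : (1 + ‖zeta φ h z‖) ^ (1 / 4 : ℝ) ≤ k * K₂ := by
      refine (Real.rpow_le_rpow (by positivity) e1 (by norm_num)).trans_eq ?_
      rw [Real.mul_rpow (rpow_neg_two_thirds_pos hh).le (by positivity), ← Real.rpow_mul hh.le, hk, hK₂,
        show (-(2 / 3) * (1 / 4) : ℝ) = -(1 / 6) by norm_num]
    calc C * (1 + ‖zeta φ h z‖) ^ (1 / 4 : ℝ) ≤ C * (k * K₂) := mul_le_mul_of_nonneg_left e4 hC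
      _ = k * (C * K₂) := by ring
  have hK₂0 : 0 ≤ K₂ := by positivity
  have hL := norm_lensFactor_le hζ0 fun h1 => D.lens_arg hh hz' hr h1
  rw [Nendpoint, Shat, D.Shol_eq hA hh hz' hr, mul_assoc (sig x)]
  have hPS := norm_mul_entry_le hK₁0 hP hSb
  have hPSL := norm_mul_entry_le (by positivity) hPS hL
  refine (norm_sig_mul_mul_sig_le hPSL i j).trans_eq ?_
  rw [← hkk]; ring

/-- Lens factor and swap occur in both models and cancel in the quotient. What is left is the
mismatch of the Airy model with its frame, conjugated by the prefactor. -/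
lemma Nendpoint_mul_Nout_inv (D : EndpointData A x r Θ φ e) (hA : IsProfile A) (hh : 0 < h)
    (hz : z ∈ Metric.ball (I * A x) r) (hr : z.re ≠ 0) :
    Nendpoint A x Θ φ h z * (Nout A x Θ φ h z)⁻¹ - 1 =
      sig x * (prefactor (scaled e h z) * (Sloc (zeta φ h z) * (StildeLoc (zeta φ h z))⁻¹ - 1) *
        (prefactor (scaled e h z))⁻¹) * sig x := by
  have hζ0 := zeta_ne_zero (φ := φ) (z := z) hh (D.phi_ne_zero hz hr)
  have uSt : IsUnit (StildeLoc (zeta φ h z)).det := isUnit_det_StildeLoc hζ0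
  have uP : IsUnit (prefactor (scaled e h z)).det := by
    rw [det_prefactor (D.scaled_ne_zero hh)]; exact isUnit_one
  have uL : IsUnit (lensFactor (zeta φ h z) (Θ z / h)).det := by
    rw [det_lensFactor]; exact isUnit_one
  have hS := D.Shol_eq hA hh hz hr
  have hc : ∀ M : Mat, sig x * (sig x * M) = M := fun M => by
    rw [← mul_assoc, sig_mul_sig, one_mul]
  have hO : Otilde (A x) z =
      sig x * (prefactor (scaled e h z) * StildeLoc (zeta φ h z)) * sig x := by
    rw [← hS, Shol, Matrix.nonsing_inv_mul_cancel_right _ _ uSt]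
    simp only [mul_assoc, hc, sig_mul_sig, mul_one]
  rw [← conj_mul_conj_inv_sub_one (sig_mul_sig x) uP uL, Nendpoint, Shat, Nout, hS, hO]

/-- Matching of the endpoint model with the outer model. -/
lemma matching (D : EndpointData A x r Θ φ e) (hA : IsProfile A) (hs0 : 0 < s) (hs : s < r) (h₁ : ℝ) :
    ∃ C : ℝ, ∀ h, 0 < h → h ≤ h₁ → ∀ z ∈ Metric.sphere (I * A x) s, z.re ≠ 0 → ∀ i j,
      ‖(Nendpoint A x Θ φ h z * (Nout A x Θ φ h z)⁻¹ - 1) i j‖ ≤ C * h ^ (1 / 3 : ℝ) := by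
  obtain ⟨M, hM1, hM⟩ := D.exists_bounds hs
  have hsub : Metric.sphere (I * (A x : ℂ)) s ⊆ Metric.ball (I * A x) r :=
    Metric.sphere_subset_closedBall.trans (Metric.closedBall_subset_ball hs)
  have hcen : I * (A x : ℂ) ∈ Metric.ball (I * (A x : ℂ)) r := Metric.mem_ball_self (hs0.trans hs)
  -- φ vanishes at the centre and is injective, so it has no zero on the circle; by compactness |ζ|
  -- is at least a constant times h^{-2/3} there.
  have hne : ∀ z ∈ Metric.sphere (I * (A x : ℂ)) s, φ z ≠ 0 := by
    intro z hz h0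
    have := D.map.phi_injective (hsub hz) hcen (h0.trans D.center.symm)
    rw [this, Metric.mem_sphere, dist_self] at hz
    exact hs0.ne hz
  obtain ⟨B, hB⟩ := (isCompact_sphere (I * (A x : ℂ)) s).exists_bound_of_continuousOn
    ((D.map.phi_analytic.continuousOn.mono hsub).inv₀ hne)
  set c := (max B 1)⁻¹ with hc
  have hc0 : 0 < c := inv_pos.2 (lt_max_of_lt_right one_pos)
  have hcφ : ∀ z ∈ Metric.sphere (I * (A x : ℂ)) s, c ≤ ‖φ z‖ := by
    intro z hz
    have h1 : ‖(φ z)⁻¹‖ ≤ max B 1 := (hB z hz).trans (le_max_left _ _)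
    rw [norm_inv] at h1
    exact inv_le_of_inv_le₀ (norm_pos_iff.2 (hne z hz)) h1
  -- The smallest |ζ| occurs for the largest admissible h, which makes this constant uniform in h ≤
  -- h₁.
  obtain ⟨C, hC, hS⟩ := Sloc_match (Real.log (h₁ ^ (-(2 / 3) : ℝ) * c))
  set K := C * (2 * c ^ (-(3 / 4) : ℝ) + c ^ (-(1 / 4) : ℝ) * M ^ 2 + c ^ (-(5 / 4) : ℝ) * M ^ 2) with hK
  refine ⟨K * h₁ ^ (1 / 6 : ℝ), fun h hh hle z hz hr i j => ?_⟩
  have hh1 : 0 < h₁ := hh.trans_le hle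
  have hz' := hsub hz
  obtain ⟨m1, m2, m3⟩ := hM z (Metric.sphere_subset_closedBall hz)
  have hζ0 := zeta_ne_zero (φ := φ) (z := z) hh (hne z hz)
  set d := h ^ (-(2 / 3) : ℝ) with hd
  have hd0 : 0 < d := rpow_neg_two_thirds_pos hh
  have hlow : d * c ≤ ‖zeta φ h z‖ := by
    rw [norm_zeta hh]; exact mul_le_mul_of_nonneg_left (hcφ z hz) hd0.le
  have hlog : Real.log (h₁ ^ (-(2 / 3) : ℝ) * c) ≤ Real.log ‖zeta φ h z‖ := by
    refine Real.log_le_log (by positivity) (le_trans ?_ hlow)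
    refine mul_le_mul_of_nonneg_right ?_ hc0.le
    exact Real.rpow_le_rpow_of_nonpos hh hle (by norm_num)
  obtain ⟨a, b, c', d', hS', ha, hb, hc', hd'⟩ := hS _ hζ0 (D.zeta_arg_ne_zero hh hz' hr) hlog
  have hpow : ∀ p : ℝ, 0 ≤ p → ‖zeta φ h z‖ ^ (-p) ≤ h ^ (2 / 3 * p) * c ^ (-p) := by
    intro p hp
    refine (Real.rpow_le_rpow_of_nonpos (by positivity) hlow (by linarith)).trans_eq ?_
    rw [Real.mul_rpow hd0.le hc0.le, hd, ← Real.rpow_mul hh.le]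
    congr 2; ring
  have p1 := hpow (3 / 4) (by norm_num)
  have p2 := hpow (1 / 4) (by norm_num)
  have p3 := hpow (5 / 4) (by norm_num)
  have hE1 : ‖scaled e h z‖ ^ (-2 : ℤ) ≤ h ^ (1 / 3 : ℝ) * M ^ 2 := by
    rw [norm_inv] at m2
    rw [norm_scaled hh, mul_zpow, zpow_neg ‖e z‖, ← inv_zpow]
    refine mul_le_mul (le_of_eq ?_) ?_ (by positivity) (by positivity)
    · rw [← Real.rpow_intCast, ← Real.rpow_mul hh.le]; norm_num
    · exact_mod_cast pow_le_pow_left₀ (inv_nonneg.2 (norm_nonneg _)) m2 2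
  have hE2 : ‖scaled e h z‖ ^ 2 ≤ h ^ (-(1 / 3) : ℝ) * M ^ 2 := by
    rw [norm_scaled hh, mul_pow]
    refine mul_le_mul (le_of_eq ?_) (pow_le_pow_left₀ (norm_nonneg _) m1 2) (by positivity) (by positivity)
    rw [← Real.rpow_natCast, ← Real.rpow_mul hh.le]; norm_num
  -- All weighted error terms have the same order: (2/3)(3/4), (2/3)(1/4) + 1/3 and (2/3)(5/4) - 1/3
  -- all equal 1/2. The surplus factor h^{1/6} is then bounded by h₁^{1/6}.
  have r1 : h ^ (2 / 3 * (3 / 4) : ℝ) = h ^ (1 / 2 : ℝ) := by norm_num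
  have r2 : h ^ (2 / 3 * (1 / 4) : ℝ) * h ^ (1 / 3 : ℝ) = h ^ (1 / 2 : ℝ) := by
    rw [← Real.rpow_add hh]; norm_num
  have r3 : h ^ (2 / 3 * (5 / 4) : ℝ) * h ^ (-(1 / 3) : ℝ) = h ^ (1 / 2 : ℝ) := by
    rw [← Real.rpow_add hh]; norm_num
  have t1 : ∀ w : ℂ, ‖w‖ ≤ C * ‖zeta φ h z‖ ^ (-(3 / 4) : ℝ) →
      ‖w‖ ≤ C * (h ^ (1 / 2 : ℝ) * c ^ (-(3 / 4) : ℝ)) := fun w hw => by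
    rw [r1] at p1
    exact hw.trans (mul_le_mul_of_nonneg_left p1 hC)
  have t2 : ‖b‖ * ‖scaled e h z‖ ^ (-2 : ℤ) ≤ C * (h ^ (1 / 2 : ℝ) * (c ^ (-(1 / 4) : ℝ) * M ^ 2)) := by
    refine (mul_le_mul (hb.trans (mul_le_mul_of_nonneg_left p2 hC)) hE1 (by positivity)
      (by positivity)).trans_eq ?_
    rw [← r2]; ring
  have t3 : ‖c'‖ * ‖scaled e h z‖ ^ 2 ≤ C * (h ^ (1 / 2 : ℝ) * (c ^ (-(5 / 4) : ℝ) * M ^ 2)) := by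
    refine (mul_le_mul (hc'.trans (mul_le_mul_of_nonneg_left p3 hC)) hE2 (by positivity)
      (by positivity)).trans_eq ?_
    rw [← r3]; ring
  have hfin : h ^ (1 / 2 : ℝ) ≤ h₁ ^ (1 / 6 : ℝ) * h ^ (1 / 3 : ℝ) := by
    have : h ^ (1 / 2 : ℝ) = h ^ (1 / 6 : ℝ) * h ^ (1 / 3 : ℝ) := by
      rw [← Real.rpow_add hh]; norm_num
    rw [this]
    exact mul_le_mul_of_nonneg_right (Real.rpow_le_rpow hh.le hle (by norm_num)) (by positivity)
  rw [D.Nendpoint_mul_Nout_inv hA hh hz' hr, hS']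
  refine norm_sig_mul_mul_sig_le (fun i j => ?_) i j
  refine (norm_prefactor_conj_le (D.scaled_ne_zero hh) i j).trans ?_
  have hK0 : 0 ≤ K := by positivity
  calc ‖a‖ + ‖b‖ * ‖scaled e h z‖ ^ (-2 : ℤ) + ‖c'‖ * ‖scaled e h z‖ ^ 2 + ‖d'‖
      ≤ K * h ^ (1 / 2 : ℝ) := by
        rw [hK]; linarith [t1 a ha, t1 d' hd', t2, t3]
    _ ≤ K * (h₁ ^ (1 / 6 : ℝ) * h ^ (1 / 3 : ℝ)) := mul_le_mul_of_nonneg_left hfin hK0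
    _ = K * h₁ ^ (1 / 6 : ℝ) * h ^ (1 / 3 : ℝ) := by ring

end EndpointData

end

end EndpointModel

/-! ### The proposition -/

theorem mainTheorem9 (A : ℝ → ℝ) (hA : IsProfile A) (x : ℝ) (hx : x ≠ 0) :
    -- the explicit Airy matrix solves the local Riemann-Hilbert problem
    IsAiryModel Sloc ∧
    -- the conformal coordinate exists near `i A(x)`; every smaller disk `D` may be used
    ∃ (r₀ : ℝ) (Θ φ : ℂ → ℂ), IsEndpointMap A x r₀ Θ φ ∧
      ∀ r : ℝ, 0 < r → r < r₀ →
        -- analyticity in the two half-disks, and the jump on the imaginary axis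
        (∀ N : ℕ, 1 ≤ N →
          (∀ i j, AnalyticOnNhd ℂ (fun z => Nendpoint A x Θ φ (hbar A N) z i j)
            (Metric.ball (Complex.I * A x) r ∩ {z | z.re < 0})) ∧
          (∀ i j, AnalyticOnNhd ℂ (fun z => Nendpoint A x Θ φ (hbar A N) z i j)
            (Metric.ball (Complex.I * A x) r ∩ {z | 0 < z.re})) ∧
          (∀ z ∈ Metric.ball (Complex.I * A x) r, z.re = 0 →
            HasJump (Nendpoint A x Θ φ (hbar A N)) z (continuumJump A x (hbar A N) z)) ∧
          (∀ Nt : ℂ → Mat,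
            SolvesContinuumLimitOn A x (hbar A N) (Metric.ball (Complex.I * A x) r) Nt →
            ∀ z ∈ Metric.ball (Complex.I * A x) r, z.re = 0 →
              (rightBV (Nendpoint A x Θ φ (hbar A N)) z)⁻¹ *
                  leftBV (Nendpoint A x Θ φ (hbar A N)) z =
                (rightBV Nt z)⁻¹ * leftBV Nt z)) ∧
        -- the bound in `D`, uniformly in `N`
        (∃ C : ℝ, ∀ N : ℕ, 1 ≤ N → ∀ z ∈ Metric.ball (Complex.I * A x) r, z.re ≠ 0 →
          ∀ i j, ‖Nendpoint A x Θ φ (hbar A N) z i j‖ ≤ C * hbar A N ^ (-(1 / 3) : ℝ)) ∧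
        -- matching with the outer model on the boundary of `D`, uniformly in `N`
        (∃ C : ℝ, ∀ N : ℕ, 1 ≤ N → ∀ z ∈ Metric.sphere (Complex.I * A x) r, z.re ≠ 0 →
          ∀ i j, ‖(Nendpoint A x Θ φ (hbar A N) z * (Nout A x Θ φ (hbar A N) z)⁻¹ - 1) i j‖ ≤
            C * hbar A N ^ (1 / 3 : ℝ)) := by
  refine ⟨isAiryModel_Sloc, ?_⟩
  obtain ⟨r₀, Θ, φ, e, D⟩ := exists_endpointData hA hx
  refine ⟨r₀, Θ, φ, D.map, fun r hr hrr => ⟨fun N hN => ?_, ?_, ?_⟩⟩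
  · have hh := hbar_pos hA hN
    have hsub : Metric.ball (Complex.I * (A x : ℂ)) r ⊆ Metric.ball (Complex.I * A x) r₀ :=
      Metric.ball_subset_ball hrr.le
    refine ⟨fun i j => (D.analyticOn_left hA hh i j).mono (Set.inter_subset_inter_left _ hsub),
      fun i j => (D.analyticOn_right hA hh i j).mono (Set.inter_subset_inter_left _ hsub),
      fun z hz hz0 => D.hasJump hA hh (hsub hz) hz0, fun Nt hNt z hz hz0 => ?_⟩
    rw [(D.hasJump hA hh (hsub hz) hz0).boundary_values hz0, (hNt.jump z hz hz0).boundary_values hz0]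
  -- The parameters ħ_N are at most ħ_1, so bounds uniform for h ≤ ħ_1 are uniform in N.
  · obtain ⟨C, hC⟩ := D.norm_Nendpoint_le hA hrr (hbar A 1)
    exact ⟨C, fun N hN => hC _ (hbar_pos hA hN) (hbar_le hA hN)⟩
  · obtain ⟨C, hC⟩ := D.matching hA hr hrr (hbar A 1)
    exact ⟨C, fun N hN => hC _ (hbar_pos hA hN) (hbar_le hA hN)⟩
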